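/- Let $\mathbb{K}$ be an algebraically closed field of characteristic zero, let $\Lambda(n)$ be the Grassmann algebra on odd generators $\xi_1,\dots,\xi_n$, and let $\partial_i$ be the odd superderivation with $\partial_i(\xi_j)=\delta_{ij}$. Let $\mathfrak g$ be one of the following Lie superalgebras of Cartan type, with the supercommutator of $\mathrm{End}_{\mathbb K}(\Lambda(n))$ as bracket: - $W(n)$ ($n\ge 2$), all superderivations $D=\sum_i P_i\partial_i$ of $\Lambda(n)$; - $S(n)$ ($n\ge3$), the $D\in W(n)$ with $\mathrm{div}(D):=\sum_i\partial_i(P_i)=0$; - $\widetilde S(n)$ ($n\ge 4$ even), the $D\in W(n)$ with $(1+\xi_1\cdots\xi_n)\,\mathrm{div}(D)+D(\xi_1\cdots\xi_n)=0$; - $H(n)=[\widetilde H(n),\widetilde H(n)]$ ($n\ge4$), where $\widetilde H(n)=\{D\in W(n)\mid D\omega=0\}$ and, with $r=[n/2]$, $\omega=\sum_{i=1}^r(d\xi_i\circ d\xi_{r+i}+d\xi_{r+i}\circ d\xi_i)$, plus $d\xi_n\circ d\xi_n$ if $n$ is odd. Let $\mathfrak h$ be the standard Cartan subalgebra of $\mathfrak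 g_0$ (spanned by the $\xi_k\partial_k$ for $W(n)$, by the $\xi_k\partial_k-\xi_{k+1}\partial_{k+1}$ for $S(n)$ and $\widetilde S(n)$, and by the $\xi_k\partial_k-\xi_{r+k}\partial_{r+k}$, $k\le r$, for $H(n)$). Put $\overline{\mathfrak h}=\mathfrak h$ for $W(n)$ and $\widetilde S(n)$, and $\overline{\mathfrak h}=\mathfrak h+\mathbb K\sum_i\xi_i\partial_i$ for $S(n)$ and $H(n)$. Let $\mathfrak g=\mathfrak h\oplus\bigoplus_{\alpha\in\Delta}\mathfrak g_\alpha$ be the root decomposition with respect to $\overline{\mathfrak h}$, with $\Delta=\Delta_{\bar0}\sqcup\Delta_{\bar1}$ the even and the odd roots, $\mu(\alpha)=\dim\mathfrak g_\alpha$, and $\Delta_z=\{\alpha\in\Delta\mid\mathfrak g_\alpha\subseteq\mathfrak g_z\}$ for $z\in\{0,-1\}$; here $\mathfrak g_z=\mathfrak g\cap W(n)_z$ for the $\mathbb Z$-grading of $W(n)$ with $\deg\xi_i=1=-\deg\partial_i$, except that $\widetilde S(n)_{-1}$ is the span of the $(\xi_1\cdots\xi_n-1)\partial_j$. Let $r$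 be the rank of $\mathfrak g$, that is $\dim\mathfrak h$, and let $H_\alpha$ be the coroot of $\alpha\in\Delta_0$, that is the element of $[\mathfrak g_\alpha,\mathfrak g_{-\alpha}]$ with $\alpha(H_\alpha)=2$. A Chevalley basis of $\mathfrak g$ is a basis $\{H_1,\dots,H_r\}\sqcup\{X_{\alpha,k}\mid\alpha\in\Delta,\ 1\le k\le\mu(\alpha)\}$ such that: (a) $H_1,\dots,H_r$ is a basis of $\mathfrak h$, $\beta(H_i)\in\mathbb Z$ for all $\beta\in\Delta$, and $H_\alpha\in\mathfrak h_{\mathbb Z}:=\mathrm{Span}_{\mathbb Z}(H_1,\dots,H_r)$ for all $\alpha\in\Delta_0$; (b) $\{X_{\alpha,k}\}_{k}$ is a basis of $\mathfrak g_\alpha$ for every $\alpha\in\Delta$; (c) $[X_{\alpha,1},X_{-\alpha,1}]=H_\alpha$ for $\alpha\in\Delta_0$; (d) let $\gamma\in\Delta_{-1}$ with $-\gamma\in\Delta$. For $W(n)$, $S(n)$, $\widetilde S(n)$: $[X_{\gamma,1},X_{-\gamma,k}]\in\mathfrak h_{\mathbb Z}$ for all $k$. For $H(n)$: $[X_{\gamma,1},X_{-\gamma,k}]=\pm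 H_{\sigma_\gamma(k)}$ for all $k$, with $\sigma_\gamma$ injective (where $\pm2H_{\sigma_\gamma(k)}$ is also allowed if $n$ is odd and $\gamma|_{\mathfrak h}=0$), and for every $i$ one of $\pm H_i$ occurs among these brackets; (e) if $\alpha,\beta,\alpha+\beta\in\Delta$, then $[X_{\alpha,k},X_{\beta,h}]=\sum_t c(t)X_{\alpha+\beta,t}$ with $c(t)\in\{0,\pm1,\pm2\}$. If moreover $\alpha,\beta\in\Delta_0$, then $c(1)=\pm(p+1)$, where $p\in\mathbb N$ is such that $\beta-p\alpha\in\Delta$ and $\beta-(p+1)\alpha\notin\Delta$. If $\alpha=\beta$, then at most one $c(t)$ is nonzero, and it is $\pm2$; (f) if $\alpha\in\Delta_0$ and $\beta,2\alpha+\beta\in\Delta$, then $[X_{\alpha,1},[X_{\alpha,1},X_{\beta,h}]]=\pm2X_{2\alpha+\beta,t}$ for a unique $t$. Fix a Chevalley basis of $\mathfrak g$. Let $U(\mathfrak g)$ be the universal enveloping superalgebra: the quotient of the tensor algebra by the relations $x\otimes y-(-1)^{p(x)p(y)}y\otimes x=[x,y]$ for $x,y$ homogeneous, and $z\otimes z=z\circ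 z$ for $z$ odd. In $U(\mathfrak g)$ put $y^{(m)}=y^m/m!$ and $\binom ym=y(y-1)\cdots(y-m+1)/m!$. The Kostant superalgebra $K_{\mathbb Z}(\mathfrak g)$ is the unital subring of $U(\mathfrak g)$ generated by all $\binom{H_i}m$, all $X_{\alpha,k}^{(m)}$ with $\alpha\in\Delta_{\bar0}$, and all $X_{\gamma,k}$ with $\gamma\in\Delta_{\bar1}$ ($m\in\mathbb N$). **Theorem.** The Kostant superalgebra $K_{\mathbb Z}(\mathfrak g)$ is a free $\mathbb Z$-module. More precisely, let $\widetilde\Delta=\{(\alpha,k)\mid\alpha\in\Delta,\ 1\le k\le\mu(\alpha)\}$, and fix any total order on the set $\widetilde\Delta\sqcup\{1,\dots,r\}$. Choose exponents $\ell_{\alpha,k}\in\mathbb N$ for $\alpha\in\Delta_{\bar0}$, $n_i\in\mathbb N$ for $1\le i\le r$, and $e_{\gamma,k}\in\{0,1\}$ for $\gamma\in\Delta_{\bar1}$, and form the product, in increasing order of the indices and with one factor for each index, of the factors $X_{\alpha,k}^{(\ell_{\alpha,k})}$, $\binom{H_i}{n_i}$ and $X_{\gamma,k}^{e_{\gamma,k}}$.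 These ordered monomials, indexed by all the choices of exponents, form a $\mathbb Z$-basis of $K_{\mathbb Z}(\mathfrak g)$. -/

import Mathlib

namespace CartanSuper

noncomputable section

/-! ### The Grassmann algebra and its endomorphisms -/

section Grassmann

variable (K : Type*) [Field K] (n : ℕ)

/-- The Grassmann algebra `Λ(n)` over `K`. -/
abbrev Lam : Type _ := ExteriorAlgebra K (Fin n → K)

/-- The associative (super)algebra of all `K`-linear endomorphisms of `Λ(n)`. -/
abbrev Op : Type _ := Module.End K (Lam K n)

variable {n}

/-- The odd generator `ξ_i` (indices start at `0`). -/
def xi (i : Fin n) : Lam K n := ExteriorAlgebra.ι K (Pi.single i 1)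

/-- The odd superderivation `∂_i`, with `∂_i (ξ_j) = δ_{ij}`. -/
def pd (i : Fin n) : Op K n :=
  CliffordAlgebra.contractLeft (LinearMap.proj i : (Fin n → K) →ₗ[K] K)

/-- The operator `P ∂_i : f ↦ P * ∂_i f`. -/
def mulPd (P : Lam K n) (i : Fin n) : Op K n := LinearMap.mulLeft K P * pd K i

variable (n)

/-- The product `ξ_1 ⋯ ξ_n`. -/
def vol : Lam K n := (List.ofFn (fun i : Fin n => xi K i)).prod

/-- The parity involution of `Λ(n)`: `+1` on even elements, `-1` on odd elements. -/
def parInv : Op K n :=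
  (CliffordAlgebra.involute (Q := (0 : QuadraticForm K (Fin n → K)))).toLinearMap

variable {K n}

/-- `D` is homogeneous of parity `p` in `End(Λ(n))`. -/
def HasParity (p : ZMod 2) (D : Op K n) : Prop :=
  parInv K n * D = (-1 : K) ^ p.val • (D * parInv K n)

/-- The even component of an endomorphism. -/
def evenPart (D : Op K n) : Op K n := (2 : K)⁻¹ • (D + parInv K n * D * parInv K n)

/-- The odd component of an endomorphism. -/
def oddPart (D : Op K n) : Op K n := (2 : K)⁻¹ • (D - parInv K n * D * parInv K n)

/-- The supercommutator on `End(Λ(n))`: bilinear, with `[x, y] = x y - (-1)^{p(x) p(y)} y x`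
on homogeneous elements. -/
def sbr (x y : Op K n) : Op K n :=
  x * y - (evenPart y * evenPart x + evenPart y * oddPart x + oddPart y * evenPart x
    - oddPart y * oddPart x)

variable (K n)

/-- Superderivations of `Λ(n)` of parity `p`: `D (f g) = D f * g + (-1)^{p p(f)} f * D g`. -/
def superDer (p : ZMod 2) : Submodule K (Op K n) where
  carrier := {D | HasParity p D ∧
    ∀ f g : Lam K n, D (f * g) = D f * g + (parInv K n ^ p.val) f * D g}
  add_mem' := by
    rintro a b ⟨ha, ha'⟩ ⟨hb, hb'⟩
    refine ⟨?_, fun f g => ?_⟩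
    · unfold HasParity at *
      rw [mul_add, ha, hb, add_mul, smul_add]
    · rw [LinearMap.add_apply, ha', hb', LinearMap.add_apply, LinearMap.add_apply, add_mul,
        mul_add]
      abel
  zero_mem' := by
    refine ⟨?_, fun f g => ?_⟩
    · unfold HasParity
      simp
    · simp
  smul_mem' := by
    rintro c a ⟨ha, ha'⟩
    refine ⟨?_, fun f g => ?_⟩
    · unfold HasParity at *
      rw [mul_smul_comm, ha, smul_mul_assoc, smul_comm]
    · rw [LinearMap.smul_apply, ha', LinearMap.smul_apply, LinearMap.smul_apply, smul_add,
        smul_mul_assoc, mul_smul_comm]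

/-- `W(n)`: all superderivations of `Λ(n)`. -/
def Wn : Submodule K (Op K n) := superDer K n 0 ⊔ superDer K n 1

/-- The divergence `div (∑ P_i ∂_i) = ∑ ∂_i (P_i)`; here `P_i = D (ξ_i)`. -/
def dvg (D : Op K n) : Lam K n := ∑ i : Fin n, pd K i (D (xi K i))

/-- `S(n) = {D ∈ W(n) | div D = 0}`. -/
def Sn : Submodule K (Op K n) where
  carrier := {D | D ∈ Wn K n ∧ dvg K n D = 0}
  add_mem' := by
    rintro a b ⟨ha, ha'⟩ ⟨hb, hb'⟩
    refine ⟨add_mem ha hb, ?_⟩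
    simp only [dvg, LinearMap.add_apply, map_add, Finset.sum_add_distrib] at *
    rw [ha', hb', add_zero]
  zero_mem' := ⟨zero_mem _, by simp [dvg]⟩
  smul_mem' := by
    rintro c a ⟨ha, ha'⟩
    refine ⟨Submodule.smul_mem _ c ha, ?_⟩
    simp only [dvg, LinearMap.smul_apply, map_smul, ← Finset.smul_sum] at *
    rw [ha', smul_zero]

/-- `S~(n) = {D ∈ W(n) | (1 + ξ_1 ⋯ ξ_n) div D + D (ξ_1 ⋯ ξ_n) = 0}`. -/
def Stn : Submodule K (Op K n) where
  carrier := {D | D ∈ Wn K n ∧ (1 + vol K n) * dvg K n D + D (vol K n) = 0}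
  add_mem' := by
    rintro a b ⟨ha, ha'⟩ ⟨hb, hb'⟩
    refine ⟨add_mem ha hb, ?_⟩
    have h : dvg K n (a + b) = dvg K n a + dvg K n b := by
      simp only [dvg, LinearMap.add_apply, map_add, Finset.sum_add_distrib]
    rw [h, LinearMap.add_apply, mul_add, add_add_add_comm, ha', hb', add_zero]
  zero_mem' := ⟨zero_mem _, by simp [dvg]⟩
  smul_mem' := by
    rintro c a ⟨ha, ha'⟩
    refine ⟨Submodule.smul_mem _ c ha, ?_⟩
    have h : dvg K n (c • a) = c • dvg K n a := by
      simp only [dvg, LinearMap.smul_apply, map_smul, ← Finset.smul_sum]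
    rw [h, LinearMap.smul_apply, mul_smul_comm, ← smul_add, ha', smul_zero]

/-- The canonical symmetric matrix `ω`: with `r = [n/2]`, it pairs the indices `i` and `r + i`
(for `i < r`), and the last index with itself when `n` is odd. -/
def omega : Matrix (Fin n) (Fin n) K := fun i j =>
  if (i.val < n / 2 ∧ j.val = n / 2 + i.val) ∨ (j.val < n / 2 ∧ i.val = n / 2 + j.val) ∨
      (i = j ∧ i.val = 2 * (n / 2)) then 1 else 0

/-- The coefficient `Q_j = ∑_i ω_{ij} D (ξ_i)`; up to a common sign and a factor `2`,
`D ω = ∑_{k,j} ∂_k (Q_j) dξ_k ∘ dξ_j`, where the `dξ`'s commute with each other. -/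
def omegaCoeff (D : Op K n) (j : Fin n) : Lam K n := ∑ i : Fin n, omega K n i j • D (xi K i)

/-- `H~(n) = {D ∈ W(n) | D ω = 0}`, for the canonical form `ω = ∑ ω_{ij} dξ_i ∘ dξ_j`.
As `dξ_k ∘ dξ_j = dξ_j ∘ dξ_k`, the equation `D ω = 0` says that the symmetrized coefficients
`∂_k (Q_j) + ∂_j (Q_k)` vanish. -/
def Htn : Submodule K (Op K n) where
  carrier := {D | D ∈ Wn K n ∧
    ∀ k j : Fin n, pd K k (omegaCoeff K n D j) + pd K j (omegaCoeff K n D k) = 0}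
  add_mem' := by
    rintro a b ⟨ha, ha'⟩ ⟨hb, hb'⟩
    refine ⟨add_mem ha hb, fun k j => ?_⟩
    have h : ∀ i, omegaCoeff K n (a + b) i = omegaCoeff K n a i + omegaCoeff K n b i := by
      intro i
      simp only [omegaCoeff, LinearMap.add_apply, smul_add, Finset.sum_add_distrib]
    rw [h, h, map_add, map_add, add_add_add_comm, ha', hb', add_zero]
  zero_mem' := ⟨zero_mem _, by simp [omegaCoeff]⟩
  smul_mem' := by
    rintro c a ⟨ha, ha'⟩
    refine ⟨Submodule.smul_mem _ c ha, fun k j => ?_⟩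
    have h : ∀ i, omegaCoeff K n (c • a) i = c • omegaCoeff K n a i := by
      intro i
      simp only [omegaCoeff, LinearMap.smul_apply, Finset.smul_sum]
      exact Finset.sum_congr rfl fun x _ => smul_comm _ _ _
    rw [h, h, map_smul, map_smul, ← smul_add, ha', smul_zero]

/-- `H(n) = [H~(n), H~(n)]`. -/
def Hn : Submodule K (Op K n) :=
  Submodule.span K {z | ∃ x ∈ Htn K n, ∃ y ∈ Htn K n, z = sbr x y}

/-- The component `W(n)_{d-1}` of `W(n)`: all coefficients `P_i = D (ξ_i)` have degree `d`. -/
def degW (d : ℕ) : Submodule K (Op K n) where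
  carrier := {D | D ∈ Wn K n ∧ ∀ i : Fin n, D (xi K i) ∈ ExteriorAlgebra.exteriorPower K d (Fin n → K)}
  add_mem' := by
    rintro a b ⟨ha, ha'⟩ ⟨hb, hb'⟩
    exact ⟨add_mem ha hb, fun i => by rw [LinearMap.add_apply]; exact add_mem (ha' i) (hb' i)⟩
  zero_mem' := ⟨zero_mem _, fun i => by rw [LinearMap.zero_apply]; exact zero_mem _⟩
  smul_mem' := by
    rintro c a ⟨ha, ha'⟩
    exact ⟨Submodule.smul_mem _ c ha,
      fun i => by rw [LinearMap.smul_apply]; exact Submodule.smul_mem _ c (ha' i)⟩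

end Grassmann

/-! ### The four families of Lie superalgebras of Cartan type -/

/-- The four types `W`, `S`, `S~`, `H`. -/
inductive CartanType
  | W
  | S
  | St
  | H

/-- The values of `n` for which `W(n)`, `S(n)`, `S~(n)`, `H(n)` are considered. -/
def CartanType.Admissible : CartanType → ℕ → Prop
  | .W, n => 2 ≤ n
  | .S, n => 3 ≤ n
  | .St, n => 4 ≤ n ∧ Even n
  | .H, n => 4 ≤ n

/-- The rank of the Lie superalgebra. -/
def CartanType.rank : CartanType → ℕ → ℕ
  | .W, n => n
  | .S, n => n - 1
  | .St, n => n - 1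
  | .H, n => n / 2

section LieSuperalgebra

variable (K : Type*) [Field K]

/-- The Lie superalgebra `𝔤` of the given type, with the supercommutator `sbr` of `End(Λ(n))`
as bracket (`𝔤` is closed under it) and `z ↦ z ∘ z` as `2`-operation. -/
def galg (t : CartanType) (n : ℕ) : Submodule K (Op K n) :=
  match t with
  | .W => Wn K n
  | .S => Sn K n
  | .St => Stn K n
  | .H => Hn K n

/-- The standard Cartan subalgebra `𝔥` of `𝔤_0`. -/
def cartan (t : CartanType) (n : ℕ) : Submodule K (Op K n) :=
  match t with
  | .W => Submodule.span K {h | ∃ k : Fin n, h = mulPd K (xi K k) k}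
  | .S => Submodule.span K {h | ∃ k l : Fin n, l.val = k.val + 1 ∧
      h = mulPd K (xi K k) k - mulPd K (xi K l) l}
  | .St => Submodule.span K {h | ∃ k l : Fin n, l.val = k.val + 1 ∧
      h = mulPd K (xi K k) k - mulPd K (xi K l) l}
  | .H => Submodule.span K {h | ∃ k l : Fin n, k.val < n / 2 ∧ l.val = n / 2 + k.val ∧
      h = mulPd K (xi K k) k - mulPd K (xi K l) l}

/-- The Euler field `ℰ = ∑ ξ_i ∂_i`. -/
def euler (n : ℕ) : Op K n := ∑ i : Fin n, mulPd K (xi K i) i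

/-- `𝔥‾`: this is `𝔥` for the types `W`, `S~`, and `𝔥 + K ℰ` for the types `S`, `H`. -/
def cartanBar (t : CartanType) (n : ℕ) : Submodule K (Op K n) :=
  match t with
  | .W => cartan K .W n
  | .S => cartan K .S n ⊔ Submodule.span K {euler K n}
  | .St => cartan K .St n
  | .H => cartan K .H n ⊔ Submodule.span K {euler K n}

theorem cartan_le_cartanBar (t : CartanType) (n : ℕ) : cartan K t n ≤ cartanBar K t n := by
  cases t
  · exact le_rfl
  · exact le_sup_left
  · exact le_rfl
  · exact le_sup_left

theorem sbr_smul_right {n : ℕ} (x y : Op K n) (c : K) : sbr x (c • y) = c • sbr x y := by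
  have h0 : evenPart (c • y) = c • evenPart y := by
    simp only [evenPart, mul_smul_comm, smul_mul_assoc, ← smul_add]
    rw [smul_comm]
  have h1 : oddPart (c • y) = c • oddPart y := by
    unfold oddPart
    rw [mul_smul_comm, smul_mul_assoc, smul_comm c, smul_sub c]
  unfold sbr
  rw [h0, h1, mul_smul_comm, smul_mul_assoc, smul_mul_assoc, smul_mul_assoc, smul_mul_assoc,
    smul_sub, smul_sub, smul_add, smul_add]

theorem sbr_add_right {n : ℕ} (x y z : Op K n) : sbr x (y + z) = sbr x y + sbr x z := by
  have h0 : evenPart (y + z) = evenPart y + evenPart z := by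
    simp only [evenPart, mul_add, add_mul, ← smul_add]
    congr 1
    abel
  have h1 : oddPart (y + z) = oddPart y + oddPart z := by
    simp only [oddPart, mul_add, add_mul, ← smul_add]
    congr 1
    abel
  simp only [sbr, h0, h1, mul_add, add_mul]
  abel

/-- The space `𝔤_α` of the vectors of weight `α` in `𝔤`, for `α` in the dual of `𝔥‾`. -/
def rootSpace (t : CartanType) (n : ℕ) (α : Module.Dual K (cartanBar K t n)) :
    Submodule K (Op K n) where
  carrier := {w | w ∈ galg K t n ∧ ∀ h : cartanBar K t n, sbr (h : Op K n) w = α h • w}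
  add_mem' := by
    rintro a b ⟨ha, ha'⟩ ⟨hb, hb'⟩
    exact ⟨add_mem ha hb, fun h => by rw [sbr_add_right, ha', hb', smul_add]⟩
  zero_mem' := ⟨zero_mem _, fun h => by simp [sbr, evenPart, oddPart]⟩
  smul_mem' := by
    rintro c a ⟨ha, ha'⟩
    exact ⟨Submodule.smul_mem _ c ha, fun h => by rw [sbr_smul_right, ha', smul_comm]⟩

/-- The set `Δ` of the roots of `𝔤`. -/
def Root (t : CartanType) (n : ℕ) : Type _ :=
  {α : Module.Dual K (cartanBar K t n) // α ≠ 0 ∧ rootSpace K t n α ≠ ⊥}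

variable {K} {t : CartanType} {n : ℕ}

/-- The multiplicity `μ(α) = dim 𝔤_α`. -/
def Root.mult (α : Root K t n) : ℕ := Module.finrank K (rootSpace K t n α.1)

/-- `α ∈ Δ_{0‾}`. -/
def Root.IsEven (α : Root K t n) : Prop := ∀ w ∈ rootSpace K t n α.1, HasParity 0 w

/-- `α ∈ Δ_{1‾}`. -/
def Root.IsOdd (α : Root K t n) : Prop := ∀ w ∈ rootSpace K t n α.1, HasParity 1 w

/-- `α ∈ Δ_0`: the root `α` has height `0`, that is `𝔤_α ⊆ 𝔤_0 = 𝔤 ∩ W(n)_0`. -/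
def Root.IsClassical (α : Root K t n) : Prop := rootSpace K t n α.1 ≤ degW K n 1

/-- The span of the components of `W(n)` that contain `𝔤_{-1}`: `𝔤_{-1} = 𝔤 ∩ W(n)_{-1}`, except
that for `S~(n)` it is `𝔤 ∩ (W(n)_{-1} ⊕ W(n)_{n-1})`, the span of the `(ξ_1 ⋯ ξ_n - 1) ∂_j`. -/
def minusOnePart (K : Type*) [Field K] (t : CartanType) (n : ℕ) : Submodule K (Op K n) :=
  match t with
  | .W => degW K n 0
  | .S => degW K n 0
  | .St => degW K n 0 ⊔ degW K n n
  | .H => degW K n 0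

/-- `α ∈ Δ_{-1}`: the root `α` has height `-1`, that is `𝔤_α ⊆ 𝔤_{-1}`. -/
def Root.IsMinusOne (α : Root K t n) : Prop := rootSpace K t n α.1 ≤ minusOnePart K t n

/-- `h` is the coroot `H_α` of the classical root `α`: the element of `[𝔤_α, 𝔤_{-α}]` with
`α(h) = 2`. -/
def Root.IsCoroot (α : Root K t n) (h : cartanBar K t n) : Prop :=
  (h : Op K n) ∈ Submodule.span K
    {z | ∃ x ∈ rootSpace K t n α.1, ∃ y ∈ rootSpace K t n (-α.1), z = sbr x y} ∧ α.1 h = 2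

variable (K t n)

/-! ### Chevalley bases -/

/-- Chevalley bases `{H_i} ∪ {X_{α,k}}` of `𝔤`. For classical roots and for roots of height `-1`
the multiplicity is `1`, so that a quantification over all indices `k` of such a root just means
"the root vector `X_{α,1}`". The root vectors are automatically homogeneous, and automatically
`[X_{α,k}, X_{α,k}] = 0` for `α` even, `[X_{α,k}, X_{β,h}] = 0` if `α + β ∉ Δ ∪ {0}`, and
`X_{γ,k} ∘ X_{γ,k} = [X_{γ,k}, X_{γ,k}] / 2` for `γ` odd. -/
structure ChevalleyBasis where
  /-- the Cartan elements `H_1, …, H_r` -/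
  H : Fin (t.rank n) → galg K t n
  /-- the root vectors `X_{α,k}`, `1 ≤ k ≤ μ(α)` -/
  X : (α : Root K t n) → Fin α.mult → galg K t n
  /-- `H_1, …, H_r` is a basis of `𝔥` … -/
  H_mem : ∀ i, (H i : Op K n) ∈ cartan K t n
  H_indep : LinearIndependent K H
  H_span : ∀ h ∈ cartan K t n, h ∈ Submodule.span K (Set.range fun i => (H i : Op K n))
  /-- … on which all roots take integral values … -/
  H_int : ∀ (β : Root K t n) (i : Fin (t.rank n)),
    ∃ m : ℤ, β.1 ⟨(H i : Op K n), cartan_le_cartanBar K t n (H_mem i)⟩ = (m : K)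
  /-- … and whose `ℤ`-span contains all coroots of classical roots. -/
  coroot_mem : ∀ α : Root K t n, α.IsClassical → ∀ h : cartanBar K t n, α.IsCoroot h →
    (h : Op K n) ∈ Submodule.span ℤ (Set.range fun i => (H i : Op K n))
  /-- `X_{α,1}, …, X_{α,μ(α)}` is a basis of `𝔤_α`. -/
  X_mem : ∀ α k, (X α k : Op K n) ∈ rootSpace K t n α.1
  X_indep : ∀ α, LinearIndependent K (X α)
  X_span : ∀ α, ∀ w ∈ rootSpace K t n α.1,
    w ∈ Submodule.span K (Set.range fun k => (X α k : Op K n))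
  /-- `[X_{α,1}, X_{-α,1}] = H_α` for `α ∈ Δ_0`. -/
  classical_bracket : ∀ α β : Root K t n, α.IsClassical → β.1 = -α.1 → ∀ k l,
    ∃ h : cartanBar K t n, α.IsCoroot h ∧ sbr (X α k : Op K n) (X β l) = h
  /-- Types `W`, `S`, `S~`: `[X_{γ,1}, X_{-γ,k}]` is a `ℤ`-linear combination of the `H_i`'s, for
  `γ ∈ Δ_{-1}`. -/
  minusOne_bracket : t ≠ .H → ∀ γ β : Root K t n, γ.IsMinusOne → β.1 = -γ.1 → ∀ k l,
    sbr (X γ k : Op K n) (X β l) ∈ Submodule.span ℤ (Set.range fun i => (H i : Op K n))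
  /-- Type `H`: `[X_{γ,1}, X_{-γ,k}] = ± H_{σ_γ(k)}` for `γ ∈ Δ_{-1}`, with `σ_γ` injective; if
  `n` is odd and `γ` vanishes on `𝔥` then `± 2 H_{σ_γ(k)}` is allowed as well. -/
  minusOne_bracket_H : t = .H → ∀ γ β : Root K t n, γ.IsMinusOne → β.1 = -γ.1 →
    ∃ σ : Fin β.mult → Fin (t.rank n), Function.Injective σ ∧ ∀ k l,
      ∃ m : ℤ, sbr (X γ k : Op K n) (X β l) = m • (H (σ l) : Op K n) ∧
        (|m| = 1 ∨ (|m| = 2 ∧ Odd n ∧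
          ∀ i, γ.1 ⟨(H i : Op K n), cartan_le_cartanBar K t n (H_mem i)⟩ = 0))
  /-- Type `H`: all `± H_i` occur among these brackets. -/
  minusOne_bracket_H_surj : t = .H → ∀ i, ∃ γ β : Root K t n, γ.IsMinusOne ∧ β.1 = -γ.1 ∧
    ∃ k l, ∃ m : ℤ, |m| = 1 ∧ sbr (X γ k : Op K n) (X β l) = m • (H i : Op K n)
  /-- `[X_{α,k}, X_{β,h}] = ∑ c(s) X_{α+β,s}` with `c(s) ∈ {0, ±1, ±2}` if `α + β ∈ Δ`; moreover
  `c(1) = ±(p+1)` if `α, β ∈ Δ_0`, where `β - p α ∈ Δ` and `β - (p+1) α ∉ Δ`; and, if `α = β`,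
  at most one `c(s)` is nonzero, and it is `±2`. -/
  struct_const : ∀ α β δ : Root K t n, δ.1 = α.1 + β.1 → ∀ k l,
    ∃ c : Fin δ.mult → ℤ, (∀ s, |c s| ≤ 2) ∧
      sbr (X α k : Op K n) (X β l) = ∑ s, c s • (X δ s : Op K n) ∧
      (α.IsClassical → β.IsClassical → ∀ p : ℕ,
        (∃ η : Root K t n, η.1 = β.1 - p • α.1) →
        (¬ ∃ η : Root K t n, η.1 = β.1 - (p + 1) • α.1) → ∀ s, |c s| = p + 1) ∧
      (α = β → (∀ s, c s ≠ 0 → |c s| = 2) ∧ ∀ s s', c s ≠ 0 → c s' ≠ 0 → s = s')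
  /-- `[X_{α,1}, [X_{α,1}, X_{β,h}]] = ± 2 X_{2α+β,s}` for a unique `s`, if `α ∈ Δ_0` and
  `2α + β ∈ Δ`. -/
  double_bracket : ∀ α β δ : Root K t n, α.IsClassical → δ.1 = 2 • α.1 + β.1 → ∀ k l,
    ∃! s : Fin δ.mult,
      sbr (X α k : Op K n) (sbr (X α k : Op K n) (X β l)) = (2 : ℤ) • (X δ s : Op K n) ∨
      sbr (X α k : Op K n) (sbr (X α k : Op K n) (X β l)) = (-2 : ℤ) • (X δ s : Op K n)

/-! ### The universal enveloping superalgebra -/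

/-- The relations `x ⊗ y - (-1)^{p(x) p(y)} y ⊗ x = [x, y]` and `z ⊗ z = z^⟨2⟩` (for `z` odd). -/
inductive EnvRel : TensorAlgebra K (galg K t n) → TensorAlgebra K (galg K t n) → Prop
  | bracket (p q : ZMod 2) (x y z : galg K t n) (hx : HasParity p (x : Op K n))
      (hy : HasParity q (y : Op K n)) (hz : (z : Op K n) = sbr (x : Op K n) (y : Op K n)) :
      EnvRel (TensorAlgebra.ι K x * TensorAlgebra.ι K y)
        ((-1 : K) ^ (p.val * q.val) • (TensorAlgebra.ι K y * TensorAlgebra.ι K x)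
          + TensorAlgebra.ι K z)
  | square (x z : galg K t n) (hx : HasParity 1 (x : Op K n))
      (hz : (z : Op K n) = (x : Op K n) * (x : Op K n)) :
      EnvRel (TensorAlgebra.ι K x * TensorAlgebra.ι K x) (TensorAlgebra.ι K z)

/-- The universal enveloping superalgebra `U(𝔤)`. -/
def Env : Type _ := RingQuot (EnvRel K t n)

instance : Ring (Env K t n) := inferInstanceAs (Ring (RingQuot (EnvRel K t n)))

instance : Algebra K (Env K t n) := inferInstanceAs (Algebra K (RingQuot (EnvRel K t n)))

/-- The canonical map `𝔤 → U(𝔤)`. -/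
def toEnv (x : galg K t n) : Env K t n :=
  RingQuot.mkAlgHom K (EnvRel K t n) (TensorAlgebra.ι K x)

variable {K t n}

/-- The divided power `y^{(m)} = y^m / m!`. -/
def divPow (y : Env K t n) (m : ℕ) : Env K t n := ((m.factorial : K)⁻¹) • y ^ m

/-- The binomial coefficient `y (y - 1) ⋯ (y - m + 1) / m!`. -/
def binom (y : Env K t n) (m : ℕ) : Env K t n :=
  ((m.factorial : K)⁻¹) • ((List.range m).map fun j : ℕ => y - (j : Env K t n)).prod

/-! ### The Kostant superalgebra and the PBW-like monomials -/

/-- The Kostant superalgebra `K_ℤ(𝔤)`: the unital subring of `U(𝔤)` generated by the binomial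
coefficients of the `H_i`'s, the divided powers of the even root vectors and the odd root
vectors. -/
def ChevalleyBasis.kostant (B : ChevalleyBasis K t n) : Subring (Env K t n) :=
  Subring.closure
    ({y | ∃ i m, y = binom (toEnv K t n (B.H i)) m} ∪
     {y | ∃ (α : Root K t n) (k : Fin α.mult) (m : ℕ), α.IsEven ∧
        y = divPow (toEnv K t n (B.X α k)) m} ∪
     {y | ∃ (γ : Root K t n) (k : Fin γ.mult), γ.IsOdd ∧ y = toEnv K t n (B.X γ k)})

variable (K t n)

/-- The set `Δ~ ⊔ {1, …, r}`, where `Δ~ = {(α, k) | α ∈ Δ, 1 ≤ k ≤ μ(α)}`. -/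
inductive PBWIndex
  | root (α : Root K t n) (k : Fin α.mult)
  | cartan (i : Fin (t.rank n))

/-- The systems of exponents of the PBW-like monomials: the exponent of an odd root vector is
at most `1`. -/
def PBWExponent : Type _ :=
  {e : PBWIndex K t n →₀ ℕ //
    ∀ (γ : Root K t n) (k : Fin γ.mult), γ.IsOdd → e (.root γ k) ≤ 1}

variable {K t n}

/-- The factor with exponent `m` at an index of `Δ~ ⊔ {1, …, r}`: a divided power of a root vector
(just `1` or `X` when `m ≤ 1`), or a binomial coefficient of some `H_i`. -/
def ChevalleyBasis.factor (B : ChevalleyBasis K t n) (j : PBWIndex K t n) (m : ℕ) : Env K t n :=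
  match j with
  | .root α k => divPow (toEnv K t n (B.X α k)) m
  | .cartan i => binom (toEnv K t n (B.H i)) m

/-- The ordered PBW-like monomial: the product, in increasing order of the indices, of the factors
with nonzero exponent. -/
def ChevalleyBasis.monomial (B : ChevalleyBasis K t n) [LinearOrder (PBWIndex K t n)]
    (e : PBWExponent K t n) : Env K t n :=
  ((e.1.support.sort (· ≤ ·)).map fun j => B.factor j (e.1 j)).prod

end LieSuperalgebra

end

end CartanSuper

/-!
The Kostant superalgebra is free with the ordered monomials as a basis, because these monomials
are linearly independent over the field and span over the integers.

**Independence** is the Poincaré–Birkhoff–Witt theorem. It is proved here without rewriting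
systems, using that `𝔤` acts faithfully on `Λ(n)`: the algebra `U(𝔤)` maps to the enveloping
superalgebra `SuperEnv` of the associative superalgebra `E = End(Λ(n))`, and it is enough to find
enough linear forms there. The algebra `SuperEnv` acts on `E ⊗ SuperEnv` by the coproduct, with
left multiplication on the first factor (`coact`); applying to `1 ⊗ 1` and contracting with a linear
form that kills `1 ∈ E` gives a partial derivative `senvDeriv`, which obeys the graded Leibniz rule
modulo shorter words. Differentiating letter by letter shows that ordered words in a family
independent modulo `1` are independent modulo shorter words (`senvWord_independent`). A Chevalley
basis together with the identity operator is independent, and the leading word of a monomial is, up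
to a nonzero factor, the corresponding ordered word (`ChevalleyBasis.hasLeadingWord_monomial`).

**Spanning** is a straightening argument by induction on the degree (`degLT_le_ordSpan`). It needs
only that the factors commute up to sign modulo terms of lower degree (`ChevalleyBasis.factor_comm`),
that two factors with the same even index merge (`ChevalleyBasis.factor_merge`) and that squares of
odd root vectors have lower degree (`ChevalleyBasis.factor_square`). The main case is that of the
divided powers of two even root vectors `x`, `y`. For opposite classical roots it is Kostant's
formula in `U(sl₂)` (`dpow_mul_dpow_sl2`). In the other cases, if `[y, [x, y]] = 0` and `(ad x)³ y = 0`,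
and if `(ad x)² y / 2` is integral, then conjugation by the formal exponential of `x` commutes
`x^{(a)}` past `y^{(b)}` (`commutesMod_dpow`). So the theorem comes down to facts about even root
vectors:

* if `α` is a classical root and `β` a root, then `3α + β` is not a root, and if moreover `β` is classical
  and not `-α`, then one of `2α + β` and `2β + α` is not a root (`Root.IsClassical.string`,
  `Root.IsClassical.strings`);
* even root spaces are commutative, and opposite even root spaces that are not classical commute
  (`Root.IsEven.abelian`, `Root.IsEven.opposite`);
* for an even root that is not classical, the lattice spanned by the root vectors is generated by
  elements `x` with `(ad x)² = 0` (`ChevalleyBasis.lat_le_closure_good`).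

For `W(n)`, `S(n)` and `S~(n)` they are read off from the weights of `W(n)`, whose entries are `0` or
`1` with at most one exception `-1`. For `H(n)`, root vectors are Hamiltonian vector fields, and the
third fact is the delicate one: a root space can have dimension greater than one, a general
element `x` of it need not satisfy `(ad x)² = 0`, and nothing in the definition says that the basis
of the root space consists of monomials. The conditions on the brackets of `X_{-ε_k}` with the root
vectors of weight `ε_k` force the `H_i` to be `±(ξ_l ∂_l - ξ_{τ l} ∂_{τ l})`, where `τ` is the involution
that pairs the indices (`ChevalleyBasis.exists_H_eq`). Hence brackets with `X_{±ε_k}` provide integral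
operators on the root lattices, which move pairs `ξ_k ξ_{τ k}` (`ChevalleyBasis.movePair_mem`), and
their products are commuting idempotents `pairProj`. A lattice stable under commuting idempotents
is generated by joint eigenvectors, which are here weight vectors for the full torus of `W(n)`, and
for these `(ad x)² = 0` holds (`ChevalleyBasis.lat_le_good_H`).
-/

namespace CartanSuper

noncomputable section

open scoped TensorProduct

set_option linter.unusedSectionVars false

/-! ### The supercommutator and parities -/

section Parity

variable {K : Type*} [Field K] {n : ℕ}

-- The next lemmas restate general facts on rings and modules for the type `Op K n`, on which
-- rewriting with the general ones does not see through the instances.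

theorem op_neg_mul (a b : Op K n) : -a * b = -(a * b) := neg_mul a b

theorem op_mul_neg (a b : Op K n) : a * -b = -(a * b) := mul_neg a b

theorem op_neg_smul (c : K) (a : Op K n) : (-c) • a = -(c • a) := neg_smul c a

theorem op_neg_one_smul (a : Op K n) : (-1 : K) • a = -a := by rw [op_neg_smul, one_smul]

theorem parInv_mul_parInv : parInv K n * parInv K n = 1 := 
  LinearMap.ext fun x => CliffordAlgebra.involute_involute x

theorem hasParity_zero_iff {D : Op K n} : HasParity 0 D ↔ parInv K n * D = D * parInv K n := by
  simp [HasParity]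

theorem hasParity_one_iff {D : Op K n} :
    HasParity 1 D ↔ parInv K n * D = -(D * parInv K n) := by
  simp [HasParity, show (1 : ZMod 2).val = 1 from rfl, op_neg_one_smul]

theorem HasParity.conj_zero {D : Op K n} (h : HasParity 0 D) :
    parInv K n * D * parInv K n = D := by
  rw [hasParity_zero_iff.1 h, mul_assoc, parInv_mul_parInv, mul_one]

theorem HasParity.conj_one {D : Op K n} (h : HasParity 1 D) :
    parInv K n * D * parInv K n = -D := by
  rw [hasParity_one_iff.1 h, op_neg_mul, mul_assoc, parInv_mul_parInv, mul_one]

theorem hasParity_zero_of_conj {D : Op K n} (h : parInv K n * D * parInv K n = D) :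
    HasParity 0 D := by
  rw [hasParity_zero_iff]
  nth_rewrite 2 [← h]
  rw [mul_assoc, mul_assoc, parInv_mul_parInv, mul_one]

theorem hasParity_one_of_conj {D : Op K n} (h : parInv K n * D * parInv K n = -D) :
    HasParity 1 D := by
  rw [hasParity_one_iff, ← op_neg_mul, ← h]
  rw [mul_assoc, mul_assoc, parInv_mul_parInv, mul_one]

theorem zmod_two_cases (p : ZMod 2) : p = 0 ∨ p = 1 := by
  revert p; decide

theorem HasParity.add {p : ZMod 2} {a b : Op K n} (ha : HasParity p a) (hb : HasParity p b) :
    HasParity p (a + b) := by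
  unfold HasParity at *
  rw [mul_add, ha, hb, add_mul, smul_add]

theorem HasParity.smul {p : ZMod 2} {a : Op K n} (c : K) (ha : HasParity p a) :
    HasParity p (c • a) := by
  unfold HasParity at *
  rw [mul_smul_comm, ha, smul_mul_assoc, smul_comm]

theorem hasParity_zero_op (p : ZMod 2) : HasParity p (0 : Op K n) := by
  simp [HasParity]

theorem HasParity.neg {p : ZMod 2} {a : Op K n} (ha : HasParity p a) : HasParity p (-a) := by
  rw [← op_neg_one_smul]
  exact ha.smul (-1)

theorem HasParity.sub {p : ZMod 2} {a b : Op K n} (ha : HasParity p a) (hb : HasParity p b) :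
    HasParity p (a - b) := by
  have h := ha.add hb.neg
  rwa [show a + -b = a - b from (sub_eq_add_neg a b).symm] at h

theorem HasParity.mul {p q : ZMod 2} {a b : Op K n} (ha : HasParity p a) (hb : HasParity q b) :
    HasParity (p + q) (a * b) := by
  have h : parInv K n * (a * b) * parInv K n
      = (parInv K n * a * parInv K n) * (parInv K n * b * parInv K n) := by
    simp only [mul_assoc]
    rw [← mul_assoc (parInv K n) (parInv K n), parInv_mul_parInv, one_mul]
  rcases zmod_two_cases p with rfl | rfl <;> rcases zmod_two_cases q with rfl | rfl
  · exact hasParity_zero_of_conj (by rw [h, ha.conj_zero, hb.conj_zero])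
  · exact hasParity_one_of_conj (by rw [h, ha.conj_zero, hb.conj_one, op_mul_neg])
  · exact hasParity_one_of_conj (by rw [h, ha.conj_one, hb.conj_zero, op_neg_mul])
  · exact hasParity_zero_of_conj (by rw [h, ha.conj_one, hb.conj_one, op_neg_mul, op_mul_neg, neg_neg])

variable (K n)

/-- `D ↦ P D P`, where `P` is the parity involution of `Λ(n)`. -/
def parConj : Op K n →ₗ[K] Op K n :=
  LinearMap.mulLeft K (parInv K n) ∘ₗ LinearMap.mulRight K (parInv K n)

/-- The projection onto the even operators, as a linear map. -/
def evenPartL : Op K n →ₗ[K] Op K n := (2 : K)⁻¹ • (LinearMap.id + parConj K n)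

/-- The projection onto the odd operators, as a linear map. -/
def oddPartL : Op K n →ₗ[K] Op K n := (2 : K)⁻¹ • (LinearMap.id - parConj K n)

variable {K n}

theorem evenPartL_apply (D : Op K n) : evenPartL K n D = evenPart D := by
  simp [evenPartL, evenPart, parConj, mul_assoc]

theorem oddPartL_apply (D : Op K n) : oddPartL K n D = oddPart D := by
  simp [oddPartL, oddPart, parConj, mul_assoc]

theorem parConj_apply (D : Op K n) : parConj K n D = parInv K n * D * parInv K n := by
  simp [parConj, mul_assoc]

theorem parConj_of_zero {D : Op K n} (h : HasParity 0 D) : parConj K n D = D := by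
  rw [parConj_apply, h.conj_zero]

theorem parConj_of_one {D : Op K n} (h : HasParity 1 D) : parConj K n D = -D := by
  rw [parConj_apply, h.conj_one]

theorem parConj_parConj (D : Op K n) : parConj K n (parConj K n D) = D := by
  simp only [parConj_apply]
  rw [mul_assoc, mul_assoc, mul_assoc, parInv_mul_parInv, mul_one, ← mul_assoc,
    parInv_mul_parInv, one_mul]

variable [CharZero K]

theorem half_smul_add_self {V : Type*} [AddCommGroup V] [Module K V] (D : V) :
    (2 : K)⁻¹ • (D + D) = D := by
  rw [← two_smul K D, smul_smul, inv_mul_cancel₀ two_ne_zero, one_smul]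

theorem evenPart_of_zero {D : Op K n} (h : HasParity 0 D) : evenPart D = D := by
  rw [evenPart, h.conj_zero, half_smul_add_self]

theorem oddPart_of_zero {D : Op K n} (h : HasParity 0 D) : oddPart D = 0 := by
  rw [oddPart, h.conj_zero, sub_self, smul_zero]

theorem evenPart_of_one {D : Op K n} (h : HasParity 1 D) : evenPart D = 0 := by
  rw [evenPart, h.conj_one, add_neg_cancel, smul_zero]

theorem oddPart_of_one {D : Op K n} (h : HasParity 1 D) : oddPart D = D := by
  rw [oddPart, h.conj_one, sub_neg_eq_add, half_smul_add_self]

theorem evenPart_add_oddPart (D : Op K n) : evenPart D + oddPart D = D := by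
  rw [evenPart, oddPart, ← smul_add, add_add_sub_cancel, half_smul_add_self]

theorem evenPart_parity (D : Op K n) : HasParity 0 (evenPart D) := by
  apply hasParity_zero_of_conj
  rw [← evenPartL_apply, ← parConj_apply]
  simp only [evenPartL, LinearMap.smul_apply, map_smul, LinearMap.add_apply, map_add,
    LinearMap.id_apply, parConj_parConj]
  rw [add_comm]

theorem oddPart_parity (D : Op K n) : HasParity 1 (oddPart D) := by
  apply hasParity_one_of_conj
  rw [← oddPartL_apply, ← parConj_apply]
  simp only [oddPartL, LinearMap.smul_apply, map_smul, LinearMap.sub_apply, map_sub,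
    LinearMap.id_apply, parConj_parConj]
  rw [← smul_neg, neg_sub]

/-- An operator that is both even and odd vanishes. -/
theorem eq_zero_of_parity {D : Op K n} (h0 : HasParity 0 D) (h1 : HasParity 1 D) : D = 0 := by
  rw [← evenPart_of_zero h0, evenPart_of_one h1]

theorem sbr_even_left {x : Op K n} (hx : HasParity 0 x) (y : Op K n) :
    sbr x y = x * y - y * x := by
  rw [sbr, evenPart_of_zero hx, oddPart_of_zero hx, mul_zero, mul_zero, add_zero, sub_zero,
    ← add_mul, evenPart_add_oddPart]

theorem sbr_even_right (x : Op K n) {y : Op K n} (hy : HasParity 0 y) :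
    sbr x y = x * y - y * x := by
  rw [sbr, evenPart_of_zero hy, oddPart_of_zero hy, zero_mul, zero_mul, add_zero, sub_zero,
    ← mul_add, evenPart_add_oddPart]

theorem sbr_odd_odd {x y : Op K n} (hx : HasParity 1 x) (hy : HasParity 1 y) :
    sbr x y = x * y + y * x := by
  rw [sbr, evenPart_of_one hx, oddPart_of_one hx, evenPart_of_one hy, oddPart_of_one hy]
  simp

theorem sbr_of_parity {p q : ZMod 2} {x y : Op K n} (hx : HasParity p x) (hy : HasParity q y) :
    sbr x y = x * y - (-1 : K) ^ (p.val * q.val) • (y * x) := by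
  rcases zmod_two_cases p with rfl | rfl
  · simp [sbr_even_left hx]
  · rcases zmod_two_cases q with rfl | rfl
    · simp [sbr_even_right x hy]
    · simp [sbr_odd_odd hx hy, show (1 : ZMod 2).val = 1 from rfl, op_neg_one_smul]

theorem sbr_parity {p q : ZMod 2} {x y : Op K n} (hx : HasParity p x) (hy : HasParity q y) :
    HasParity (p + q) (sbr x y) := by
  rw [sbr_of_parity hx hy]
  refine (hx.mul hy).sub (HasParity.smul _ ?_)
  rw [add_comm]
  exact hy.mul hx

variable (K n) in
theorem sbr_bilin_aux (x y : Op K n) : sbr x y =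
    LinearMap.mul K _ x y - (LinearMap.mul K _ (evenPartL K n y) (evenPartL K n x)
      + LinearMap.mul K _ (evenPartL K n y) (oddPartL K n x)
      + LinearMap.mul K _ (oddPartL K n y) (evenPartL K n x)
      - LinearMap.mul K _ (oddPartL K n y) (oddPartL K n x)) := by
  simp [sbr, evenPartL_apply, oddPartL_apply]

variable (K n) in
/-- The supercommutator as a bilinear map. -/
def sbrL : Op K n →ₗ[K] Op K n →ₗ[K] Op K n :=
  LinearMap.mk₂ K sbr
    (fun x y z => by simp only [sbr_bilin_aux, map_add, LinearMap.add_apply]; abel)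
    (fun c x y => by
      simp only [sbr_bilin_aux, map_smul, LinearMap.smul_apply]; module)
    (fun x y z => sbr_add_right K x y z) (fun c x y => sbr_smul_right K x y c)

theorem sbrL_apply (x y : Op K n) : sbrL K n x y = sbr x y := rfl

end Parity

/-! ### The enveloping superalgebra of an associative superalgebra -/

section SuperEnv

variable {K : Type*} [Field K] {E : Type*} [Ring E] [Algebra K E] (σ : E →ₐ[K] E)

/-- `x` is homogeneous of parity `p` for the `ℤ/2`-grading whose parity automorphism is `σ`. -/
def SPar (p : ZMod 2) (x : E) : Prop := σ x = (-1 : K) ^ p.val • x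

/-- The defining relations of the enveloping superalgebra of the Lie superalgebra attached to an
associative superalgebra `E` with parity automorphism `σ`. -/
inductive SuperRel : TensorAlgebra K E → TensorAlgebra K E → Prop
  | bracket (p q : ZMod 2) (x y : E) (hx : SPar σ p x) (hy : SPar σ q y) :
      SuperRel (TensorAlgebra.ι K x * TensorAlgebra.ι K y)
        ((-1 : K) ^ (p.val * q.val) • (TensorAlgebra.ι K y * TensorAlgebra.ι K x)
          + TensorAlgebra.ι K (x * y - (-1 : K) ^ (p.val * q.val) • (y * x)))
  | square (x : E) (hx : SPar σ 1 x) :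
      SuperRel (TensorAlgebra.ι K x * TensorAlgebra.ι K x) (TensorAlgebra.ι K (x * x))

/-- The enveloping superalgebra of the Lie superalgebra attached to an associative superalgebra
`E` with parity automorphism `σ`. -/
def SuperEnv : Type _ := RingQuot (SuperRel σ)

instance : Ring (SuperEnv σ) := inferInstanceAs (Ring (RingQuot (SuperRel σ)))

instance : Algebra K (SuperEnv σ) := inferInstanceAs (Algebra K (RingQuot (SuperRel σ)))

/-- The canonical map `E → SuperEnv`. -/
def senvι : E →ₗ[K] SuperEnv σ :=
  (RingQuot.mkAlgHom K (SuperRel σ)).toLinearMap ∘ₗ TensorAlgebra.ι K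

variable {σ}

theorem sPar_zero_iff {x : E} : SPar σ 0 x ↔ σ x = x := by simp [SPar]

theorem sPar_one_iff {x : E} : SPar σ 1 x ↔ σ x = -x := by
  simp [SPar, show (1 : ZMod 2).val = 1 from rfl]

theorem SPar.mul_self {x : E} (hx : SPar σ 1 x) : SPar σ 0 (x * x) := by
  rw [sPar_one_iff] at hx
  rw [sPar_zero_iff, map_mul, hx, neg_mul_neg]

theorem SPar.bracket {p q : ZMod 2} {x y : E} (hx : SPar σ p x) (hy : SPar σ q y) :
    SPar σ (p + q) (x * y - (-1 : K) ^ (p.val * q.val) • (y * x)) := by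
  rcases zmod_two_cases p with rfl | rfl <;> rcases zmod_two_cases q with rfl | rfl <;>
  simp_all [SPar, show (1 : ZMod 2).val = 1 from rfl, show (1 + 1 : ZMod 2) = 0 from rfl] <;> abel

theorem senvι_bracket {p q : ZMod 2} {x y : E} (hx : SPar σ p x) (hy : SPar σ q y) :
    senvι σ x * senvι σ y = (-1 : K) ^ (p.val * q.val) • (senvι σ y * senvι σ x)
      + senvι σ (x * y - (-1 : K) ^ (p.val * q.val) • (y * x)) := by
  have := RingQuot.mkAlgHom_rel K (SuperRel.bracket p q x y hx hy)
  rw [map_mul, map_add, map_smul, map_mul] at this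
  exact this

theorem senvι_square {x : E} (hx : SPar σ 1 x) :
    senvι σ x * senvι σ x = senvι σ (x * x) := by
  have := RingQuot.mkAlgHom_rel K (SuperRel.square x hx)
  rw [map_mul] at this
  exact this

theorem superRel_lift {A : Type*} [Ring A] [Algebra K A] (f : E →ₗ[K] A)
    (hb : ∀ (p q : ZMod 2) (x y : E), SPar σ p x → SPar σ q y →
      f x * f y = (-1 : K) ^ (p.val * q.val) • (f y * f x)
        + f (x * y - (-1 : K) ^ (p.val * q.val) • (y * x)))
    (hs : ∀ x : E, SPar σ 1 x → f x * f x = f (x * x)) :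
    ∀ ⦃a b : TensorAlgebra K E⦄, SuperRel σ a b →
      TensorAlgebra.lift K f a = TensorAlgebra.lift K f b := by
  rintro _ _ (⟨p, q, x, y, hx, hy⟩ | ⟨x, hx⟩)
  · simpa using hb p q x y hx hy
  · simpa using hs x hx

/-- The universal property of `SuperEnv`. -/
def senvLift {A : Type*} [Ring A] [Algebra K A] (f : E →ₗ[K] A)
    (hb : ∀ (p q : ZMod 2) (x y : E), SPar σ p x → SPar σ q y →
      f x * f y = (-1 : K) ^ (p.val * q.val) • (f y * f x)
        + f (x * y - (-1 : K) ^ (p.val * q.val) • (y * x)))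
    (hs : ∀ x : E, SPar σ 1 x → f x * f x = f (x * x)) : SuperEnv σ →ₐ[K] A :=
  RingQuot.liftAlgHom K ⟨TensorAlgebra.lift K f, superRel_lift f hb hs⟩

theorem senvLift_senvι {A : Type*} [Ring A] [Algebra K A] (f : E →ₗ[K] A) (hb hs)
    (x : E) : senvLift (σ := σ) f hb hs (senvι σ x) = f x := by
  have := RingQuot.liftAlgHom_mkAlgHom_apply K (TensorAlgebra.lift K f) (superRel_lift f hb hs)
    (TensorAlgebra.ι K x)
  rw [TensorAlgebra.lift_ι_apply] at this
  exact this

theorem senv_hom_ext {A : Type*} [Ring A] [Algebra K A] {f g : SuperEnv σ →ₐ[K] A}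
    (h : ∀ x, f (senvι σ x) = g (senvι σ x)) : f = g := by
  apply RingQuot.ringQuot_ext'
  apply TensorAlgebra.hom_ext
  ext1 x
  exact h x

variable (σ) in
/-- The augmentation of `SuperEnv`. -/
def senvAug : SuperEnv σ →ₐ[K] K := senvLift 0 (by simp) (by simp)

instance : Nontrivial (SuperEnv σ) := (senvAug σ).toRingHom.domain_nontrivial

variable [CharZero K] [hσ : Fact (∀ x, σ (σ x) = x)]

variable (σ) in
/-- The parity automorphism of `SuperEnv`. -/
def senvPar : SuperEnv σ →ₐ[K] SuperEnv σ :=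
  senvLift (senvι σ ∘ₗ σ.toLinearMap)
    (by
      intro p q x y hx hy
      simp only [LinearMap.comp_apply, AlgHom.toLinearMap_apply]
      have h := hx.bracket hy
      have hb := senvι_bracket hx hy
      unfold SPar at hx hy h
      rw [h, hx, hy]
      simp only [map_smul, smul_mul_smul_comm]
      rw [hb]
      rcases zmod_two_cases p with rfl | rfl <;> rcases zmod_two_cases q with rfl | rfl <;>
      simp [show (1 : ZMod 2).val = 1 from rfl, show (1 + 1 : ZMod 2) = 0 from rfl])
    (by
      intro x hx
      simp only [LinearMap.comp_apply, AlgHom.toLinearMap_apply]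
      rw [sPar_zero_iff.1 hx.mul_self, sPar_one_iff.1 hx, map_neg, neg_mul_neg, senvι_square hx])

theorem senvPar_senvι (x : E) : senvPar σ (senvι σ x) = senvι σ (σ x) :=
  senvLift_senvι _ _ _ x

theorem senvPar_senvPar (u : SuperEnv σ) : senvPar σ (senvPar σ u) = u := by
  have : (senvPar σ).comp (senvPar σ) = AlgHom.id K _ := by
    apply senv_hom_ext
    intro x
    simp [senvPar_senvι, hσ.out]
  exact DFunLike.congr_fun this u

variable (σ) in
/-- The projection onto the even part. -/
def sEven : E →ₗ[K] E := (2 : K)⁻¹ • (LinearMap.id + σ.toLinearMap)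

variable (σ) in
/-- The projection onto the odd part. -/
def sOdd : E →ₗ[K] E := (2 : K)⁻¹ • (LinearMap.id - σ.toLinearMap)

theorem sEven_zero {x : E} (hx : SPar σ 0 x) : sEven σ x = x := by
  rw [sEven, LinearMap.smul_apply, LinearMap.add_apply, AlgHom.toLinearMap_apply,
    sPar_zero_iff.1 hx, LinearMap.id_apply, half_smul_add_self]

theorem sEven_one {x : E} (hx : SPar σ 1 x) : sEven σ x = 0 := by
  simp [sEven, sPar_one_iff.1 hx]

theorem sOdd_zero {x : E} (hx : SPar σ 0 x) : sOdd σ x = 0 := by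
  simp [sOdd, sPar_zero_iff.1 hx]

theorem sOdd_one {x : E} (hx : SPar σ 1 x) : sOdd σ x = x := by
  rw [sOdd, LinearMap.smul_apply, LinearMap.sub_apply, AlgHom.toLinearMap_apply,
    sPar_one_iff.1 hx, LinearMap.id_apply, sub_neg_eq_add, half_smul_add_self]

variable (σ) in
/-- The linear map underlying the coproduct representation of `SuperEnv` on `E ⊗ SuperEnv`:
an even `x` acts by `x ⊗ 1 + 1 ⊗ x`, an odd one by `x ⊗ π + 1 ⊗ x`, with `π` the parity. -/
def coactL : E →ₗ[K] Module.End K (E ⊗[K] SuperEnv σ) :=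
  (LinearMap.rTensorHom (SuperEnv σ)) ∘ₗ (LinearMap.mul K (E)) ∘ₗ sEven σ
  + LinearMap.mulLeft K ((senvPar σ).toLinearMap.lTensor (E)) ∘ₗ
      (LinearMap.rTensorHom (SuperEnv σ)) ∘ₗ (LinearMap.mul K (E)) ∘ₗ sOdd σ
  + (LinearMap.lTensorHom (E)) ∘ₗ (LinearMap.mul K (SuperEnv σ)) ∘ₗ senvι σ

theorem coactL_tmul (x b : E) (u : SuperEnv σ) : coactL σ x (b ⊗ₜ u)
    = (sEven σ x * b) ⊗ₜ u + (sOdd σ x * b) ⊗ₜ (senvPar σ u) + b ⊗ₜ (senvι σ x * u) := by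
  simp [coactL, ]

theorem coactL_zero {x : E} (hx : SPar σ 0 x) (b : E) (u : SuperEnv σ) :
    coactL σ x (b ⊗ₜ u) = (x * b) ⊗ₜ u + b ⊗ₜ (senvι σ x * u) := by
  simp [coactL_tmul, sEven_zero hx, sOdd_zero hx]

theorem coactL_one {x : E} (hx : SPar σ 1 x) (b : E) (u : SuperEnv σ) :
    coactL σ x (b ⊗ₜ u) = (x * b) ⊗ₜ senvPar σ u + b ⊗ₜ (senvι σ x * u) := by
  simp [coactL_tmul, sEven_one hx, sOdd_one hx]

theorem senvPar_zero {x : E} (hx : SPar σ 0 x) : senvPar σ (senvι σ x) = senvι σ x := by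
  rw [senvPar_senvι, sPar_zero_iff.1 hx]

theorem senvPar_one {x : E} (hx : SPar σ 1 x) : senvPar σ (senvι σ x) = -senvι σ x := by
  rw [senvPar_senvι, sPar_one_iff.1 hx, map_neg]

variable (σ) in
/-- The coproduct representation of `SuperEnv` on `E ⊗ SuperEnv`. -/
def coact : SuperEnv σ →ₐ[K] Module.End K (E ⊗[K] SuperEnv σ) :=
  senvLift (coactL σ)
    (by
      intro p q x y hx hy
      refine TensorProduct.ext' (R := K) (M := E) (N := SuperEnv σ) fun b u => ?_
      have hbr := senvι_bracket hx hy
      have hxy := hx.bracket hy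
      obtain ⟨z, hz⟩ : ∃ z, z = x * y - (-1 : K) ^ (p.val * q.val) • (y * x) := ⟨_, rfl⟩
      have hz' : x * y = (-1 : K) ^ (p.val * q.val) • (y * x) + z := by rw [hz]; abel
      rw [← hz] at hbr hxy ⊢
      have hu : senvι σ x * (senvι σ y * u) = ((-1 : K) ^ (p.val * q.val) • (senvι σ y * senvι σ x)
          + senvι σ z) * u := by rw [← hbr, mul_assoc]
      have hb : x * (y * b) = ((-1 : K) ^ (p.val * q.val) • (y * x) + z) * b := by
        rw [← hz', mul_assoc]
      clear hz hz' hbr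
      rcases zmod_two_cases p with rfl | rfl <;> rcases zmod_two_cases q with rfl | rfl
      · simp only [LinearMap.add_apply, LinearMap.smul_apply, Module.End.mul_apply,
          coactL_zero hx, coactL_zero hy, coactL_zero hxy, map_add, hu, hb]
        simp [TensorProduct.add_tmul, TensorProduct.tmul_add, add_mul, mul_assoc]
        abel
      · simp only [LinearMap.add_apply, LinearMap.smul_apply, Module.End.mul_apply,
          coactL_zero hx, coactL_one hy, coactL_one hxy, map_add, hu, hb]
        simp [TensorProduct.add_tmul, TensorProduct.tmul_add, add_mul, mul_assoc, senvPar_zero hx]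
        abel
      · simp only [LinearMap.add_apply, LinearMap.smul_apply, Module.End.mul_apply,
          coactL_one hx, coactL_zero hy, coactL_one hxy, map_add, hu, hb]
        simp [TensorProduct.add_tmul, TensorProduct.tmul_add, add_mul, mul_assoc, senvPar_zero hy]
        abel
      · have h1 : (1 : ZMod 2).val = 1 := rfl
        simp only [LinearMap.add_apply, LinearMap.smul_apply, Module.End.mul_apply,
          coactL_one hx, coactL_one hy, coactL_zero hxy, map_add, hu, hb]
        simp [TensorProduct.add_tmul, TensorProduct.tmul_add, add_mul, mul_assoc, senvPar_one hx,
          senvPar_one hy, senvPar_senvPar, h1, TensorProduct.neg_tmul, TensorProduct.tmul_neg]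
        abel)
    (by
      intro x hx
      refine TensorProduct.ext' (R := K) (M := E) (N := SuperEnv σ) fun b u => ?_
      have hxy := hx.mul_self
      have hu : senvι σ x * (senvι σ x * u) = senvι σ (x * x) * u := by
        rw [← senvι_square hx, mul_assoc]
      simp only [Module.End.mul_apply, coactL_one hx, coactL_zero hxy, map_add, hu]
      simp [mul_assoc, senvPar_one hx, senvPar_senvPar, TensorProduct.tmul_neg])

theorem coact_senvι (x : E) : coact σ (senvι σ x) = coactL σ x := senvLift_senvι _ _ _ x

/-! ### Independence of ordered words -/

variable (σ) in
/-- The span of the words of length less than `m` in `SuperEnv`. -/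
def wordsLT (m : ℕ) : Submodule K (SuperEnv σ) :=
  Submodule.span K {u | ∃ l : List (E), l.length < m ∧ u = (l.map (senvι σ)).prod}

theorem wordsLT_mono {m m' : ℕ} (h : m ≤ m') : wordsLT σ m ≤ wordsLT σ m' :=
  Submodule.span_mono fun _ ⟨l, hl, hu⟩ => ⟨l, hl.trans_le h, hu⟩

theorem wordsLT_zero : wordsLT σ 0 = ⊥ := by
  rw [wordsLT, Submodule.span_eq_bot]
  rintro u ⟨l, hl, -⟩
  exact absurd hl (Nat.not_lt_zero _)

theorem one_mem_wordsLT (m : ℕ) : (1 : SuperEnv σ) ∈ wordsLT σ (m + 1) :=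
  Submodule.subset_span ⟨[], by simp, by simp⟩

theorem senvι_mul_mem_wordsLT {m : ℕ} (x : E) {u : SuperEnv σ} (hu : u ∈ wordsLT σ m) :
    senvι σ x * u ∈ wordsLT σ (m + 1) := by
  induction hu using Submodule.span_induction with
  | mem u hu =>
    obtain ⟨l, hl, rfl⟩ := hu
    exact Submodule.subset_span ⟨x :: l, by simpa using hl, by simp⟩
  | zero => simp
  | add u v _ _ hu hv => rw [mul_add]; exact add_mem hu hv
  | smul c u _ hu => rw [mul_smul_comm]; exact Submodule.smul_mem _ c hu

/-- Words of length at most `m` are built from `1` by multiplying by letters from the left. -/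
theorem wordsLT_induction {C : ℕ → SuperEnv σ → Prop} (h0 : ∀ m, C m 0)
    (hone : ∀ m, C m 1)
    (hadd : ∀ m u v, C m u → C m v → C m (u + v)) (hsmul : ∀ m (c : K) u, C m u → C m (c • u))
    (_hmono : ∀ m u, C m u → C (m + 1) u)
    (hmul : ∀ m x u, u ∈ wordsLT σ (m + 1) → C m u → C (m + 1) (senvι σ x * u))
    (m : ℕ) (u : SuperEnv σ) (hu : u ∈ wordsLT σ (m + 1)) : C m u := by
  have key : ∀ (l : List (E)) (m : ℕ), l.length < m + 1 → C m (l.map (senvι σ)).prod := by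
    intro l
    induction l with
    | nil => intro m _; simpa using hone m
    | cons x l ih =>
      intro m hm
      obtain ⟨m, rfl⟩ : ∃ k, m = k + 1 := ⟨m - 1, by simp at hm; omega⟩
      have hl : l.length < m + 1 := by simpa using hm
      rw [List.map_cons, List.prod_cons]
      exact hmul m x _ (Submodule.subset_span ⟨l, hl, rfl⟩) (ih m hl)
  induction hu using Submodule.span_induction with
  | mem u hu => obtain ⟨l, hl, rfl⟩ := hu; exact key l m hl
  | zero => exact h0 m
  | add u v _ _ hu hv => exact hadd m u v hu hv
  | smul c u _ hu => exact hsmul m c u hu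

theorem senvPar_mem_wordsLT {m : ℕ} {u : SuperEnv σ} (hu : u ∈ wordsLT σ m) :
    senvPar σ u ∈ wordsLT σ m := by
  induction hu using Submodule.span_induction with
  | mem u hu =>
    obtain ⟨l, hl, rfl⟩ := hu
    refine Submodule.subset_span ⟨l.map (σ), by simpa using hl, ?_⟩
    rw [map_list_prod, List.map_map, List.map_map]
    congr 1
    refine List.map_congr_left fun x _ => ?_
    simp [senvPar_senvι]
  | zero => simp
  | add u v _ _ hu hv => rw [map_add]; exact add_mem hu hv
  | smul c u _ hu => rw [map_smul]; exact Submodule.smul_mem _ c hu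

variable (σ) in
/-- `E ⊗ V`, with `V` the span of the words of length less than `m`. -/
def tensorLT (m : ℕ) : Submodule K (E ⊗[K] SuperEnv σ) :=
  Submodule.span K {z | ∃ b : E, ∃ u ∈ wordsLT σ m, z = b ⊗ₜ u}

theorem tmul_mem_tensorLT {m : ℕ} (b : E) {u : SuperEnv σ} (hu : u ∈ wordsLT σ m) :
    b ⊗ₜ[K] u ∈ tensorLT σ m := Submodule.subset_span ⟨b, u, hu, rfl⟩

theorem tensorLT_mono {m m' : ℕ} (h : m ≤ m') : tensorLT σ m ≤ tensorLT σ m' :=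
  Submodule.span_mono fun _ ⟨b, u, hu, hz⟩ => ⟨b, u, wordsLT_mono h hu, hz⟩

theorem coactL_mem_tensorLT {m : ℕ} (x : E) {z : E ⊗[K] SuperEnv σ}
    (hz : z ∈ tensorLT σ m) : coactL σ x z ∈ tensorLT σ (m + 1) := by
  induction hz using Submodule.span_induction with
  | mem z hz =>
    obtain ⟨b, u, hu, rfl⟩ := hz
    rw [coactL_tmul]
    have hu' := wordsLT_mono (Nat.le_succ m) hu
    exact add_mem (add_mem (tmul_mem_tensorLT _ hu')
      (tmul_mem_tensorLT _ (senvPar_mem_wordsLT hu'))) (tmul_mem_tensorLT _ (senvι_mul_mem_wordsLT x hu))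
  | zero => simp
  | add u v _ _ hu hv => rw [map_add]; exact add_mem hu hv
  | smul c u _ hu => rw [map_smul]; exact Submodule.smul_mem _ c hu

/-- The coproduct of a word `u` is `1 ⊗ u` up to terms with a shorter second factor. -/
theorem coact_sub_mem {m : ℕ} {u : SuperEnv σ} (hu : u ∈ wordsLT σ (m + 1)) :
    coact σ u (1 ⊗ₜ 1) - 1 ⊗ₜ u ∈ tensorLT σ m := by
  refine wordsLT_induction (C := fun m u => coact σ u (1 ⊗ₜ 1) - 1 ⊗ₜ u ∈ tensorLT σ m)
    ?_ ?_ ?_ ?_ ?_ ?_ m u hu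
  · intro m; simp
  · intro m; simp
  · intro m u v hu hv
    convert add_mem hu hv using 1
    rw [map_add, LinearMap.add_apply, TensorProduct.tmul_add]
    abel
  · intro m c u hu
    convert Submodule.smul_mem _ c hu using 1
    rw [map_smul, LinearMap.smul_apply, TensorProduct.tmul_smul]
    module
  · intro m u hu
    exact tensorLT_mono (Nat.le_succ m) hu
  · intro m x u hu h
    have h2 := coactL_mem_tensorLT x h
    rw [map_sub, coactL_tmul] at h2
    rw [map_mul, Module.End.mul_apply, coact_senvι]
    have h3 := add_mem h2 (add_mem (tmul_mem_tensorLT (sEven σ x * 1) hu)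
      (tmul_mem_tensorLT (sOdd σ x * 1) (senvPar_mem_wordsLT hu)))
    convert h3 using 1
    abel

/-- The partial derivative of `SuperEnv` defined by a functional `lam` on `E`. -/
def senvDeriv (lam : E →ₗ[K] K) : SuperEnv σ →ₗ[K] SuperEnv σ :=
  (TensorProduct.lid K (SuperEnv σ)).toLinearMap ∘ₗ lam.rTensor (SuperEnv σ) ∘ₗ
    LinearMap.applyₗ ((1 : E) ⊗ₜ[K] (1 : SuperEnv σ)) ∘ₗ (coact σ).toLinearMap

theorem contract_mem {lam : E →ₗ[K] K} {m : ℕ} {z : E ⊗[K] SuperEnv σ}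
    (hz : z ∈ tensorLT σ m) :
    TensorProduct.lid K (SuperEnv σ) (lam.rTensor (SuperEnv σ) z) ∈ wordsLT σ m := by
  induction hz using Submodule.span_induction with
  | mem z hz =>
    obtain ⟨b, u, hu, rfl⟩ := hz
    simpa using Submodule.smul_mem _ _ hu
  | zero => simp
  | add u v _ _ hu hv => rw [map_add, map_add]; exact add_mem hu hv
  | smul c u _ hu => rw [map_smul, map_smul]; exact Submodule.smul_mem _ c hu

theorem senvDeriv_apply (lam : E →ₗ[K] K) (u : SuperEnv σ) : senvDeriv lam u =
    TensorProduct.lid K (SuperEnv σ) (lam.rTensor (SuperEnv σ) (coact σ u (1 ⊗ₜ 1))) := rfl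

theorem senvDeriv_mem {lam : E →ₗ[K] K} (h1 : lam 1 = 0) {m : ℕ} {u : SuperEnv σ}
    (hu : u ∈ wordsLT σ (m + 1)) : senvDeriv lam u ∈ wordsLT σ m := by
  have h := contract_mem (lam := lam) (coact_sub_mem hu)
  simpa [senvDeriv_apply, h1] using h

theorem senvDeriv_one {lam : E →ₗ[K] K} (h1 : lam 1 = 0) : senvDeriv lam (1 : SuperEnv σ) = 0 := by
  simp [senvDeriv_apply, h1]

/-- The Leibniz rule for `senvDeriv`, modulo shorter words. -/
theorem senvDeriv_mul {lam : E →ₗ[K] K} {m : ℕ} {p : ZMod 2} {y : E}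
    (hy : SPar σ p y) {w : SuperEnv σ} (hw : w ∈ wordsLT σ (m + 1)) :
    senvDeriv lam (senvι σ y * w)
      - (lam y • (if p = 0 then w else senvPar σ w) + senvι σ y * senvDeriv lam w)
        ∈ wordsLT σ m := by
  have h := coact_sub_mem hw
  -- the part of the action of `y` that multiplies the first factor
  set g : E ⊗[K] SuperEnv σ →ₗ[K] E ⊗[K] SuperEnv σ := coactL σ y with hg
  set f : E ⊗[K] SuperEnv σ →ₗ[K] E ⊗[K] SuperEnv σ :=
    g - LinearMap.lTensor (E) (LinearMap.mulLeft K (senvι σ y)) with hf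
  have hfmem : ∀ z ∈ tensorLT σ m, f z ∈ tensorLT σ m := by
    intro z hz
    induction hz using Submodule.span_induction with
    | mem z hz =>
      obtain ⟨b, u, hu, rfl⟩ := hz
      simp only [hf, hg, LinearMap.sub_apply, coactL_tmul,
        LinearMap.lTensor_tmul, LinearMap.mulLeft_apply, add_sub_cancel_right]
      exact add_mem (tmul_mem_tensorLT _ hu) (tmul_mem_tensorLT _ (senvPar_mem_wordsLT hu))
    | zero => simp
    | add u v _ _ hu hv => rw [map_add]; exact add_mem hu hv
    | smul c u _ hu => rw [map_smul]; exact Submodule.smul_mem _ c hu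
  have hc : ∀ z : E ⊗[K] SuperEnv σ,
      TensorProduct.lid K (SuperEnv σ) (lam.rTensor (SuperEnv σ)
        (LinearMap.lTensor (E) (LinearMap.mulLeft K (senvι σ y)) z))
      = senvι σ y * TensorProduct.lid K (SuperEnv σ) (lam.rTensor (SuperEnv σ) z) := by
    intro z
    induction z using TensorProduct.induction_on with
    | zero => simp
    | tmul b u => simp
    | add a b ha hb => simp only [map_add, ha, hb, mul_add]
  have h2 := contract_mem (lam := lam) (hfmem _ h)
  have h3 : f (1 ⊗ₜ w) = y ⊗ₜ (if p = 0 then w else senvPar σ w) := by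
    simp only [hf, hg, LinearMap.sub_apply, LinearMap.lTensor_tmul, LinearMap.mulLeft_apply]
    rcases zmod_two_cases p with rfl | rfl
    · simp [coactL_zero hy]
    · simp [coactL_one hy]
  rw [map_sub, h3, map_sub, map_sub] at h2
  simp only [hf, hg, LinearMap.sub_apply, map_sub, hc, LinearMap.rTensor_tmul,
    TensorProduct.lid_tmul] at h2
  rw [senvDeriv_apply, map_mul, Module.End.mul_apply, coact_senvι, senvDeriv_apply]
  convert h2 using 1
  abel

section Family

variable {J : Type*} (x : J → E) (par : J → ZMod 2)

/-- The word in `SuperEnv` with the letters `x j`. -/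
def senvWord (l : List J) : SuperEnv σ := (l.map fun j => senvι σ (x j)).prod

theorem senvWord_mem (l : List J) : senvWord x l ∈ wordsLT σ (l.length + 1) :=
  Submodule.subset_span ⟨l.map x, by simp, by simp [senvWord, Function.comp_def]⟩

theorem senvPar_senvWord (hx : ∀ j, SPar σ (par j) (x j)) (l : List J) :
    ∃ c : K, c ≠ 0 ∧ senvPar σ (senvWord x l) = c • senvWord x l := by
  induction l with
  | nil => exact ⟨1, one_ne_zero, by simp [senvWord]⟩
  | cons j l ih =>
    obtain ⟨c, hc, h⟩ := ih
    refine ⟨(-1 : K) ^ (par j).val * c, mul_ne_zero (pow_ne_zero _ (by simp)) hc, ?_⟩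
    simp only [senvWord, List.map_cons, List.prod_cons, map_mul] at h ⊢
    rw [h, senvPar_senvι, hx j, map_smul, smul_mul_smul_comm]

variable [LinearOrder J]

/-- Differentiating a sorted word in the direction dual to the letter `j` removes one letter `j`,
up to a nonzero factor and shorter words. -/
theorem senvDeriv_senvWord (hx : ∀ j, SPar σ (par j) (x j)) {lam : E →ₗ[K] K} (h1 : lam 1 = 0)
    {j : J} (hj : lam (x j) = 1) (hlam : ∀ i, i ≠ j → lam (x i) = 0) (l : List J)
    (hl : l.Pairwise (· ≤ ·)) (hodd : par j ≠ 0 → l.count j ≤ 1) :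
    ∃ c : K, (j ∈ l → c ≠ 0) ∧ (j ∉ l → c = 0) ∧ (par j = 0 → c = l.count j) ∧
      senvDeriv lam (senvWord x l) - c • senvWord x (l.erase j) ∈ wordsLT σ (l.length - 1) := by
  induction l with
  | nil => exact ⟨0, by simp, by simp, by simp, by simp [senvWord, senvDeriv_one h1]⟩
  | cons i l ih =>
    obtain ⟨c, hc1, hc0, hc, h⟩ := ih hl.of_cons
      (fun hp => (List.count_le_count_cons).trans (hodd hp))
    have hL := senvDeriv_mul (lam := lam) (hx i) (senvWord_mem x l)
    have e1 : senvWord x (i :: l) = senvι σ (x i) * senvWord x l := by simp [senvWord]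
    -- multiplication of the inductive error term by a letter
    have h' : senvι σ (x i) * (senvDeriv lam (senvWord x l) - c • senvWord x (l.erase j))
        ∈ wordsLT σ l.length := by
      cases l with
      | nil =>
        have : c = 0 := hc0 (by simp)
        simp [senvWord, senvDeriv_one h1, this]
      | cons a l => simpa using senvι_mul_mem_wordsLT (x i) h
    by_cases hij : i = j
    · subst hij
      have e2 : (i :: l).erase i = l := by simp
      rw [hj, one_smul] at hL
      by_cases hp : par i = 0
      · rw [if_pos hp] at hL
        have e3 : c • (senvι σ (x i) * senvWord x (l.erase i)) = c • senvWord x l := by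
          by_cases hil : i ∈ l
          · congr 1
            cases l with
            | nil => simp at hil
            | cons a l =>
              have : a = i := by
                rw [List.pairwise_cons] at hl
                rcases List.mem_cons.1 hil with h | h
                · exact h.symm
                · exact le_antisymm ((List.pairwise_cons.1 hl.2).1 i h) (hl.1 a (by simp))
              subst this
              simp [senvWord]
          · rw [hc0 hil]; simp
        refine ⟨1 + c, fun _ => ?_, by simp, fun _ => ?_, ?_⟩
        · rw [hc hp]; exact_mod_cast (by omega : 1 + l.count i ≠ 0)
        · rw [hc hp, List.count_cons_self]; push_cast; ring
        · rw [e1, e2, List.length_cons, Nat.add_sub_cancel]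
          convert add_mem hL h' using 1
          rw [mul_sub, mul_smul_comm, e3]
          module
      · rw [if_neg hp] at hL
        have hil : i ∉ l := by
          have := hodd hp
          rw [List.count_cons_self] at this
          exact List.count_eq_zero.1 (by omega)
        obtain ⟨s, hs, hsw⟩ := senvPar_senvWord x par hx l
        rw [hc0 hil] at h'
        refine ⟨s, fun _ => hs, by simp, fun h => absurd h hp, ?_⟩
        rw [e1, e2, List.length_cons, Nat.add_sub_cancel]
        convert add_mem hL h' using 1
        rw [hsw, zero_smul, sub_zero]
        abel
    · rw [hlam i hij, zero_smul, zero_add] at hL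
      have e2 : (i :: l).erase j = i :: l.erase j := by simp [hij]
      have hmem : j ∈ i :: l ↔ j ∈ l := by simp [Ne.symm hij]
      refine ⟨c, fun h => hc1 (hmem.1 h), fun h => hc0 (fun h' => h (hmem.2 h')), fun h => ?_, ?_⟩
      · rw [hc h, List.count_cons_of_ne hij]
      · rw [e1, e2, List.length_cons, Nat.add_sub_cancel]
        convert add_mem hL h' using 1
        simp only [senvWord, List.map_cons, List.prod_cons, mul_sub, mul_smul_comm]
        abel

/-- Ordered words of length `d` in a homogeneous family that is independent modulo `1` are
linearly independent modulo shorter words. -/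
theorem senvWord_independent (hx : ∀ j, SPar σ (par j) (x j))
    (hlam : ∀ j, ∃ lam : E →ₗ[K] K, lam 1 = 0 ∧ lam (x j) = 1 ∧ ∀ i, i ≠ j → lam (x i) = 0)
    (d : ℕ) (s : Finset (Multiset J)) (hs : ∀ m ∈ s, m.card = d ∧ ∀ j, par j ≠ 0 → m.count j ≤ 1)
    (c : Multiset J → K) (h : ∑ m ∈ s, c m • senvWord x (m.sort (· ≤ ·)) ∈ wordsLT σ d) :
    ∀ m ∈ s, c m = 0 := by
  classical
  induction d generalizing s c with
  | zero =>
    intro m hm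
    have hs0 : s = {0} := by
      refine Finset.eq_singleton_iff_unique_mem.2 ⟨?_, fun m' hm' => ?_⟩
      · rwa [Multiset.card_eq_zero.1 (hs m hm).1] at hm
      · exact Multiset.card_eq_zero.1 (hs m' hm').1
    rw [hs0] at hm h
    rw [wordsLT_zero] at h
    rw [Finset.mem_singleton.1 hm]
    simpa [senvWord] using h
  | succ d ih =>
    intro m0 hm0
    obtain ⟨j, hj⟩ : ∃ j, j ∈ m0 := Multiset.card_pos_iff_exists_mem.1 (by rw [(hs m0 hm0).1]; omega)
    obtain ⟨lam, h1, hlj, hli⟩ := hlam j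
    have key : ∀ m ∈ s, ∃ κ : K, (j ∈ m → κ ≠ 0) ∧ (j ∉ m → κ = 0) ∧
        senvDeriv lam (senvWord x (m.sort (· ≤ ·))) - κ • senvWord x ((m.erase j).sort (· ≤ ·))
          ∈ wordsLT σ d := by
      intro m hm
      obtain ⟨κ, hk1, hk0, -, hk⟩ := senvDeriv_senvWord x par hx h1 hlj hli (m.sort (· ≤ ·))
        (Multiset.pairwise_sort m _)
        (fun hp => by rw [← Multiset.coe_count, Multiset.sort_eq]; exact (hs m hm).2 j hp)
      refine ⟨κ, fun h => hk1 (by simpa using h), fun h => hk0 (by simpa using h), ?_⟩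
      have e : (m.erase j).sort (· ≤ ·) = (m.sort (· ≤ ·)).erase j := by
        refine List.Perm.eq_of_pairwise' (r := (· ≤ ·)) (Multiset.pairwise_sort _ _)
          ((Multiset.pairwise_sort m (· ≤ ·)).sublist List.erase_sublist) ?_
        rw [← Multiset.coe_eq_coe, Multiset.sort_eq, ← Multiset.coe_erase, Multiset.sort_eq]
      rw [e]
      simpa [(hs m hm).1] using hk
    choose! κ hk1 hk0 hk using key
    have h2 := senvDeriv_mem h1 h
    rw [map_sum] at h2
    have h3 : ∑ m ∈ s, c m • (senvDeriv lam (senvWord x (m.sort (· ≤ ·)))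
        - κ m • senvWord x ((m.erase j).sort (· ≤ ·))) ∈ wordsLT σ d :=
      sum_mem fun m hm => Submodule.smul_mem _ _ (hk m hm)
    have h4 := sub_mem h2 h3
    rw [← Finset.sum_sub_distrib] at h4
    have h5 : ∑ m ∈ s with j ∈ m, (c m * κ m) • senvWord x ((m.erase j).sort (· ≤ ·))
        ∈ wordsLT σ d := by
      rw [Finset.sum_filter]
      convert h4 using 2 with m hm
      split_ifs with hjm
      · rw [map_smul]; module
      · rw [hk0 m hm hjm, map_smul]; module
    have hinj : Set.InjOn (fun m : Multiset J => m.erase j) ((s.filter (j ∈ ·) : Finset _) : Set _) := by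
      intro a ha b hb hab
      simp only [Finset.coe_filter, Set.mem_ofPred_eq] at ha hb
      rw [← Multiset.cons_erase ha.2, ← Multiset.cons_erase hb.2]
      exact congrArg _ hab
    have h6 := ih ((s.filter (j ∈ ·)).image fun m => m.erase j)
      (by
        intro m hm
        simp only [Finset.mem_image, Finset.mem_filter] at hm
        obtain ⟨m, ⟨hm, hjm⟩, rfl⟩ := hm
        refine ⟨by rw [Multiset.card_erase_of_mem hjm, (hs m hm).1]; rfl, fun i hi => ?_⟩
        exact (Multiset.count_le_of_le _ (Multiset.erase_le _ _)).trans ((hs m hm).2 i hi))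
      (fun m => c (j ::ₘ m) * κ (j ::ₘ m))
      (by
        rw [Finset.sum_image hinj]
        convert h5 using 2 with m hm
        rw [Multiset.cons_erase (Finset.mem_filter.1 hm).2])
    have h7 := h6 (m0.erase j) (Finset.mem_image_of_mem _ (Finset.mem_filter.2 ⟨hm0, hj⟩))
    rw [Multiset.cons_erase hj] at h7
    exact (mul_eq_zero.1 h7).resolve_right (hk1 m0 hm0 hj)

end Family

end SuperEnv

/-! ### Straightening of products -/

section Straightening

variable {A : Type*} [Ring A] {J : Type*} (g : J → ℕ → A) (odd : J → Prop)

/-- The product of the generators `g j m` for the pairs `(j, m)` in a list. -/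
def genProd (l : List (J × ℕ)) : A := (l.map fun p => g p.1 p.2).prod

/-- The degree of a list of pairs `(j, m)`: the sum of the exponents `m`. -/
def wordDeg (l : List (J × ℕ)) : ℕ := (l.map Prod.snd).sum

/-- The pairs with an odd index have exponent at most `1`. -/
def Admissible (l : List (J × ℕ)) : Prop := ∀ p ∈ l, odd p.1 → p.2 ≤ 1

/-- The additive span of the products of generators of degree less than `d`. -/
def degLT (d : ℕ) : AddSubgroup A :=
  AddSubgroup.closure {a | ∃ l, Admissible odd l ∧ wordDeg l < d ∧ a = genProd g l}

variable {g odd}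

theorem genProd_cons (p : J × ℕ) (l : List (J × ℕ)) :
    genProd g (p :: l) = g p.1 p.2 * genProd g l := by simp [genProd]

theorem wordDeg_cons (p : J × ℕ) (l : List (J × ℕ)) : wordDeg (p :: l) = p.2 + wordDeg l := by
  simp [wordDeg]

theorem wordDeg_append (l l' : List (J × ℕ)) : wordDeg (l ++ l') = wordDeg l + wordDeg l' := by
  simp [wordDeg]

theorem wordDeg_perm {l l' : List (J × ℕ)} (h : l.Perm l') : wordDeg l = wordDeg l' :=
  (h.map _).sum_eq

theorem Admissible.perm {l l' : List (J × ℕ)} (h : l.Perm l') (hl : Admissible odd l) :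
    Admissible odd l' := fun p hp => hl p (h.mem_iff.2 hp)

theorem admissible_cons {p : J × ℕ} {l : List (J × ℕ)} :
    Admissible odd (p :: l) ↔ (odd p.1 → p.2 ≤ 1) ∧ Admissible odd l := by
  simp [Admissible]

theorem degLT_mono {d d' : ℕ} (h : d ≤ d') : degLT g odd d ≤ degLT g odd d' :=
  AddSubgroup.closure_mono fun _ ⟨l, hl, hd, ha⟩ => ⟨l, hl, hd.trans_le h, ha⟩

theorem genProd_mem_degLT {l : List (J × ℕ)} (hl : Admissible odd l) {d : ℕ} (hd : wordDeg l < d) :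
    genProd g l ∈ degLT g odd d := AddSubgroup.subset_closure ⟨l, hl, hd, rfl⟩

theorem one_mem_degLT (d : ℕ) : (1 : A) ∈ degLT g odd (d + 1) := by
  simpa [genProd] using genProd_mem_degLT (g := g) (odd := odd) (l := []) (by simp [Admissible])
    (d := d + 1) (by simp [wordDeg])

theorem degLT_zero {a : A} (h : a ∈ degLT g odd 0) : a = 0 := by
  have : degLT g odd 0 = ⊥ := by
    rw [degLT, AddSubgroup.closure_eq_bot_iff]
    rintro _ ⟨l, -, hd, -⟩
    exact absurd hd (Nat.not_lt_zero _)
  rwa [this, AddSubgroup.mem_bot] at h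

theorem mul_mem_degLT {a b : ℕ} {u v : A} (hu : u ∈ degLT g odd (a + 1))
    (hv : v ∈ degLT g odd b) : u * v ∈ degLT g odd (a + b) := by
  induction hu using AddSubgroup.closure_induction with
  | mem u hu =>
    obtain ⟨l, hl, hd, rfl⟩ := hu
    induction hv using AddSubgroup.closure_induction with
    | mem v hv =>
      obtain ⟨l', hl', hd', rfl⟩ := hv
      have h : genProd g l * genProd g l' = genProd g (l ++ l') := by simp [genProd]
      rw [h]
      refine genProd_mem_degLT (fun p hp => ?_) (by rw [wordDeg_append]; omega)
      rcases List.mem_append.1 hp with h | h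
      · exact hl p h
      · exact hl' p h
    | zero => rw [mul_zero]; exact zero_mem _
    | add v w _ _ hv hw => rw [mul_add]; exact add_mem hv hw
    | neg v _ hv => rw [mul_neg]; exact neg_mem hv
  | zero => rw [zero_mul]; exact zero_mem _
  | add v w _ _ hv hw => rw [add_mul]; exact add_mem hv hw
  | neg v _ hv => rw [neg_mul]; exact neg_mem hv

theorem mul_mem_degLT' {a b : ℕ} {u v : A} (hu : u ∈ degLT g odd a)
    (hv : v ∈ degLT g odd (b + 1)) : u * v ∈ degLT g odd (a + b) := by
  cases a with
  | zero => rw [degLT_zero hu, zero_mul]; exact zero_mem _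
  | succ a => exact degLT_mono (by omega) (mul_mem_degLT hu hv)

theorem gen_mem_degLT (j : J) (m : ℕ) (h : odd j → m ≤ 1) : g j m ∈ degLT g odd (m + 1) := by
  have := genProd_mem_degLT (g := g) (odd := odd) (l := [(j, m)]) (d := m + 1)
    (by simpa [Admissible] using h) (by simp [wordDeg])
  simpa [genProd] using this

/-- Permuting the factors of a product changes it by a sign, up to products of smaller degree. -/
theorem genProd_perm
    (hcomm : ∀ (i j : J) (a b : ℕ), (odd i → a ≤ 1) → (odd j → b ≤ 1) →
      ∃ ε : ℤ, g i a * g j b - ε • (g j b * g i a) ∈ degLT g odd (a + b))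
    {l l' : List (J × ℕ)} (h : l.Perm l') (hl : Admissible odd l) :
    ∃ ε : ℤ, genProd g l - ε • genProd g l' ∈ degLT g odd (wordDeg l) := by
  induction h with
  | nil => exact ⟨1, by rw [one_smul, sub_self]; exact zero_mem _⟩
  | cons p h ih =>
    rw [admissible_cons] at hl
    obtain ⟨ε, hε⟩ := ih hl.2
    refine ⟨ε, ?_⟩
    have := mul_mem_degLT (gen_mem_degLT p.1 p.2 hl.1) hε
    rwa [mul_sub, mul_smul_comm, ← genProd_cons, ← genProd_cons, ← wordDeg_cons] at this
  | swap p q l =>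
    rw [admissible_cons, admissible_cons] at hl
    obtain ⟨ε, hε⟩ := hcomm q.1 p.1 q.2 p.2 hl.1 hl.2.1
    refine ⟨ε, ?_⟩
    have := mul_mem_degLT' hε (genProd_mem_degLT hl.2.2 (Nat.lt_succ_self _))
    rw [sub_mul, smul_mul_assoc, mul_assoc, mul_assoc, ← genProd_cons, ← genProd_cons,
      ← genProd_cons, ← genProd_cons] at this
    rwa [wordDeg_cons, wordDeg_cons, ← add_assoc]
  | trans h1 h2 ih1 ih2 =>
    obtain ⟨ε, hε⟩ := ih1 hl
    obtain ⟨ε', hε'⟩ := ih2 (hl.perm h1)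
    refine ⟨ε * ε', ?_⟩
    rw [← wordDeg_perm h1] at hε'
    have := add_mem hε (zsmul_mem hε' ε)
    rwa [smul_sub, smul_smul, sub_add_sub_cancel] at this

variable [LinearOrder J]

/-- The ordered monomial with exponents `e`. -/
def ordMonomial (g : J → ℕ → A) (e : J →₀ ℕ) : A :=
  ((e.support.sort (· ≤ ·)).map fun j => g j (e j)).prod

variable (g odd) in
/-- The additive span of the ordered monomials. -/
def ordSpan : AddSubgroup A :=
  AddSubgroup.closure {a | ∃ e : J →₀ ℕ, (∀ j, odd j → e j ≤ 1) ∧ a = ordMonomial g e}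

theorem exists_exponent (l : List (J × ℕ)) (hnd : (l.map Prod.fst).Nodup)
    (hpos : ∀ p ∈ l, p.2 ≠ 0) :
    ∃ e : J →₀ ℕ, e.support = (l.map Prod.fst).toFinset ∧ ∀ p ∈ l, e p.1 = p.2 := by
  induction l with
  | nil => exact ⟨0, by simp⟩
  | cons p l ih =>
    rw [List.map_cons, List.nodup_cons] at hnd
    obtain ⟨e, he, hv⟩ := ih hnd.2 fun q hq => hpos q (by simp [hq])
    refine ⟨e.update p.1 p.2, ?_, ?_⟩
    · rw [Finsupp.support_update_ne_zero _ _ (hpos p (by simp)), he]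
      simp
    · intro q hq
      rcases List.mem_cons.1 hq with rfl | hq
      · simp
      · have : q.1 ≠ p.1 := fun h => hnd.1 (h ▸ List.mem_map_of_mem hq)
        simp [Function.update_of_ne this, hv q hq]

/-- If the generators commute up to sign and products of smaller degree, and products of two
generators with the same index can be merged, then the ordered monomials span. -/
theorem degLT_le_ordSpan (hzero : ∀ j, g j 0 = 1)
    (hcomm : ∀ (i j : J) (a b : ℕ), (odd i → a ≤ 1) → (odd j → b ≤ 1) →
      ∃ ε : ℤ, g i a * g j b - ε • (g j b * g i a) ∈ degLT g odd (a + b))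
    (heven : ∀ (j : J) (a b : ℕ), ¬ odd j →
      ∃ c : ℤ, g j a * g j b - c • g j (a + b) ∈ degLT g odd (a + b))
    (hodd : ∀ j, odd j → g j 1 * g j 1 ∈ degLT g odd 2) (d : ℕ) :
    degLT g odd d ≤ ordSpan g odd := by
  induction d with
  | zero => intro a ha; rw [degLT_zero ha]; exact zero_mem _
  | succ d ih =>
    have key : ∀ (k : ℕ) (l : List (J × ℕ)), l.length = k → Admissible odd l → wordDeg l = d →
        genProd g l ∈ ordSpan g odd := by
      intro k
      induction k using Nat.strong_induction_on with
      | _ k ihk =>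
      intro l hk hl hd
      -- it suffices to treat a permuted list
      have hperm : ∀ l', l.Perm l' → genProd g l' ∈ ordSpan g odd →
          genProd g l ∈ ordSpan g odd := by
        intro l' hp h
        obtain ⟨ε, hε⟩ := genProd_perm hcomm hp hl
        rw [hd] at hε
        have := add_mem (ih hε) (zsmul_mem h ε)
        rwa [sub_add_cancel] at this
      by_cases h0 : ∃ p ∈ l, p.2 = 0
      · obtain ⟨p, hp, hp0⟩ := h0
        refine hperm _ (List.perm_cons_erase hp) ?_
        have hl' := hl.perm (List.perm_cons_erase hp)
        rw [admissible_cons] at hl'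
        have hd' := wordDeg_perm (List.perm_cons_erase hp)
        rw [wordDeg_cons, hp0, zero_add] at hd'
        rw [genProd_cons, hp0, hzero, one_mul]
        refine ihk (l.erase p).length ?_ _ rfl hl'.2 (hd'.symm.trans hd)
        rw [← hk, List.length_erase_of_mem hp]
        have := List.length_pos_of_mem hp
        omega
      · by_cases hnd : (l.map Prod.fst).Nodup
        · push Not at h0
          obtain ⟨e, he, hv⟩ := exists_exponent l hnd h0
          have hsorted : l.Perm ((e.support.sort (· ≤ ·)).map fun j => (j, e j)) := by
            have hl1 : l = (l.map Prod.fst).map fun j => (j, e j) := by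
              rw [List.map_map]
              conv_lhs => rw [← List.map_id l]
              refine List.map_congr_left fun p hp => ?_
              simp [hv p hp]
            have hl2 : ((l.map Prod.fst).map fun j => (j, e j)).Perm
                ((e.support.sort (· ≤ ·)).map fun j => (j, e j)) := by
              refine List.Perm.map _ ?_
              refine (List.perm_ext_iff_of_nodup hnd (Finset.sort_nodup _ _)).2 fun j => ?_
              simp [he]
            rwa [← hl1] at hl2
          refine hperm _ hsorted (AddSubgroup.subset_closure ⟨e, fun j hj => ?_, ?_⟩)
          · by_cases hj' : j ∈ e.support
            · rw [he, List.mem_toFinset, List.mem_map] at hj'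
              obtain ⟨p, hp, rfl⟩ := hj'
              rw [hv p hp]
              exact hl p hp hj
            · rw [Finsupp.notMem_support_iff.1 hj']; omega
          · simp [genProd, ordMonomial, Function.comp_def]
        · obtain ⟨i, a, b, l', hp⟩ : ∃ i a b l', l.Perm ((i, a) :: (i, b) :: l') := by
            obtain ⟨i, hi⟩ := List.exists_duplicate_iff_not_nodup.2 hnd
            rw [List.duplicate_iff_two_le_count] at hi
            obtain ⟨p, hpl, rfl⟩ := List.mem_map.1 (List.count_pos_iff.1 (by omega : 0 < (l.map Prod.fst).count i))
            have h1 := List.perm_cons_erase hpl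
            have h2 := (h1.map Prod.fst).count_eq p.1
            rw [List.map_cons, List.count_cons_self] at h2
            obtain ⟨q, hql, hq⟩ := List.mem_map.1
              (List.count_pos_iff.1 (by omega : 0 < ((l.erase p).map Prod.fst).count p.1))
            refine ⟨p.1, p.2, q.2, (l.erase p).erase q, h1.trans ?_⟩
            have h3 := List.perm_cons_erase hql
            have h4 : (p.1, q.2) = q := Prod.ext hq.symm rfl
            rw [h4]
            exact List.Perm.cons _ h3
          have hl' := hl.perm hp
          rw [admissible_cons, admissible_cons] at hl'
          have hd' := wordDeg_perm hp
          rw [wordDeg_cons, wordDeg_cons, hd] at hd'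
          have hk' := hp.length_eq
          simp only [List.length_cons] at hk'
          refine hperm _ hp ?_
          rw [genProd_cons, genProd_cons, ← mul_assoc]
          have hl'' := genProd_mem_degLT (g := g) hl'.2.2 (Nat.lt_succ_self (wordDeg l'))
          by_cases hi : odd i
          · have ha := hl'.1 hi
            have hb := hl'.2.1 hi
            have h0' : a = 1 ∧ b = 1 := by
              have h1 : (i, a) ∈ l := hp.mem_iff.2 (by simp)
              have h2 : (i, b) ∈ l := hp.mem_iff.2 (by simp)
              have h3 : a ≠ 0 := fun h => h0 ⟨_, h1, h⟩
              have h4 : b ≠ 0 := fun h => h0 ⟨_, h2, h⟩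
              simp only at ha hb
              omega
            obtain ⟨rfl, rfl⟩ := h0'
            exact ih (degLT_mono (by simp only at hd'; omega) (mul_mem_degLT' (hodd i hi) hl''))
          · obtain ⟨c, hc⟩ := heven i a b hi
            have h1 := ih (degLT_mono (by simp only at hd'; omega) (mul_mem_degLT' hc hl''))
            have h2 : genProd g ((i, a + b) :: l') ∈ ordSpan g odd := by
              refine ihk (l'.length + 1) (by omega) _ (by simp) ?_ ?_
              · rw [admissible_cons]; exact ⟨fun h => absurd h hi, hl'.2.2⟩
              · rw [wordDeg_cons]; simp only at hd' ⊢; omega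
            have h3 := add_mem h1 (zsmul_mem h2 c)
            rw [sub_mul, smul_mul_assoc, genProd_cons, sub_add_cancel] at h3
            exact h3
    refine (AddSubgroup.closure_le _).2 ?_
    rintro _ ⟨l, hl, hd, rfl⟩
    rcases Nat.lt_succ_iff_lt_or_eq.1 hd with h | h
    · exact ih (genProd_mem_degLT hl h)
    · exact key l.length l rfl hl h

end Straightening

/-! ### Divided powers and binomial coefficients -/

section DividedPowers

variable {K : Type*} [Field K] [CharZero K] {A : Type*} [Ring A] [Algebra K A]

variable (K) in
/-- The divided power `x^m / m!`. -/
def dpow (x : A) (m : ℕ) : A := ((m.factorial : K)⁻¹) • x ^ m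

theorem dpow_zero (x : A) : dpow K x 0 = 1 := by simp [dpow]

theorem dpow_one (x : A) : dpow K x 1 = x := by simp [dpow]

theorem factorial_smul_dpow (x : A) (m : ℕ) : m.factorial • dpow K x m = x ^ m := by
  rw [dpow, ← Nat.cast_smul_eq_nsmul K, smul_smul,
    mul_inv_cancel₀ (by exact_mod_cast Nat.factorial_ne_zero m), one_smul]

theorem nsmul_cancel (K : Type*) [Field K] [CharZero K] {A : Type*} [Ring A] [Algebra K A] {m : ℕ}
    (hm : m ≠ 0) {a b : A} (h : m • a = m • b) : a = b := by
  rw [← Nat.cast_smul_eq_nsmul K, ← Nat.cast_smul_eq_nsmul K] at h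
  exact smul_right_injective A (r := (m : K)) (by exact_mod_cast hm) h

theorem mul_dpow (x : A) (m : ℕ) : x * dpow K x m = (m + 1) • dpow K x (m + 1) := by
  apply nsmul_cancel K (Nat.factorial_ne_zero m)
  rw [← mul_smul_comm, factorial_smul_dpow, smul_smul, mul_comm, ← Nat.factorial_succ,
    factorial_smul_dpow, pow_succ']

theorem dpow_mul_dpow (x : A) (a b : ℕ) :
    dpow K x a * dpow K x b = (a + b).choose a • dpow K x (a + b) := by
  apply nsmul_cancel K (mul_ne_zero (Nat.factorial_ne_zero a) (Nat.factorial_ne_zero b))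
  rw [← smul_mul_smul_comm, factorial_smul_dpow, factorial_smul_dpow, smul_smul, ← pow_add,
    ← factorial_smul_dpow (K := K), ← Nat.add_choose_mul_factorial_mul_factorial, mul_assoc, mul_comm,
    Nat.choose_symm_add]

theorem dpow_add {x y : A} (h : Commute x y) (m : ℕ) :
    dpow K (x + y) m = ∑ p ∈ Finset.HasAntidiagonal.antidiagonal m, dpow K x p.1 * dpow K y p.2 := by
  rw [dpow, h.add_pow', Finset.smul_sum]
  refine Finset.sum_congr rfl fun p hp => ?_
  rw [Finset.HasAntidiagonal.mem_antidiagonal] at hp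
  subst hp
  rw [dpow, dpow, smul_mul_smul_comm, ← Nat.cast_smul_eq_nsmul K, smul_smul]
  congr 1
  have h1 : ((p.1.factorial : ℕ) : K) ≠ 0 := by exact_mod_cast Nat.factorial_ne_zero _
  have h2 : ((p.2.factorial : ℕ) : K) ≠ 0 := by exact_mod_cast Nat.factorial_ne_zero _
  have h3 : (((p.1 + p.2).factorial : ℕ) : K) ≠ 0 := by exact_mod_cast Nat.factorial_ne_zero _
  have h4 : (((p.1 + p.2).choose p.1 : ℕ) : K) * p.1.factorial * p.2.factorial
      = (p.1 + p.2).factorial := by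
    rw [Nat.choose_symm_add]
    exact_mod_cast Nat.add_choose_mul_factorial_mul_factorial p.1 p.2
  field_simp
  rw [← h4]

theorem dpow_zsmul (c : ℤ) (x : A) (m : ℕ) : dpow K (c • x) m = c ^ m • dpow K x m := by
  rw [dpow, smul_pow, dpow, smul_comm]

theorem dpow_zero_left (m : ℕ) : dpow K (0 : A) (m + 1) = 0 := by simp [dpow]

/-- If `T k = (ad X)^k (T 0) / k!`, then `X^{(a)} T 0 = ∑_k T k X^{(a-k)}`. -/
theorem dpow_mul_of_seq {X : A} {T : ℕ → A}
    (hT : ∀ k, X * T k = T k * X + (k + 1) • T (k + 1)) (a : ℕ) :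
    dpow K X a * T 0 = ∑ k ∈ Finset.range (a + 1), T k * dpow K X (a - k) := by
  induction a with
  | zero => simp [dpow_zero]
  | succ a ih =>
    apply nsmul_cancel K (Nat.succ_ne_zero a)
    rw [← smul_mul_assoc, Nat.succ_eq_add_one, ← mul_dpow, mul_assoc, ih, Finset.mul_sum]
    have h1 : ∀ k ∈ Finset.range (a + 1), X * (T k * dpow K X (a - k))
        = (a + 1 - k) • (T k * dpow K X (a + 1 - k)) + (k + 1) • (T (k + 1) * dpow K X (a - k)) := by
      intro k hk
      have hk' : a + 1 - k = a - k + 1 := by have := Finset.mem_range.1 hk; omega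
      rw [← mul_assoc, hT, add_mul, mul_assoc, mul_dpow, hk', mul_smul_comm, smul_mul_assoc]
    rw [Finset.sum_congr rfl h1, Finset.sum_add_distrib]
    have h2 : ∑ k ∈ Finset.range (a + 1), (k + 1) • (T (k + 1) * dpow K X (a - k))
        = ∑ k ∈ Finset.range (a + 1 + 1), k • (T k * dpow K X (a + 1 - k)) := by
      rw [Finset.sum_range_succ' _ (a + 1)]
      simp
    have h3 : ∑ k ∈ Finset.range (a + 1), (a + 1 - k) • (T k * dpow K X (a + 1 - k))
        = ∑ k ∈ Finset.range (a + 1 + 1), (a + 1 - k) • (T k * dpow K X (a + 1 - k)) := by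
      rw [Finset.sum_range_succ _ (a + 1)]
      simp
    rw [h2, h3, ← Finset.sum_add_distrib, Finset.smul_sum]
    refine Finset.sum_congr rfl fun k hk => ?_
    rw [← add_smul]
    congr 1
    have := Finset.mem_range.1 hk
    omega

/-- The polynomial `Y + Z s + W s²`. -/
def pairPoly (Y Z W : A) : Polynomial A :=
  Polynomial.C Y + Polynomial.C Z * Polynomial.X + Polynomial.C W * Polynomial.X ^ 2

/-- `(ad X)^k (Y^{(b)}) / k!`, when `(ad X) Y = Z`, `(ad X)² Y = 2 W` and `(ad X)³ Y = 0`: the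
coefficient of `s^k` in the divided power of `exp(s ad X) Y = Y + Z s + W s²`. -/
theorem pairPoly_seq {X Y Z W : A} (h1 : X * Y = Y * X + Z) (h2 : X * Z = Z * X + 2 • W)
    (h3 : X * W = W * X) (b k : ℕ) :
    X * (dpow K (pairPoly Y Z W) b).coeff k = (dpow K (pairPoly Y Z W) b).coeff k * X
      + (k + 1) • (dpow K (pairPoly Y Z W) b).coeff (k + 1) := by
  have hD : Polynomial.C X * pairPoly Y Z W = pairPoly Y Z W * Polynomial.C X
      + Polynomial.derivative (pairPoly Y Z W) := by
    have hX : ∀ m, (Polynomial.X : Polynomial A) ^ m * Polynomial.C X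
        = Polynomial.C X * Polynomial.X ^ m := fun m => (Polynomial.X_pow_mul_C X m)
    have hX1 : (Polynomial.X : Polynomial A) * Polynomial.C X
        = Polynomial.C X * Polynomial.X := Polynomial.X_mul_C X
    simp only [pairPoly, mul_add, add_mul, ← mul_assoc, ← Polynomial.C_mul, h1, h2, h3]
    rw [mul_assoc (Polynomial.C Z), hX1, ← mul_assoc, mul_assoc (Polynomial.C W) _ (Polynomial.C X),
      hX 2, ← mul_assoc]
    simp only [Polynomial.C_add, ← Polynomial.C_mul, add_mul, Polynomial.derivative_add,
      Polynomial.derivative_mul, Polynomial.derivative_C, Polynomial.derivative_X_sq,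
      Polynomial.derivative_X, zero_mul, zero_add, mul_one]
    rw [← mul_assoc, ← Polynomial.C_mul, two_nsmul, mul_two]
    abel
  have hpow : ∀ b : ℕ, Polynomial.C X * pairPoly Y Z W ^ b = pairPoly Y Z W ^ b * Polynomial.C X
      + Polynomial.derivative (pairPoly Y Z W ^ b) := by
    intro b
    induction b with
    | zero => simp
    | succ b ih =>
      rw [pow_succ, ← mul_assoc, ih, add_mul, mul_assoc, hD, Polynomial.derivative_mul]
      noncomm_ring
  have h := congrArg (fun p => ((b.factorial : K)⁻¹ • p).coeff k) (hpow b)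
  simp only [Polynomial.coeff_smul, Polynomial.coeff_add, Polynomial.coeff_C_mul,
    Polynomial.coeff_mul_C, Polynomial.coeff_derivative, smul_add] at h
  simp only [dpow, Polynomial.coeff_smul]
  rw [mul_smul_comm, h, smul_mul_assoc, nsmul_eq_mul']
  congr 1
  push_cast
  rw [smul_mul_assoc]

theorem dpow_polyC (x : A) (m : ℕ) : dpow K (Polynomial.C x) m = Polynomial.C (dpow K x m) := by
  rw [dpow, dpow, ← Polynomial.C_pow, Polynomial.smul_C]

theorem dpow_mul_X_pow (x : A) (e m : ℕ) : dpow K (Polynomial.C x * Polynomial.X ^ e) m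
    = Polynomial.C (dpow K x m) * Polynomial.X ^ (e * m) := by
  have : Commute (Polynomial.C x) ((Polynomial.X : Polynomial A) ^ e) :=
    (Polynomial.commute_X_pow (Polynomial.C x) e).symm
  rw [dpow, this.mul_pow, ← smul_mul_assoc, ← pow_mul, ← dpow_polyC, dpow]

theorem coeff_dpow_pairPoly_zero (Y Z W : A) (b : ℕ) :
    (dpow K (pairPoly Y Z W) b).coeff 0 = dpow K Y b := by
  rw [dpow, Polynomial.coeff_smul, dpow]
  congr 1
  have h : Polynomial.constantCoeff (pairPoly Y Z W ^ b) = Y ^ b := by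
    rw [map_pow]
    simp [pairPoly]
  simpa using h

/-- The coefficients of the divided powers of `Y + Z s + W s²`, for commuting `Y`, `Z`, `W`, are
sums of products of divided powers. -/
theorem coeff_dpow_pairPoly_mem {Y Z W : A} (hYZ : Commute Y Z) (hYW : Commute Y W)
    (hZW : Commute Z W) {S : AddSubgroup A} (b k : ℕ)
    (hS : ∀ i j l, i + (j + l) = b → dpow K Y i * (dpow K Z j * dpow K W l) ∈ S) :
    (dpow K (pairPoly Y Z W) b).coeff k ∈ S := by
  have hc : ∀ {u v : A} (e f : ℕ), Commute u v →
      Commute (Polynomial.C u * Polynomial.X ^ e) (Polynomial.C v * Polynomial.X ^ f) := by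
    intro u v e f h
    refine Commute.mul_left (Commute.mul_right ?_ (Polynomial.commute_X_pow _ f).symm)
      (Polynomial.commute_X_pow _ e)
    exact h.map Polynomial.C
  have e1 : pairPoly Y Z W = Polynomial.C Y * Polynomial.X ^ 0
      + (Polynomial.C Z * Polynomial.X ^ 1 + Polynomial.C W * Polynomial.X ^ 2) := by
    simp [pairPoly, add_assoc]
  rw [e1, dpow_add (Commute.add_right (hc 0 1 hYZ) (hc 0 2 hYW)), Polynomial.finsetSum_coeff]
  refine sum_mem fun p hp => ?_
  rw [dpow_add (hc 1 2 hZW), Finset.mul_sum, Polynomial.finsetSum_coeff]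
  refine sum_mem fun q hq => ?_
  rw [dpow_mul_X_pow, dpow_mul_X_pow, dpow_mul_X_pow]
  rw [Finset.HasAntidiagonal.mem_antidiagonal] at hp hq
  have e2 : Polynomial.C (dpow K Y p.1) * Polynomial.X ^ (0 * p.1) *
      (Polynomial.C (dpow K Z q.1) * Polynomial.X ^ (1 * q.1) *
        (Polynomial.C (dpow K W q.2) * Polynomial.X ^ (2 * q.2)))
      = Polynomial.C (dpow K Y p.1 * (dpow K Z q.1 * dpow K W q.2))
        * Polynomial.X ^ (q.1 + 2 * q.2) := by
    rw [zero_mul, pow_zero, mul_one, one_mul, Polynomial.C_mul, Polynomial.C_mul, pow_add]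
    simp only [mul_assoc]
    rw [← mul_assoc (Polynomial.X ^ q.1) (Polynomial.C _), Polynomial.X_pow_mul_C, mul_assoc]
  rw [e2, Polynomial.coeff_C_mul_X_pow]
  split_ifs
  · exact hS _ _ _ (by rw [hq, hp])
  · exact zero_mem _

variable (K) in
/-- The binomial coefficient `y (y - 1) ⋯ (y - m + 1) / m!`. -/
def bin (y : A) (m : ℕ) : A :=
  ((m.factorial : K)⁻¹) • ((List.range m).map fun j : ℕ => y - (j : A)).prod

variable [BinomialRing A]

theorem bin_eq_choose (y : A) (m : ℕ) : bin K y m = Ring.choose y m := by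
  apply nsmul_cancel K (Nat.factorial_ne_zero m)
  rw [← Ring.descPochhammer_eq_factorial_smul_choose, bin, ← Nat.cast_smul_eq_nsmul K, smul_smul,
    mul_inv_cancel₀ (by exact_mod_cast Nat.factorial_ne_zero m), one_smul]
  induction m with
  | zero => simp
  | succ m ih =>
    rw [List.range_succ, List.map_append, List.prod_append, ih, descPochhammer_succ_right,
      Polynomial.smeval_mul, Polynomial.smeval_sub, Polynomial.smeval_X, Polynomial.smeval_natCast]
    simp

variable (K) in
theorem bin_zero (y : A) : bin K y 0 = 1 := by simp [bin]

variable (K) in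
theorem bin_one (y : A) : bin K y 1 = y := by simp [bin]

theorem bin_commute {x y : A} (h : Commute x y) (m : ℕ) : Commute (bin K x m) y := by
  refine Commute.smul_left (List.prod_induction (Commute · y) (fun a b ha hb => ha.mul_left hb)
    (Commute.one_left y) ?_) _
  intro z hz
  obtain ⟨j, -, rfl⟩ := List.mem_map.1 hz
  exact h.sub_left (Nat.cast_commute j y)

variable (K) in
theorem succ_smul_bin (y : A) (m : ℕ) :
    (m + 1) • bin K y (m + 1) = (y - m) * bin K y m := by
  have h := Ring.choose_smul_choose y (n := m + 1) (k := m) (Nat.le_succ m)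
  rw [Nat.choose_succ_self_right, Nat.add_sub_cancel_left, Ring.choose_one_right] at h
  rw [bin_eq_choose, bin_eq_choose, h, ← bin_eq_choose (K := K)]
  exact (bin_commute (Commute.refl y) m).sub_right (Nat.cast_commute m _).symm

variable (K) in
theorem bin_add_one (y : A) (m : ℕ) : bin K (y + 1) (m + 1) = bin K y m + bin K y (m + 1) := by
  simp only [bin_eq_choose]
  exact Ring.choose_succ_succ y m

theorem bin_add {x y : A} (h : Commute x y) (m : ℕ) : bin K (x + y) m =
    ∑ p ∈ Finset.HasAntidiagonal.antidiagonal m, bin K x p.1 * bin K y p.2 := by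
  simp only [bin_eq_choose]
  exact Ring.add_choose_eq m h

variable (K) in
theorem bin_intCast (c : ℤ) (m : ℕ) : bin K (c : A) m = (Ring.choose c m : ℤ) := by
  rw [bin_eq_choose]
  exact (Ring.map_choose (Int.castRingHom A) c m).symm

variable (K) in
theorem bin_neg (y : A) (m : ℕ) :
    ∃ ε : ℤ, bin K (-y) m = ε • bin K (y + ((m - 1 : ℤ) : A)) m := by
  refine ⟨Int.negOnePow m, ?_⟩
  rw [bin_eq_choose, bin_eq_choose, Ring.choose_neg, Units.smul_def]
  push_cast
  rw [add_sub_assoc]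

variable (K) in
theorem bin_merge (y : A) (a b : ℕ) : bin K y a * bin K y b =
    ∑ p ∈ Finset.HasAntidiagonal.antidiagonal b,
      ((a + p.1).choose a * (Ring.choose (a : ℤ) p.2)) • bin K y (a + p.1) := by
  have h : y = (y - a) + ((a : ℤ) : A) := by simp
  have h1 := bin_add (K := K) (Int.cast_commute (a : ℤ) (y - a)).symm b
  rw [← h] at h1
  rw [h1, Finset.mul_sum]
  refine Finset.sum_congr rfl fun p hp => ?_
  rw [bin_intCast, ← mul_assoc]
  have h2 := Ring.choose_smul_choose y (n := a + p.1) (k := a) (Nat.le_add_right _ _)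
  rw [Nat.add_sub_cancel_left] at h2
  simp only [bin_eq_choose]
  rw [← h2, mul_comm _ (Ring.choose (a : ℤ) p.2), mul_smul, ← Int.cast_comm, ← zsmul_eq_mul,
    natCast_zsmul]

/-- Moving `X` past a polynomial in `H`, when `[H, X] = c X`. -/
theorem mul_bin_of_semiconj {X H H' : A} (h : H * X = X * H') (m : ℕ) :
    bin K H m * X = X * bin K H' m := by
  rw [bin, bin, mul_smul_comm, smul_mul_assoc]
  congr 1
  induction m with
  | zero => simp
  | succ m ih =>
    rw [List.range_succ, List.map_append, List.prod_append, List.map_append, List.prod_append]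
    simp only [List.map_cons, List.map_nil, List.prod_cons, List.prod_nil, mul_one]
    rw [mul_assoc, sub_mul, h, Nat.cast_comm, ← mul_sub, ← mul_assoc, ih, mul_assoc]

theorem mul_dpow_of_weight {X H : A} {c : ℤ} (h : H * X = X * H + c • X) (m : ℕ) :
    H * dpow K X m = dpow K X m * (H + ((m * c : ℤ) : A)) := by
  rw [dpow, mul_smul_comm, smul_mul_assoc]
  congr 1
  induction m with
  | zero => simp
  | succ m ih =>
    rw [pow_succ, ← mul_assoc, ih, mul_assoc, add_mul, h, mul_assoc]
    congr 1
    push_cast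
    have h2 : (m : A) * (c : A) * X = X * ((m : A) * (c : A)) :=
      ((Nat.cast_commute m X).mul_left (Int.cast_commute c X)).eq
    rw [zsmul_eq_mul, h2, Int.cast_comm c X]
    noncomm_ring

theorem bin_mul_dpow {X H : A} {c : ℤ} (h : H * X = X * H + c • X) (a m : ℕ) :
    bin K H a * dpow K X m = dpow K X m * bin K (H + ((m * c : ℤ) : A)) a :=
  mul_bin_of_semiconj (mul_dpow_of_weight h m) a

theorem mul_bin_of_weight_two {X H : A} (h : H * X = X * H + (2 : ℤ) • X) (y : A) (hy : Commute y X)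
    (m : ℕ) : X * bin K (H + y) m = bin K (H + y - 2) m * X := by
  refine (mul_bin_of_semiconj ?_ m).symm
  rw [sub_mul, add_mul, mul_add, h, hy.eq, two_zsmul, two_mul]
  abel

/-- Kostant's formula: `X^{(a)} Y^{(b)} = ∑_i Y^{(b-i)} C(H - a - b + 2i, i) X^{(a-i)}` for an
`sl₂`-triple. -/
theorem dpow_mul_dpow_sl2 {X Y H : A} (hXY : X * Y = Y * X + H)
    (hX : H * X = X * H + (2 : ℤ) • X) (hY : H * Y = Y * H + (-2 : ℤ) • Y) (a b : ℕ) :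
    dpow K X a * dpow K Y b = ∑ i ∈ Finset.range (a + 1), (if i ≤ b then dpow K Y (b - i) else 0) *
      (bin K (H + ((2 * i - a - b : ℤ) : A)) i * dpow K X (a - i)) := by
  have hXYb : ∀ b : ℕ, X * dpow K Y (b + 1) = dpow K Y (b + 1) * X + dpow K Y b * (H - b) := by
    intro b
    induction b with
    | zero => simp [dpow_zero, dpow_one, hXY]
    | succ b ih =>
      apply nsmul_cancel K (Nat.succ_ne_zero (b + 1))
      have h1 : H * dpow K Y (b + 1) = dpow K Y (b + 1) * (H - ((2 * (b + 1) : ℕ) : A)) := by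
        rw [mul_dpow_of_weight hY, sub_eq_add_neg]
        congr 2
        push_cast
        rw [mul_neg, mul_two, two_mul]
      have h2 : (b + 1) • (H - (b : A)) + (H - ((2 * (b + 1) : ℕ) : A))
          = (b + 1 + 1) • (H - ((b + 1 : ℕ) : A)) := by
        have h3 : (b + 1) • (b : A) + ((2 * (b + 1) : ℕ) : A) = (b + 1 + 1) • ((b + 1 : ℕ) : A) := by
          rw [← Nat.cast_smul_eq_nsmul ℕ, ← Nat.cast_smul_eq_nsmul ℕ]
          simp only [nsmul_eq_mul, Nat.cast_id]
          norm_cast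
          ring_nf
        rw [smul_sub, smul_sub, ← h3, succ_nsmul H (b + 1)]
        abel
      rw [← mul_smul_comm, Nat.succ_eq_add_one, ← mul_dpow, ← mul_assoc, hXY, add_mul, h1,
        mul_assoc, ih, mul_add, ← mul_assoc, mul_dpow, ← mul_assoc, mul_dpow, smul_mul_assoc,
        add_assoc, smul_add, ← mul_smul_comm (b + 1 + 1) _ (H - _), ← h2, mul_add (dpow K Y (b + 1)),
        smul_mul_assoc, mul_smul_comm]
  have hstep : ∀ i : ℕ, X * (if i ≤ b then dpow K Y (b - i) else 0)
      = (if i ≤ b then dpow K Y (b - i) else 0) * X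
        + (if i + 1 ≤ b then dpow K Y (b - (i + 1)) else 0) * (H - ((b - (i + 1) : ℤ) : A)) := by
    intro i
    rcases lt_trichotomy i b with h | rfl | h
    · have h1 : b - i = b - (i + 1) + 1 := by omega
      have h2 : ((b - (i + 1) : ℤ) : A) = ((b - (i + 1) : ℕ) : A) := by
        rw [← Int.cast_natCast (b - (i + 1))]
        congr 1
        omega
      rw [if_pos h.le, if_pos (Nat.succ_le_of_lt h), h1, hXYb, h2]
    · simp [dpow_zero]
    · rw [if_neg (by omega), if_neg (by omega)]; simp
  have hcH : ∀ c : ℤ, ∀ i, X * bin K (H + (c : A)) i = bin K (H + ((c - 2 : ℤ) : A)) i * X := by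
    intro c i
    rw [mul_bin_of_weight_two hX _ (Int.cast_commute c X)]
    push_cast
    rw [add_sub_assoc]
  induction a with
  | zero =>
    rw [Finset.sum_range_one, if_pos (Nat.zero_le b), bin_zero, dpow_zero]
    simp [dpow_zero]
  | succ a ih =>
    apply nsmul_cancel K (Nat.succ_ne_zero a)
    rw [← smul_mul_assoc, Nat.succ_eq_add_one, ← mul_dpow, mul_assoc, ih, Finset.mul_sum]
    set Q : ℕ → A := fun i => if i ≤ b then dpow K Y (b - i) else 0 with hQ
    change ∑ i ∈ Finset.range (a + 1), X * (Q i * (bin K (H + ((2 * i - a - b : ℤ) : A)) i *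
      dpow K X (a - i))) = (a + 1) • ∑ i ∈ Finset.range (a + 1 + 1), Q i *
      (bin K (H + ((2 * i - (a + 1 : ℕ) - b : ℤ) : A)) i * dpow K X (a + 1 - i))
    have h1 : ∀ i ∈ Finset.range (a + 1), X * (Q i * (bin K (H + ((2 * i - a - b : ℤ) : A)) i *
        dpow K X (a - i)))
        = (a + 1 - i) • (Q i * (bin K (H + ((2 * i - a - b - 2 : ℤ) : A)) i * dpow K X (a + 1 - i)))
        + Q (i + 1) * ((H - ((b - (i + 1) : ℤ) : A)) * bin K (H + ((2 * i - a - b : ℤ) : A)) i *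
          dpow K X (a - i)) := by
      intro i hi
      have hi' : a + 1 - i = a - i + 1 := by have := Finset.mem_range.1 hi; omega
      rw [← mul_assoc, hstep, add_mul, mul_assoc, ← mul_assoc X, hcH, mul_assoc (bin _ _ _),
        mul_dpow, hi', mul_smul_comm, mul_smul_comm, mul_assoc, mul_assoc]
    have h2 : ∑ i ∈ Finset.range (a + 1), (a + 1 - i) • (Q i *
        (bin K (H + ((2 * i - a - b - 2 : ℤ) : A)) i * dpow K X (a + 1 - i)))
        = ∑ i ∈ Finset.range (a + 1 + 1), (a + 1 - i) • (Q i *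
        (bin K (H + ((2 * i - a - b - 2 : ℤ) : A)) i * dpow K X (a + 1 - i))) := by
      rw [Finset.sum_range_succ _ (a + 1)]
      simp
    rw [Finset.sum_congr rfl h1, Finset.sum_add_distrib, h2, Finset.sum_range_succ',
      Finset.sum_range_succ' _ (a + 1), smul_add, add_right_comm, ← Finset.sum_add_distrib,
      Finset.smul_sum]
    congr 1
    · refine Finset.sum_congr rfl fun i hi => ?_
      have hi' := Finset.mem_range.1 hi
      have e1 : a + 1 - (i + 1) = a - i := by omega
      rw [e1, ← mul_smul_comm, ← mul_add, ← mul_smul_comm (a + 1), ← smul_mul_assoc, ← add_mul,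
        ← smul_mul_assoc (a + 1)]
      congr 2
      -- the identity `(a - i) C(z, i + 1) + (z - i + a + 1) C(z, i) = (a + 1) C(z + 1, i + 1)`
      set z : A := H + ((2 * i - a - b : ℤ) : A) with hz
      have e2 : H + ((2 * (i + 1 : ℕ) - a - b - 2 : ℤ) : A) = z := by
        rw [hz]; congr 2; push_cast; ring
      have e3 : H + ((2 * (i + 1 : ℕ) - (a + 1 : ℕ) - b : ℤ) : A) = z + 1 := by
        rw [hz, add_assoc, ← Int.cast_one, ← Int.cast_add]
        congr 2; push_cast; ring
      have e4 : H - ((b - (i + 1) : ℤ) : A) = (z - (i : A)) + ((a + 1 : ℕ) : A) := by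
        rw [hz, ← Int.cast_natCast (R := A) i, ← Int.cast_natCast (R := A) (a + 1), add_sub_assoc, ← Int.cast_sub,
          add_assoc, ← Int.cast_add, sub_eq_add_neg, ← Int.cast_neg]
        congr 2; push_cast; ring
      rw [e2, e3, e4, bin_add_one, add_mul, ← succ_smul_bin, ← nsmul_eq_mul, smul_add,
        ← add_assoc, ← add_smul, add_comm]
      congr 2
      omega


end DividedPowers

/-! ### Commutation modulo lower degree -/

section CommutesMod

variable {K : Type*} [Field K] [CharZero K] {A : Type*} [Ring A] [Algebra K A]
variable {J : Type*} {g : J → ℕ → A} {odd : J → Prop}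

theorem mul_mem_degLT_succ {a b : ℕ} {u v : A} (hu : u ∈ degLT g odd (a + 1))
    (hv : v ∈ degLT g odd (b + 1)) : u * v ∈ degLT g odd (a + b + 1) :=
  mul_mem_degLT (b := b + 1) hu hv

variable (K g odd) in
/-- All divided powers `x^{(m)}` are integral of degree at most `m`. -/
def DPIntegral (x : A) : Prop := ∀ m, dpow K x m ∈ degLT g odd (m + 1)

variable (K g odd) in
/-- The divided powers of `x` commute with `v` (of degree `b`) modulo terms of lower degree. -/
def CommutesMod (x v : A) (b : ℕ) : Prop :=
  ∀ a, dpow K x a * v - v * dpow K x a ∈ degLT g odd (a + b)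

theorem dpIntegral_zero : DPIntegral K g odd (0 : A) := by
  rintro (_ | m)
  · rw [dpow_zero]; exact one_mem_degLT 0
  · rw [dpow_zero_left]; exact zero_mem _

theorem DPIntegral.zsmul {x : A} (h : DPIntegral K g odd x) (c : ℤ) :
    DPIntegral K g odd (c • x) := fun m => by
  rw [dpow_zsmul]; exact zsmul_mem (h m) _

theorem DPIntegral.add {x y : A} (hx : DPIntegral K g odd x) (hy : DPIntegral K g odd y)
    (h : Commute x y) : DPIntegral K g odd (x + y) := fun m => by
  rw [dpow_add h]
  refine sum_mem fun p hp => ?_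
  rw [Finset.HasAntidiagonal.mem_antidiagonal] at hp
  subst hp
  exact mul_mem_degLT_succ (hx _) (hy _)

theorem commute_of_mem_closure {S : Set A} (hc : ∀ x ∈ S, ∀ y ∈ S, Commute x y) {x y : A}
    (hx : x ∈ AddSubgroup.closure S) (hy : y ∈ AddSubgroup.closure S) : Commute x y := by
  induction hx using AddSubgroup.closure_induction with
  | mem x hx =>
    induction hy using AddSubgroup.closure_induction with
    | mem y hy => exact hc x hx y hy
    | zero => exact Commute.zero_right x
    | add _ _ _ _ h h' => exact h.add_right h'
    | neg _ _ h => exact h.neg_right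
  | zero => exact Commute.zero_left y
  | add _ _ _ _ h h' => exact h.add_left h'
  | neg _ _ h => exact h.neg_left

/-- The divided powers of an element of the additive span of a commuting family. -/
theorem dpIntegral_of_mem_closure {S : Set A} (hc : ∀ x ∈ S, ∀ y ∈ S, Commute x y)
    (hS : ∀ x ∈ S, DPIntegral K g odd x) {x : A} (hx : x ∈ AddSubgroup.closure S) :
    DPIntegral K g odd x := by
  have key := fun x hx y hy => commute_of_mem_closure hc (x := x) (y := y) hx hy
  induction hx using AddSubgroup.closure_induction with
  | mem x hx => exact hS x hx
  | zero => exact dpIntegral_zero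
  | add x y hx hy h h' => exact h.add h' (key x hx y hy)
  | neg x _ h => simpa using h.zsmul (-1)

theorem CommutesMod.zero (v : A) (b : ℕ) : CommutesMod K g odd (0 : A) v b := by
  rintro (_ | m)
  · rw [dpow_zero]; simp
  · rw [dpow_zero_left]; simp

theorem CommutesMod.neg {x v : A} {b : ℕ} (h : CommutesMod K g odd x v b) :
    CommutesMod K g odd (-x) v b := fun a => by
  have := zsmul_mem (h a) ((-1) ^ a)
  rw [smul_sub, ← smul_mul_assoc, ← mul_smul_comm, ← dpow_zsmul] at this
  simpa using this

theorem CommutesMod.add {x y v : A} {b : ℕ} (h : CommutesMod K g odd x v b)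
    (h' : CommutesMod K g odd y v b) (hxy : Commute x y) (hx : DPIntegral K g odd x)
    (hy : DPIntegral K g odd y) : CommutesMod K g odd (x + y) v b := fun a => by
  rw [dpow_add hxy, Finset.sum_mul, Finset.mul_sum, ← Finset.sum_sub_distrib]
  refine sum_mem fun p hp => ?_
  rw [Finset.HasAntidiagonal.mem_antidiagonal] at hp
  subst hp
  have h1 := mul_mem_degLT (hx p.1) (h' p.2)
  have h2 := mul_mem_degLT' (h p.1) (hy p.2)
  have h3 := add_mem (degLT_mono (d' := p.1 + p.2 + b) (by omega) h1)
    (degLT_mono (d' := p.1 + p.2 + b) (by omega) h2)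
  convert h3 using 1
  noncomm_ring

/-- Commutation modulo lower degree extends from a commuting family to its additive span; this is
how it passes from spanning vectors of a root lattice to the root vectors themselves. -/
theorem commutesMod_of_mem_closure {S : Set A} (hc : ∀ x ∈ S, ∀ y ∈ S, Commute x y)
    (hS : ∀ x ∈ S, DPIntegral K g odd x) {v : A} {b : ℕ}
    (hv : ∀ x ∈ S, CommutesMod K g odd x v b) {x : A} (hx : x ∈ AddSubgroup.closure S) :
    CommutesMod K g odd x v b := by
  have key := fun x hx y hy => commute_of_mem_closure hc (x := x) (y := y) hx hy
  induction hx using AddSubgroup.closure_induction with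
  | mem x hx => exact hv x hx
  | zero => exact CommutesMod.zero v b
  | add x y hx hy h h' =>
    exact h.add h' (key x hx y hy) (dpIntegral_of_mem_closure hc hS hx)
      (dpIntegral_of_mem_closure hc hS hy)
  | neg x _ h => exact h.neg

theorem commutesMod_comm {x y : A} : (∀ b, CommutesMod K g odd x (dpow K y b) b) ↔
    ∀ a, CommutesMod K g odd y (dpow K x a) a := by
  have : ∀ x y : A, (∀ b, CommutesMod K g odd x (dpow K y b) b) →
      ∀ a, CommutesMod K g odd y (dpow K x a) a := by
    intro x y h a b
    rw [← neg_sub, add_comm]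
    exact neg_mem (h b a)
  exact ⟨this x y, this y x⟩

theorem commutesMod_of_commute {x v : A} (h : Commute x v) (b : ℕ) :
    CommutesMod K g odd x v b := fun a => by
  have h1 : Commute (dpow K x a) v := (h.pow_left a).smul_left _
  rw [h1.eq, sub_self]
  exact zero_mem _

theorem commutesMod_of_seq {X : A} (hX : DPIntegral K g odd X) {T : ℕ → A} {b : ℕ}
    (hT : ∀ k, X * T k = T k * X + (k + 1) • T (k + 1)) (hm : ∀ k, T k ∈ degLT g odd (b + 1)) :
    CommutesMod K g odd X (T 0) b := fun a => by
  rw [dpow_mul_of_seq hT, Finset.sum_range_succ', Nat.sub_zero, add_sub_cancel_right]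
  refine sum_mem fun k hk => ?_
  have := Finset.mem_range.1 hk
  exact degLT_mono (by omega) (mul_mem_degLT_succ (hm (k + 1)) (hX (a - (k + 1))))

/-- Divided powers of `X` and `Y` commute modulo lower degree, if `(ad X)³ Y = 0` and `Y` commutes
with `[X, Y]`. -/
theorem commutesMod_dpow {X Y Z W : A} (h1 : X * Y = Y * X + Z) (h2 : X * Z = Z * X + 2 • W)
    (h3 : X * W = W * X) (h4 : Commute Y Z) (hX : DPIntegral K g odd X)
    (hY : DPIntegral K g odd Y) (hZ : DPIntegral K g odd Z) (hW : DPIntegral K g odd W) (b : ℕ) :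
    CommutesMod K g odd X (dpow K Y b) b := by
  -- the Jacobi identity shows that `Y`, `Z`, `W` commute
  have h5 : Commute Y W := by
    apply nsmul_cancel K two_ne_zero
    rw [← mul_smul_comm, ← smul_mul_assoc, eq_sub_of_add_eq' h2.symm]
    have e := h4.eq
    have e1 : Y * (X * Z - Z * X) - (X * Z - Z * X) * Y
        = (Y * X - X * Y) * Z + X * (Y * Z - Z * Y) - (Y * Z - Z * Y) * X - Z * (Y * X - X * Y) := by
      noncomm_ring
    rw [e, sub_self, h1] at e1
    rw [← sub_eq_zero, e1]
    noncomm_ring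
  have h6 : Commute Z W := by
    have e1 : Z = X * Y - Y * X := eq_sub_of_add_eq' h1.symm
    have e : Z * W - W * Z = X * (Y * W - W * Y) - (Y * W - W * Y) * X + (X * W - W * X) * Y
        - Y * (X * W - W * X) := by rw [e1]; noncomm_ring
    rw [h3, h5.eq] at e
    exact sub_eq_zero.1 (by rw [e]; simp)
  have h := commutesMod_of_seq (K := K) hX (b := b)
    (T := fun k => (dpow K (pairPoly Y Z W) b).coeff k) (pairPoly_seq h1 h2 h3 b) fun k => by
      refine coeff_dpow_pairPoly_mem h4 h5 h6 b k fun i j l hl => ?_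
      rw [← hl]
      exact mul_mem_degLT_succ (hY i) (mul_mem_degLT_succ (hZ j) (hW l))
  simp only [coeff_dpow_pairPoly_zero] at h
  exact h

/-- The divided powers of `X` commute with `Y` modulo lower degree, if `(ad X)³ Y = 0`. -/
theorem commutesMod_of_bracket {X Y Z W : A} (h1 : X * Y = Y * X + Z)
    (h2 : X * Z = Z * X + 2 • W) (h3 : X * W = W * X) (hX : DPIntegral K g odd X) {b : ℕ}
    (hY : Y ∈ degLT g odd (b + 1)) (hZ : Z ∈ degLT g odd (b + 1)) (hW : W ∈ degLT g odd (b + 1)) :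
    CommutesMod K g odd X Y b := by
  have h := commutesMod_of_seq (K := K) hX (b := b)
    (T := fun k => match k with | 0 => Y | 1 => Z | 2 => W | _ => 0) ?_ ?_
  · exact h
  · rintro (_ | _ | _ | k)
    · simpa using h1
    · simpa [one_add_one_eq_two] using h2
    · simpa using h3
    · simp
  · rintro (_ | _ | _ | k)
    exacts [hY, hZ, hW, zero_mem _]

variable [BinomialRing A]

theorem bin_intCast_mem (c : ℤ) (m : ℕ) : bin K (c : A) m ∈ degLT g odd 1 := by
  rw [bin_intCast, ← zsmul_one]
  exact zsmul_mem (one_mem_degLT 0) _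

theorem bin_add_mem_degLT {x y : A} (hx : ∀ m, bin K x m ∈ degLT g odd (m + 1))
    (hy : ∀ m, bin K y m ∈ degLT g odd (m + 1)) (h : Commute x y) (m : ℕ) :
    bin K (x + y) m ∈ degLT g odd (m + 1) := by
  rw [bin_add h]
  refine sum_mem fun p hp => ?_
  rw [Finset.HasAntidiagonal.mem_antidiagonal] at hp
  subst hp
  exact mul_mem_degLT_succ (hx _) (hy _)

theorem bin_add_intCast_mem_degLT {x : A} (hx : ∀ m, bin K x m ∈ degLT g odd (m + 1)) (c : ℤ)
    (m : ℕ) : bin K (x + (c : A)) m ∈ degLT g odd (m + 1) :=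
  bin_add_mem_degLT hx (fun m => degLT_mono (by omega) (bin_intCast_mem c m))
    (Int.cast_commute c x).symm m

theorem bin_mem_degLT_of_mem_closure {S : Set A} (hc : ∀ x ∈ S, ∀ y ∈ S, Commute x y)
    (hS : ∀ x ∈ S, ∀ m, bin K x m ∈ degLT g odd (m + 1)) {x : A}
    (hx : x ∈ AddSubgroup.closure S) : ∀ m, bin K x m ∈ degLT g odd (m + 1) := by
  induction hx using AddSubgroup.closure_induction with
  | mem x hx => exact hS x hx
  | zero =>
    intro m
    rw [← Int.cast_zero]
    exact degLT_mono (by omega) (bin_intCast_mem 0 m)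
  | add x y hx hy h h' => exact bin_add_mem_degLT h h' (commute_of_mem_closure hc hx hy)
  | neg x _ h =>
    intro m
    obtain ⟨ε, hε⟩ := bin_neg K x m
    rw [hε]
    exact zsmul_mem (bin_add_intCast_mem_degLT h _ m) _

/-- `C(y + c, m)` and `C(y, m)` agree modulo lower degree. -/
theorem bin_add_intCast_sub_mem {y : A} (hy : ∀ m, bin K y m ∈ degLT g odd (m + 1)) (c : ℤ)
    (m : ℕ) : bin K (y + (c : A)) m - bin K y m ∈ degLT g odd m := by
  rw [bin_add (Int.cast_commute c y).symm,
    ← Finset.add_sum_erase _ _ (Finset.HasAntidiagonal.mem_antidiagonal.2 (add_zero m) :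
      (m, 0) ∈ Finset.HasAntidiagonal.antidiagonal m)]
  simp only [bin_zero, mul_one, add_sub_cancel_left]
  refine sum_mem fun p hp => ?_
  rw [Finset.mem_erase, Finset.HasAntidiagonal.mem_antidiagonal] at hp
  have h0 : p.2 ≠ 0 := fun h => hp.1 (Prod.ext (by omega) h)
  exact degLT_mono (by omega) (mul_mem_degLT_succ (b := 0) (hy p.1) (bin_intCast_mem c p.2))

theorem bin_merge_mem {y : A} (hy : ∀ m, bin K y m ∈ degLT g odd (m + 1)) (a b : ℕ) :
    ∃ c : ℤ, bin K y a * bin K y b - c • bin K y (a + b) ∈ degLT g odd (a + b) := by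
  refine ⟨(a + b).choose a, ?_⟩
  rw [bin_merge,
    ← Finset.add_sum_erase _ _ (Finset.HasAntidiagonal.mem_antidiagonal.2 (add_zero b) :
      (b, 0) ∈ Finset.HasAntidiagonal.antidiagonal b)]
  simp only [Ring.choose_zero_right, mul_one, add_sub_cancel_left]
  refine sum_mem fun p hp => zsmul_mem ?_ _
  rw [Finset.mem_erase, Finset.HasAntidiagonal.mem_antidiagonal] at hp
  have h0 : p.2 ≠ 0 := fun h => hp.1 (Prod.ext (by omega) h)
  exact degLT_mono (by omega) (hy _)

/-- Divided powers of the opposite elements of an `sl₂`-triple commute modulo lower degree, by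
Kostant's formula, of which every term but the first has lower degree. -/
theorem commutesMod_sl2 {X Y H : A} (hXY : X * Y = Y * X + H)
    (hX : H * X = X * H + (2 : ℤ) • X) (hY : H * Y = Y * H + (-2 : ℤ) • Y)
    (hX' : DPIntegral K g odd X) (hY' : DPIntegral K g odd Y)
    (hH : ∀ m, bin K H m ∈ degLT g odd (m + 1)) (b : ℕ) :
    CommutesMod K g odd X (dpow K Y b) b := fun a => by
  rw [dpow_mul_dpow_sl2 hXY hX hY, Finset.sum_range_succ', Nat.sub_zero, if_pos (Nat.zero_le b),
    Nat.sub_zero, bin_zero, one_mul, add_sub_cancel_right]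
  refine sum_mem fun i hi => ?_
  have := Finset.mem_range.1 hi
  split_ifs with hb
  · exact degLT_mono (by omega) (mul_mem_degLT_succ (hY' _)
      (mul_mem_degLT_succ (bin_add_intCast_mem_degLT hH _ _) (hX' _)))
  · rw [zero_mul]; exact zero_mem _

end CommutesMod

/-! ### The Grassmann algebra -/

section GrassmannCalculus

variable {K : Type*} [Field K] {n : ℕ}

theorem xi_mul_self (i : Fin n) : xi K i * xi K i = 0 := ExteriorAlgebra.ι_sq_zero _

theorem xi_mul_xi (i j : Fin n) : xi K i * xi K j = -(xi K j * xi K i) :=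
  eq_neg_of_add_eq_zero_left (ExteriorAlgebra.ι_add_mul_swap _ _)

theorem pd_xi_mul (i j : Fin n) (f : Lam K n) :
    pd K i (xi K j * f) = (if i = j then f else 0) - xi K j * pd K i f := by
  have h := CliffordAlgebra.contractLeft_ι_mul (Q := (0 : QuadraticForm K (Fin n → K)))
    (LinearMap.proj i : (Fin n → K) →ₗ[K] K) (Pi.single j 1) f
  refine h.trans ?_
  congr 1
  rw [LinearMap.proj_apply, Pi.single_apply]
  split_ifs <;> simp

theorem pd_one (i : Fin n) : pd K i (1 : Lam K n) = 0 :=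
  CliffordAlgebra.contractLeft_one (Q := (0 : QuadraticForm K (Fin n → K))) _

theorem pd_algebraMap (i : Fin n) (c : K) : pd K i (algebraMap K (Lam K n) c) = 0 := by
  rw [Algebra.algebraMap_eq_smul_one, map_smul, pd_one, smul_zero]

theorem pd_xi (i j : Fin n) : pd K i (xi K j) = if i = j then 1 else 0 := by
  have := pd_xi_mul i j (1 : Lam K n)
  rwa [mul_one, pd_one, mul_zero, sub_zero] at this

theorem pd_pd (i j : Fin n) (f : Lam K n) : pd K i (pd K j f) = -pd K j (pd K i f) :=
  CliffordAlgebra.contractLeft_comm (Q := (0 : QuadraticForm K (Fin n → K))) _ _ f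

theorem pd_pd_self (i : Fin n) (f : Lam K n) : pd K i (pd K i f) = 0 :=
  CliffordAlgebra.contractLeft_contractLeft (Q := (0 : QuadraticForm K (Fin n → K))) _ _

theorem lam_induction {P : Lam K n → Prop} (one : P 1) (smul : ∀ (c : K) f, P f → P (c • f))
    (add : ∀ f g, P f → P g → P (f + g)) (xi_mul : ∀ i f, P f → P (xi K i * f)) (f : Lam K n) :
    P f := by
  refine CliffordAlgebra.left_induction (Q := (0 : QuadraticForm K (Fin n → K))) (fun c => ?_)
    add (fun f v hf => ?_) f
  · rw [Algebra.algebraMap_eq_smul_one]; exact smul c 1 one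
  · have h0 : P 0 := by simpa using smul 0 1 one
    have hv : v = ∑ i, v i • (Pi.single i 1 : Fin n → K) := by
      rw [← Finset.univ_sum_single v]
      refine Finset.sum_congr rfl fun i _ => ?_
      rw [Finset.univ_sum_single, ← Pi.single_smul, smul_eq_mul, mul_one]
    rw [hv, map_sum, Finset.sum_mul]
    refine Finset.sum_induction _ P add h0 fun i _ => ?_
    rw [map_smul, smul_mul_assoc]
    exact smul _ _ (xi_mul i f hf)

theorem op_ext {D D' : Op K n} (h1 : D 1 = D' 1)
    (hx : ∀ i f, D f = D' f → D (xi K i * f) = D' (xi K i * f)) : D = D' :=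
  LinearMap.ext <| lam_induction h1 (fun c f h => by rw [map_smul, map_smul, h])
    (fun f g h h' => by rw [map_add, map_add, h, h']) hx

theorem parInv_mul (f g : Lam K n) : parInv K n (f * g) = parInv K n f * parInv K n g :=
  map_mul CliffordAlgebra.involute f g

theorem parInv_one : parInv K n (1 : Lam K n) = 1 := map_one CliffordAlgebra.involute

theorem parInv_xi (i : Fin n) : parInv K n (xi K i) = -xi K i :=
  CliffordAlgebra.involute_ι _

theorem parInv_parInv (f : Lam K n) : parInv K n (parInv K n f) = f :=
  CliffordAlgebra.involute_involute f

theorem parInv_pd (i : Fin n) (f : Lam K n) : parInv K n (pd K i f) = -pd K i (parInv K n f) := by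
  have : parInv K n * pd K i = -(pd K i * parInv K n) := by
    refine op_ext ?_ fun j f h => ?_
    · simp [pd_one, parInv_one, Module.End.mul_apply]
    · simp only [Module.End.mul_apply, LinearMap.neg_apply] at h ⊢
      rw [pd_xi_mul, map_sub, parInv_mul, parInv_xi, h, parInv_mul, parInv_xi, neg_mul, neg_mul,
        map_neg, pd_xi_mul]
      split_ifs <;> simp [sub_eq_add_neg]
  simpa [Module.End.mul_apply] using LinearMap.congr_fun this f

/-- The derivations `∂_i` satisfy the graded Leibniz rule. -/
theorem pd_mul (i : Fin n) (f g : Lam K n) :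
    pd K i (f * g) = pd K i f * g + parInv K n f * pd K i g := by
  induction f using lam_induction with
  | one => simp [pd_one, parInv_one]
  | smul c f h => simp only [smul_mul_assoc, map_smul, h, smul_add]
  | add f f' h h' => simp only [add_mul, map_add, h, h']; abel
  | xi_mul j f h =>
    rw [mul_assoc, pd_xi_mul, h, pd_xi_mul, parInv_mul, parInv_xi]
    split_ifs <;> noncomm_ring

theorem xi_mul_comm (j : Fin n) (f : Lam K n) : xi K j * f = parInv K n f * xi K j := by
  induction f using lam_induction with
  | one => simp [parInv_one]
  | smul c f h => rw [mul_smul_comm, h, map_smul, smul_mul_assoc]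
  | add f f' h h' => rw [mul_add, h, h', map_add, add_mul]
  | xi_mul i f h => rw [← mul_assoc, xi_mul_xi, neg_mul, mul_assoc, h, parInv_mul, parInv_xi,
      neg_mul, neg_mul, mul_assoc]

theorem mul_comm_of_even {f : Lam K n} (hf : parInv K n f = f) (g : Lam K n) : f * g = g * f := by
  induction g using lam_induction with
  | one => simp
  | smul c g h => rw [mul_smul_comm, h, smul_mul_assoc]
  | add g g' h h' => rw [mul_add, h, h', add_mul]
  | xi_mul i g h => rw [mul_assoc, ← h, ← mul_assoc, ← mul_assoc, xi_mul_comm, hf]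

theorem mul_comm_of_odd {f : Lam K n} (hf : parInv K n f = -f) (g : Lam K n) :
    f * g = parInv K n g * f := by
  induction g using lam_induction with
  | one => simp [parInv_one]
  | smul c g h => rw [mul_smul_comm, h, map_smul, smul_mul_assoc]
  | add g g' h h' => rw [mul_add, h, h', map_add, add_mul]
  | xi_mul i g h => rw [parInv_mul, mul_assoc, ← h, ← mul_assoc, ← mul_assoc, parInv_xi, neg_mul,
      xi_mul_comm, hf, neg_mul, neg_mul, neg_mul, neg_neg]

/-- The idempotent `ξ_k ∂_k`. -/
abbrev eop (K : Type*) [Field K] {n : ℕ} (k : Fin n) : Op K n := mulPd K (xi K k) k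

theorem mulPd_apply (P : Lam K n) (i : Fin n) (f : Lam K n) : mulPd K P i f = P * pd K i f := rfl

theorem eop_apply (k : Fin n) (f : Lam K n) : eop K k f = xi K k * pd K k f := rfl

theorem pd_eop (k : Fin n) (f : Lam K n) : pd K k (eop K k f) = pd K k f := by
  rw [eop_apply, pd_xi_mul, if_pos rfl, pd_pd_self, mul_zero, sub_zero]

theorem eop_pd_self (k : Fin n) (f : Lam K n) : eop K k (pd K k f) = 0 := by
  rw [eop_apply, pd_pd_self, mul_zero]

theorem eop_pd {k j : Fin n} (h : k ≠ j) (f : Lam K n) :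
    eop K k (pd K j f) = pd K j (eop K k f) := by
  rw [eop_apply, eop_apply, pd_xi_mul, if_neg h.symm, zero_sub, pd_pd k j, mul_neg]

theorem eop_xi_mul {k j : Fin n} (h : k ≠ j) (f : Lam K n) :
    eop K k (xi K j * f) = xi K j * eop K k f := by
  rw [eop_apply, eop_apply, pd_xi_mul, if_neg h, zero_sub, mul_neg, ← mul_assoc, xi_mul_xi, neg_mul,
    neg_neg, mul_assoc]

theorem eop_xi_mul_self (k : Fin n) (f : Lam K n) : eop K k (xi K k * f) = xi K k * f := by
  rw [eop_apply, pd_xi_mul, if_pos rfl, mul_sub, ← mul_assoc, xi_mul_self, zero_mul, sub_zero]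

theorem eop_one (k : Fin n) : eop K k (1 : Lam K n) = 0 := by
  rw [eop_apply, pd_one, mul_zero]

theorem eop_xi (k j : Fin n) : eop K k (xi K j) = if k = j then xi K j else 0 := by
  rw [eop_apply, pd_xi]
  split_ifs with h
  · rw [mul_one, h]
  · rw [mul_zero]

theorem eop_idem (k : Fin n) : eop K k * eop K k = eop K k := by
  refine LinearMap.ext fun f => ?_
  rw [Module.End.mul_apply, eop_apply k (eop K k f), pd_eop, eop_apply]

theorem eop_commute (k j : Fin n) : eop K k * eop K j = eop K j * eop K k := by
  rcases eq_or_ne k j with rfl | h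
  · rfl
  · refine LinearMap.ext fun f => ?_
    rw [Module.End.mul_apply, Module.End.mul_apply, eop_apply j f, eop_xi_mul h, eop_pd h]
    rfl

/-- Elements of `W(n)` are determined by their values on the generators. -/
theorem apply_eq_of_superDer {p : ZMod 2} {D : Op K n} (hD : D ∈ superDer K n p) (f : Lam K n) :
    D f = ∑ i, D (xi K i) * pd K i f := by
  obtain ⟨hp, hL⟩ := hD
  have h1 : D 1 = 0 := by
    have := hL 1 1
    have h2 : (parInv K n ^ p.val) (1 : Lam K n) = 1 := by
      rcases zmod_two_cases p with rfl | rfl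
      · simp
      · simp [ZMod.val_one, parInv_one]
    rw [mul_one, mul_one, h2, one_mul] at this
    simpa using this
  induction f using lam_induction with
  | one => simp [h1, pd_one]
  | smul c f h => simp only [map_smul, h, Finset.smul_sum, mul_smul_comm]
  | add f g h h' => simp only [map_add, h, h', mul_add, Finset.sum_add_distrib]
  | xi_mul j f h =>
    have hpar : ∀ i, D (xi K i) * xi K j = -((parInv K n ^ p.val) (xi K j) * D (xi K i)) := by
      intro i
      have h3 := LinearMap.congr_fun hp (xi K i)
      rw [Module.End.mul_apply, LinearMap.smul_apply, Module.End.mul_apply, parInv_xi, map_neg] at h3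
      rcases zmod_two_cases p with rfl | rfl
      · rw [ZMod.val_zero, pow_zero, one_smul] at h3
        rw [mul_comm_of_odd h3, parInv_xi, neg_mul]; simp
      · rw [ZMod.val_one, pow_one, smul_neg, neg_smul, one_smul, neg_neg] at h3
        rw [mul_comm_of_even h3, ZMod.val_one, pow_one, parInv_xi, neg_mul, neg_neg]
    simp only [pd_xi_mul, mul_sub, Finset.sum_sub_distrib, mul_ite, mul_zero]
    rw [Finset.sum_ite_eq' Finset.univ j, if_pos (Finset.mem_univ j), hL, h, Finset.mul_sum,
      sub_eq_add_neg, ← Finset.sum_neg_distrib]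
    congr 1
    refine Finset.sum_congr rfl fun i _ => ?_
    rw [← mul_assoc, ← mul_assoc, hpar, neg_mul, neg_neg]

theorem mulPd_mem_superDer {p : ZMod 2} {P : Lam K n}
    (hP : parInv K n P = -(-1 : K) ^ p.val • P) (i : Fin n) : mulPd K P i ∈ superDer K n p := by
  refine ⟨?_, fun f g => ?_⟩
  · refine LinearMap.ext fun f => ?_
    rw [Module.End.mul_apply, mulPd_apply, parInv_mul, hP, parInv_pd, LinearMap.smul_apply,
      Module.End.mul_apply, mulPd_apply]
    simp
  · rw [mulPd_apply, pd_mul, mul_add, mulPd_apply, mulPd_apply, mul_assoc, ← mul_assoc P,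
      ← mul_assoc (_ : Lam K n) P]
    congr 1
    rw [← mul_assoc]
    congr 1
    rcases zmod_two_cases p with rfl | rfl
    · rw [ZMod.val_zero, pow_zero, neg_one_smul] at hP
      rw [mul_comm_of_odd hP, parInv_parInv]; simp
    · rw [ZMod.val_one, pow_one, neg_neg, one_smul] at hP
      rw [mul_comm_of_even hP, ZMod.val_one, pow_one]

variable [CharZero K]

theorem mulPd_mem_Wn (P : Lam K n) (i : Fin n) : mulPd K P i ∈ Wn K n := by
  have h : mulPd K P i = mulPd K ((2 : K)⁻¹ • (P - parInv K n P)) i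
      + mulPd K ((2 : K)⁻¹ • (P + parInv K n P)) i := by
    refine LinearMap.ext fun f => ?_
    rw [LinearMap.add_apply, mulPd_apply, mulPd_apply, mulPd_apply, ← add_mul, ← smul_add]
    congr 1
    rw [sub_add_add_cancel, ← two_smul K, smul_smul, inv_mul_cancel₀ two_ne_zero, one_smul]
  rw [h]
  refine Submodule.add_mem_sup (mulPd_mem_superDer ?_ i) (mulPd_mem_superDer ?_ i)
  · simp [parInv_parInv, ← smul_neg]
  · simp [parInv_parInv, ZMod.val_one, add_comm]

/-- `W(n)` consists of the operators `∑ P_i ∂_i`. -/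
theorem mem_Wn_iff {D : Op K n} : D ∈ Wn K n ↔ ∀ f, D f = ∑ i, D (xi K i) * pd K i f := by
  constructor
  · intro h
    obtain ⟨a, ha, b, hb, rfl⟩ := Submodule.mem_sup.1 h
    intro f
    simp only [LinearMap.add_apply, add_mul, Finset.sum_add_distrib]
    rw [apply_eq_of_superDer ha f, apply_eq_of_superDer hb f]
  · intro h
    have : D = ∑ i, mulPd K (D (xi K i)) i := by
      refine LinearMap.ext fun f => ?_
      rw [h f, LinearMap.sum_apply]
      rfl
    rw [this]
    exact sum_mem fun i _ => mulPd_mem_Wn _ i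

theorem Wn_ext {D D' : Op K n} (hD : D ∈ Wn K n) (hD' : D' ∈ Wn K n)
    (h : ∀ i, D (xi K i) = D' (xi K i)) : D = D' := by
  refine LinearMap.ext fun f => ?_
  rw [mem_Wn_iff.1 hD, mem_Wn_iff.1 hD']
  simp only [h]

theorem mem_superDer_of_parity {p : ZMod 2} {D : Op K n} (hD : D ∈ Wn K n) (hp : HasParity p D) :
    D ∈ superDer K n p := by
  have : D = ∑ i, mulPd K (D (xi K i)) i := by
    refine LinearMap.ext fun f => ?_
    rw [mem_Wn_iff.1 hD f, LinearMap.sum_apply]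
    rfl
  rw [this]
  refine sum_mem fun i _ => mulPd_mem_superDer ?_ i
  have h3 := LinearMap.congr_fun hp (xi K i)
  rw [Module.End.mul_apply, LinearMap.smul_apply, Module.End.mul_apply, parInv_xi, map_neg] at h3
  rw [h3, smul_neg, neg_smul]

theorem superDer_le_Wn (p : ZMod 2) : superDer K n p ≤ Wn K n := by
  rcases zmod_two_cases p with rfl | rfl
  exacts [le_sup_left, le_sup_right]

end GrassmannCalculus

/-! ### Weights -/

section Weights

variable {K : Type*} [Field K] [CharZero K] {n : ℕ}

/-- A submodule that is stable under commuting endomorphisms with `T³ = T` is spanned by joint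
eigenvectors. -/
theorem le_of_joint_eigenvectors {V : Type*} [AddCommGroup V] [Module K V] {ι : Type*} [Fintype ι]
    (T : ι → Module.End K V) (hcomm : ∀ i j v, T i (T j v) = T j (T i v))
    (hcube : ∀ i v, T i (T i (T i v)) = T i v) {M N : Submodule K V}
    (hM : ∀ i, ∀ v ∈ M, T i v ∈ M)
    (h : ∀ a : ι → ℤ, ∀ v ∈ M, (∀ i, T i v = (a i : K) • v) → v ∈ N) : M ≤ N := by
  classical
  have key : ∀ s : Finset ι, ∀ v ∈ M, (∀ i ∉ s, ∃ a : ℤ, T i v = (a : K) • v) → v ∈ N := by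
    intro s
    induction s using Finset.induction_on with
    | empty =>
      intro v hv hs
      choose a ha using fun i => hs i (Finset.notMem_empty i)
      exact h a v hv ha
    | insert j s hj ih =>
      intro v hv hs
      have hstep : ∀ w ∈ M, (∀ i ∉ insert j s, ∃ a : ℤ, T i w = (a : K) • w) →
          (∃ a : ℤ, T j w = (a : K) • w) → w ∈ N := by
        intro w hw hw1 hw2
        refine ih w hw fun i hi => ?_
        rcases eq_or_ne i j with rfl | hij
        · exact hw2
        · exact hw1 i (by simp [hij, hi])
      have h1 : T j v ∈ M := hM j v hv
      have h2 : T j (T j v) ∈ M := hM j _ h1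
      have e0 := hstep (v - T j (T j v)) (sub_mem hv h2) (fun i hi => by
        obtain ⟨a, ha⟩ := hs i hi
        exact ⟨a, by rw [map_sub, hcomm, hcomm i j, ha, map_smul, map_smul, smul_sub]⟩)
        ⟨0, by rw [map_sub, hcube]; simp⟩
      have e1 := hstep (T j (T j v) + T j v) (add_mem h2 h1) (fun i hi => by
        obtain ⟨a, ha⟩ := hs i hi
        exact ⟨a, by rw [map_add, hcomm, hcomm i j, ha, map_smul, map_smul, smul_add]⟩)
        ⟨1, by rw [map_add, hcube]; simp [add_comm]⟩
      have e2 := hstep (T j (T j v) - T j v) (sub_mem h2 h1) (fun i hi => by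
        obtain ⟨a, ha⟩ := hs i hi
        exact ⟨a, by rw [map_sub, hcomm, hcomm i j, ha, map_smul, map_smul, smul_sub]⟩)
        ⟨-1, by rw [map_sub, hcube]; simp⟩
      have e3 : v = (v - T j (T j v)) + (2 : K)⁻¹ • ((T j (T j v) + T j v)
          + (T j (T j v) - T j v)) := by
        rw [add_add_sub_cancel, ← two_smul K (T j (T j v)), smul_smul, inv_mul_cancel₀ two_ne_zero,
          one_smul, sub_add_cancel]
      rw [e3]
      exact add_mem e0 (N.smul_mem _ (add_mem e1 e2))
  exact fun v hv => key Finset.univ v hv fun i hi => absurd (Finset.mem_univ i) hi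

theorem commutator_mul {A : Type*} [Ring A] (e x y : A) :
    e * (x * y) - x * y * e = (e * x - x * e) * y + x * (e * y - y * e) := by
  noncomm_ring

theorem commutator_commutator {A : Type*} [Ring A] {e f : A} (h : e * f = f * e) (x : A) :
    e * (f * x - x * f) - (f * x - x * f) * e = f * (e * x - x * e) - (e * x - x * e) * f := by
  have e : e * (f * x - x * f) - (f * x - x * f) * e
      - (f * (e * x - x * e) - (e * x - x * e) * f)
      = (e * f - f * e) * x - x * (e * f - f * e) := by noncomm_ring
  rw [h, sub_self, zero_mul, mul_zero, sub_zero] at e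
  exact sub_eq_zero.1 e

/-- The elements of `Λ(n)` of weight `b` for the operators `ξ_k ∂_k`. -/
def lamWeight (K : Type*) [Field K] {n : ℕ} (b : Fin n → ℤ) : Submodule K (Lam K n) where
  carrier := {f | ∀ k, eop K k f = (b k : K) • f}
  add_mem' := fun {f g} hf hg k => by rw [map_add, hf k, hg k, smul_add]
  zero_mem' := fun k => by rw [map_zero, smul_zero]
  smul_mem' := fun c f hf k => by rw [map_smul, hf k, smul_comm]

/-- The endomorphisms of `Λ(n)` that shift weights by `a`. -/
def opWeight (K : Type*) [Field K] {n : ℕ} (a : Fin n → ℤ) : Submodule K (Op K n) where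
  carrier := {D | ∀ k, eop K k * D - D * eop K k = (a k : K) • D}
  add_mem' := fun {f g} hf hg k => by
    rw [mul_add, add_mul, smul_add, ← hf k, ← hg k]; abel
  zero_mem' := fun k => by rw [mul_zero, zero_mul, sub_zero, smul_zero]
  smul_mem' := fun c f hf k => by
    rw [mul_smul_comm, smul_mul_assoc, ← smul_sub, hf k, smul_comm]

theorem opWeight_apply {a b : Fin n → ℤ} {D : Op K n} (hD : D ∈ opWeight K a) {f : Lam K n}
    (hf : f ∈ lamWeight K b) : D f ∈ lamWeight K (a + b) := fun k => by
  have h := LinearMap.congr_fun (hD k) f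
  rw [LinearMap.sub_apply, Module.End.mul_apply, Module.End.mul_apply, LinearMap.smul_apply, hf k,
    map_smul] at h
  rw [eq_add_of_sub_eq h, Pi.add_apply, Int.cast_add, add_smul]

theorem opWeight_mul {a b : Fin n → ℤ} {D D' : Op K n} (hD : D ∈ opWeight K a)
    (hD' : D' ∈ opWeight K b) : D * D' ∈ opWeight K (a + b) := fun k => by
  rw [commutator_mul, hD k, hD' k, smul_mul_assoc, mul_smul_comm, ← add_smul, Pi.add_apply, Int.cast_add]

theorem eop_parInv (k : Fin n) (f : Lam K n) :
    eop K k (parInv K n f) = parInv K n (eop K k f) := by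
  rw [eop_apply, eop_apply, parInv_mul, parInv_xi, parInv_pd, neg_mul_neg]

theorem parInv_mem_opWeight : parInv K n ∈ opWeight K (0 : Fin n → ℤ) := fun k => by
  have : eop K k * parInv K n = parInv K n * eop K k :=
    LinearMap.ext fun f => eop_parInv k f
  rw [this, sub_self]; simp

theorem sbr_mem_opWeight {a b : Fin n → ℤ} {D D' : Op K n} (hD : D ∈ opWeight K a)
    (hD' : D' ∈ opWeight K b) : sbr D D' ∈ opWeight K (a + b) := by
  have hc : ∀ {c : Fin n → ℤ} {E : Op K n}, E ∈ opWeight K c →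
      parInv K n * E * parInv K n ∈ opWeight K c := by
    intro c E hE
    have := opWeight_mul (opWeight_mul parInv_mem_opWeight hE) parInv_mem_opWeight
    rwa [zero_add, add_zero] at this
  have he : ∀ {c : Fin n → ℤ} {E : Op K n}, E ∈ opWeight K c → evenPart E ∈ opWeight K c :=
    fun hE => Submodule.smul_mem _ _ (add_mem hE (hc hE))
  have ho : ∀ {c : Fin n → ℤ} {E : Op K n}, E ∈ opWeight K c → oddPart E ∈ opWeight K c :=
    fun hE => Submodule.smul_mem _ _ (sub_mem hE (hc hE))
  have hm : ∀ {E E' : Op K n}, E ∈ opWeight K b → E' ∈ opWeight K a →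
      E * E' ∈ opWeight K (a + b) := fun h h' => by rw [add_comm]; exact opWeight_mul h h'
  exact sub_mem (opWeight_mul hD hD') (sub_mem (add_mem (add_mem (hm (he hD') (he hD))
    (hm (he hD') (ho hD))) (hm (ho hD') (he hD))) (hm (ho hD') (ho hD)))

theorem xi_mem_lamWeight (i : Fin n) : xi K i ∈ lamWeight K (Pi.single i 1 : Fin n → ℤ) := fun k => by
  rw [eop_xi, Pi.single_apply]
  split_ifs <;> simp

theorem pd_mem_opWeight (i : Fin n) : pd K i ∈ opWeight K (-Pi.single i 1 : Fin n → ℤ) := fun k => by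
  refine LinearMap.ext fun f => ?_
  rw [LinearMap.sub_apply, Module.End.mul_apply, Module.End.mul_apply, Pi.neg_apply,
    Pi.single_apply, LinearMap.smul_apply]
  split_ifs with h
  · rw [h, eop_pd_self, pd_eop]; simp
  · rw [eop_pd h]; simp

/-- The weights of `Λ(n)` have coordinates `0` and `1`. -/
theorem lamWeight_eq {b : Fin n → ℤ} {f : Lam K n} (hf : f ∈ lamWeight K b) (h0 : f ≠ 0)
    (k : Fin n) : b k = 0 ∨ b k = 1 := by
  have h := LinearMap.congr_fun (eop_idem (K := K) k) f
  rw [Module.End.mul_apply, hf k, map_smul, hf k, smul_smul] at h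
  have h1 : ((b k : K) * b k) = b k := smul_left_injective K h0 h
  have h2 : b k * b k = b k := by exact_mod_cast h1
  rcases eq_or_ne (b k) 0 with h3 | h3
  · exact Or.inl h3
  · exact Or.inr (mul_left_cancel₀ h3 (by rw [h2, mul_one]))

theorem eq_xi_mul_pd {b : Fin n → ℤ} {f : Lam K n} (hf : f ∈ lamWeight K b) {k : Fin n}
    (h : b k = 1) : f = xi K k * pd K k f := by
  have := hf k
  rw [h, Int.cast_one, one_smul] at this
  exact this.symm

theorem pd_eq_zero {b : Fin n → ℤ} {f : Lam K n} (hf : f ∈ lamWeight K b) {k : Fin n}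
    (h : b k = 0) : pd K k f = 0 := by
  have := hf k
  rw [h, Int.cast_zero, zero_smul] at this
  rw [← pd_eop, this, map_zero]

theorem mul_mem_lamWeight {b c : Fin n → ℤ} {f g : Lam K n} (hf : f ∈ lamWeight K b)
    (hg : g ∈ lamWeight K c) : f * g ∈ lamWeight K (b + c) := fun k => by
  rw [eop_apply, pd_mul, mul_add, ← mul_assoc, ← eop_apply, hf k, ← mul_assoc, xi_mul_comm,
    parInv_parInv, mul_assoc, ← eop_apply, hg k, smul_mul_assoc, mul_smul_comm, ← add_smul,
    Pi.add_apply, Int.cast_add]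

/-- Products of elements with overlapping weights vanish. -/
theorem mul_eq_zero_of_weights {b c : Fin n → ℤ} {f g : Lam K n} (hf : f ∈ lamWeight K b)
    (hg : g ∈ lamWeight K c) {m : Fin n} (hb : b m = 1) (hc : c m = 1) : f * g = 0 := by
  by_contra h
  have := lamWeight_eq (mul_mem_lamWeight hf hg) h m
  rw [Pi.add_apply, hb, hc] at this
  omega

theorem euler_apply (f : Lam K n) : euler K n f = ∑ k, eop K k f := by
  rw [euler, LinearMap.sum_apply]

theorem euler_of_mem_lamWeight {b : Fin n → ℤ} {f : Lam K n} (hf : f ∈ lamWeight K b) :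
    euler K n f = ((∑ k, b k : ℤ) : K) • f := by
  rw [euler_apply, Finset.sum_congr rfl fun k _ => hf k, ← Finset.sum_smul, Int.cast_sum]

theorem lam_le_of_weights {M N : Submodule K (Lam K n)} (hM : ∀ k, ∀ f ∈ M, eop K k f ∈ M)
    (h : ∀ b, ∀ f ∈ M, f ∈ lamWeight K b → f ∈ N) : M ≤ N := by
  have h1 : ∀ (i j : Fin n) (f : Lam K n), eop K i (eop K j f) = eop K j (eop K i f) :=
    fun i j f => LinearMap.congr_fun (eop_commute i j) f
  have h2 : ∀ (i : Fin n) (f : Lam K n), eop K i (eop K i f) = eop K i f :=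
    fun i f => LinearMap.congr_fun (eop_idem i) f
  exact le_of_joint_eigenvectors (fun k => eop K k) h1 (fun i f => by rw [h2, h2]) hM
    fun b f hf hb => h b f hf hb

/-- The operator `D ↦ e_k D - D e_k`. -/
def adE (K : Type*) [Field K] {n : ℕ} (k : Fin n) : Module.End K (Op K n) :=
  LinearMap.mulLeft K (eop K k) - LinearMap.mulRight K (eop K k)

theorem adE_apply (k : Fin n) (D : Op K n) : adE K k D = eop K k * D - D * eop K k := rfl

theorem adE_commute (i j : Fin n) (D : Op K n) : adE K i (adE K j D) = adE K j (adE K i D) :=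
  commutator_commutator (eop_commute i j) D

theorem idem_cube {A : Type*} [Ring A] {e : A} (he : e * e = e) (D : A) :
    e * (e * (e * D - D * e) - (e * D - D * e) * e)
      - (e * (e * D - D * e) - (e * D - D * e) * e) * e = e * D - D * e := by
  have h1 : ∀ x : A, e * (e * x) = e * x := fun x => by rw [← mul_assoc, he]
  have h2 : ∀ x : A, x * e * e = x * e := fun x => by rw [mul_assoc, he]
  simp only [mul_sub, sub_mul, h1, h2, mul_assoc, he]
  abel

theorem op_le_of_weights {M N : Submodule K (Op K n)} (hM : ∀ k, ∀ D ∈ M, adE K k D ∈ M)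
    (h : ∀ a, ∀ D ∈ M, D ∈ opWeight K a → D ∈ N) : M ≤ N :=
  le_of_joint_eigenvectors (fun k => adE K k) adE_commute
    (fun i D => idem_cube (eop_idem i) D) hM fun a D hD ha => h a D hD fun k => ha k

/-- The possible weights of `W(n)`: all coordinates are `0` or `1`, except one, which is `-1`
or `0`. -/
def IsWt (a : Fin n → ℤ) : Prop := ∃ i, (a i = -1 ∨ a i = 0) ∧ ∀ k ≠ i, a k = 0 ∨ a k = 1

theorem isWt_of_ne_zero {a : Fin n → ℤ} {D : Op K n} (hD : D ∈ Wn K n) (ha : D ∈ opWeight K a)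
    (h0 : D ≠ 0) : IsWt a := by
  obtain ⟨i, hi⟩ : ∃ i, D (xi K i) ≠ 0 := by
    by_contra! h
    exact h0 (Wn_ext hD (zero_mem _) fun i => by rw [h i, LinearMap.zero_apply])
  have h1 := lamWeight_eq (opWeight_apply ha (xi_mem_lamWeight i)) hi
  refine ⟨i, ?_, fun k hk => ?_⟩
  · have := h1 i
    rw [Pi.add_apply, Pi.single_eq_same] at this
    omega
  · have := h1 k
    rw [Pi.add_apply, Pi.single_eq_of_ne hk] at this
    omega

theorem eq_zero_of_not_isWt {a : Fin n → ℤ} {D : Op K n} (hD : D ∈ Wn K n)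
    (ha : D ∈ opWeight K a) (h : ¬ IsWt a) : D = 0 := by
  by_contra h0
  exact h (isWt_of_ne_zero hD ha h0)

/-! ### Degrees and parity -/

/-- Induction on the degree for homogeneous elements of the Grassmann algebra. -/
theorem mem_exteriorPower_succ_induction {d : ℕ} {P : Lam K n → Prop}
    (zero : P 0) (add : ∀ f g, P f → P g → P (f + g)) 
    (xi_mul : ∀ i, ∀ f ∈ ExteriorAlgebra.exteriorPower K d (Fin n → K), ∀ c : K,
      P (c • (xi K i * f))) :
    ∀ f ∈ ExteriorAlgebra.exteriorPower K (d + 1) (Fin n → K), P f := by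
  intro f hf
  change f ∈ LinearMap.range (ExteriorAlgebra.ι K : (Fin n → K) →ₗ[K] _) ^ (d + 1) at hf
  rw [pow_succ'] at hf
  refine Submodule.mul_induction_on hf ?_ add
  rintro _ ⟨v, rfl⟩ g hg
  have hv : v = ∑ i, v i • (Pi.single i 1 : Fin n → K) := by
    rw [← Finset.univ_sum_single v]
    refine Finset.sum_congr rfl fun i _ => ?_
    rw [Finset.univ_sum_single, ← Pi.single_smul, smul_eq_mul, mul_one]
  rw [hv, map_sum, Finset.sum_mul]
  refine Finset.sum_induction _ P add zero fun i _ => ?_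
  rw [map_smul, smul_mul_assoc]
  exact xi_mul i g hg _

theorem euler_one : euler K n (1 : Lam K n) = 0 := by
  rw [euler_apply]
  exact Finset.sum_eq_zero fun k _ => eop_one k

theorem euler_xi_mul (i : Fin n) (f : Lam K n) :
    euler K n (xi K i * f) = xi K i * f + xi K i * euler K n f := by
  rw [euler_apply, euler_apply, ← Finset.add_sum_erase _ _ (Finset.mem_univ i),
    ← Finset.add_sum_erase Finset.univ (fun k => eop K k f) (Finset.mem_univ i), eop_xi_mul_self,
    mul_add, eop_apply i f, ← mul_assoc, xi_mul_self, zero_mul, zero_add, Finset.mul_sum]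
  congr 1
  exact Finset.sum_congr rfl fun k hk => eop_xi_mul (Finset.ne_of_mem_erase hk) f

theorem euler_of_mem_exteriorPower {d : ℕ} :
    ∀ f ∈ ExteriorAlgebra.exteriorPower K d (Fin n → K), euler K n f = (d : K) • f := by
  induction d with
  | zero =>
    intro f hf
    change f ∈ LinearMap.range (ExteriorAlgebra.ι K : (Fin n → K) →ₗ[K] _) ^ 0 at hf
    rw [pow_zero, Submodule.mem_one] at hf
    obtain ⟨c, rfl⟩ := hf
    rw [Algebra.algebraMap_eq_smul_one, map_smul, euler_one]
    simp
  | succ d ih =>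
    refine mem_exteriorPower_succ_induction (by simp) (fun f g h h' => by rw [map_add, h, h', smul_add])
      fun i f hf c => ?_
    rw [map_smul, euler_xi_mul, ih f hf, mul_smul_comm, smul_add, smul_smul, smul_smul, ← add_smul]
    push_cast
    congr 1
    ring

theorem parInv_of_mem_exteriorPower {d : ℕ} :
    ∀ f ∈ ExteriorAlgebra.exteriorPower K d (Fin n → K), parInv K n f = (-1 : K) ^ d • f := by
  induction d with
  | zero =>
    intro f hf
    change f ∈ LinearMap.range (ExteriorAlgebra.ι K : (Fin n → K) →ₗ[K] _) ^ 0 at hf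
    rw [pow_zero, Submodule.mem_one] at hf
    obtain ⟨c, rfl⟩ := hf
    rw [Algebra.algebraMap_eq_smul_one, map_smul, parInv_one]
    simp
  | succ d ih =>
    refine mem_exteriorPower_succ_induction (by simp) (fun f g h h' => by rw [map_add, h, h', smul_add])
      fun i f hf c => ?_
    rw [map_smul, parInv_mul, parInv_xi, ih f hf, mul_smul_comm, pow_succ', neg_one_mul, neg_smul,
      neg_mul, smul_neg, smul_neg, smul_comm]

theorem mem_exteriorPower_of_euler {d : ℕ} {f : Lam K n} (hf : euler K n f = (d : K) • f) :
    f ∈ ExteriorAlgebra.exteriorPower K d (Fin n → K) := by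
  classical
  set 𝒜 := fun i : ℕ => ExteriorAlgebra.exteriorPower K i (Fin n → K)
  have h1 : ∀ (j : ℕ) (f : Lam K n), GradedAlgebra.proj 𝒜 j (euler K n f)
      = (j : K) • GradedAlgebra.proj 𝒜 j f := by
    intro j f
    induction f using DirectSum.Decomposition.inductionOn 𝒜 with
    | zero => simp
    | @homogeneous i m =>
      rw [euler_of_mem_exteriorPower _ m.2, map_smul]
      rcases eq_or_ne i j with rfl | hij
      · rfl
      · rw [GradedAlgebra.proj_apply, DirectSum.decompose_of_mem_ne 𝒜 m.2 hij, smul_zero, smul_zero]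
    | add f g h h' => rw [map_add, map_add, h, h', map_add, smul_add]
  rw [← DirectSum.sum_support_decompose 𝒜 f]
  refine sum_mem fun i _ => ?_
  rcases eq_or_ne i d with rfl | hid
  · exact SetLike.coe_mem _
  · have h2 := h1 i f
    rw [hf, map_smul] at h2
    have h3 : ((d : K) - i) • GradedAlgebra.proj 𝒜 i f = 0 := by rw [sub_smul, h2, sub_self]
    have h4 : (d : K) - i ≠ 0 := sub_ne_zero.2 (by exact_mod_cast hid.symm)
    rw [smul_eq_zero_iff_right h4, GradedAlgebra.proj_apply] at h3
    rw [h3]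
    exact zero_mem _

/-- The augmentation `Λ(n) → K`, the constant term. -/
def lamAug (K : Type*) [Field K] (n : ℕ) : Lam K n →ₐ[K] K := ExteriorAlgebra.algebraMapInv

theorem lamAug_xi (i : Fin n) : lamAug K n (xi K i) = 0 := by
  simp [lamAug, xi, ExteriorAlgebra.algebraMapInv]

theorem lamAug_xi_mul (i : Fin n) (f : Lam K n) : lamAug K n (xi K i * f) = 0 := by
  rw [map_mul, lamAug_xi, zero_mul]

theorem eq_algebraMap_of_euler {f : Lam K n} (hf : euler K n f = 0) :
    f = algebraMap K (Lam K n) (lamAug K n f) := by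
  have h := mem_exteriorPower_of_euler (d := 0) (f := f) (by rw [hf]; simp)
  change f ∈ LinearMap.range (ExteriorAlgebra.ι K : (Fin n → K) →ₗ[K] _) ^ 0 at h
  rw [pow_zero, Submodule.mem_one] at h
  obtain ⟨c, rfl⟩ := h
  rw [AlgHom.commutes]
  rfl

theorem eq_algebraMap_of_pd {f : Lam K n} (hf : ∀ i, pd K i f = 0) :
    f = algebraMap K (Lam K n) (lamAug K n f) :=
  eq_algebraMap_of_euler (by
    rw [euler_apply]
    exact Finset.sum_eq_zero fun k _ => by rw [eop_apply, hf, mul_zero])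

theorem pd_euler (i : Fin n) (f : Lam K n) :
    pd K i (euler K n f) = pd K i f + euler K n (pd K i f) := by
  rw [euler_apply, euler_apply, map_sum, ← Finset.add_sum_erase _ _ (Finset.mem_univ i), pd_eop,
    ← Finset.add_sum_erase Finset.univ (fun k => eop K k (pd K i f)) (Finset.mem_univ i),
    eop_pd_self, zero_add]
  congr 1
  exact Finset.sum_congr rfl fun k hk => (eop_pd (Finset.ne_of_mem_erase hk) f).symm

theorem apply_xi_mem_of_weight {a : Fin n → ℤ} {D : Op K n} (ha : D ∈ opWeight K a) (i : Fin n) :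
    euler K n (D (xi K i)) = ((∑ k, a k + 1 : ℤ) : K) • D (xi K i) := by
  rw [euler_of_mem_lamWeight (opWeight_apply ha (xi_mem_lamWeight i))]
  congr 2
  simp [Finset.sum_add_distrib]

theorem mem_degW_of_weight {a : Fin n → ℤ} {D : Op K n} (hD : D ∈ Wn K n) (ha : D ∈ opWeight K a)
    {d : ℕ} (hd : ∑ k, a k + 1 = d) : D ∈ degW K n d :=
  ⟨hD, fun i => mem_exteriorPower_of_euler (by
    rw [apply_xi_mem_of_weight ha, hd, Int.cast_natCast])⟩

theorem hasParity_of_weight {a : Fin n → ℤ} {D : Op K n} (hD : D ∈ Wn K n)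
    (ha : D ∈ opWeight K a) (p : ZMod 2) (hp : ((∑ k, a k : ℤ) : ZMod 2) = p) : HasParity p D := by
  by_cases h0 : D = 0
  · rw [h0, HasParity]; simp
  · obtain ⟨i, hi, hk⟩ := isWt_of_ne_zero hD ha h0
    have hs : -1 ≤ ∑ k, a k := by
      rw [← Finset.add_sum_erase _ _ (Finset.mem_univ i)]
      have := Finset.sum_nonneg (s := Finset.univ.erase i) (f := a) fun k hk' => by
        have := hk k (Finset.ne_of_mem_erase hk'); omega
      omega
    obtain ⟨d, hd⟩ : ∃ d : ℕ, ∑ k, a k + 1 = d := ⟨(∑ k, a k + 1).toNat, by omega⟩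
    have h1 := (mem_degW_of_weight hD ha hd).2
    refine LinearMap.ext fun f => ?_
    rw [Module.End.mul_apply, LinearMap.smul_apply, Module.End.mul_apply, mem_Wn_iff.1 hD f,
      mem_Wn_iff.1 hD (parInv K n f), map_sum, Finset.smul_sum]
    refine Finset.sum_congr rfl fun k _ => ?_
    rw [parInv_mul, parInv_of_mem_exteriorPower _ (h1 k), parInv_pd, mul_neg, smul_mul_assoc,
      ← neg_smul]
    congr 1
    have hp' : ((d : ℤ) : ZMod 2) = p + 1 := by rw [← hd, Int.cast_add, hp, Int.cast_one]
    rw [Int.cast_natCast] at hp'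
    rcases zmod_two_cases p with rfl | rfl
    · have : Odd d := by rw [← ZMod.natCast_eq_one_iff_odd, hp', zero_add]
      rw [this.neg_one_pow]; simp
    · have : Even d := by rw [← ZMod.natCast_eq_zero_iff_even, hp']; rfl
      rw [this.neg_one_pow]; simp [ZMod.val_one]

theorem eop_mem_Wn (k : Fin n) : eop K k ∈ Wn K n := mulPd_mem_Wn _ _

theorem euler_mem_Wn : euler K n ∈ Wn K n := sum_mem fun k _ => eop_mem_Wn k

end Weights

/-! ### Closure under the supercommutator -/

section Closure

variable {K : Type*} [Field K] [CharZero K] {n : ℕ}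

theorem evenPart_eq (x : Op K n) : evenPart x = (2 : K)⁻¹ • (x + parConj K n x) := by
  rw [parConj_apply]; rfl

theorem oddPart_eq (x : Op K n) : oddPart x = (2 : K)⁻¹ • (x - parConj K n x) := by
  rw [parConj_apply]; rfl

/-- To check that a subspace contains the supercommutators of two subspaces stable under the parity
automorphism, it suffices to consider homogeneous elements. -/
theorem sbr_mem_of_homogeneous {G N : Submodule K (Op K n)} (hG : ∀ x ∈ G, parConj K n x ∈ G)
    (h : ∀ (p q : ZMod 2) (x y : Op K n), x ∈ G → y ∈ G → HasParity p x → HasParity q y →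
      x * y - (-1 : K) ^ (p.val * q.val) • (y * x) ∈ N) {x y : Op K n} (hx : x ∈ G) (hy : y ∈ G) :
    sbr x y ∈ N := by
  have he : ∀ z ∈ G, evenPart z ∈ G := fun z hz => by
    rw [evenPart_eq]; exact G.smul_mem _ (add_mem hz (hG z hz))
  have ho : ∀ z ∈ G, oddPart z ∈ G := fun z hz => by
    rw [oddPart_eq]; exact G.smul_mem _ (sub_mem hz (hG z hz))
  have hs : ∀ (p q : ZMod 2) (x y : Op K n), x ∈ G → y ∈ G → HasParity p x → HasParity q y →
      sbrL K n x y ∈ N := fun p q x y hx hy hp hq => by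
    rw [sbrL_apply, sbr_of_parity hp hq]; exact h p q x y hx hy hp hq
  rw [← sbrL_apply, ← evenPart_add_oddPart x, ← evenPart_add_oddPart y]
  simp only [map_add, LinearMap.add_apply]
  exact add_mem
    (add_mem (hs 0 0 _ _ (he x hx) (he y hy) (evenPart_parity x) (evenPart_parity y))
      (hs 1 0 _ _ (ho x hx) (he y hy) (oddPart_parity x) (evenPart_parity y)))
    (add_mem (hs 0 1 _ _ (he x hx) (ho y hy) (evenPart_parity x) (oddPart_parity y))
      (hs 1 1 _ _ (ho x hx) (ho y hy) (oddPart_parity x) (oddPart_parity y)))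

theorem parConj_mem_Wn {x : Op K n} (hx : x ∈ Wn K n) : parConj K n x ∈ Wn K n := by
  obtain ⟨a, ha, b, hb, rfl⟩ := Submodule.mem_sup.1 hx
  rw [map_add, parConj_of_zero ha.1, parConj_of_one hb.1]
  exact add_mem (superDer_le_Wn 0 ha) (neg_mem (superDer_le_Wn 1 hb))

theorem HasParity.apply_xi {p : ZMod 2} {D : Op K n} (hp : HasParity p D) (i : Fin n) :
    parInv K n (D (xi K i)) = -((-1 : K) ^ p.val • D (xi K i)) := by
  have h3 := LinearMap.congr_fun hp (xi K i)
  rwa [Module.End.mul_apply, LinearMap.smul_apply, Module.End.mul_apply, parInv_xi, map_neg,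
    smul_neg] at h3

/-- The commutator of `∂_i` with a homogeneous `D ∈ W(n)`. -/
theorem pd_apply_of_parity {p : ZMod 2} {D : Op K n} (hD : D ∈ Wn K n) (hp : HasParity p D)
    (i : Fin n) (f : Lam K n) : pd K i (D f) = (-1 : K) ^ p.val • D (pd K i f)
      + ∑ j, pd K i (D (xi K j)) * pd K j f := by
  rw [mem_Wn_iff.1 hD f, mem_Wn_iff.1 hD (pd K i f), map_sum, Finset.smul_sum,
    ← Finset.sum_add_distrib]
  refine Finset.sum_congr rfl fun j _ => ?_
  rw [pd_mul, hp.apply_xi, pd_pd i j, neg_mul_neg, smul_mul_assoc, add_comm]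

theorem mul_comm_of_parity {p q : ZMod 2} {f g : Lam K n}
    (hf : parInv K n f = (-1 : K) ^ p.val • f) (hg : parInv K n g = (-1 : K) ^ q.val • g) :
    f * g = (-1 : K) ^ (p.val * q.val) • (g * f) := by
  rcases zmod_two_cases p with rfl | rfl
  · rw [ZMod.val_zero, pow_zero, one_smul] at hf
    simp [mul_comm_of_even hf g]
  · rw [ZMod.val_one, pow_one, neg_one_smul] at hf
    rw [mul_comm_of_odd hf, hg, ZMod.val_one, one_mul, smul_mul_assoc]

theorem parInv_pd_apply_xi {p : ZMod 2} {D : Op K n} (hp : HasParity p D) (i j : Fin n) :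
    parInv K n (pd K i (D (xi K j))) = (-1 : K) ^ p.val • pd K i (D (xi K j)) := by
  rw [parInv_pd, hp.apply_xi, map_neg, neg_neg, map_smul]

theorem neg_one_pow_sq (m : ℕ) : ((-1 : K) ^ m) * (-1) ^ m = 1 := by
  rw [← mul_pow]; simp

theorem parInv_pow_apply {q : ZMod 2} {D : Op K n} (hq : HasParity q D) (p : ZMod 2)
    (f : Lam K n) : (parInv K n ^ p.val) (D f)
      = (-1 : K) ^ (p.val * q.val) • D ((parInv K n ^ p.val) f) := by
  rcases zmod_two_cases p with rfl | rfl
  · simp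
  · rw [ZMod.val_one, pow_one, one_mul]
    exact LinearMap.congr_fun hq f

theorem parInv_pow_add (p q : ZMod 2) (f : Lam K n) : (parInv K n ^ (p + q).val) f
    = (parInv K n ^ p.val) ((parInv K n ^ q.val) f) := by
  rcases zmod_two_cases p with rfl | rfl <;> rcases zmod_two_cases q with rfl | rfl
  · simp
  · simp
  · simp
  · rw [show (1 + 1 : ZMod 2) = 0 from rfl, ZMod.val_one, pow_one, parInv_parInv]; simp

/-- Superderivations are closed under the supercommutator. -/
theorem bracket_mem_Wn {p q : ZMod 2} {x y : Op K n} (hx : x ∈ Wn K n) (hy : y ∈ Wn K n)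
    (hp : HasParity p x) (hq : HasParity q y) :
    x * y - (-1 : K) ^ (p.val * q.val) • (y * x) ∈ Wn K n := by
  have hx' := (mem_superDer_of_parity hx hp).2
  have hy' := (mem_superDer_of_parity hy hq).2
  have key : ∀ f g : Lam K n, x (y (f * g)) = x (y f) * g
      + (-1 : K) ^ (p.val * q.val) • (y ((parInv K n ^ p.val) f) * x g)
      + (x ((parInv K n ^ q.val) f) * y g + (parInv K n ^ (p + q).val) f * x (y g)) := by
    intro f g
    rw [hy', map_add, hx', hx', parInv_pow_apply hq, smul_mul_assoc, ← parInv_pow_add]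
  have key' : ∀ f g : Lam K n, y (x (f * g)) = y (x f) * g
      + (-1 : K) ^ (p.val * q.val) • (x ((parInv K n ^ q.val) f) * y g)
      + (y ((parInv K n ^ p.val) f) * x g + (parInv K n ^ (p + q).val) f * y (x g)) := by
    intro f g
    rw [hx', map_add, hy', hy', parInv_pow_apply hp, smul_mul_assoc, ← parInv_pow_add, add_comm q p,
      mul_comm q.val]
  refine superDer_le_Wn (p + q) ⟨?_, fun f g => ?_⟩
  · rw [← sbr_of_parity hp hq]
    exact sbr_parity hp hq
  · have h1 := neg_one_pow_sq (K := K) (p.val * q.val)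
    simp only [LinearMap.sub_apply, LinearMap.smul_apply, Module.End.mul_apply]
    rw [key, key', smul_add, smul_add, smul_smul, h1, one_smul, smul_add, sub_mul, mul_sub,
      smul_mul_assoc, mul_smul_comm]
    abel

theorem sbr_mem_Wn {x y : Op K n} (hx : x ∈ Wn K n) (hy : y ∈ Wn K n) : sbr x y ∈ Wn K n :=
  sbr_mem_of_homogeneous (fun _ => parConj_mem_Wn)
    (fun _ _ _ _ hx hy hp hq => bracket_mem_Wn hx hy hp hq) hx hy

theorem dvg_parConj (x : Op K n) : dvg K n (parConj K n x) = parInv K n (dvg K n x) := by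
  rw [dvg, dvg, map_sum]
  refine Finset.sum_congr rfl fun i _ => ?_
  rw [parConj_apply, Module.End.mul_apply, Module.End.mul_apply, parInv_xi, map_neg, map_neg,
    map_neg, parInv_pd]

/-- The divergence of a supercommutator. -/
theorem dvg_bracket {p q : ZMod 2} {x y : Op K n} (hx : x ∈ Wn K n) (hy : y ∈ Wn K n)
    (hp : HasParity p x) (hq : HasParity q y) :
    dvg K n (x * y - (-1 : K) ^ (p.val * q.val) • (y * x))
      = (-1 : K) ^ p.val • x (dvg K n y)
        - (-1 : K) ^ (p.val * q.val) • (-1 : K) ^ q.val • y (dvg K n x) := by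
  have h1 : ∀ i, pd K i (x (y (xi K i))) = (-1 : K) ^ p.val • x (pd K i (y (xi K i)))
      + ∑ j, pd K i (x (xi K j)) * pd K j (y (xi K i)) := fun i => pd_apply_of_parity hx hp i _
  have h2 : ∀ i, pd K i (y (x (xi K i))) = (-1 : K) ^ q.val • y (pd K i (x (xi K i)))
      + ∑ j, pd K i (y (xi K j)) * pd K j (x (xi K i)) := fun i => pd_apply_of_parity hy hq i _
  have h3 : ∑ i, ∑ j, pd K i (x (xi K j)) * pd K j (y (xi K i))
      = (-1 : K) ^ (p.val * q.val) • ∑ i, ∑ j, pd K i (y (xi K j)) * pd K j (x (xi K i)) := by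
    rw [Finset.sum_comm, Finset.smul_sum]
    refine Finset.sum_congr rfl fun i _ => ?_
    rw [Finset.smul_sum]
    refine Finset.sum_congr rfl fun j _ => ?_
    exact mul_comm_of_parity (parInv_pd_apply_xi hp _ _) (parInv_pd_apply_xi hq _ _)
  simp only [dvg, LinearMap.sub_apply, LinearMap.smul_apply, Module.End.mul_apply, map_sub,
    map_smul, h1, h2, Finset.sum_sub_distrib, Finset.sum_add_distrib, smul_add, h3, map_sum,
    Finset.smul_sum]
  abel

theorem sbr_mem_Sn {x y : Op K n} (hx : x ∈ Sn K n) (hy : y ∈ Sn K n) : sbr x y ∈ Sn K n := by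
  refine sbr_mem_of_homogeneous (G := Sn K n) (N := Sn K n) (fun x hx => ?_)
    (fun p q x y hx hy hp hq => ?_) hx hy
  · refine ⟨parConj_mem_Wn hx.1, ?_⟩
    rw [dvg_parConj, hx.2, map_zero]
  · refine ⟨bracket_mem_Wn hx.1 hy.1 hp hq, ?_⟩
    rw [dvg_bracket hx.1 hy.1 hp hq, hx.2, hy.2]
    simp

/-! ### The volume element -/

theorem one_mem_lamWeight : (1 : Lam K n) ∈ lamWeight K (0 : Fin n → ℤ) := fun k => by
  rw [eop_one]; simp

theorem vol_mem_lamWeight : vol K n ∈ lamWeight K (1 : Fin n → ℤ) := by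
  have h : ∀ l : List (Fin n), (l.map fun i => xi K i).prod
      ∈ lamWeight K ((l.map fun i => (Pi.single i 1 : Fin n → ℤ)).sum) := by
    intro l
    induction l with
    | nil => simpa using one_mem_lamWeight
    | cons i l ih => simpa using mul_mem_lamWeight (xi_mem_lamWeight i) ih
  have h2 := h (List.finRange n)
  rw [← List.ofFn_eq_map, ← List.ofFn_eq_map, List.sum_ofFn] at h2
  have h3 : (∑ i, Pi.single i 1 : Fin n → ℤ) = 1 := by
    funext k
    simp [Finset.sum_apply, Pi.single_apply]
  rw [h3] at h2
  exact h2

theorem xi_mul_vol (i : Fin n) : xi K i * vol K n = 0 :=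
  mul_eq_zero_of_weights (xi_mem_lamWeight i) vol_mem_lamWeight (m := i) (by simp) rfl

theorem mul_vol (f : Lam K n) : f * vol K n = lamAug K n f • vol K n := by
  induction f using lam_induction with
  | one => simp
  | smul c f h => rw [smul_mul_assoc, h, map_smul, smul_smul, smul_eq_mul]
  | add f g h h' => rw [add_mul, h, h', map_add, add_smul]
  | xi_mul i f h => rw [mul_assoc, h, mul_smul_comm, xi_mul_vol, lamAug_xi_mul]; simp

theorem lamAug_parInv (f : Lam K n) : lamAug K n (parInv K n f) = lamAug K n f := by
  induction f using lam_induction with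
  | one => simp [parInv_one]
  | smul c f h => rw [map_smul, map_smul, map_smul, h]
  | add f g h h' => rw [map_add, map_add, map_add, h, h']
  | xi_mul i f h => rw [parInv_mul, map_mul, map_mul, parInv_xi, map_neg, lamAug_xi]; simp

theorem mul_pd_vol (f : Lam K n) (i : Fin n) :
    f * pd K i (vol K n) = lamAug K n f • pd K i (vol K n) + lamAug K n (pd K i f) • vol K n := by
  have h := pd_mul i (parInv K n f) (vol K n)
  rw [parInv_parInv, mul_vol, mul_vol, lamAug_parInv, map_smul] at h
  have h2 : pd K i (parInv K n f) = -parInv K n (pd K i f) := by rw [parInv_pd, neg_neg]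
  rw [h2, map_neg, lamAug_parInv] at h
  rw [h, neg_smul]
  abel

theorem apply_vol {D : Op K n} (hD : D ∈ Wn K n) : D (vol K n) =
    ∑ i, lamAug K n (D (xi K i)) • pd K i (vol K n) + lamAug K n (dvg K n D) • vol K n := by
  rw [mem_Wn_iff.1 hD, dvg, map_sum, Finset.sum_smul, ← Finset.sum_add_distrib]
  exact Finset.sum_congr rfl fun i _ => mul_pd_vol _ i

theorem pd_vol_mem_lamWeight (i : Fin n) :
    pd K i (vol K n) ∈ lamWeight K (1 - Pi.single i 1 : Fin n → ℤ) := by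
  rw [sub_eq_neg_add]
  exact opWeight_apply (pd_mem_opWeight i) vol_mem_lamWeight

theorem vol_mul_self (hn : 1 ≤ n) : vol K n * vol K n = 0 :=
  mul_eq_zero_of_weights vol_mem_lamWeight vol_mem_lamWeight (m := ⟨0, hn⟩) rfl rfl

theorem lamAug_vol (hn : 1 ≤ n) : lamAug K n (vol K n) = 0 := by
  obtain ⟨m, rfl⟩ : ∃ m, n = m + 1 := ⟨n - 1, by omega⟩
  rw [vol, List.ofFn_succ, List.prod_cons, lamAug_xi_mul]

theorem vol_mul_apply_vol (hn : 2 ≤ n) {D : Op K n} (hD : D ∈ Wn K n) :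
    vol K n * D (vol K n) = 0 := by
  rw [apply_vol hD, mul_add, mul_smul_comm, vol_mul_self (by omega), smul_zero, add_zero,
    Finset.mul_sum]
  refine Finset.sum_eq_zero fun i _ => ?_
  obtain ⟨m, hm⟩ : ∃ m : Fin n, m ≠ i := by
    have : Nontrivial (Fin n) := Fin.nontrivial_iff_two_le.2 hn
    exact exists_ne i
  rw [mul_smul_comm, mul_eq_zero_of_weights vol_mem_lamWeight (pd_vol_mem_lamWeight i) (m := m) rfl
    (by simp [hm]), smul_zero]

/-- `S~(n) = {D ∈ W(n) | div D = - D(ξ_1 ⋯ ξ_n)}`. -/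
theorem mem_Stn_iff (hn : 2 ≤ n) {D : Op K n} :
    D ∈ Stn K n ↔ D ∈ Wn K n ∧ dvg K n D = -D (vol K n) := by
  refine and_congr_right fun hD => ?_
  have h1 := vol_mul_apply_vol hn hD
  constructor
  · intro h
    have h2 := congrArg (fun z => (1 - vol K n) * z) h
    have h3 : (1 - vol K n) * ((1 + vol K n) * dvg K n D + D (vol K n))
        = dvg K n D + D (vol K n) - vol K n * vol K n * dvg K n D - vol K n * D (vol K n) := by
      noncomm_ring
    simp only [h3, vol_mul_self (K := K) (show 1 ≤ n by omega), h1, zero_mul, sub_zero,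
      mul_zero] at h2
    exact eq_neg_of_add_eq_zero_left h2
  · intro h
    rw [h, add_mul, one_mul, mul_neg, h1]
    simp

theorem apply_vol_of_even {D : Op K n} (hD : D ∈ Wn K n) (hp : HasParity 0 D) :
    D (vol K n) = lamAug K n (dvg K n D) • vol K n := by
  rw [apply_vol hD, add_eq_right]
  refine Finset.sum_eq_zero fun i _ => ?_
  have h := congrArg (lamAug K n) (hp.apply_xi i)
  rw [lamAug_parInv, ZMod.val_zero, pow_zero, one_smul, map_neg] at h
  rw [self_eq_neg.1 h, zero_smul]

theorem even_mem_Stn (hn : 2 ≤ n) {D : Op K n} (hD : D ∈ Wn K n) (hp : HasParity 0 D)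
    (h : dvg K n D = D (vol K n) ∨ dvg K n D = -D (vol K n)) :
    dvg K n D = 0 ∧ D (vol K n) = 0 := by
  have h1 := apply_vol_of_even hD hp
  have h2 : lamAug K n (dvg K n D) = 0 := by
    rcases h with h | h
    · have := congrArg (lamAug K n) (h.trans h1)
      rwa [map_smul, lamAug_vol (by omega), smul_zero] at this
    · have := congrArg (lamAug K n) (h.trans (congrArg Neg.neg h1))
      rwa [map_neg, map_smul, lamAug_vol (by omega), smul_zero, neg_zero] at this
  rw [h2, zero_smul] at h1
  rw [h1] at h
  exact ⟨by simpa using h, h1⟩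

theorem parInv_vol : parInv K n (vol K n) = (-1 : K) ^ n • vol K n :=
  parInv_of_mem_exteriorPower _ (mem_exteriorPower_of_euler (by
    rw [euler_of_mem_lamWeight vol_mem_lamWeight]; simp))

/-- For even `n` the volume element is even, so that the condition `div D = -D(ξ_1 ⋯ ξ_n)` is stable
under supercommutators. -/
theorem sbr_mem_Stn (hn : 2 ≤ n) (hev : Even n) {x y : Op K n} (hx : x ∈ Stn K n)
    (hy : y ∈ Stn K n) : sbr x y ∈ Stn K n := by
  refine sbr_mem_of_homogeneous (fun x hx => ?_) (fun p q x y hx hy hp hq => ?_) hx hy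
  · rw [mem_Stn_iff hn] at hx ⊢
    refine ⟨parConj_mem_Wn hx.1, ?_⟩
    rw [dvg_parConj, hx.2, parConj_apply, Module.End.mul_apply, Module.End.mul_apply, parInv_vol,
      hev.neg_one_pow, one_smul, map_neg]
  · rw [mem_Stn_iff hn] at hx hy ⊢
    have hW := bracket_mem_Wn hx.1 hy.1 hp hq
    refine ⟨hW, ?_⟩
    have hd := dvg_bracket hx.1 hy.1 hp hq
    rw [hx.2, hy.2, map_neg, map_neg] at hd
    rcases zmod_two_cases p with rfl | rfl <;> rcases zmod_two_cases q with rfl | rfl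
    · rw [hd]; simp [neg_add_eq_sub]
    · have h0 := (even_mem_Stn hn hx.1 hp (Or.inr hx.2)).2
      rw [hd]; simp [h0, ZMod.val_one]
    · have h0 := (even_mem_Stn hn hy.1 hq (Or.inr hy.2)).2
      rw [hd]; simp [h0, ZMod.val_one]
    · have hpar := sbr_parity hp hq
      rw [sbr_of_parity hp hq] at hpar
      have h0 := even_mem_Stn hn hW hpar (Or.inl (by rw [hd]; simp [ZMod.val_one]))
      rw [h0.1, h0.2, neg_zero]

end Closure

/-! ### Roots as weights -/

section Roots

variable {K : Type*} [Field K] [CharZero K] {n : ℕ}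

theorem eop_mem_opWeight (k : Fin n) : eop K k ∈ opWeight K (0 : Fin n → ℤ) := fun j => by
  rw [eop_commute, sub_self]; simp

theorem eop_parity (k : Fin n) : HasParity 0 (eop K k) := by
  rw [hasParity_zero_iff]
  exact (LinearMap.ext fun f => eop_parInv k f).symm

variable (K n) in
/-- The span of the operators `ξ_k ∂_k`. -/
def torus : Submodule K (Op K n) := Submodule.span K (Set.range fun k : Fin n => eop K k)

theorem eop_mem_torus (k : Fin n) : eop K k ∈ torus K n := Submodule.subset_span ⟨k, rfl⟩

theorem euler_mem_torus : euler K n ∈ torus K n := sum_mem fun k _ => eop_mem_torus k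

theorem cartan_le_torus (t : CartanType) : cartan K t n ≤ torus K n := by
  cases t <;> refine Submodule.span_le.2 ?_
  · rintro _ ⟨k, rfl⟩; exact eop_mem_torus k
  · rintro _ ⟨k, l, -, rfl⟩; exact sub_mem (eop_mem_torus k) (eop_mem_torus l)
  · rintro _ ⟨k, l, -, rfl⟩; exact sub_mem (eop_mem_torus k) (eop_mem_torus l)
  · rintro _ ⟨k, l, -, -, rfl⟩; exact sub_mem (eop_mem_torus k) (eop_mem_torus l)

theorem cartanBar_le_torus (t : CartanType) : cartanBar K t n ≤ torus K n := by
  have he : Submodule.span K {euler K n} ≤ torus K n := by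
    rw [Submodule.span_le, Set.singleton_subset_iff]; exact euler_mem_torus
  cases t
  · exact cartan_le_torus .W
  · exact sup_le (cartan_le_torus .S) he
  · exact cartan_le_torus .St
  · exact sup_le (cartan_le_torus .H) he

theorem torus_parity {h : Op K n} (hh : h ∈ torus K n) : HasParity 0 h := by
  induction hh using Submodule.span_induction with
  | mem x hx => obtain ⟨k, rfl⟩ := hx; exact eop_parity k
  | zero => exact hasParity_zero_op 0
  | add x y _ _ hx hy => exact hx.add hy
  | smul c x _ hx => exact hx.smul c

theorem torus_le_opWeight : torus K n ≤ opWeight K (0 : Fin n → ℤ) := by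
  refine Submodule.span_le.2 ?_
  rintro _ ⟨k, rfl⟩; exact eop_mem_opWeight k

/-- The coefficient of `ξ_k ∂_k` in an element of `W(n)`. -/
def coefE (K : Type*) [Field K] {n : ℕ} (k : Fin n) : Op K n →ₗ[K] K :=
  (lamAug K n).toLinearMap ∘ₗ pd K k ∘ₗ LinearMap.applyₗ (xi K k)

theorem coefE_apply (k : Fin n) (D : Op K n) :
    coefE K k D = lamAug K n (pd K k (D (xi K k))) := rfl

theorem coefE_eop (k j : Fin n) : coefE K k (eop K j) = if k = j then 1 else 0 := by
  rw [coefE_apply, eop_xi]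
  split_ifs with h h1 h1
  · rw [pd_xi, if_pos rfl, map_one]
  · exact absurd h.symm h1
  · exact absurd h1.symm h
  · simp

theorem torus_eq_sum {h : Op K n} (hh : h ∈ torus K n) : h = ∑ k, coefE K k h • eop K k := by
  induction hh using Submodule.span_induction with
  | mem x hx =>
    obtain ⟨j, rfl⟩ := hx
    simp [coefE_eop]
  | zero => simp
  | add x y _ _ hx hy => 
    conv_lhs => rw [hx, hy]
    rw [← Finset.sum_add_distrib]
    exact Finset.sum_congr rfl fun k _ => by rw [map_add, add_smul]
  | smul c x _ hx =>
    conv_lhs => rw [hx]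
    rw [Finset.smul_sum]
    exact Finset.sum_congr rfl fun k _ => by rw [map_smul, smul_smul, smul_eq_mul]

/-- The linear form on `𝔥‾` defined by a weight `a`: it takes the value `a k` on `ξ_k ∂_k`. -/
def wt (K : Type*) [Field K] (t : CartanType) {n : ℕ} (a : Fin n → ℤ) :
    Module.Dual K (cartanBar K t n) :=
  (∑ k, (a k : K) • coefE K k) ∘ₗ (cartanBar K t n).subtype

variable {t : CartanType}

theorem wt_apply (a : Fin n → ℤ) (h : cartanBar K t n) :
    wt K t a h = ∑ k, (a k : K) * coefE K k (h : Op K n) := by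
  simp [wt]

theorem wt_add (a b : Fin n → ℤ) : wt K t (a + b) = wt K t a + wt K t b := by
  ext h
  simp [wt_apply, add_mul, Finset.sum_add_distrib]

theorem wt_neg (a : Fin n → ℤ) : wt K t (-a) = -wt K t a := by
  ext h
  simp [wt_apply]

theorem wt_zero : wt K t (0 : Fin n → ℤ) = 0 := by
  ext h
  simp [wt_apply]

theorem wt_smul (m : ℕ) (a : Fin n → ℤ) : wt K t (m • a) = m • wt K t a := by
  ext h
  simp [wt_apply, Finset.mul_sum, mul_assoc]

theorem sbr_torus {h : Op K n} (hh : h ∈ torus K n) {a : Fin n → ℤ} {D : Op K n}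
    (hD : D ∈ opWeight K a) : sbr h D = (∑ k, (a k : K) * coefE K k h) • D := by
  rw [sbr_even_left (torus_parity hh), Finset.sum_smul]
  conv_lhs => rw [torus_eq_sum hh]
  rw [Finset.sum_mul, Finset.mul_sum, ← Finset.sum_sub_distrib]
  refine Finset.sum_congr rfl fun k _ => ?_
  rw [smul_mul_assoc, mul_smul_comm]
  refine (smul_sub _ _ _).symm.trans ?_
  rw [hD k, smul_smul, mul_comm]

theorem sbr_of_opWeight {a : Fin n → ℤ} {D : Op K n} (hD : D ∈ opWeight K a)
    (h : cartanBar K t n) : sbr (h : Op K n) D = wt K t a h • D := by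
  rw [sbr_torus (cartanBar_le_torus t h.2) hD, wt_apply]

theorem galg_le_Wn (hH : Hn K n ≤ Wn K n) : galg K t n ≤ Wn K n := by
  cases t
  · exact le_rfl
  · exact fun x hx => hx.1
  · exact fun x hx => hx.1
  · exact hH

theorem Htn_le_Wn : Htn K n ≤ Wn K n := fun _ hx => hx.1

theorem Hn_le_Wn : Hn K n ≤ Wn K n := by
  refine Submodule.span_le.2 ?_
  rintro _ ⟨x, hx, y, hy, rfl⟩
  exact sbr_mem_Wn (Htn_le_Wn hx) (Htn_le_Wn hy)

theorem galg_le : galg K t n ≤ Wn K n := galg_le_Wn Hn_le_Wn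

variable (t) in
/-- The weight space of `W(n)` for a linear form on `𝔥‾`. -/
def wnSpace (α : Module.Dual K (cartanBar K t n)) : Submodule K (Op K n) where
  carrier := {w | w ∈ Wn K n ∧ ∀ h : cartanBar K t n, sbr (h : Op K n) w = α h • w}
  add_mem' := by
    rintro a b ⟨ha, ha'⟩ ⟨hb, hb'⟩
    exact ⟨add_mem ha hb, fun h => by rw [sbr_add_right, ha', hb', smul_add]⟩
  zero_mem' := ⟨zero_mem _, fun h => by rw [← sbrL_apply, map_zero, smul_zero]⟩
  smul_mem' := by
    rintro c a ⟨ha, ha'⟩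
    exact ⟨Submodule.smul_mem _ c ha, fun h => by rw [sbr_smul_right, ha', smul_comm]⟩

theorem rootSpace_le_wnSpace (α : Module.Dual K (cartanBar K t n)) :
    rootSpace K t n α ≤ wnSpace t α := fun _ hw => ⟨galg_le hw.1, hw.2⟩

theorem adE_mem_wnSpace {α : Module.Dual K (cartanBar K t n)} (k : Fin n) {D : Op K n}
    (hD : D ∈ wnSpace t α) : adE K k D ∈ wnSpace t α := by
  refine ⟨?_, fun h => ?_⟩
  · rw [adE_apply, ← sbr_even_left (eop_parity k)]
    exact sbr_mem_Wn (eop_mem_Wn k) hD.1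
  · have hp := torus_parity (cartanBar_le_torus t h.2)
    have hc : (h : Op K n) * eop K k = eop K k * (h : Op K n) := by
      have := torus_le_opWeight (cartanBar_le_torus t h.2) k
      rw [Pi.zero_apply, Int.cast_zero, zero_smul] at this
      exact (sub_eq_zero.1 this).symm
    have h1 := hD.2 h
    rw [sbr_even_left hp] at h1 ⊢
    rw [adE_apply, commutator_commutator hc, h1, mul_smul_comm, smul_mul_assoc, smul_sub]

theorem eq_wt_of_mem {α : Module.Dual K (cartanBar K t n)} {a : Fin n → ℤ} {D : Op K n}
    (hD : D ∈ wnSpace t α) (ha : D ∈ opWeight K a) (h0 : D ≠ 0) : α = wt K t a := by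
  ext h
  have h1 := hD.2 h
  rw [sbr_of_opWeight ha] at h1
  exact (smul_left_injective K h0 h1).symm

/-- A weight space is the sum of its intersections with the spaces `opWeight a`. -/
theorem wnSpace_le {α : Module.Dual K (cartanBar K t n)} {N : Submodule K (Op K n)}
    (h : ∀ a, IsWt a → α = wt K t a → ∀ D ∈ Wn K n, D ∈ opWeight K a → D ∈ N) :
    wnSpace t α ≤ N := by
  refine op_le_of_weights (fun k D hD => adE_mem_wnSpace k hD) fun a D hD ha => ?_
  by_cases h0 : D = 0
  · rw [h0]; exact zero_mem _
  · exact h a (isWt_of_ne_zero hD.1 ha h0) (eq_wt_of_mem hD ha h0) D hD.1 ha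

theorem rootSpace_le {α : Module.Dual K (cartanBar K t n)} {N : Submodule K (Op K n)}
    (h : ∀ a, IsWt a → α = wt K t a → ∀ D ∈ Wn K n, D ∈ opWeight K a → D ∈ N) :
    rootSpace K t n α ≤ N := (rootSpace_le_wnSpace α).trans (wnSpace_le h)

theorem exists_wt {α : Module.Dual K (cartanBar K t n)} (hα : rootSpace K t n α ≠ ⊥) :
    ∃ a, IsWt a ∧ α = wt K t a := by
  by_contra! h
  exact hα (le_bot_iff.1 (rootSpace_le fun a ha hα => absurd hα (h a ha)))

theorem Root.exists_wt (α : Root K t n) : ∃ a, IsWt a ∧ α.1 = wt K t a :=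
  CartanSuper.exists_wt α.2.2

theorem rootSpace_eq_bot {α : Module.Dual K (cartanBar K t n)}
    (h : ∀ a, IsWt a → α ≠ wt K t a) : rootSpace K t n α = ⊥ := by
  by_contra h0
  obtain ⟨a, ha, hα⟩ := CartanSuper.exists_wt h0
  exact h a ha hα

theorem euler_bracket_of_weight {a : Fin n → ℤ} {D : Op K n} (ha : D ∈ opWeight K a) :
    euler K n * D - D * euler K n = ((∑ k, a k : ℤ) : K) • D := by
  rw [euler, Finset.sum_mul, Finset.mul_sum, ← Finset.sum_sub_distrib,
    Finset.sum_congr rfl fun k _ => ha k, ← Finset.sum_smul, Int.cast_sum]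

theorem euler_bracket_of_degW {d : ℕ} {D : Op K n} (hD : D ∈ degW K n d) :
    euler K n * D - D * euler K n = ((d : K) - 1) • D := by
  have h1 : euler K n * D - D * euler K n ∈ Wn K n := by
    rw [← sbr_even_left (torus_parity euler_mem_torus)]
    exact sbr_mem_Wn euler_mem_Wn hD.1
  refine Wn_ext h1 (Submodule.smul_mem _ _ hD.1) fun i => ?_
  have h2 : euler K n (xi K i) = xi K i := by
    have := euler_xi_mul (K := K) i 1
    rwa [mul_one, euler_one, mul_zero, add_zero] at this
  rw [LinearMap.sub_apply, Module.End.mul_apply, Module.End.mul_apply, h2,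
    euler_of_mem_exteriorPower _ (hD.2 i), LinearMap.smul_apply, sub_smul, one_smul]

/-- A classical root is the weight of a field of degree `0`. -/
theorem Root.IsClassical.exists_wt {α : Root K t n} (h : α.IsClassical) :
    ∃ a, IsWt a ∧ α.1 = wt K t a ∧ ∑ k, a k = 0 := by
  by_contra! hc
  refine α.2.2 (le_bot_iff.1 ?_)
  have hM : rootSpace K t n α.1 ≤ wnSpace t α.1 ⊓
      LinearMap.ker (LinearMap.mulLeft K (euler K n) - LinearMap.mulRight K (euler K n)) :=
    le_inf (rootSpace_le_wnSpace _) fun D hD => by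
      have := euler_bracket_of_degW (h hD)
      rw [Nat.cast_one, sub_self, zero_smul] at this
      exact this
  refine hM.trans (op_le_of_weights (fun k D hD => ⟨adE_mem_wnSpace k hD.1, ?_⟩) ?_)
  · have h1 : euler K n * D - D * euler K n = 0 := hD.2
    have h2 : euler K n * eop K k = eop K k * euler K n := by
      have := torus_le_opWeight (euler_mem_torus (K := K)) k
      rw [Pi.zero_apply, Int.cast_zero, zero_smul] at this
      exact (sub_eq_zero.1 this).symm
    change euler K n * adE K k D - adE K k D * euler K n = 0
    rw [adE_apply, commutator_commutator h2, h1]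
    simp
  · intro a D hD ha
    by_contra h0
    refine hc a (isWt_of_ne_zero hD.1.1 ha h0) (eq_wt_of_mem hD.1 ha h0) ?_
    have h1 : euler K n * D - D * euler K n = 0 := hD.2
    rw [euler_bracket_of_weight ha] at h1
    exact_mod_cast (smul_eq_zero.1 h1).resolve_right h0

theorem Root.isClassical_of_wt {α : Root K t n}
    (h : ∀ a, IsWt a → α.1 = wt K t a → ∑ k, a k = 0) : α.IsClassical :=
  rootSpace_le fun a ha hα D hD hD' => mem_degW_of_weight hD hD' (by rw [h a ha hα]; rfl)

theorem rootSpace_parity {α : Module.Dual K (cartanBar K t n)} (p : ZMod 2)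
    (h : ∀ a, IsWt a → α = wt K t a → ((∑ k, a k : ℤ) : ZMod 2) = p) :
    ∀ w ∈ rootSpace K t n α, HasParity p w := by
  have : rootSpace K t n α ≤
      LinearMap.ker (LinearMap.mulLeft K (parInv K n) - (-1 : K) ^ p.val • LinearMap.mulRight K (parInv K n)) :=
    rootSpace_le fun a ha hα D hD hD' => by
      have := hasParity_of_weight hD hD' p (h a ha hα)
      rw [LinearMap.mem_ker, LinearMap.sub_apply, LinearMap.smul_apply]
      exact sub_eq_zero.2 this
  intro w hw
  have h1 := this hw
  rw [LinearMap.mem_ker, LinearMap.sub_apply, LinearMap.smul_apply] at h1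
  exact sub_eq_zero.1 h1

end Roots

/-! ### Root combinatorics -/

section Combinatorics

variable {n : ℕ}

theorem IsWt.le_one {a : Fin n → ℤ} (h : IsWt a) (k : Fin n) : a k ≤ 1 := by
  obtain ⟨i, hi, hk⟩ := h
  rcases eq_or_ne k i with rfl | hki
  · omega
  · have := hk k hki; omega

theorem IsWt.neg_one_le {a : Fin n → ℤ} (h : IsWt a) (k : Fin n) : -1 ≤ a k := by
  obtain ⟨i, hi, hk⟩ := h
  rcases eq_or_ne k i with rfl | hki
  · omega
  · have := hk k hki; omega

theorem sum_eq_single_add {a : Fin n → ℤ} (i : Fin n) :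
    ∑ k, a k = a i + ∑ k ∈ Finset.univ.erase i, a k :=
  (Finset.add_sum_erase _ _ (Finset.mem_univ i)).symm

theorem IsWt.neg_one_le_sum {a : Fin n → ℤ} (h : IsWt a) : -1 ≤ ∑ k, a k := by
  obtain ⟨i, hi, hk⟩ := h
  rw [sum_eq_single_add i]
  have := Finset.sum_nonneg (s := Finset.univ.erase i) (f := a) fun k hk' => by
    have := hk k (Finset.ne_of_mem_erase hk'); omega
  omega

/-- A nonzero weight of degree `0` is of the form `ε_i - ε_j`. -/
theorem IsWt.eq_of_sum_zero {a : Fin n → ℤ} (h : IsWt a) (h0 : a ≠ 0) (hs : ∑ k, a k = 0) :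
    ∃ i j, i ≠ j ∧ a = Pi.single i 1 - Pi.single j 1 := by
  obtain ⟨j, hj, hk⟩ := h
  have hk' : ∀ k ∈ Finset.univ.erase j, 0 ≤ a k := fun k hk' => by
    have := hk k (Finset.ne_of_mem_erase hk'); omega
  rw [sum_eq_single_add j] at hs
  rcases hj with hj | hj
  · have h1 : ∃ i ∈ Finset.univ.erase j, a i ≠ 0 := by
      by_contra! hc
      rw [Finset.sum_eq_zero hc] at hs
      omega
    obtain ⟨i, hi, hi0⟩ := h1
    have hij := Finset.ne_of_mem_erase hi
    have hi1 : a i = 1 := (hk i hij).resolve_left hi0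
    rw [← Finset.add_sum_erase _ _ hi, hi1, hj, neg_add_cancel_left,
      Finset.sum_eq_zero_iff_of_nonneg fun k hk'' => hk' k (Finset.mem_of_mem_erase hk'')] at hs
    refine ⟨i, j, hij, funext fun k => ?_⟩
    rw [Pi.sub_apply, Pi.single_apply, Pi.single_apply]
    rcases eq_or_ne k i with rfl | hki
    · simp [hij, hi1]
    · rcases eq_or_ne k j with rfl | hkj
      · simp [hki, hj]
      · simp [hki, hkj, hs k (by simp [hki, hkj])]
  · rw [hj, zero_add, Finset.sum_eq_zero_iff_of_nonneg hk'] at hs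
    refine absurd (funext fun k => ?_) h0
    rcases eq_or_ne k j with rfl | hkj
    · exact hj
    · exact hs k (by simp [hkj])

/-- A weight of degree `-1` is of the form `-ε_j`. -/
theorem IsWt.eq_of_sum_neg_one {a : Fin n → ℤ} (h : IsWt a) (hs : ∑ k, a k = -1) :
    ∃ j, a = -Pi.single j 1 := by
  obtain ⟨j, hj, hk⟩ := h
  have hk' : ∀ k ∈ Finset.univ.erase j, 0 ≤ a k := fun k hk' => by
    have := hk k (Finset.ne_of_mem_erase hk'); omega
  rw [sum_eq_single_add j] at hs
  have h1 := Finset.sum_nonneg hk'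
  have h2 : a j = -1 := by omega
  rw [h2, add_eq_left, Finset.sum_eq_zero_iff_of_nonneg hk'] at hs
  refine ⟨j, funext fun k => ?_⟩
  rw [Pi.neg_apply, Pi.single_apply]
  split_ifs with hkj
  · rw [hkj, h2]
  · rw [hs k (by simp [hkj]), neg_zero]

theorem IsWt.eq_zero_of_const {a : Fin n → ℤ} (hn : 2 ≤ n) (h : IsWt a) {c : ℤ}
    (hc : ∀ k, a k = c) : c = 0 := by
  obtain ⟨i, hi, hk⟩ := h
  have : Nontrivial (Fin n) := Fin.nontrivial_iff_two_le.2 hn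
  obtain ⟨m, hm⟩ := exists_ne i
  have := hk m hm
  rw [hc] at this hi
  omega

/-- If both `a` and `-a` are weights, then `a` has degree `-1`, `0` or `1`. -/
theorem IsWt.sum_of_neg {a : Fin n → ℤ} (h : IsWt a) (h' : IsWt (-a)) :
    ∑ k, a k = -1 ∨ ∑ k, a k = 0 ∨ ∑ k, a k = 1 := by
  have h1 := h.neg_one_le_sum
  have h2 := h'.neg_one_le_sum
  simp only [Pi.neg_apply, Finset.sum_neg_distrib] at h2
  omega

end Combinatorics

section RootFacts

variable {K : Type*} [Field K] [CharZero K] {n : ℕ} {t : CartanType}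

theorem sbr_eq_zero_of_wt {α β : Module.Dual K (cartanBar K t n)}
    (h : ∀ a b, IsWt a → IsWt b → α = wt K t a → β = wt K t b → ¬ IsWt (a + b)) :
    ∀ x ∈ rootSpace K t n α, ∀ y ∈ rootSpace K t n β, sbr x y = 0 := by
  intro x hx y hy
  refine rootSpace_le (N := LinearMap.ker ((sbrL K n).flip y)) (fun a ha hα D hD hD' => ?_) hx
  refine rootSpace_le (N := LinearMap.ker (sbrL K n D)) (fun b hb hβ D' hD1 hD1' => ?_) hy
  exact eq_zero_of_not_isWt (sbr_mem_Wn hD hD1) (sbr_mem_opWeight hD' hD1') (h a b ha hb hα hβ)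

theorem sbr_sbr_eq_zero_of_wt {α β : Module.Dual K (cartanBar K t n)}
    (h : ∀ a a' b, IsWt a → IsWt a' → IsWt b → α = wt K t a → α = wt K t a' → β = wt K t b →
      ¬ IsWt (a + (a' + b))) :
    ∀ x ∈ rootSpace K t n α, ∀ y ∈ rootSpace K t n β, sbr x (sbr x y) = 0 := by
  have key1 : ∀ a, IsWt a → α = wt K t a → ∀ D ∈ Wn K n, D ∈ opWeight K a →
      ∀ a', IsWt a' → α = wt K t a' → ∀ D' ∈ Wn K n, D' ∈ opWeight K a' →
      ∀ y ∈ rootSpace K t n β, sbr D (sbr D' y) = 0 := by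
    intro a ha hα D hD hD' a' ha' hα' D' hD1 hD1' y hy
    have hle : rootSpace K t n β ≤ (LinearMap.ker (sbrL K n D)).comap (sbrL K n D') :=
      rootSpace_le fun b hb hβ D'' hD2 hD2' => by
        rw [Submodule.mem_comap, LinearMap.mem_ker, sbrL_apply, sbrL_apply]
        exact eq_zero_of_not_isWt (sbr_mem_Wn hD (sbr_mem_Wn hD1 hD2))
          (sbr_mem_opWeight hD' (sbr_mem_opWeight hD1' hD2')) (h a a' b ha ha' hb hα hα' hβ)
    have := hle hy
    rwa [Submodule.mem_comap, LinearMap.mem_ker, sbrL_apply, sbrL_apply] at this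
  have key2 : ∀ a, IsWt a → α = wt K t a → ∀ D ∈ Wn K n, D ∈ opWeight K a →
      ∀ x' ∈ rootSpace K t n α, ∀ y ∈ rootSpace K t n β, sbr D (sbr x' y) = 0 := by
    intro a ha hα D hD hD' x' hx' y hy
    have hle : rootSpace K t n α ≤ (LinearMap.ker (sbrL K n D)).comap ((sbrL K n).flip y) :=
      rootSpace_le fun a' ha' hα' D' hD1 hD1' => by
        rw [Submodule.mem_comap, LinearMap.mem_ker, sbrL_apply, LinearMap.flip_apply, sbrL_apply]
        exact key1 a ha hα D hD hD' a' ha' hα' D' hD1 hD1' y hy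
    have := hle hx'
    rwa [Submodule.mem_comap, LinearMap.mem_ker, sbrL_apply, LinearMap.flip_apply,
      sbrL_apply] at this
  intro x hx y hy
  have hle : rootSpace K t n α ≤ LinearMap.ker ((sbrL K n).flip (sbr x y)) :=
    rootSpace_le fun a ha hα D hD hD' => by
      rw [LinearMap.mem_ker, LinearMap.flip_apply, sbrL_apply]
      exact key2 a ha hα D hD hD' x hx y hy
  have := hle hx
  rwa [LinearMap.mem_ker, LinearMap.flip_apply, sbrL_apply] at this

theorem wt_eval (a : Fin n → ℤ) {c : Fin n → ℤ} {h : Op K n}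
    (hh : h = ∑ k, (c k : K) • eop K k) (hm : h ∈ cartanBar K t n) :
    wt K t a ⟨h, hm⟩ = ((∑ k, a k * c k : ℤ) : K) := by
  have h1 : ∀ k, coefE K k h = (c k : K) := fun k => by
    simp [hh, map_sum, coefE_eop]
  simp [wt_apply, h1]

theorem wt_eq_eval {a b : Fin n → ℤ} (hab : wt K t a = wt K t b) {c : Fin n → ℤ}
    (hm : ∑ k, (c k : K) • eop K k ∈ cartanBar K t n) :
    ∑ k, a k * c k = ∑ k, b k * c k := by
  have h := LinearMap.congr_fun hab ⟨_, hm⟩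
  rw [wt_eval a rfl, wt_eval b rfl] at h
  exact_mod_cast h

theorem sum_single_sub_single (i j : Fin n) :
    ∑ k, (((Pi.single i 1 - Pi.single j 1 : Fin n → ℤ) k : ℤ) : K) • eop K k
      = eop K i - eop K j := by
  have h : ∀ (M : Type _) [AddCommGroup M] [Module K M] (v : Fin n → M),
      ∑ k, (((Pi.single i 1 - Pi.single j 1 : Fin n → ℤ) k : ℤ) : K) • v k = v i - v j := by
    intro M _ _ v
    simp [sub_smul, Finset.sum_sub_distrib, Pi.single_apply]
  exact h _ _

theorem eop_sub_eop_mem_cartan_S (i j : Fin n) : eop K i - eop K j ∈ cartan K .S n := by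
  have h : ∀ (m : ℕ) (hm : m < n), eop K (⟨0, by omega⟩ : Fin n) - eop K ⟨m, hm⟩ ∈ cartan K .S n := by
    intro m
    induction m with
    | zero => intro hm; rw [sub_self]; exact zero_mem _
    | succ m ih =>
      intro hm
      have h1 : eop K (⟨m, by omega⟩ : Fin n) - eop K ⟨m + 1, hm⟩ ∈ cartan K .S n :=
        Submodule.subset_span ⟨⟨m, by omega⟩, ⟨m + 1, hm⟩, rfl, rfl⟩
      have h2 := add_mem (ih (by omega)) h1
      rwa [sub_add_sub_cancel] at h2
  have h1 := sub_mem (h j.1 j.2) (h i.1 i.2)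
  rwa [sub_sub_sub_cancel_left] at h1

theorem eop_sub_eop_mem (ht : t ≠ .H) (i j : Fin n) : eop K i - eop K j ∈ cartanBar K t n := by
  cases t
  · exact sub_mem (Submodule.subset_span ⟨i, rfl⟩) (Submodule.subset_span ⟨j, rfl⟩)
  · exact Submodule.mem_sup_left (eop_sub_eop_mem_cartan_S i j)
  · exact eop_sub_eop_mem_cartan_S i j
  · exact absurd rfl ht

theorem euler_mem_cartanBar (ht : t ≠ .St) : euler K n ∈ cartanBar K t n := by
  cases t
  · exact sum_mem fun k _ => Submodule.subset_span ⟨k, rfl⟩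
  · exact Submodule.mem_sup_right (Submodule.mem_span_singleton_self _)
  · exact absurd rfl ht
  · exact Submodule.mem_sup_right (Submodule.mem_span_singleton_self _)

/-- Unless the type is `S~`, the Euler field lies in `𝔥‾`, so that a root determines the degree of
its weights. -/
theorem sum_eq_of_wt_eq (ht : t ≠ .St) {a b : Fin n → ℤ} (hab : wt K t a = wt K t b) :
    ∑ k, a k = ∑ k, b k := by
  have h := wt_eq_eval (c := 1) hab (by
    have h : ∑ k, (((1 : Fin n → ℤ) k : ℤ) : K) • eop K k = euler K n := by simp [euler]
    rw [h]
    exact euler_mem_cartanBar ht)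
  simpa using h

/-- Unless the type is `H`, the differences `ξ_i ∂_i - ξ_j ∂_j` lie in `𝔥‾`, so that a root
determines its weights up to constants. -/
theorem sub_eq_of_wt_eq (ht : t ≠ .H) {a b : Fin n → ℤ} (hab : wt K t a = wt K t b)
    (i j : Fin n) : a i - a j = b i - b j := by
  have h := wt_eq_eval (c := Pi.single i 1 - Pi.single j 1) hab (by
    rw [sum_single_sub_single]; exact eop_sub_eop_mem ht i j)
  simpa [mul_sub, Finset.sum_sub_distrib, Pi.single_apply] using h

/-- For the types `W`, `S`, `S~` the weights of a root are unique up to constants, which are `0`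
except for the type `S~`. -/
theorem const_of_wt_eq (ht : t ≠ .H) (hn : t.Admissible n) {a b : Fin n → ℤ}
    (hab : wt K t a = wt K t b) : ∃ c : ℤ, (∀ k, b k = a k + c) ∧ (c = 0 ∨ t = .St) := by
  have hn2 : 2 ≤ n := by
    cases t <;> simp only [CartanType.Admissible] at hn <;> omega
  have h1 := sub_eq_of_wt_eq ht hab
  refine ⟨b ⟨0, by omega⟩ - a ⟨0, by omega⟩, fun k => ?_, ?_⟩
  · have := h1 k ⟨0, by omega⟩
    omega
  · rw [or_iff_not_imp_right]
    intro ht'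
    have h2 := sum_eq_of_wt_eq ht' hab
    have h3 : ∑ k, (b k - a k) = ∑ _k : Fin n, (b ⟨0, by omega⟩ - a ⟨0, by omega⟩) :=
      Finset.sum_congr rfl fun k _ => by have := h1 k ⟨0, by omega⟩; omega
    rw [Finset.sum_sub_distrib, h2, sub_self, Finset.sum_const, Finset.card_univ, Fintype.card_fin,
      nsmul_eq_mul] at h3
    exact (mul_eq_zero.1 h3.symm).resolve_left (by exact_mod_cast (by omega : n ≠ 0))

theorem two_le_of_admissible (hn : t.Admissible n) : 2 ≤ n := by
  cases t <;> simp only [CartanType.Admissible] at hn <;> omega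

theorem even_of_St (hn : t.Admissible n) (ht : t = .St) : Even n := by
  subst ht; exact hn.2

/-- The parity of a root can be read off from any of its weights. -/
theorem sum_parity_of_wt_eq (hn : t.Admissible n) {a b : Fin n → ℤ}
    (hab : wt K t a = wt K t b) : ((∑ k, a k : ℤ) : ZMod 2) = ((∑ k, b k : ℤ) : ZMod 2) := by
  by_cases ht : t = .St
  · obtain ⟨c, hc, -⟩ := const_of_wt_eq (by simp [ht]) hn hab
    have hev := (ZMod.natCast_eq_zero_iff_even).2 (even_of_St hn ht)
    rw [Finset.sum_congr rfl fun k _ => hc k, Finset.sum_add_distrib]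
    simp [hev]
  · rw [sum_eq_of_wt_eq ht hab]

theorem rootSpace_parity_of_wt (hn : t.Admissible n) {α : Module.Dual K (cartanBar K t n)}
    {a : Fin n → ℤ} (hα : α = wt K t a) :
    ∀ w ∈ rootSpace K t n α, HasParity ((∑ k, a k : ℤ) : ZMod 2) w :=
  rootSpace_parity _ fun _ _ hb => sum_parity_of_wt_eq hn (hb.symm.trans hα)

theorem Root.isEven_or_isOdd (hn : t.Admissible n) (α : Root K t n) : α.IsEven ∨ α.IsOdd := by
  obtain ⟨a, -, hα⟩ := α.exists_wt
  have h := rootSpace_parity_of_wt hn hα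
  rcases zmod_two_cases ((∑ k, a k : ℤ) : ZMod 2) with h0 | h0 <;> rw [h0] at h
  exacts [Or.inl h, Or.inr h]

theorem Root.exists_ne_zero (α : Root K t n) : ∃ w ∈ rootSpace K t n α.1, w ≠ 0 := by
  obtain ⟨w, hw, h0⟩ := (Submodule.ne_bot_iff _).1 α.2.2
  exact ⟨w, hw, h0⟩

theorem Root.not_isOdd_of_isEven {α : Root K t n} (h : α.IsEven) : ¬ α.IsOdd := fun h' => by
  obtain ⟨w, hw, h0⟩ := α.exists_ne_zero
  exact h0 (eq_zero_of_parity (h w hw) (h' w hw))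

theorem Root.IsEven.sum (hn : t.Admissible n) {α : Root K t n} (h : α.IsEven) {a : Fin n → ℤ}
    (hα : α.1 = wt K t a) : Even (∑ k, a k) := by
  rw [← ZMod.intCast_eq_zero_iff_even]
  obtain ⟨w, hw, h0⟩ := α.exists_ne_zero
  have h1 := rootSpace_parity_of_wt hn hα w hw
  refine (zmod_two_cases _).resolve_right fun h2 => h0 (eq_zero_of_parity (h w hw) ?_)
  rwa [h2] at h1

theorem Root.IsOdd.sum (hn : t.Admissible n) {α : Root K t n} (h : α.IsOdd) {a : Fin n → ℤ}
    (hα : α.1 = wt K t a) : Odd (∑ k, a k) := by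
  rw [← ZMod.intCast_eq_one_iff_odd]
  obtain ⟨w, hw, h0⟩ := α.exists_ne_zero
  have h1 := rootSpace_parity_of_wt hn hα w hw
  refine (zmod_two_cases _).resolve_left fun h2 => h0 (eq_zero_of_parity ?_ (h w hw))
  rwa [h2] at h1

theorem Root.IsClassical.isEven (hn : t.Admissible n) {α : Root K t n} (h : α.IsClassical) :
    α.IsEven := by
  obtain ⟨a, -, hα, hs⟩ := h.exists_wt
  have := rootSpace_parity_of_wt hn hα
  rw [hs, Int.cast_zero] at this
  exact this

theorem Root.wt_ne_zero {α : Root K t n} {a : Fin n → ℤ} (hα : α.1 = wt K t a) : a ≠ 0 := by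
  rintro rfl
  exact α.2.1 (hα.trans wt_zero)

end RootFacts

section NonHamiltonian

variable {K : Type*} [Field K] [CharZero K] {n : ℕ} {t : CartanType}

theorem Root.isClassical_of_sum_zero (ht : t ≠ .H) (hn : t.Admissible n) {α : Root K t n}
    {a : Fin n → ℤ} (ha : IsWt a) (hα : α.1 = wt K t a) (hs : ∑ k, a k = 0) : α.IsClassical := by
  obtain ⟨i, j, hij, h⟩ := ha.eq_of_sum_zero (Root.wt_ne_zero hα) hs
  refine Root.isClassical_of_wt fun b hb hβ => ?_
  obtain ⟨c, hc, -⟩ := const_of_wt_eq ht hn (hα.symm.trans hβ)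
  have h1 := hc i
  have h2 := hc j
  have h3 := hb.le_one i
  have h4 := hb.neg_one_le j
  have e1 : a i = 1 := by simp [h, hij]
  have e2 : a j = -1 := by simp [h, hij.symm]
  have h5 : c = 0 := by omega
  rw [Finset.sum_congr rfl fun k _ => (hc k).trans (by rw [h5, add_zero]), hs]

/-- Except for the type `H`, a classical root has the weight `ε_i - ε_j`, and the values of a root
on `ξ_i ∂_i - ξ_j ∂_j` lie between `-2` and `2`. -/
theorem classical_string (ht : t ≠ .H) {α β : Root K t n} (hα : α.IsClassical) :
    2 • α.1 + β.1 ≠ 0 ∧ 3 • α.1 + β.1 ≠ 0 ∧ rootSpace K t n (3 • α.1 + β.1) = ⊥ := by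
  obtain ⟨a, ha, hαa, hs⟩ := hα.exists_wt
  obtain ⟨i, j, hij, h⟩ := ha.eq_of_sum_zero (Root.wt_ne_zero hαa) hs
  obtain ⟨b, hb, hβb⟩ := β.exists_wt
  have e1 : a i = 1 := by simp [h, hij]
  have e2 : a j = -1 := by simp [h, hij.symm]
  have h3 := hb.neg_one_le i
  have h4 := hb.le_one j
  have key : ∀ (m : ℕ) c, m • α.1 + β.1 = wt K t c → m * 2 + b i - b j = c i - c j := by
    intro m c hc
    rw [hαa, hβb, ← wt_smul, ← wt_add] at hc
    have := sub_eq_of_wt_eq ht hc i j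
    have hm : ∀ k, (m • a) k = m * a k := fun k => by simp
    rw [Pi.add_apply, Pi.add_apply, hm, hm, e1, e2] at this
    linarith
  refine ⟨fun h0 => ?_, fun h0 => ?_, rootSpace_eq_bot fun c hc h0 => ?_⟩
  · have := key 2 0 (h0.trans wt_zero.symm)
    simp at this; omega
  · have := key 3 0 (h0.trans wt_zero.symm)
    simp at this; omega
  · have := key 3 c h0
    have := hc.le_one i
    have := hc.neg_one_le j
    push_cast at *; omega

theorem classical_strings (ht : t ≠ .H) {α β : Root K t n} (hα : α.IsClassical)
    (hβ : β.IsClassical) (hne : α.1 + β.1 ≠ 0) : rootSpace K t n (2 • α.1 + β.1) = ⊥ := by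
  obtain ⟨a, ha, hαa, hs⟩ := hα.exists_wt
  obtain ⟨i, j, hij, h⟩ := ha.eq_of_sum_zero (Root.wt_ne_zero hαa) hs
  obtain ⟨b, hb, hβb, hs'⟩ := hβ.exists_wt
  obtain ⟨k, l, hkl, h'⟩ := hb.eq_of_sum_zero (Root.wt_ne_zero hβb) hs'
  refine rootSpace_eq_bot fun c hc h0 => hne ?_
  rw [hαa, hβb, ← wt_smul, ← wt_add] at h0
  have h1 := sub_eq_of_wt_eq ht h0 i j
  have e1 : a i = 1 := by simp [h, hij]
  have e2 : a j = -1 := by simp [h, hij.symm]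
  simp only [Pi.add_apply, Pi.smul_apply, e1, e2] at h1
  have := hc.le_one i
  have := hc.neg_one_le j
  have := hb.neg_one_le i
  have := hb.le_one j
  have hb1 : b i = -1 := by simp at h1; omega
  have hb2 : b j = 1 := by simp at h1; omega
  have hil : i = l := by
    by_contra hil
    rw [h', Pi.sub_apply, Pi.single_apply, Pi.single_eq_of_ne hil] at hb1
    split_ifs at hb1 <;> omega
  have hjk : j = k := by
    by_contra hjk
    rw [h', Pi.sub_apply, Pi.single_eq_of_ne hjk, Pi.single_apply] at hb2
    split_ifs at hb2 <;> omega
  rw [hαa, hβb, ← wt_add, h, h', hil, hjk, sub_add_sub_cancel, sub_self, wt_zero]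

/-- Weights of opposite roots are opposite if their sum is again a weight; otherwise the
corresponding vectors commute. -/
theorem opposite_weights (ht : t ≠ .H) (hn : t.Admissible n) {α β : Root K t n}
    (hβ : β.1 = -α.1) {a b : Fin n → ℤ} (hαa : α.1 = wt K t a) (hβb : β.1 = wt K t b)
    (hab : IsWt (a + b)) : b = -a := by
  have h0 : wt K t (a + b) = wt K t 0 := by rw [wt_add, ← hαa, ← hβb, hβ, wt_zero, add_neg_cancel]
  have h1 : ∀ k, (a + b) k = (a + b) ⟨0, by have := two_le_of_admissible hn; omega⟩ := fun k => by
    have := sub_eq_of_wt_eq ht h0 k ⟨0, by have := two_le_of_admissible hn; omega⟩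
    simp only [Pi.zero_apply, sub_self] at this
    omega
  have h2 := hab.eq_zero_of_const (two_le_of_admissible hn) h1
  funext k
  have := h1 k
  rw [h2, Pi.add_apply] at this
  rw [Pi.neg_apply]; omega

/-- Except for the type `H`, opposite even root spaces commute unless the roots are classical: the
weights `a` and `-a` have entries between `-1` and `1` with at most one `-1` each, so that their
degree is `0` if it is even. -/
theorem even_opposite (ht : t ≠ .H) (hn : t.Admissible n) {α β : Root K t n} (hβ : β.1 = -α.1)
    (hα : α.IsEven) (hc : ¬ α.IsClassical) :
    ∀ x ∈ rootSpace K t n α.1, ∀ y ∈ rootSpace K t n β.1, sbr x y = 0 := by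
  refine sbr_eq_zero_of_wt fun a b ha hb hαa hβb hab => hc ?_
  have h := opposite_weights ht hn hβ hαa hβb hab
  subst h
  refine Root.isClassical_of_sum_zero ht hn ha hαa ?_
  have h1 := hα.sum hn hαa
  rcases ha.sum_of_neg hb with h | h | h
  · rw [h] at h1; exact absurd h1 (by decide)
  · exact h
  · rw [h] at h1; exact absurd h1 (by decide)

theorem Root.isMinusOne_of_wt (ht : t ≠ .H) (hn : t.Admissible n) {α : Root K t n} {j : Fin n}
    (hα : α.1 = wt K t (-Pi.single j 1)) : α.IsMinusOne := by
  refine rootSpace_le fun b hb hβ D hD hD' => ?_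
  have hn2 := two_le_of_admissible hn
  have : Nontrivial (Fin n) := Fin.nontrivial_iff_two_le.2 hn2
  obtain ⟨m, hm⟩ := exists_ne j
  obtain ⟨c, hc, hc'⟩ := const_of_wt_eq ht hn (hα.symm.trans hβ)
  have h1 := hc j
  have h2 := hc m
  rw [Pi.neg_apply, Pi.single_eq_same] at h1
  rw [Pi.neg_apply, Pi.single_eq_of_ne hm] at h2
  have := hb.neg_one_le j
  have := hb.le_one m
  have hs : ∑ k, b k = n * c - 1 := by
    rw [Finset.sum_congr rfl fun k _ => hc k, Finset.sum_add_distrib]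
    simp
    ring
  have h01 : c = 0 ∨ c = 1 := by omega
  have h0 : c = 0 → D ∈ degW K n 0 := fun h => mem_degW_of_weight hD hD' (by rw [hs, h]; simp)
  cases t
  · exact h0 (hc'.resolve_right (by simp))
  · exact h0 (hc'.resolve_right (by simp))
  · rcases h01 with h | h
    · exact Submodule.mem_sup_left (h0 h)
    · exact Submodule.mem_sup_right (mem_degW_of_weight hD hD' (by rw [hs, h]; simp))
  · exact absurd rfl ht

/-- Except for the type `H`, of two opposite odd roots one has degree `-1`, unless the root spaces
commute. -/
theorem odd_opposite (ht : t ≠ .H) (hn : t.Admissible n) {α β : Root K t n} (hβ : β.1 = -α.1)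
    (hα : α.IsOdd) : α.IsMinusOne ∨ β.IsMinusOne ∨
    ∀ x ∈ rootSpace K t n α.1, ∀ y ∈ rootSpace K t n β.1, sbr x y = 0 := by
  by_cases hall : ∀ a b, IsWt a → IsWt b → α.1 = wt K t a → β.1 = wt K t b → ¬ IsWt (a + b)
  · exact Or.inr (Or.inr (sbr_eq_zero_of_wt hall))
  · push Not at hall
    obtain ⟨a, b, ha, hb, hαa, hβb, hab⟩ := hall
    have h := opposite_weights ht hn hβ hαa hβb hab
    subst h
    have h1 := hα.sum hn hαa
    rcases ha.sum_of_neg hb with h | h | h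
    · obtain ⟨j, rfl⟩ := ha.eq_of_sum_neg_one h
      exact Or.inl (Root.isMinusOne_of_wt ht hn hαa)
    · rw [h] at h1; exact absurd h1 (by decide)
    · obtain ⟨j, hj⟩ := hb.eq_of_sum_neg_one (by simp [h])
      rw [hj] at hβb
      exact Or.inr (Or.inl (Root.isMinusOne_of_wt ht hn hβb))

/-- Except for the type `H`, even root spaces are commutative: two weights `a`, `b` of an even root
differ by a constant `c`, and parity arguments show that `a + b = 2a + c` is not a weight. -/
theorem even_abelian (ht : t ≠ .H) (hn : t.Admissible n) {α : Root K t n} (hα : α.IsEven) :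
    ∀ x ∈ rootSpace K t n α.1, ∀ y ∈ rootSpace K t n α.1, sbr x y = 0 := by
  refine sbr_eq_zero_of_wt fun a b ha hb hαa hαb hab => ?_
  obtain ⟨c, hc, hc'⟩ := const_of_wt_eq ht hn (hαa.symm.trans hαb)
  have hn2 := two_le_of_admissible hn
  have hsum : ∀ k, (a + b) k = 2 * a k + c := fun k => by rw [Pi.add_apply, hc]; ring
  rcases Int.even_or_odd c with ⟨m, hm⟩ | ⟨m, hm⟩
  · have h1 : ∀ k, a k = -m := fun k => by
      have h2 := hab.le_one k
      have h3 := hab.neg_one_le k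
      rw [hsum] at h2 h3
      omega
    have h2 := ha.eq_zero_of_const hn2 h1
    exact Root.wt_ne_zero hαa (funext fun k => by rw [h1 k, h2]; rfl)
  · have hSt : t = .St := hc'.resolve_left (by omega)
    obtain ⟨i, hi, hk⟩ := hab
    have h1 : ∀ k ∈ Finset.univ.erase i, a k = -m := fun k hk' => by
      have := hk k (Finset.ne_of_mem_erase hk')
      rw [hsum] at this
      omega
    have h2 : a i = -m - 1 := by
      rw [hsum] at hi
      omega
    have h3 := hα.sum hn hαa
    rw [sum_eq_single_add i, h2, Finset.sum_congr rfl h1, Finset.sum_const,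
      Finset.card_erase_of_mem (Finset.mem_univ i), Finset.card_univ, Fintype.card_fin] at h3
    obtain ⟨u, hu⟩ := even_of_St hn hSt
    obtain ⟨v, hv⟩ := h3
    have h4 : n - 1 = 2 * (u - 1) + 1 := by omega
    rw [h4, nsmul_eq_mul] at hv
    push_cast at hv
    have : 2 * (v + m * ((u - 1 : ℕ) : ℤ) + m) = -1 := by linarith
    omega

/-- Except for the type `H`, an even nonclassical root has a single weight `a`, of degree at least
`2`. It has an entry `1` outside of any given index, and so `2a + b` is not a weight, for any weight
`b`. -/
theorem even_good (ht : t ≠ .H) (hn : t.Admissible n) {α β : Root K t n} (hα : α.IsEven)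
    (hc : ¬ α.IsClassical) :
    ∀ x ∈ rootSpace K t n α.1, ∀ y ∈ rootSpace K t n β.1, sbr x (sbr x y) = 0 := by
  have hn2 := two_le_of_admissible hn
  have huniq : ∀ a a' : Fin n → ℤ, IsWt a → IsWt a' → α.1 = wt K t a → α.1 = wt K t a' →
      ∀ c : ℤ, (∀ k, a' k = a k + c) → c ≤ 0 := by
    intro a a' ha ha' hαa hαa' c hc
    by_contra! hc0
    have h1 : ∀ k, a k ≤ 0 := fun k => by
      have := ha'.le_one k
      rw [hc] at this
      omega
    have h2 : ∑ k, a k ≤ 0 := Finset.sum_nonpos fun k _ => h1 k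
    have h3 := ha.neg_one_le_sum
    have h4 : ∑ k, a k = 0 := by
      obtain ⟨m, hm⟩ := hα.sum hn hαa
      omega
    have h5 := (Finset.sum_eq_zero_iff_of_nonpos fun k _ => h1 k).1 h4
    exact Root.wt_ne_zero hαa (funext fun k => h5 k (Finset.mem_univ k))
  refine sbr_sbr_eq_zero_of_wt fun a a' b ha ha' hb hαa hαa' hβb hab => ?_
  obtain ⟨c, hc1, -⟩ := const_of_wt_eq ht hn (hαa.symm.trans hαa')
  have hc0 : c = 0 := le_antisymm (huniq a a' ha ha' hαa hαa' c hc1)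
    (by have := huniq a' a ha' ha hαa' hαa (-c) fun k => by rw [hc1]; ring
        omega)
  have h2 : 2 ≤ ∑ k, a k := by
    have h3 := ha.neg_one_le_sum
    have h4 : ∑ k, a k ≠ 0 := fun h => hc (Root.isClassical_of_sum_zero ht hn ha hαa h)
    obtain ⟨m, hm⟩ := hα.sum hn hαa
    omega
  obtain ⟨i, hi, hk⟩ := hb
  obtain ⟨m, hmi, hm⟩ : ∃ m, m ≠ i ∧ 1 ≤ a m := by
    by_contra! h
    have h3 : ∑ k, a k ≤ 1 := by
      rw [sum_eq_single_add i]
      have h4 := Finset.sum_nonpos (s := Finset.univ.erase i) (f := a) fun k hk' => by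
        have := h k (Finset.ne_of_mem_erase hk'); omega
      have := ha.le_one i
      omega
    omega
  have h5 := hab.le_one m
  have h6 := hk m hmi
  rw [Pi.add_apply, Pi.add_apply, hc1, hc0] at h5
  omega

end NonHamiltonian

/-! ### Hamiltonian vector fields -/

section Hamiltonian

variable {K : Type*} [Field K] [CharZero K] {n : ℕ}

/-- The index paired with `i` by the form `ω`; for `n` odd, the last index is paired with
itself. -/
def tau (i : Fin n) : Fin n :=
  if h : i.val < n / 2 then ⟨n / 2 + i.val, by omega⟩
  else if i.val < 2 * (n / 2) then ⟨i.val - n / 2, by omega⟩ else i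

theorem tau_tau (i : Fin n) : tau (tau i) = i := by
  refine Fin.ext ?_
  unfold tau
  by_cases h1 : i.val < n / 2
  · have h2 : ¬ n / 2 + i.val < n / 2 := by omega
    have h3 : n / 2 + i.val < 2 * (n / 2) := by omega
    simp [h1, h2, h3]
  · by_cases h2 : i.val < 2 * (n / 2)
    · have h3 : i.val - n / 2 < n / 2 := by omega
      simp [h1, h2, h3]
      omega
    · simp [h1, h2]

theorem tau_injective : Function.Injective (tau : Fin n → Fin n) :=
  Function.LeftInverse.injective tau_tau

theorem omega_eq (i j : Fin n) : omega K n i j = if i = tau j then 1 else 0 := by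
  unfold omega tau
  congr 1
  rw [eq_iff_iff]
  split_ifs <;> simp only [Fin.ext_iff] <;> omega

theorem omegaCoeff_eq (D : Op K n) (j : Fin n) : omegaCoeff K n D j = D (xi K (tau j)) := by
  simp [omegaCoeff, omega_eq]

/-- The sums `∑ f_i` and `∑ f_{τ i}` agree. -/
theorem sum_tau {M : Type*} [AddCommMonoid M] (f : Fin n → M) : ∑ i, f (tau i) = ∑ i, f i :=
  Equiv.sum_comp (⟨tau, tau, tau_tau, tau_tau⟩ : Fin n ≃ Fin n) f

variable (K n) in
/-- The Hamiltonian vector field `∑_j ∂_j(F) ∂_{τ j}` of `F ∈ Λ(n)`, as a linear map in `F`. -/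
def ham : Lam K n →ₗ[K] Op K n :=
  ∑ j, (LinearMap.mul K (Op K n)).flip (pd K (tau j)) ∘ₗ LinearMap.mul K (Lam K n) ∘ₗ pd K j

theorem ham_eq (F : Lam K n) : ham K n F = ∑ j, mulPd K (pd K j F) (tau j) := by
  unfold ham
  rw [LinearMap.sum_apply]
  rfl

theorem ham_apply (F g : Lam K n) : ham K n F g = ∑ j, pd K j F * pd K (tau j) g := by
  rw [ham_eq, LinearMap.sum_apply]
  exact Finset.sum_congr rfl fun j _ => mulPd_apply _ _ _

theorem ham_xi (F : Lam K n) (i : Fin n) : ham K n F (xi K i) = pd K (tau i) F := by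
  rw [ham_apply, Finset.sum_eq_single (tau i)]
  · rw [tau_tau, pd_xi, if_pos rfl, mul_one]
  · intro j _ hj
    rw [pd_xi, if_neg fun h => hj (by rw [← h, tau_tau]), mul_zero]
  · simp

theorem ham_mem_Wn (F : Lam K n) : ham K n F ∈ Wn K n := by
  rw [ham_eq]
  exact sum_mem fun j _ => mulPd_mem_Wn _ _

theorem ham_parity {p : ZMod 2} {F : Lam K n} (hF : parInv K n F = (-1 : K) ^ p.val • F) :
    HasParity p (ham K n F) := by
  rw [ham_eq]
  have h : ∀ j, mulPd K (pd K j F) (tau j) ∈ superDer K n p := fun j =>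
    mulPd_mem_superDer (by rw [parInv_pd, hF, map_smul, neg_smul]) _
  exact (Submodule.sum_mem _ fun j _ => h j).1

theorem parInv_of_mem_lamWeight {b : Fin n → ℤ} {f : Lam K n} (hf : f ∈ lamWeight K b) :
    parInv K n f = (-1 : K) ^ ((∑ k, b k : ℤ) : ZMod 2).val • f := by
  by_cases h0 : f = 0
  · simp [h0]
  have hb := lamWeight_eq hf h0
  obtain ⟨d, hd⟩ : ∃ d : ℕ, ∑ k, b k = d := by
    refine ⟨(∑ k, b k).toNat, (Int.toNat_of_nonneg ?_).symm⟩
    exact Finset.sum_nonneg fun k _ => by have := hb k; omega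
  have h1 := euler_of_mem_lamWeight hf
  rw [hd] at h1
  rw [parInv_of_mem_exteriorPower f (mem_exteriorPower_of_euler (by exact_mod_cast h1)), hd,
    Int.cast_natCast, ZMod.val_natCast, neg_one_pow_eq_pow_mod_two]

/-- The bracket of Hamiltonian vector fields is Hamiltonian. -/
theorem sbr_ham_of_parity {p q : ZMod 2} {G F : Lam K n}
    (hG : parInv K n G = (-1 : K) ^ p.val • G) (hF : parInv K n F = (-1 : K) ^ q.val • F) :
    sbr (ham K n G) (ham K n F) = (-1 : K) ^ p.val • ham K n (ham K n G F) := by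
  refine Wn_ext (sbr_mem_Wn (ham_mem_Wn _) (ham_mem_Wn _))
    (Submodule.smul_mem _ _ (ham_mem_Wn _)) fun i => ?_
  rw [sbr_of_parity (ham_parity hG) (ham_parity hF), LinearMap.sub_apply, LinearMap.smul_apply,
    LinearMap.smul_apply, Module.End.mul_apply, Module.End.mul_apply, ham_xi, ham_xi, ham_xi,
    pd_apply_of_parity (ham_mem_Wn _) (ham_parity hG), smul_add, smul_smul, neg_one_pow_sq,
    one_smul, sub_eq_add_neg]
  congr 1
  rw [ham_apply F, Finset.smul_sum, Finset.smul_sum, ← Finset.sum_neg_distrib]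
  refine Finset.sum_congr rfl fun j _ => ?_
  rw [ham_xi]
  have h1 : parInv K n (pd K j F) = (-1 : K) ^ (q + 1).val • pd K j F := by
    rw [parInv_pd, hF, map_smul]
    rcases zmod_two_cases q with rfl | rfl
    · simp [ZMod.val_one]
    · rw [show (1 + 1 : ZMod 2) = 0 from rfl, ZMod.val_one, ZMod.val_zero]; simp
  have h2 : parInv K n (pd K (tau j) (pd K (tau i) G))
      = (-1 : K) ^ p.val • pd K (tau j) (pd K (tau i) G) := by
    rw [parInv_pd, parInv_pd, hG, map_smul, map_neg, neg_neg, map_smul]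
  rw [mul_comm_of_parity h1 h2, pd_pd (tau i), neg_mul, smul_neg, smul_smul]
  congr 2
  rcases zmod_two_cases p with rfl | rfl <;> rcases zmod_two_cases q with rfl | rfl <;>
    simp [ZMod.val_one, show (1 + 1 : ZMod 2) = 0 from rfl]

theorem sbr_ham (G F : Lam K n) :
    sbr (ham K n G) (ham K n F) = ham K n (ham K n (parInv K n G) F) := by
  have h1 : (⊤ : Submodule K (Lam K n)) ≤ LinearMap.eqLocus
      ((sbrL K n).flip (ham K n F) ∘ₗ ham K n)
      (ham K n ∘ₗ LinearMap.applyₗ F ∘ₗ ham K n ∘ₗ parInv K n) := by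
    refine lam_le_of_weights (fun _ _ _ => trivial) fun b G' _ hG => ?_
    have h2 : (⊤ : Submodule K (Lam K n)) ≤ LinearMap.eqLocus (sbrL K n (ham K n G') ∘ₗ ham K n)
        (ham K n ∘ₗ ham K n (parInv K n G')) := by
      refine lam_le_of_weights (fun _ _ _ => trivial) fun c F' _ hF => ?_
      rw [LinearMap.mem_eqLocus]
      have h3 := parInv_of_mem_lamWeight hG
      have h4 := sbr_ham_of_parity h3 (parInv_of_mem_lamWeight hF)
      refine h4.trans ?_
      rw [h3, map_smul, LinearMap.comp_apply, LinearMap.smul_apply, map_smul]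
    exact h2 (show F ∈ ⊤ from trivial)
  exact h1 (show G ∈ ⊤ from trivial)

theorem euler_add_one_injective {f : Lam K n} (hf : euler K n f + f = 0) : f = 0 := by
  have h1 : LinearMap.ker (euler K n + 1) ≤ (⊥ : Submodule K (Lam K n)) := by
    refine lam_le_of_weights (fun k g hg => ?_) fun b g hg hb => ?_
    · rw [LinearMap.mem_ker] at hg ⊢
      have h2 : euler K n (eop K k g) = eop K k (euler K n g) := by
        rw [euler_apply, euler_apply, map_sum]
        exact Finset.sum_congr rfl fun j _ => LinearMap.congr_fun (eop_commute j k) g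
      have h3 : euler K n g + g = 0 := hg
      show euler K n (eop K k g) + eop K k g = 0
      rw [h2, ← map_add, h3, map_zero]
    · by_contra h0
      have h2 : euler K n g + g = 0 := hg
      rw [euler_of_mem_lamWeight hb] at h2
      have h3 : ((∑ k, b k + 1 : ℤ) : K) • g = 0 := by
        rw [Int.cast_add, Int.cast_one, add_smul, one_smul, h2]
      rcases smul_eq_zero.1 h3 with h4 | h4
      · have h5 : ∑ k, b k + 1 = 0 := by exact_mod_cast h4
        have h6 : 0 ≤ ∑ k, b k := Finset.sum_nonneg fun k _ => by
          have := lamWeight_eq hb (fun h => h0 (by simp [h])) k; omega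
        omega
      · exact h0 (by simp [h4])
  exact (Submodule.mem_bot K).1 (h1 (LinearMap.mem_ker.2 hf))

theorem euler_add_one_surjective (g : Lam K n) : ∃ f, euler K n f + f = g := by
  have h1 : (⊤ : Submodule K (Lam K n)) ≤ LinearMap.range (euler K n + 1) := by
    refine lam_le_of_weights (fun _ _ _ => trivial) fun b f _ hb => ?_
    by_cases h0 : f = 0
    · rw [h0]; exact zero_mem _
    have h6 : 0 ≤ ∑ k, b k := Finset.sum_nonneg fun k _ => by
      have := lamWeight_eq hb h0 k; omega
    have h7 : ((∑ k, b k + 1 : ℤ) : K) ≠ 0 := by exact_mod_cast (by omega : ∑ k, b k + 1 ≠ 0)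
    refine ⟨((∑ k, b k + 1 : ℤ) : K)⁻¹ • f, ?_⟩
    rw [map_smul]
    have h8 : (euler K n + 1) f = ((∑ k, b k + 1 : ℤ) : K) • f := by
      rw [LinearMap.add_apply, euler_of_mem_lamWeight hb, Module.End.one_apply, Int.cast_add,
        Int.cast_one, add_smul, one_smul]
    rw [h8, smul_smul, inv_mul_cancel₀ h7, one_smul]
  obtain ⟨f, hf⟩ := h1 (show g ∈ ⊤ from trivial)
  exact ⟨f, hf⟩

/-- `H~(n)` consists of the Hamiltonian vector fields: the Poincaré lemma, obtained from
`ℰ F = ∑ ξ_j Q_j`. -/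
theorem mem_Htn_iff {D : Op K n} : D ∈ Htn K n ↔ ∃ F, D = ham K n F := by
  constructor
  · rintro ⟨hD, h⟩
    simp only [omegaCoeff_eq] at h
    choose P hP using fun j => euler_add_one_surjective (D (xi K (tau j)))
    have h1 : euler K n (∑ j, xi K j * P j) = ∑ j, xi K j * D (xi K (tau j)) := by
      rw [map_sum]
      refine Finset.sum_congr rfl fun j _ => ?_
      rw [euler_xi_mul, ← hP j, mul_add, add_comm]
    refine ⟨∑ j, xi K j * P j, Wn_ext hD (ham_mem_Wn _) fun i => ?_⟩
    rw [ham_xi]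
    have h2 := congrArg (pd K (tau i)) h1
    rw [pd_euler, map_sum (pd K (tau i)) (fun j => xi K j * D (xi K (tau j)))] at h2
    have h3 : ∀ j, pd K (tau i) (xi K j * D (xi K (tau j)))
        = (if tau i = j then D (xi K (tau j)) else 0) + xi K j * pd K j (D (xi K i)) := by
      intro j
      have h4 := h (tau i) j
      rw [tau_tau] at h4
      rw [pd_xi_mul, eq_neg_of_add_eq_zero_left h4, mul_neg, sub_neg_eq_add]
    rw [Finset.sum_congr rfl fun j _ => h3 j, Finset.sum_add_distrib, Finset.sum_ite_eq,
      if_pos (Finset.mem_univ _), tau_tau] at h2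
    have h5 : ∑ j, xi K j * pd K j (D (xi K i)) = euler K n (D (xi K i)) := by
      rw [euler_apply]
      exact Finset.sum_congr rfl fun j _ => (eop_apply _ _).symm
    rw [h5] at h2
    refine (sub_eq_zero.1 (euler_add_one_injective ?_)).symm
    rw [map_sub, ← sub_eq_zero.2 h2]
    abel
  · rintro ⟨F, rfl⟩
    refine ⟨ham_mem_Wn _, fun k j => ?_⟩
    rw [omegaCoeff_eq, omegaCoeff_eq, ham_xi, ham_xi, tau_tau, tau_tau, pd_pd, neg_add_cancel]

theorem ham_mem_Htn (F : Lam K n) : ham K n F ∈ Htn K n := mem_Htn_iff.2 ⟨F, rfl⟩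

theorem Hn_le_Htn : Hn K n ≤ Htn K n := by
  refine Submodule.span_le.2 ?_
  rintro _ ⟨x, hx, y, hy, rfl⟩
  obtain ⟨G, rfl⟩ := mem_Htn_iff.1 hx
  obtain ⟨F, rfl⟩ := mem_Htn_iff.1 hy
  rw [sbr_ham]
  exact ham_mem_Htn _

theorem sbr_mem_Hn {x y : Op K n} (hx : x ∈ Hn K n) (hy : y ∈ Hn K n) : sbr x y ∈ Hn K n :=
  Submodule.subset_span ⟨x, Hn_le_Htn hx, y, Hn_le_Htn hy, rfl⟩

theorem sbr_mem_galg {t : CartanType} (hn : t.Admissible n) {x y : Op K n} (hx : x ∈ galg K t n)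
    (hy : y ∈ galg K t n) : sbr x y ∈ galg K t n := by
  cases t
  · exact sbr_mem_Wn hx hy
  · exact sbr_mem_Sn hx hy
  · exact sbr_mem_Stn (two_le_of_admissible hn) hn.2 hx hy
  · exact sbr_mem_Hn hx hy

theorem ham_eq_zero {F : Lam K n} (h : ham K n F = 0) (h0 : lamAug K n F = 0) : F = 0 := by
  refine (eq_algebraMap_of_pd fun i => ?_).trans (by rw [h0, map_zero])
  have h1 := ham_xi F (tau i)
  rw [tau_tau] at h1
  rw [← h1, h, LinearMap.zero_apply]

theorem ham_algebraMap (c : K) : ham K n (algebraMap K (Lam K n) c) = 0 := by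
  refine Wn_ext (ham_mem_Wn _) (zero_mem _) fun i => ?_
  rw [ham_xi, pd_algebraMap, LinearMap.zero_apply]

theorem exists_ham_of_mem_Hn {D : Op K n} (hD : D ∈ Hn K n) :
    ∃ F, D = ham K n F ∧ lamAug K n F = 0 := by
  obtain ⟨F, rfl⟩ := mem_Htn_iff.1 (Hn_le_Htn hD)
  refine ⟨F - algebraMap K _ (lamAug K n F), ?_, ?_⟩
  · rw [map_sub, ham_algebraMap, sub_zero]
  · rw [map_sub, AlgHom.commutes, Algebra.algebraMap_self_apply, sub_self]

end Hamiltonian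

/-! ### Root vectors of `H(n)` -/

section HamiltonianRoots

variable {K : Type*} [Field K] [CharZero K] {n : ℕ}

/-- The Cartan element `ξ_k ∂_k - ξ_{τ k} ∂_{τ k}` of `H(n)`. -/
def hv (K : Type*) [Field K] {n : ℕ} (k : Fin n) : Op K n := eop K k - eop K (tau k)

theorem hv_apply (k : Fin n) (f : Lam K n) : hv K k f = eop K k f - eop K (tau k) f := rfl

theorem hv_tau (k : Fin n) : hv K (tau k) = -hv K k := by
  rw [hv, hv, tau_tau]
  exact (neg_sub _ _).symm

theorem hv_eq_zero {k : Fin n} (h : tau k = k) : hv K k = 0 := by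
  rw [hv, h, sub_self]

theorem hv_eq_ham (k : Fin n) : hv K k = -ham K n (xi K k * xi K (tau k)) := by
  refine Wn_ext (sub_mem (eop_mem_Wn _) (eop_mem_Wn _)) (neg_mem (ham_mem_Wn _)) fun i => ?_
  rw [LinearMap.neg_apply, ham_xi, pd_xi_mul, pd_xi, hv_apply, eop_xi, eop_xi, neg_sub]
  congr 1
  · by_cases h : k = i
    · subst h; simp
    · rw [if_neg h, if_neg fun h' => h (tau_injective h').symm, mul_zero]
  · by_cases h : tau k = i
    · rw [if_pos h, if_pos (by rw [← h, tau_tau]), h]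
    · rw [if_neg h, if_neg fun h' => h (by rw [← h', tau_tau])]

theorem hv_mem_cartan (k : Fin n) : hv K k ∈ cartan K .H n := by
  have h1 : ∀ k : Fin n, k.val < n / 2 → hv K k ∈ cartan K .H n := fun k hk =>
    Submodule.subset_span ⟨k, tau k, hk, by simp [tau, hk], rfl⟩
  by_cases hk : k.val < n / 2
  · exact h1 k hk
  · by_cases hk' : k.val < 2 * (n / 2)
    · have h2 := h1 (tau k) (by simp only [tau, hk, hk', dif_neg, if_pos, not_false_iff]; omega)
      rw [hv_tau] at h2
      exact (Submodule.neg_mem_iff _).1 h2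
    · rw [hv_eq_zero (by simp [tau, hk, hk'])]
      exact zero_mem _

theorem cartan_H_le {N : Submodule K (Op K n)} (h : ∀ k, hv K k ∈ N) : cartan K .H n ≤ N := by
  refine Submodule.span_le.2 ?_
  rintro _ ⟨k, l, hk, hl, rfl⟩
  have h1 : l = tau k := by ext; simp [tau, hk, hl]
  rw [h1]
  exact h k

variable (K) in
/-- The element `ξ_k ∂_k - ξ_{τ k} ∂_{τ k}`, as an element of `𝔥‾`. -/
def hvBar (k : Fin n) : cartanBar K .H n := ⟨hv K k, cartan_le_cartanBar K .H n (hv_mem_cartan k)⟩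

variable (K n) in
/-- The Euler field, as an element of `𝔥‾`. -/
def eulerBar : cartanBar K .H n := ⟨euler K n, euler_mem_cartanBar (by simp)⟩

theorem cartanBar_H_ext {M : Type*} [AddCommGroup M] [Module K M]
    {f g : cartanBar K .H n →ₗ[K] M} (h : ∀ k, f (hvBar K k) = g (hvBar K k))
    (he : f (eulerBar K n) = g (eulerBar K n)) : f = g := by
  have h1 : cartanBar K .H n ≤ (LinearMap.eqLocus f g).map (cartanBar K .H n).subtype := by
    refine sup_le (cartan_H_le fun k => ?_) ((Submodule.span_singleton_le_iff_mem _ _).2 ?_)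
    · exact ⟨hvBar K k, h k, rfl⟩
    · exact ⟨eulerBar K n, he, rfl⟩
  refine LinearMap.ext fun x => ?_
  obtain ⟨y, hy, hyx⟩ := h1 x.2
  rw [← Subtype.ext hyx]
  exact hy

theorem sbr_hv_ham (k : Fin n) (F : Lam K n) : sbr (hv K k) (ham K n F) = ham K n (hv K k F) := by
  have h1 : parInv K n (xi K k * xi K (tau k)) = xi K k * xi K (tau k) := by
    rw [parInv_mul, parInv_xi, parInv_xi, neg_mul_neg]
  rw [hv_eq_ham, ← map_neg, sbr_ham, map_neg (parInv K n), h1]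

theorem sbr_euler_ham (F : Lam K n) :
    sbr (euler K n) (ham K n F) = ham K n (euler K n F) - (2 : K) • ham K n F := by
  refine Wn_ext (sbr_mem_Wn euler_mem_Wn (ham_mem_Wn _))
    (sub_mem (ham_mem_Wn _) (Submodule.smul_mem _ _ (ham_mem_Wn _))) fun i => ?_
  rw [sbr_even_left (torus_parity euler_mem_torus), LinearMap.sub_apply, LinearMap.sub_apply,
    LinearMap.smul_apply, Module.End.mul_apply, Module.End.mul_apply, ham_xi, ham_xi, pd_euler,
    euler_apply (xi K i)]
  have h1 : ∑ k, eop K k (xi K i) = xi K i := by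
    simp [eop_xi]
  rw [h1, ham_xi, two_smul]
  abel

/-- The space of the Hamiltonians `F`, without constant term, of the vectors of weight `α` in
`H~(n)`. -/
def hamSpace (α : Module.Dual K (cartanBar K .H n)) : Submodule K (Lam K n) where
  carrier := {F | lamAug K n F = 0 ∧ (∀ k, hv K k F = α (hvBar K k) • F) ∧
    euler K n F = (α (eulerBar K n) + 2) • F}
  add_mem' := by
    rintro a b ⟨ha, ha', ha''⟩ ⟨hb, hb', hb''⟩
    exact ⟨by rw [map_add, ha, hb, add_zero], fun k => by rw [map_add, ha', hb', smul_add],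
      by rw [map_add, ha'', hb'', smul_add]⟩
  zero_mem' := by simp
  smul_mem' := by
    rintro c a ⟨ha, ha', ha''⟩
    exact ⟨by rw [map_smul, ha, smul_zero], fun k => by rw [map_smul, ha', smul_comm],
      by rw [map_smul, ha'', smul_comm]⟩

theorem lamAug_eop (k : Fin n) (F : Lam K n) : lamAug K n (eop K k F) = 0 := by
  rw [eop_apply, lamAug_xi_mul]

theorem eop_eop_comm (i j : Fin n) (f : Lam K n) : eop K i (eop K j f) = eop K j (eop K i f) :=
  LinearMap.congr_fun (eop_commute i j) f

theorem eop_mem_hamSpace {α : Module.Dual K (cartanBar K .H n)} (k : Fin n) {F : Lam K n}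
    (hF : F ∈ hamSpace α) : eop K k F ∈ hamSpace α := by
  refine ⟨lamAug_eop k F, fun j => ?_, ?_⟩
  · rw [hv_apply, eop_eop_comm j, eop_eop_comm (tau j), ← map_sub, ← hv_apply, hF.2.1, map_smul]
  · rw [euler_apply, Finset.sum_congr rfl fun j _ => eop_eop_comm j k F, ← map_sum, ← euler_apply,
      hF.2.2, map_smul]

theorem exists_hamSpace_of_mem_rootSpace {α : Module.Dual K (cartanBar K .H n)} {w : Op K n}
    (hw : w ∈ rootSpace K .H n α) : ∃ F ∈ hamSpace α, w = ham K n F := by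
  obtain ⟨F, rfl, h0⟩ := exists_ham_of_mem_Hn hw.1
  refine ⟨F, ⟨h0, fun k => ?_, ?_⟩, rfl⟩
  · have h1 : sbr (hv K k) (ham K n F) = α (hvBar K k) • ham K n F := hw.2 (hvBar K k)
    rw [sbr_hv_ham] at h1
    refine sub_eq_zero.1 (ham_eq_zero ?_ ?_)
    · rw [map_sub, map_smul, h1, sub_self]
    · rw [map_sub, map_smul, h0, smul_zero, hv_apply, map_sub, lamAug_eop, lamAug_eop, sub_zero,
        sub_zero]
  · have h1 : sbr (euler K n) (ham K n F) = α (eulerBar K n) • ham K n F := hw.2 (eulerBar K n)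
    rw [sbr_euler_ham, sub_eq_iff_eq_add] at h1
    refine sub_eq_zero.1 (ham_eq_zero ?_ ?_)
    · rw [map_sub, map_smul, h1, add_smul, sub_self]
    · rw [map_sub, map_smul, h0, smul_zero, euler_apply, map_sum,
        Finset.sum_eq_zero fun k _ => lamAug_eop k F, sub_zero]

theorem ham_mem_rootSpace {α : Module.Dual K (cartanBar K .H n)} {F : Lam K n}
    (hF : F ∈ hamSpace α) (hH : ham K n F ∈ Hn K n) : ham K n F ∈ rootSpace K .H n α := by
  refine ⟨hH, fun h => ?_⟩
  have h1 : (sbrL K n).flip (ham K n F) ∘ₗ (cartanBar K .H n).subtype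
      = α.smulRight (ham K n F) := by
    refine cartanBar_H_ext (fun k => ?_) ?_
    · show sbr (hv K k) (ham K n F) = α (hvBar K k) • ham K n F
      rw [sbr_hv_ham, hF.2.1, map_smul]
    · show sbr (euler K n) (ham K n F) = α (eulerBar K n) • ham K n F
      rw [sbr_euler_ham, hF.2.2, map_smul, add_smul, add_sub_cancel_right]
  exact LinearMap.congr_fun h1 h

theorem hv_of_mem_lamWeight {b : Fin n → ℤ} {F : Lam K n} (hb : F ∈ lamWeight K b) (k : Fin n) :
    hv K k F = ((b k - b (tau k) : ℤ) : K) • F := by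
  rw [hv_apply, hb k, hb (tau k), Int.cast_sub, sub_smul]

/-- The values of the linear form `α` on the standard generators of `𝔥‾`, for the type `H`. -/
def IsHamWt (α : Module.Dual K (cartanBar K .H n)) (A : Fin n → ℤ) (d : ℤ) : Prop :=
  (∀ k, α (hvBar K k) = (A k : K)) ∧ α (eulerBar K n) = (d : K)

namespace IsHamWt

variable {α β : Module.Dual K (cartanBar K .H n)} {A B : Fin n → ℤ} {d e : ℤ}

theorem add (h : IsHamWt α A d) (h' : IsHamWt β B e) : IsHamWt (α + β) (A + B) (d + e) :=
  ⟨fun k => by simp [h.1, h'.1], by simp [h.2, h'.2]⟩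

theorem neg (h : IsHamWt α A d) : IsHamWt (-α) (-A) (-d) :=
  ⟨fun k => by simp [h.1], by simp [h.2]⟩

theorem smul (h : IsHamWt α A d) (m : ℕ) : IsHamWt (m • α) ((m : ℤ) • A) (m * d) :=
  ⟨fun k => by simp [h.1], by simp [h.2]⟩

theorem zero : IsHamWt (0 : Module.Dual K (cartanBar K .H n)) 0 0 := by
  constructor <;> simp

theorem ext (h : IsHamWt α A d) (h' : IsHamWt β A d) : α = β :=
  cartanBar_H_ext (fun k => by rw [h.1, h'.1]) (by rw [h.2, h'.2])

theorem unique (h : IsHamWt α A d) (h' : IsHamWt α B e) : A = B ∧ d = e :=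
  ⟨funext fun k => by have := (h.1 k).symm.trans (h'.1 k); exact_mod_cast this,
    by have := h.2.symm.trans h'.2; exact_mod_cast this⟩

end IsHamWt

theorem isHamWt_of_mem_lamWeight {α : Module.Dual K (cartanBar K .H n)} {F : Lam K n}
    (hF : F ∈ hamSpace α) (h0 : F ≠ 0) {b : Fin n → ℤ} (hb : F ∈ lamWeight K b) :
    IsHamWt α (fun k => b k - b (tau k)) (∑ k, b k - 2) := by
  constructor
  · intro k
    have h1 := hF.2.1 k
    rw [hv_of_mem_lamWeight hb] at h1
    exact (smul_left_injective K h0 h1).symm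
  · have h1 := hF.2.2
    rw [euler_of_mem_lamWeight hb] at h1
    have h2 : ((∑ k, b k : ℤ) : K) = α (eulerBar K n) + 2 := smul_left_injective K h0 h1
    rw [Int.cast_sub, h2]
    simp

/-- A Hamiltonian of a given weight is a sum of weight vectors for the full torus. -/
theorem hamSpace_le {α : Module.Dual K (cartanBar K .H n)} {N : Submodule K (Lam K n)}
    (h : ∀ b : Fin n → ℤ, (∀ k, b k = 0 ∨ b k = 1) →
      IsHamWt α (fun k => b k - b (tau k)) (∑ k, b k - 2) →
      ∀ F ∈ hamSpace α, F ∈ lamWeight K b → F ∈ N) : hamSpace α ≤ N := by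
  refine lam_le_of_weights (fun k F hF => eop_mem_hamSpace k hF) fun b F hF hb => ?_
  by_cases h0 : F = 0
  · rw [h0]; exact zero_mem _
  · exact h b (lamWeight_eq hb h0) (isHamWt_of_mem_lamWeight hF h0 hb) F hF hb

theorem exists_isHamWt {α : Module.Dual K (cartanBar K .H n)} (hα : rootSpace K .H n α ≠ ⊥) :
    ∃ b : Fin n → ℤ, (∀ k, b k = 0 ∨ b k = 1) ∧
      IsHamWt α (fun k => b k - b (tau k)) (∑ k, b k - 2) := by
  by_contra! h
  refine hα ((Submodule.eq_bot_iff _).2 fun w hw => ?_)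
  obtain ⟨F, hF, rfl⟩ := exists_hamSpace_of_mem_rootSpace hw
  have h1 : hamSpace α ≤ ⊥ := hamSpace_le fun b hb hb' => absurd hb' (h b hb)
  rw [(Submodule.mem_bot K).1 (h1 hF), map_zero]

theorem isHamWt_wt (a : Fin n → ℤ) :
    IsHamWt (wt K .H a) (fun k => a k - a (tau k)) (∑ k, a k) := by
  constructor
  · intro k
    rw [wt_apply]
    show ∑ j, (a j : K) * coefE K j (eop K k - eop K (tau k)) = _
    simp [map_sub, coefE_eop, mul_sub, Finset.sum_sub_distrib]
  · rw [wt_apply]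
    show ∑ j, (a j : K) * coefE K j (euler K n) = _
    have h : ∀ j, coefE K j (euler K n) = 1 := fun j => by
      simp [euler, map_sum, coefE_eop]
    simp [h]

/-- Of a root, the values on the generators of `𝔥` are `0`, `1` or `-1`. -/
theorem IsHamWt.abs_le {α : Module.Dual K (cartanBar K .H n)} {A : Fin n → ℤ} {d : ℤ}
    (h : IsHamWt α A d) (hα : rootSpace K .H n α ≠ ⊥) (k : Fin n) : |A k| ≤ 1 := by
  obtain ⟨b, hb, hb'⟩ := exists_isHamWt hα
  rw [(h.unique hb').1, _root_.abs_le]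
  have := hb k
  have := hb (tau k)
  constructor <;> dsimp only <;> omega

theorem IsHamWt.neg_one_le {α : Module.Dual K (cartanBar K .H n)} {A : Fin n → ℤ} {d : ℤ}
    (h : IsHamWt α A d) (hα : rootSpace K .H n α ≠ ⊥) : -1 ≤ d := by
  obtain ⟨a, ha, hα'⟩ := CartanSuper.exists_wt hα
  rw [(h.unique (hα' ▸ isHamWt_wt a)).2]
  exact ha.neg_one_le_sum

theorem Root.exists_isHamWt (α : Root K .H n) : ∃ A d, IsHamWt α.1 A d := by
  obtain ⟨b, -, hb⟩ := CartanSuper.exists_isHamWt α.2.2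
  exact ⟨_, _, hb⟩

theorem Root.isClassical_of_isHamWt {α : Root K .H n} {A : Fin n → ℤ} (h : IsHamWt α.1 A 0) :
    α.IsClassical :=
  Root.isClassical_of_wt fun a _ hα => (h.unique (hα ▸ isHamWt_wt a)).2.symm

theorem Root.IsClassical.deg_eq_zero {α : Root K .H n} (hα : α.IsClassical) {A : Fin n → ℤ}
    {d : ℤ} (h : IsHamWt α.1 A d) : d = 0 := by
  obtain ⟨a, -, ha, hs⟩ := hα.exists_wt
  rw [(h.unique (ha ▸ isHamWt_wt a)).2, hs]

theorem Root.IsEven.deg_even (hn : 4 ≤ n) {α : Root K .H n} (hα : α.IsEven) {A : Fin n → ℤ}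
    {d : ℤ} (h : IsHamWt α.1 A d) : Even d := by
  obtain ⟨a, -, ha⟩ := α.exists_wt
  rw [(h.unique (ha ▸ isHamWt_wt a)).2]
  exact hα.sum (t := .H) hn ha

theorem Root.IsOdd.deg_odd (hn : 4 ≤ n) {α : Root K .H n} (hα : α.IsOdd) {A : Fin n → ℤ}
    {d : ℤ} (h : IsHamWt α.1 A d) : Odd d := by
  obtain ⟨a, -, ha⟩ := α.exists_wt
  rw [(h.unique (ha ▸ isHamWt_wt a)).2]
  exact hα.sum (t := .H) hn ha

theorem Root.isMinusOne_of_isHamWt {α : Root K .H n} {A : Fin n → ℤ} (h : IsHamWt α.1 A (-1)) :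
    α.IsMinusOne := by
  refine rootSpace_le fun a _ hα D hD hD' => mem_degW_of_weight hD hD' ?_
  have h1 := isHamWt_wt (K := K) a
  rw [← hα] at h1
  rw [← (h.unique h1).2]
  simp

/-- For the type `H`, opposite even roots are classical: their degrees are opposite and at least
`-1`. -/
theorem even_opposite_H (hn : 4 ≤ n) {α β : Root K .H n} (hβ : β.1 = -α.1) (hα : α.IsEven) :
    α.IsClassical := by
  obtain ⟨A, d, h⟩ := α.exists_isHamWt
  have h1 := h.neg_one_le α.2.2
  have h2 := (hβ ▸ h.neg : IsHamWt β.1 (-A) (-d)).neg_one_le β.2.2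
  obtain ⟨m, hm⟩ := hα.deg_even hn h
  have h3 : d = 0 := by omega
  subst h3
  exact Root.isClassical_of_isHamWt h

/-- For the type `H`, of two opposite odd roots one has degree `-1`. -/
theorem odd_opposite_H (hn : 4 ≤ n) {α β : Root K .H n} (hβ : β.1 = -α.1) (hα : α.IsOdd) :
    α.IsMinusOne ∨ β.IsMinusOne := by
  obtain ⟨A, d, h⟩ := α.exists_isHamWt
  have h1 := h.neg_one_le α.2.2
  have h3 : IsHamWt β.1 (-A) (-d) := hβ ▸ h.neg
  have h2 := h3.neg_one_le β.2.2
  obtain ⟨m, hm⟩ := hα.deg_odd hn h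
  rcases (by omega : d = -1 ∨ d = 1) with rfl | rfl
  · exact Or.inl (Root.isMinusOne_of_isHamWt h)
  · exact Or.inr (Root.isMinusOne_of_isHamWt h3)

/-- The pairing with the restriction `A` of a root to `𝔥` plays the role of a coroot: its values on
the roots are bounded by its value on the root itself. -/
theorem abs_sum_mul_le {A B : Fin n → ℤ} (hA : ∀ k, |A k| ≤ 1) (hB : ∀ k, |B k| ≤ 1) :
    |∑ k, A k * B k| ≤ ∑ k, A k * A k := by
  refine (Finset.abs_sum_le_sum_abs _ _).trans (Finset.sum_le_sum fun k _ => ?_)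
  rw [abs_mul, ← abs_mul_abs_self (A k)]
  have h1 := abs_le.1 (hA k)
  have h2 : |A k| = 0 ∨ |A k| = 1 := by have := hA k; have := abs_nonneg (A k); omega
  have := hB k
  rcases h2 with h | h <;> rw [h] <;> simp [this]

theorem sum_mul_self_pos {A : Fin n → ℤ} (hA : A ≠ 0) : 0 < ∑ k, A k * A k := by
  obtain ⟨k, hk⟩ := Function.ne_iff.1 hA
  exact Finset.sum_pos' (fun i _ => mul_self_nonneg _) ⟨k, Finset.mem_univ k, mul_self_pos.2 hk⟩

theorem sum_smul_add_mul (m : ℤ) (A B : Fin n → ℤ) :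
    ∑ k, A k * (m • A + B) k = m * ∑ k, A k * A k + ∑ k, A k * B k := by
  rw [Finset.mul_sum, ← Finset.sum_add_distrib]
  exact Finset.sum_congr rfl fun k _ => by
    rw [Pi.add_apply, Pi.smul_apply, smul_eq_mul]; ring

theorem Root.IsClassical.restrict_ne_zero {α : Root K .H n} (hα : α.IsClassical) {A : Fin n → ℤ}
    {d : ℤ} (h : IsHamWt α.1 A d) : A ≠ 0 := by
  have h0 := hα.deg_eq_zero h
  rintro rfl
  subst h0
  exact α.2.1 (h.ext IsHamWt.zero)

/-- If `2α + β = 0` or `3α + β` is `0` or a root, then the pairing of the restriction of `β` with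
that of `α` is too small for `abs_sum_mul_le`. -/
theorem classical_string_H {α β : Root K .H n} (hα : α.IsClassical) :
    2 • α.1 + β.1 ≠ 0 ∧ 3 • α.1 + β.1 ≠ 0 ∧ rootSpace K .H n (3 • α.1 + β.1) = ⊥ := by
  obtain ⟨A, d, h⟩ := α.exists_isHamWt
  obtain ⟨B, e, h'⟩ := β.exists_isHamWt
  have hA := h.abs_le α.2.2
  have hpos := sum_mul_self_pos (hα.restrict_ne_zero h)
  have hle := abs_le.1 (abs_sum_mul_le hA (h'.abs_le β.2.2))
  refine ⟨fun h0 => ?_, fun h0 => ?_, ?_⟩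
  · have h1 := ((h.smul 2).add h').unique (h0 ▸ IsHamWt.zero)
    have h2 := sum_smul_add_mul 2 A B
    rw [show (2 : ℤ) • A + B = 0 from h1.1] at h2
    simp at h2
    omega
  · have h1 := ((h.smul 3).add h').unique (h0 ▸ IsHamWt.zero)
    have h2 := sum_smul_add_mul 3 A B
    rw [show (3 : ℤ) • A + B = 0 from h1.1] at h2
    simp at h2
    omega
  · by_contra h0
    have h1 := abs_le.1 (abs_sum_mul_le hA (((h.smul 3).add h').abs_le h0))
    have h2 := sum_smul_add_mul ((3 : ℕ) : ℤ) A B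
    rw [h2] at h1
    push_cast at h1
    omega

/-- If `2α + β` and `2β + α` were both roots, then adding the two bounds of `abs_sum_mul_le` would
give the pairing of `α + β` with itself a value that is not positive. -/
theorem classical_strings_H {α β : Root K .H n} (hα : α.IsClassical) (hβ : β.IsClassical)
    (hne : α.1 + β.1 ≠ 0) :
    rootSpace K .H n (2 • α.1 + β.1) = ⊥ ∨ rootSpace K .H n (2 • β.1 + α.1) = ⊥ := by
  obtain ⟨A, d, h⟩ := α.exists_isHamWt
  obtain ⟨B, e, h'⟩ := β.exists_isHamWt
  have hA := h.abs_le α.2.2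
  have hB := h'.abs_le β.2.2
  by_contra! hc
  have h1 := abs_le.1 (abs_sum_mul_le hA (((h.smul 2).add h').abs_le hc.1))
  have h2 := abs_le.1 (abs_sum_mul_le hB (((h'.smul 2).add h).abs_le hc.2))
  rw [sum_smul_add_mul] at h1 h2
  have h3 : ∑ k, B k * A k = ∑ k, A k * B k := Finset.sum_congr rfl fun k _ => mul_comm _ _
  have h5 : ∑ k, (A + B) k * (A + B) k
      = ∑ k, A k * A k + 2 * ∑ k, A k * B k + ∑ k, B k * B k := by
    rw [Finset.mul_sum, ← Finset.sum_add_distrib, ← Finset.sum_add_distrib]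
    exact Finset.sum_congr rfl fun k _ => by rw [Pi.add_apply]; ring
  have h6 : A + B = 0 := by
    by_contra h0
    have := sum_mul_self_pos h0
    push_cast at h1 h2
    omega
  have h7 := h.add h'
  rw [h6, hα.deg_eq_zero h, hβ.deg_eq_zero h', add_zero] at h7
  exact hne (h7.ext IsHamWt.zero)

end HamiltonianRoots

/-! ### Even root spaces of `H(n)` -/

section HamiltonianEven

variable {K : Type*} [Field K] [CharZero K] {n : ℕ}

/-- A twisted commutator of two eigenvectors of `ad h` is an eigenvector for the sum of the
eigenvalues. -/
theorem commutator_smul_mul {A : Type*} [Ring A] [Algebra K A] {h x y : A} {a b : K}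
    (hx : h * x - x * h = a • x) (hy : h * y - y * h = b • y) (e : K) :
    h * (x * y - e • (y * x)) - (x * y - e • (y * x)) * h = (a + b) • (x * y - e • (y * x)) := by
  have h1 := commutator_mul h x y
  have h2 := commutator_mul h y x
  rw [hx, hy, smul_mul_assoc, mul_smul_comm] at h1 h2
  rw [mul_sub, sub_mul, mul_smul_comm, smul_mul_assoc, sub_sub_sub_comm, ← smul_sub, h1, h2]
  module

theorem sbr_mem_rootSpace_add {t : CartanType} (hn : t.Admissible n)
    {α β : Module.Dual K (cartanBar K t n)} {p q : ZMod 2} {x y : Op K n} (hp : HasParity p x)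
    (hq : HasParity q y) (hx : x ∈ rootSpace K t n α) (hy : y ∈ rootSpace K t n β) :
    sbr x y ∈ rootSpace K t n (α + β) := by
  refine ⟨sbr_mem_galg hn hx.1 hy.1, fun h => ?_⟩
  have h0 := torus_parity (cartanBar_le_torus _ h.2)
  have h1 := hx.2 h
  have h2 := hy.2 h
  rw [sbr_even_left h0] at h1 h2
  rw [sbr_even_left h0, sbr_of_parity hp hq]
  have h3 := commutator_smul_mul (A := Op K n) h1 h2 ((-1 : K) ^ (p.val * q.val))
  rw [LinearMap.add_apply]
  exact h3

theorem pd_mem_lamWeight {b : Fin n → ℤ} {F : Lam K n} (hF : F ∈ lamWeight K b) (k : Fin n) :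
    pd K k F ∈ lamWeight K (-Pi.single k 1 + b) := opWeight_apply (pd_mem_opWeight k) hF

/-- If `b_k = b_{τ k}` for all `k`, then the two terms of `[ham G, ham F]` for a pair of indices
cancel. -/
theorem ham_apply_eq_zero {b c : Fin n → ℤ} {G F : Lam K n} (hG : G ∈ lamWeight K b)
    (hF : F ∈ lamWeight K c) (hb : ∀ k, b (tau k) = b k) (hc : ∀ k, c (tau k) = c k)
    (hfix : ∀ k, tau k = k → b k = 0) (hb01 : ∀ k, b k = 0 ∨ b k = 1)
    (hc01 : ∀ k, c k = 0 ∨ c k = 1) (hGp : parInv K n G = G) (hFp : parInv K n F = F) :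
    ham K n G F = 0 := by
  have key : ∀ j, pd K j G * pd K (tau j) F = -(pd K (tau j) G * pd K j F) := by
    intro j
    rcases hb01 j with hbj | hbj
    · rw [pd_eq_zero hG hbj, pd_eq_zero hG ((hb j).trans hbj)]; simp
    rcases hc01 j with hcj | hcj
    · rw [pd_eq_zero hF hcj, pd_eq_zero hF ((hc j).trans hcj)]; simp
    have hj : tau j ≠ j := fun h => by rw [hfix j h] at hbj; omega
    -- Both Hamiltonians are divisible by `ξ_j ξ_{τ j}`.
    have h1 : ∀ (a : Fin n → ℤ) (E : Lam K n), E ∈ lamWeight K a → a j = 1 → a (tau j) = 1 →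
        pd K j E = xi K (tau j) * pd K (tau j) (pd K j E) ∧
        pd K (tau j) E = -(xi K j * pd K (tau j) (pd K j E)) := by
      intro a E hE ha ha'
      constructor
      · refine eq_xi_mul_pd (pd_mem_lamWeight hE j) ?_
        simp [hj, ha']
      · refine (eq_xi_mul_pd (pd_mem_lamWeight hE (tau j)) (k := j) ?_).trans ?_
        · simp [hj.symm, ha]
        · rw [pd_pd, mul_neg]
    obtain ⟨e1, e2⟩ := h1 b G hG hbj ((hb j).trans hbj)
    obtain ⟨e3, e4⟩ := h1 c F hF hcj ((hc j).trans hcj)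
    have h2 : parInv K n (pd K (tau j) (pd K j G)) = pd K (tau j) (pd K j G) := by
      rw [parInv_pd, parInv_pd, hGp, map_neg, neg_neg]
    have h3 := mul_comm_of_even h2
    rw [e1, e2, e3, e4]
    generalize pd K (tau j) (pd K j G) = g at *
    generalize pd K (tau j) (pd K j F) = f at *
    rw [mul_neg, neg_mul, mul_assoc, mul_assoc, ← mul_assoc g, ← mul_assoc g, h3, h3 (xi K (tau j)),
      mul_assoc, mul_assoc, ← mul_assoc, ← mul_assoc, xi_mul_xi, neg_mul, neg_mul, mul_assoc,
      mul_assoc]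
  have h1 : ham K n G F = -ham K n G F := by
    conv_rhs => rw [ham_apply, ← sum_tau, ← Finset.sum_neg_distrib]
    rw [ham_apply]
    exact Finset.sum_congr rfl fun j _ => by rw [key, tau_tau]
  have h2 : (2 : K) • ham K n G F = 0 := by
    rw [two_smul]
    nth_rewrite 1 [h1]
    exact neg_add_cancel _
  exact (smul_eq_zero.1 h2).resolve_left two_ne_zero

theorem parInv_of_hamSpace {α : Module.Dual K (cartanBar K .H n)} {A : Fin n → ℤ} {d : ℤ}
    (h : IsHamWt α A d) (hd : Even d) {F : Lam K n} (hF : F ∈ hamSpace α) :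
    parInv K n F = F := by
  have h1 : hamSpace α ≤ LinearMap.eqLocus (parInv K n) LinearMap.id := by
    refine hamSpace_le fun b _ hb' G _ hGb => ?_
    have h2 : ((∑ k, b k : ℤ) : ZMod 2) = 0 := by
      rw [ZMod.intCast_eq_zero_iff_even]
      have := (h.unique hb').2
      obtain ⟨m, hm⟩ := hd
      exact ⟨m + 1, by omega⟩
    have h3 := parInv_of_mem_lamWeight hGb
    rw [h2, ZMod.val_zero, pow_zero, one_smul] at h3
    exact h3
  exact h1 hF

/-- For a `τ`-invariant family the pairs of indices contribute evenly. -/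
theorem sum_eq_of_tau_invariant {b : Fin n → ℤ} (hb : ∀ i, b (tau i) = b i) {k : Fin n}
    (hk : tau k = k) : ((∑ k, b k : ℤ) : ZMod 2) = (b k : ZMod 2) := by
  rw [Int.cast_sum, ← Finset.add_sum_erase _ _ (Finset.mem_univ k),
    Finset.sum_involution (fun i _ => tau i), add_zero]
  · intro i _
    rw [hb, ← two_mul]
    exact mul_eq_zero_of_left rfl _
  · intro i hi _ hti
    refine Finset.ne_of_mem_erase hi ?_
    revert hti hk
    unfold tau
    split_ifs <;> simp only [Fin.ext_iff] <;> omega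
  · intro i hi
    exact Finset.mem_erase.2 ⟨fun h2 => Finset.ne_of_mem_erase hi
      (by rw [← tau_tau i, h2, hk]), Finset.mem_univ _⟩
  · intro i _; exact tau_tau i

/-- For the type `H`, even root spaces are commutative. If the restriction of the root to `𝔥` is not
zero, then twice the root is not a root; otherwise the Hamiltonians are polynomials in the products
`ξ_k ξ_{τ k}`, and the terms of the Poisson bracket cancel in pairs. -/
theorem even_abelian_H (hn : 4 ≤ n) {α : Root K .H n} (hα : α.IsEven) :
    ∀ x ∈ rootSpace K .H n α.1, ∀ y ∈ rootSpace K .H n α.1, sbr x y = 0 := by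
  obtain ⟨A, d, h⟩ := α.exists_isHamWt
  have hd := hα.deg_even hn h
  intro x hx y hy
  obtain ⟨G, hG, rfl⟩ := exists_hamSpace_of_mem_rootSpace hx
  obtain ⟨F, hF, rfl⟩ := exists_hamSpace_of_mem_rootSpace hy
  by_cases hA : A = 0
  · rw [sbr_ham, parInv_of_hamSpace h hd hG]
    have hw : ∀ b : Fin n → ℤ, IsHamWt α.1 (fun k => b k - b (tau k)) (∑ k, b k - 2) →
        ∀ k, b (tau k) = b k := by
      intro b hb k
      have := congrFun (hb.unique h).1 k
      rw [hA, Pi.zero_apply] at this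
      omega
    -- The multiplicity of a self-paired index has the parity of the degree.
    have hfix : ∀ b : Fin n → ℤ, (∀ k, b k = 0 ∨ b k = 1) →
        IsHamWt α.1 (fun k => b k - b (tau k)) (∑ k, b k - 2) → ∀ k, tau k = k → b k = 0 := by
      intro b hb01 hb k hk
      have h1 := sum_eq_of_tau_invariant (hw b hb) hk
      have h2 : Even (∑ k, b k) := by
        have := (hb.unique h).2
        obtain ⟨m, hm⟩ := hd
        exact ⟨m + 1, by omega⟩
      rw [(ZMod.intCast_eq_zero_iff_even).2 h2, eq_comm, ZMod.intCast_eq_zero_iff_even] at h1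
      refine (hb01 k).resolve_right fun h3 => ?_
      rw [h3] at h1
      exact absurd h1 (by decide)
    have h1 : hamSpace α.1 ≤ LinearMap.ker (LinearMap.applyₗ F ∘ₗ ham K n) := by
      refine hamSpace_le fun b hb01 hb G' hG' hGb => ?_
      have h2 : hamSpace α.1 ≤ LinearMap.ker (ham K n G') := by
        refine hamSpace_le fun c hc01 hc F' hF' hFc => ?_
        exact ham_apply_eq_zero hGb hFc (hw b hb) (hw c hc) (hfix b hb01 hb) hb01 hc01
          (parInv_of_hamSpace h hd hG') (parInv_of_hamSpace h hd hF')
      exact h2 hF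
    rw [show ham K n G F = 0 from h1 hG, map_zero]
  · have h1 : rootSpace K .H n (α.1 + α.1) = ⊥ := by
      by_contra h0
      have h2 := abs_le.1 (abs_sum_mul_le (h.abs_le α.2.2) ((h.add h).abs_le h0))
      have h3 := sum_mul_self_pos hA
      have h4 := sum_smul_add_mul 1 A A
      rw [one_smul] at h4
      rw [h4] at h2
      omega
    refine (Submodule.mem_bot K).1 (h1 ▸ ?_)
    exact sbr_mem_rootSpace_add (t := .H) hn (hα _ hx) (hα _ hy) hx hy

theorem xi_mul_mul_eq_zero {b c : Fin n → ℤ} {F G : Lam K n} (hF : F ∈ lamWeight K b)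
    (hG : G ∈ lamWeight K c) {m : Fin n} (h : b m = 1) (h' : c m = 1) (x : Lam K n) :
    F * (G * x) = 0 := by
  rw [← mul_assoc, mul_eq_zero_of_weights hF hG h h', zero_mul]

theorem exists_ne_of_four_le {b : Fin n → ℤ} (hb : ∀ k, b k = 0 ∨ b k = 1) (h : 4 ≤ ∑ k, b k)
    (i j k : Fin n) : ∃ m, b m = 1 ∧ m ≠ i ∧ m ≠ j ∧ m ≠ k := by
  by_contra! hc
  have h1 : ∑ m, b m ≤ ∑ m, if m ∈ ({i, j, k} : Finset (Fin n)) then (1 : ℤ) else 0 := by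
    refine Finset.sum_le_sum fun m _ => ?_
    split_ifs with hm
    · have := hb m; omega
    · refine ((hb m).resolve_right fun h2 => hm ?_).le
      have := hc m h2
      simp only [Finset.mem_insert, Finset.mem_singleton]
      tauto
  rw [Finset.sum_ite_mem, Finset.univ_inter, Finset.sum_const, nsmul_one] at h1
  have h2 := Finset.card_le_three (a := i) (b := j) (c := k)
  omega

/-- A Hamiltonian that is a weight vector of degree at least `4` acts with square zero. -/
theorem ham_ham_eq_zero {b : Fin n → ℤ} {F : Lam K n} (hF : F ∈ lamWeight K b)
    (hb : ∀ k, b k = 0 ∨ b k = 1) (h : 4 ≤ ∑ k, b k) (G : Lam K n) :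
    ham K n F (ham K n F G) = 0 := by
  rw [ham_apply F (ham K n F G), ham_apply F G]
  refine Finset.sum_eq_zero fun j _ => ?_
  rw [map_sum, Finset.mul_sum]
  refine Finset.sum_eq_zero fun k _ => ?_
  rw [pd_mul, mul_add]
  have h1 := pd_mem_lamWeight hF j
  have h2 := pd_mem_lamWeight hF k
  have h3 := pd_mem_lamWeight h2 (tau j)
  obtain ⟨m, hm, hmj, hmt, hmk⟩ := exists_ne_of_four_le hb h j (tau j) k
  rw [xi_mul_mul_eq_zero h1 h3 (m := m), zero_add, parInv_of_mem_lamWeight h2, smul_mul_assoc,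
    mul_smul_comm, xi_mul_mul_eq_zero h1 h2 (m := m), smul_zero]
  all_goals simp [hm, hmj, hmt, hmk]

end HamiltonianEven

/-! ### The lattices spanned by root vectors -/

section Lattice

variable {K : Type*} [Field K] [CharZero K] {n : ℕ} {t : CartanType}

/-- The lattice spanned by the root vectors of weight `ν` of a Chevalley basis. -/
def ChevalleyBasis.lat (B : ChevalleyBasis K t n) (ν : Module.Dual K (cartanBar K t n)) :
    AddSubgroup (Op K n) :=
  AddSubgroup.closure {x | ∃ (δ : Root K t n) (k : Fin δ.mult), δ.1 = ν ∧ x = B.X δ k}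

theorem ChevalleyBasis.X_mem_lat (B : ChevalleyBasis K t n) (α : Root K t n) (k : Fin α.mult) :
    (B.X α k : Op K n) ∈ B.lat α.1 :=
  AddSubgroup.subset_closure ⟨α, k, rfl, rfl⟩

theorem ChevalleyBasis.lat_le_rootSpace (B : ChevalleyBasis K t n)
    (ν : Module.Dual K (cartanBar K t n)) :
    B.lat ν ≤ (rootSpace K t n ν).toAddSubgroup := by
  refine (AddSubgroup.closure_le _).2 ?_
  rintro _ ⟨δ, k, rfl, rfl⟩
  exact B.X_mem δ k

theorem ChevalleyBasis.nonempty_mult (B : ChevalleyBasis K t n) (α : Root K t n) :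
    Nonempty (Fin α.mult) := by
  by_contra h
  rw [not_nonempty_iff] at h
  refine α.2.2 ((Submodule.eq_bot_iff _).2 fun w hw => ?_)
  have h1 := B.X_span α w hw
  rwa [Set.range_eq_empty, Submodule.span_empty, Submodule.mem_bot] at h1

theorem exists_parity_rootSpace (hn : t.Admissible n) (ν : Module.Dual K (cartanBar K t n)) :
    ∃ p : ZMod 2, ∀ w ∈ rootSpace K t n ν, HasParity p w := by
  by_cases h : rootSpace K t n ν = ⊥
  · refine ⟨0, fun w hw => ?_⟩
    rw [h, Submodule.mem_bot] at hw
    rw [hw, HasParity, mul_zero, zero_mul, smul_zero]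
  · obtain ⟨a, -, ha⟩ := CartanSuper.exists_wt h
    exact ⟨_, rootSpace_parity_of_wt hn ha⟩

theorem sbr_mem_rootSpace (hn : t.Admissible n) {μ ν : Module.Dual K (cartanBar K t n)}
    {x y : Op K n} (hx : x ∈ rootSpace K t n μ) (hy : y ∈ rootSpace K t n ν) :
    sbr x y ∈ rootSpace K t n (μ + ν) := by
  obtain ⟨p, hp⟩ := exists_parity_rootSpace hn μ
  obtain ⟨q, hq⟩ := exists_parity_rootSpace hn ν
  exact sbr_mem_rootSpace_add hn (hp x hx) (hq y hy) hx hy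

theorem sbr_zero_left (y : Op K n) : sbr 0 y = 0 := by
  rw [← sbrL_apply, map_zero, LinearMap.zero_apply]

theorem sbr_zero_right (x : Op K n) : sbr x 0 = 0 := by
  rw [← sbrL_apply, map_zero]

/-- Brackets of root lattices lie in root lattices, since the structure constants are integers. -/
theorem ChevalleyBasis.sbr_mem_lat (B : ChevalleyBasis K t n) (hn : t.Admissible n)
    {μ ν : Module.Dual K (cartanBar K t n)} (h : μ + ν ≠ 0) {x y : Op K n} (hx : x ∈ B.lat μ)
    (hy : y ∈ B.lat ν) : sbr x y ∈ B.lat (μ + ν) := by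
  refine AddSubgroup.closure_induction (p := fun x _ => sbr x y ∈ B.lat (μ + ν)) ?_ ?_ ?_ ?_ hx
  · rintro _ ⟨α, k, rfl, rfl⟩
    refine AddSubgroup.closure_induction
      (p := fun y _ => sbr (B.X α k : Op K n) y ∈ B.lat (α.1 + ν)) ?_ ?_ ?_ ?_ hy
    · rintro _ ⟨β, l, rfl, rfl⟩
      by_cases h0 : rootSpace K t n (α.1 + β.1) = ⊥
      · have h1 := sbr_mem_rootSpace hn (B.X_mem α k) (B.X_mem β l)
        rw [h0, Submodule.mem_bot] at h1
        rw [h1]; exact zero_mem _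
      · obtain ⟨c, -, hc, -⟩ := B.struct_const α β ⟨α.1 + β.1, h, h0⟩ rfl k l
        rw [hc]
        exact sum_mem fun s _ => zsmul_mem (B.X_mem_lat ⟨α.1 + β.1, h, h0⟩ s) _
    · rw [sbr_zero_right]; exact zero_mem _
    · intro a b _ _ ha hb
      rw [sbr_add_right]; exact add_mem ha hb
    · intro a _ ha
      rw [← sbrL_apply, map_neg, sbrL_apply]; exact neg_mem ha
  · rw [sbr_zero_left]; exact zero_mem _
  · intro a b _ _ ha hb
    rw [← sbrL_apply, map_add, LinearMap.add_apply]; exact add_mem ha hb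
  · intro a _ ha
    rw [← sbrL_apply, map_neg, LinearMap.neg_apply, sbrL_apply]; exact neg_mem ha

theorem eq_of_sum_smul_eq {ι V : Type*} [Fintype ι] [AddCommGroup V] [Module K V] {v : ι → V}
    (hv : LinearIndependent K v) {a b : ι → K} (h : ∑ i, a i • v i = ∑ i, b i • v i) (i : ι) :
    a i = b i := by
  rw [Fintype.linearIndependent_iff] at hv
  refine sub_eq_zero.1 (hv (fun i => a i - b i) ?_ i)
  simp only [sub_smul, Finset.sum_sub_distrib, h, sub_self]

theorem linearIndependent_coe {ι V : Type*} [AddCommGroup V] [Module K V] {N : Submodule K V}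
    {v : ι → N} (h : LinearIndependent K v) : LinearIndependent K fun i => (v i : V) :=
  h.map' N.subtype (Submodule.ker_subtype _)

theorem ChevalleyBasis.H_indep' (B : ChevalleyBasis K t n) :
    LinearIndependent K fun i => (B.H i : Op K n) :=
  linearIndependent_coe B.H_indep

end Lattice

/-! ### The elements `H_i` for the type `H` -/

section HamiltonianCartan

variable {K : Type*} [Field K] [CharZero K] {n : ℕ}

theorem mem_Hn_of_sbr {h x : Op K n} (hh : h ∈ Htn K n) (hx : x ∈ Htn K n) {c : K} (hc : c ≠ 0)
    (h1 : sbr h x = c • x) : x ∈ Hn K n := by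
  have h2 : sbr h x ∈ Hn K n := Submodule.subset_span ⟨h, hh, x, hx, rfl⟩
  rw [h1] at h2
  exact (Submodule.smul_mem_iff _ hc).1 h2

theorem hv_mem_Htn (k : Fin n) : hv K k ∈ Htn K n := by
  rw [hv_eq_ham]; exact neg_mem (ham_mem_Htn _)

/-- A Hamiltonian vector field of weight `b` lies in `H(n)` if its restriction to `𝔥` is
nonzero. -/
theorem ham_mem_Hn {b : Fin n → ℤ} {F : Lam K n} (hF : F ∈ lamWeight K b) {k : Fin n}
    (hk : b k ≠ b (tau k)) : ham K n F ∈ Hn K n := by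
  refine mem_Hn_of_sbr (hv_mem_Htn k) (ham_mem_Htn F) (c := ((b k - b (tau k) : ℤ) : K)) ?_ ?_
  · exact_mod_cast sub_ne_zero.2 hk
  · rw [sbr_hv_ham, hv_of_mem_lamWeight hF, map_smul]

theorem pd_eq_ham (k : Fin n) : pd K k = ham K n (xi K (tau k)) := by
  rw [ham_eq, Finset.sum_eq_single (tau k)]
  · refine LinearMap.ext fun f => ?_
    rw [pd_xi, if_pos rfl, tau_tau, mulPd_apply, one_mul]
  · intro j _ hj
    refine LinearMap.ext fun f => ?_
    rw [pd_xi, if_neg hj, mulPd_apply, zero_mul, LinearMap.zero_apply]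
  · simp

theorem sbr_pd_ham (k : Fin n) (F : Lam K n) : sbr (pd K k) (ham K n F) = -ham K n (pd K k F) := by
  rw [pd_eq_ham, sbr_ham, parInv_xi, map_neg, LinearMap.neg_apply, map_neg]

theorem mem_hamSpace_wt {a b : Fin n → ℤ} {F : Lam K n} (hF : F ∈ lamWeight K b)
    (h0 : lamAug K n F = 0) (h1 : ∀ k, b k - b (tau k) = a k - a (tau k))
    (h2 : ∑ k, b k - 2 = ∑ k, a k) : F ∈ hamSpace (wt K .H a) := by
  have h := isHamWt_wt (K := K) a
  refine ⟨h0, fun k => ?_, ?_⟩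
  · rw [hv_of_mem_lamWeight hF, h1, h.1]
  · rw [euler_of_mem_lamWeight hF, h.2, ← h2]
    push_cast
    rw [sub_add_cancel]

theorem coefE_ham (k : Fin n) (F : Lam K n) :
    coefE K k (ham K n F) = lamAug K n (pd K k (pd K (tau k) F)) := by
  rw [coefE_apply, ham_xi]

theorem coefE_tau {h : Op K n} (hh : h ∈ cartan K .H n) (k : Fin n) :
    coefE K (tau k) h = -coefE K k h := by
  have h1 : cartan K .H n ≤ LinearMap.ker (coefE K (tau k) + coefE K k) := by
    refine cartan_H_le fun j => ?_
    rw [LinearMap.mem_ker, LinearMap.add_apply, hv, map_sub, map_sub, coefE_eop, coefE_eop,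
      coefE_eop, coefE_eop]
    have e1 : (tau k = j) = (k = tau j) := by
      rw [eq_iff_iff]
      exact ⟨fun h => by rw [← h, tau_tau], fun h => by rw [h, tau_tau]⟩
    have e2 : (tau k = tau j) = (k = j) := by
      rw [eq_iff_iff]
      exact tau_injective.eq_iff
    simp only [e1, e2]
    ring
  exact eq_neg_of_add_eq_zero_left (LinearMap.mem_ker.1 (h1 hh))

theorem eq_smul_hv {h : Op K n} (hh : h ∈ cartan K .H n) {l : Fin n} (hl : tau l ≠ l)
    (h0 : ∀ k, tau k ≠ k → k ≠ l → k ≠ tau l → coefE K k h = 0) :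
    h = coefE K l h • hv K l := by
  have h1 : ∀ k, k ≠ l → k ≠ tau l → coefE K k h = 0 := by
    intro k hk hk'
    by_cases h2 : tau k = k
    · have h3 := coefE_tau hh k
      rw [h2] at h3
      exact self_eq_neg.1 h3
    · exact h0 k h2 hk hk'
  conv_lhs => rw [torus_eq_sum (cartan_le_torus _ hh)]
  rw [Finset.sum_eq_add l (tau l) hl.symm (fun k _ hk => by rw [h1 k hk.1 hk.2, zero_smul])
    (by simp) (by simp), coefE_tau hh l, hv]
  have h2 : ∀ (M : Type _) [AddCommGroup M] [Module K M] (c : K) (v w : M),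
      c • v + (-c) • w = c • (v - w) := fun M _ _ c v w => by module
  exact h2 _ _ _ _

/-- The root `-ε_k`. -/
def gam (K : Type*) [Field K] {n : ℕ} (k : Fin n) : Module.Dual K (cartanBar K .H n) :=
  wt K .H (-Pi.single k 1)

theorem gam_hvBar {k : Fin n} (hk : tau k ≠ k) : gam K k (hvBar K k) = -1 := by
  rw [gam, (isHamWt_wt _).1]
  simp [hk]

theorem gam_ne_zero {k : Fin n} (hk : tau k ≠ k) : gam K k ≠ 0 := fun h => by
  have := gam_hvBar (K := K) hk
  rw [h] at this
  simp at this

theorem pd_mem_rootSpace {k : Fin n} (hk : tau k ≠ k) : pd K k ∈ rootSpace K .H n (gam K k) := by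
  refine ⟨?_, fun h => sbr_of_opWeight (pd_mem_opWeight k) h⟩
  rw [pd_eq_ham]
  refine ham_mem_Hn (xi_mem_lamWeight (tau k)) (k := k) ?_
  simp [hk, hk.symm]

theorem pd_ne_zero (k : Fin n) : pd K k ≠ 0 := fun h => by
  have := pd_xi (K := K) k k
  rw [h, if_pos rfl, LinearMap.zero_apply] at this
  exact zero_ne_one this

theorem rootSpace_gam_le {k : Fin n} (hk : tau k ≠ k) {D : Op K n}
    (hDk : D ∈ rootSpace K .H n (gam K k)) : ∃ c : K, D = c • pd K k := by
  have h1 : rootSpace K .H n (gam K k) ≤ Submodule.span K {pd K k} := by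
    refine rootSpace_le fun a ha hα D hD hD' => ?_
    have hα' := isHamWt_wt (K := K) (-Pi.single k 1 : Fin n → ℤ)
    rw [show wt K .H (-Pi.single k 1 : Fin n → ℤ) = wt K .H a from hα] at hα'
    obtain ⟨h2, h3⟩ := (isHamWt_wt (K := K) a).unique hα'
    obtain ⟨j, rfl⟩ := ha.eq_of_sum_neg_one (by rw [h3]; simp)
    have hj : j = k := by
      have h4 := congrFun h2 k
      by_contra hjk
      simp only [Pi.neg_apply, Pi.single_eq_same, Pi.single_eq_of_ne hk,
        Pi.single_eq_of_ne (Ne.symm hjk)] at h4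
      rw [Pi.single_apply] at h4
      split_ifs at h4 <;> omega
    subst hj
    refine Submodule.mem_span_singleton.2 ⟨lamAug K n (D (xi K j)),
      Wn_ext (Submodule.smul_mem _ _ ?_) hD fun i => ?_⟩
    · rw [pd_eq_ham]; exact ham_mem_Wn _
    · have h5 := opWeight_apply hD' (xi_mem_lamWeight i)
      rw [LinearMap.smul_apply, pd_xi]
      by_cases hij : j = i
      · subst hij
        rw [neg_add_cancel] at h5
        rw [if_pos rfl, Algebra.smul_def, mul_one]
        refine (eq_algebraMap_of_euler ?_).symm
        rw [euler_of_mem_lamWeight h5]; simp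
      · rw [if_neg hij, smul_zero]
        by_contra h6
        have h7 := lamWeight_eq h5 (fun h => h6 h.symm) j
        simp [hij] at h7
  obtain ⟨c, hc⟩ := Submodule.mem_span_singleton.1 (h1 hDk)
  exact ⟨c, hc.symm⟩

theorem triple_mem_lamWeight (k l : Fin n) : xi K k * (xi K l * xi K (tau l))
    ∈ lamWeight K (Pi.single k 1 + (Pi.single l 1 + Pi.single (tau l) 1) : Fin n → ℤ) :=
  mul_mem_lamWeight (xi_mem_lamWeight k)
    (mul_mem_lamWeight (xi_mem_lamWeight l) (xi_mem_lamWeight _))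

theorem single_tau (k i : Fin n) :
    (Pi.single k 1 : Fin n → ℤ) (tau i) = (Pi.single (tau k) 1 : Fin n → ℤ) i := by
  rw [Pi.single_apply, Pi.single_apply]
  congr 1
  rw [eq_iff_iff]
  exact ⟨fun h => by rw [← h, tau_tau], fun h => by rw [h, tau_tau]⟩



theorem triple_mem_hamSpace (k l : Fin n) :
    xi K k * (xi K l * xi K (tau l)) ∈ hamSpace (-gam K k) := by
  have h : -gam K k = wt K .H (Pi.single k 1) := by rw [gam, wt_neg, neg_neg]
  rw [h]
  refine mem_hamSpace_wt (triple_mem_lamWeight k l) (lamAug_xi_mul _ _) (fun i => ?_) ?_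
  · simp only [Pi.add_apply, single_tau, tau_tau]
    ring
  · simp [Finset.sum_add_distrib]

theorem ham_triple_mem {k l : Fin n} (hk : tau k ≠ k) :
    ham K n (xi K k * (xi K l * xi K (tau l))) ∈ rootSpace K .H n (-gam K k) := by
  refine ham_mem_rootSpace (triple_mem_hamSpace k l)
    (ham_mem_Hn (triple_mem_lamWeight k l) (k := k) ?_)
  simp only [Pi.add_apply, single_tau, tau_tau, Pi.single_eq_same, Pi.single_eq_of_ne hk.symm]
  omega

theorem pd_triple {k l : Fin n} (h : k ≠ l) (h' : k ≠ tau l) :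
    pd K k (xi K k * (xi K l * xi K (tau l))) = xi K l * xi K (tau l) := by
  simp [pd_xi_mul, pd_xi, h, h']

theorem hv_ne_zero {k : Fin n} (hk : tau k ≠ k) : hv K k ≠ 0 := fun h => by
  have h1 : coefE K k (hv K k) = 1 := by
    rw [hv, map_sub, coefE_eop, coefE_eop, if_pos rfl, if_neg hk.symm, sub_zero]
  rw [h, map_zero] at h1
  exact zero_ne_one h1

theorem sbr_pd_triple {k l : Fin n} (h : k ≠ l) (h' : k ≠ tau l) :
    sbr (pd K k) (ham K n (xi K k * (xi K l * xi K (tau l)))) = hv K l := by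
  rw [sbr_pd_ham, pd_triple h h', hv_eq_ham]

theorem triple_ne_zero {k l : Fin n} (hl : tau l ≠ l) (h : k ≠ l) (h' : k ≠ tau l) :
    ham K n (xi K k * (xi K l * xi K (tau l))) ≠ 0 := fun h0 => by
  have h1 := sbr_pd_triple (K := K) h h'
  rw [h0, ← sbrL_apply, map_zero] at h1
  exact hv_ne_zero hl h1.symm

variable (K) in
/-- The root `-ε_k` of `H(n)`, for a paired index `k`. -/
def gamRoot {k : Fin n} (hk : tau k ≠ k) : Root K .H n :=
  ⟨gam K k, gam_ne_zero hk, fun h => pd_ne_zero (K := K) k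
    ((Submodule.mem_bot K).1 (h ▸ pd_mem_rootSpace hk))⟩

variable (K) in
/-- The root `ε_k` of `H(n)`, for a paired index `k`, provided that there is another pair. -/
def gamNegRoot {k l : Fin n} (hk : tau k ≠ k) (hl : tau l ≠ l) (h : k ≠ l) (h' : k ≠ tau l) :
    Root K .H n :=
  ⟨-gam K k, neg_ne_zero.2 (gam_ne_zero hk), fun h0 => triple_ne_zero (K := K) hl h h'
    ((Submodule.mem_bot K).1 (h0 ▸ ham_triple_mem hk))⟩

theorem gamRoot_isMinusOne {k : Fin n} (hk : tau k ≠ k) : (gamRoot K hk).IsMinusOne := by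
  have h := isHamWt_wt (K := K) (-Pi.single k 1 : Fin n → ℤ)
  have h1 : ∑ i, (-Pi.single k 1 : Fin n → ℤ) i = -1 := by simp
  rw [h1] at h
  exact Root.isMinusOne_of_isHamWt (α := gamRoot K hk) h

end HamiltonianCartan

section HamiltonianCartanBasis

variable {K : Type*} [Field K] [CharZero K] {n : ℕ}

theorem ChevalleyBasis.exists_hv_eq (B : ChevalleyBasis K .H n) (k : Fin n) :
    ∃ d : Fin (CartanType.rank .H n) → K, ∑ i, d i • (B.H i : Op K n) = hv K k :=
  (Submodule.mem_span_range_iff_exists_fun K).1 (B.H_span _ (hv_mem_cartan k))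

theorem ChevalleyBasis.exists_gam_H_ne_zero (B : ChevalleyBasis K .H n) {k : Fin n}
    (hk : tau k ≠ k) : ∃ i, gam K k ⟨(B.H i : Op K n), cartan_le_cartanBar K .H n (B.H_mem i)⟩ ≠ 0 := by
  by_contra! h
  obtain ⟨d, hd⟩ := B.exists_hv_eq k
  have h1 : hvBar K k
      = ∑ i, d i • (⟨(B.H i : Op K n), cartan_le_cartanBar K .H n (B.H_mem i)⟩ : cartanBar K .H n) := by
    refine Subtype.ext ?_
    rw [AddSubmonoidClass.coe_finsetSum]
    exact hd.symm
  have h2 := gam_hvBar (K := K) hk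
  rw [h1, map_sum, Finset.sum_eq_zero fun i _ => by rw [map_smul, h, smul_zero]] at h2
  simp at h2

/-- The brackets of the vectors for `-ε_k` and `ε_k` are elements `±H_i`: the multiples `±2H_i` are
allowed only if `-ε_k` vanishes on `𝔥`. -/
theorem ChevalleyBasis.exists_sigma (B : ChevalleyBasis K .H n) {k : Fin n} (hk : tau k ≠ k)
    {β : Root K .H n} (hβ : β.1 = -gam K k) : ∃ σ : Fin β.mult → Fin (CartanType.rank .H n),
      ∀ k0 j, ∃ m : ℤ, |m| = 1 ∧
        sbr (B.X (gamRoot K hk) k0 : Op K n) (B.X β j) = m • (B.H (σ j) : Op K n) := by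
  obtain ⟨σ, -, h⟩ := B.minusOne_bracket_H rfl (gamRoot K hk) β (gamRoot_isMinusOne hk) hβ
  refine ⟨σ, fun k0 j => ?_⟩
  obtain ⟨m, hm, hm'⟩ := h k0 j
  refine ⟨m, hm'.resolve_right fun h' => ?_, hm⟩
  obtain ⟨i, hi⟩ := B.exists_gam_H_ne_zero hk
  exact hi (h'.2.2 i)

/-- The element of the Chevalley basis that is proportional to `ξ_l ∂_l - ξ_{τ l} ∂_{τ l}`: it
occurs among the brackets of the root vectors for `-ε_k` and `ε_k`, for every `k` outside of the
pair of `l`. -/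
theorem ChevalleyBasis.exists_H_bracket (B : ChevalleyBasis K .H n) {l : Fin n} (hl : tau l ≠ l) :
    ∃ i, ∀ (k : Fin n) (hk : tau k ≠ k) (h : k ≠ l) (h' : k ≠ tau l), ∀ k0, ∃ j, ∃ m : ℤ, |m| = 1 ∧
      sbr (B.X (gamRoot K hk) k0 : Op K n) (B.X (gamNegRoot K hk hl h h') j)
        = m • (B.H i : Op K n) := by
  obtain ⟨d, hd⟩ := B.exists_hv_eq l
  obtain ⟨i, hi⟩ : ∃ i, d i ≠ 0 := by
    by_contra! h
    rw [Finset.sum_eq_zero fun i _ => by rw [h, zero_smul]] at hd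
    exact hv_ne_zero hl hd.symm
  refine ⟨i, fun k hk h h' k0 => ?_⟩
  obtain ⟨σ, hσ⟩ := B.exists_sigma (β := gamNegRoot K hk hl h h') hk rfl
  choose m hm1 hm using hσ k0
  suffices hj : ∃ j, σ j = i by
    obtain ⟨j, rfl⟩ := hj
    exact ⟨j, m j, hm1 j, hm j⟩
  by_contra! hc
  refine hi ?_
  obtain ⟨c0, hc0⟩ := rootSpace_gam_le hk (B.X_mem (gamRoot K hk) k0)
  have hc00 : c0 ≠ 0 := fun h0 => by
    rw [h0, zero_smul] at hc0
    have h1 := (linearIndependent_coe (B.X_indep (gamRoot K hk))).ne_zero k0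
    exact h1 hc0
  obtain ⟨a, ha⟩ := (Submodule.mem_span_range_iff_exists_fun K).1
    (B.X_span (gamNegRoot K hk hl h h') _ (ham_triple_mem (l := l) hk))
  have h1 : c0 • hv K l = ∑ j, (a j * m j) • (B.H (σ j) : Op K n) := by
    have h2 : ∀ y, c0 • sbr (pd K k) y = sbr (B.X (gamRoot K hk) k0 : Op K n) y := fun y => by
      rw [hc0, ← sbrL_apply (c0 • pd K k), map_smul, LinearMap.smul_apply, sbrL_apply]
    rw [← sbr_pd_triple (K := K) h h', h2, ← ha, ← sbrL_apply, map_sum]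
    refine Finset.sum_congr rfl fun j _ => ?_
    rw [map_smul, sbrL_apply, hm, mul_smul, Int.cast_smul_eq_zsmul]
  have h2 : ∑ i', (c0 * d i') • (B.H i' : Op K n)
      = ∑ i', (∑ j, if σ j = i' then a j * m j else 0) • (B.H i' : Op K n) := by
    have h3 : ∑ i', (c0 * d i') • (B.H i' : Op K n) = c0 • hv K l := by
      rw [← hd, Finset.smul_sum]
      exact Finset.sum_congr rfl fun i' _ => mul_smul _ _ _
    rw [h3, h1, Finset.sum_congr rfl fun i' _ => Finset.sum_smul, Finset.sum_comm]
    refine Finset.sum_congr rfl fun j _ => ?_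
    rw [Finset.sum_eq_single (σ j) (fun i' _ hi' => by rw [if_neg (Ne.symm hi'), zero_smul])
      (by simp), if_pos rfl]
  have h3 := eq_of_sum_smul_eq B.H_indep' h2 i
  rw [Finset.sum_eq_zero fun j _ => if_neg (hc j)] at h3
  exact (mul_eq_zero.1 h3).resolve_left hc00

theorem tau_val (i : Fin n) : (tau i).val = if i.val < n / 2 then n / 2 + i.val
    else if i.val < 2 * (n / 2) then i.val - n / 2 else i.val := by
  unfold tau
  split_ifs <;> rfl

theorem exists_pair_ne (hn : 4 ≤ n) (l : Fin n) : ∃ k : Fin n, tau k ≠ k ∧ k ≠ l ∧ k ≠ tau l := by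
  have hl := tau_val l
  by_cases h : l.val = 0 ∨ l.val = n / 2
  · refine ⟨⟨1, by omega⟩, ?_⟩
    have h1 := tau_val (⟨1, by omega⟩ : Fin n)
    rw [if_pos (show 1 < n / 2 by omega)] at h1
    simp only [ne_eq, Fin.ext_iff, h1]
    rw [hl]
    split_ifs <;> omega
  · refine ⟨⟨0, by omega⟩, ?_⟩
    have h1 := tau_val (⟨0, by omega⟩ : Fin n)
    rw [if_pos (show 0 < n / 2 by omega)] at h1
    simp only [ne_eq, Fin.ext_iff, h1]
    rw [hl]
    split_ifs <;> omega

/-- The classical root `ε_k - ε_l` of `H(n)`, with coroot `h_k - h_l`. -/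
theorem ChevalleyBasis.hv_sub_hv_mem (B : ChevalleyBasis K .H n) {k l : Fin n} (hk : tau k ≠ k)
    (hl : tau l ≠ l) (h : k ≠ l) (h' : k ≠ tau l) : hv K k - hv K l
      ∈ Submodule.span ℤ (Set.range fun i => (B.H i : Op K n)) := by
  have hF : ∀ k l : Fin n, xi K k * xi K (tau l)
      ∈ lamWeight K (Pi.single k 1 + Pi.single (tau l) 1 : Fin n → ℤ) := fun k l =>
    mul_mem_lamWeight (xi_mem_lamWeight _) (xi_mem_lamWeight _)
  have hS : ∀ k l : Fin n, xi K k * xi K (tau l)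
      ∈ hamSpace (wt K .H (Pi.single k 1 - Pi.single l 1)) := fun k l =>
    mem_hamSpace_wt (hF k l) (lamAug_xi_mul _ _)
      (fun i => by
        simp only [Pi.add_apply, Pi.sub_apply, single_tau, tau_tau]; ring)
      (by simp [Finset.sum_add_distrib])
  have hR : ∀ k l : Fin n, tau k ≠ k → k ≠ l → k ≠ tau l →
      ham K n (xi K k * xi K (tau l)) ∈ rootSpace K .H n (wt K .H (Pi.single k 1 - Pi.single l 1)) := by
    intro k l hk h h'
    have h'' : k ≠ tau l := h'
    refine ham_mem_rootSpace (hS k l) (ham_mem_Hn (hF k l) (k := k) ?_)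
    have e : tau k ≠ tau l := fun h1 => h (tau_injective h1)
    simp [hk, h', e, Pi.single_apply]
  have hlk : l ≠ tau k := fun h1 => h' (by rw [h1, tau_tau])
  have h0 : wt K .H (Pi.single l 1 - Pi.single k 1)
      = -wt K .H (Pi.single k 1 - Pi.single l 1 : Fin n → ℤ) := by
    rw [← wt_neg, neg_sub]
  have hwt := isHamWt_wt (K := K) (Pi.single k 1 - Pi.single l 1 : Fin n → ℤ)
  have hvk : wt K .H (Pi.single k 1 - Pi.single l 1 : Fin n → ℤ) (hvBar K k) = 1 := by
    rw [hwt.1]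
    simp [h, h.symm, hk, h', hlk.symm, Pi.single_apply]
  have hvl : wt K .H (Pi.single k 1 - Pi.single l 1 : Fin n → ℤ) (hvBar K l) = -1 := by
    rw [hwt.1]
    simp [h, h.symm, hl, h', hlk, h'.symm, Pi.single_apply]
  have hbr : sbr (ham K n (xi K k * xi K (tau l))) (ham K n (xi K l * xi K (tau k)))
      = hv K k - hv K l := by
    have hp : parInv K n (xi K k * xi K (tau l)) = xi K k * xi K (tau l) := by
      rw [parInv_mul, parInv_xi, parInv_xi, neg_mul_neg]
    have hx : ham K n (xi K k * xi K (tau l)) (xi K l * xi K (tau k))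
        = xi K l * xi K (tau l) - xi K k * xi K (tau k) := by
      rw [ham_apply, Finset.sum_eq_add k (tau l) h' (fun j _ hj => by
        rw [pd_xi_mul, pd_xi, if_neg hj.1, if_neg hj.2, mul_zero, sub_zero, zero_mul])
        (by simp) (by simp), tau_tau]
      simp only [pd_xi_mul, pd_xi, h'.symm, h', hlk.symm, hlk, if_true, if_false, mul_zero, sub_zero,
        zero_sub, mul_one, neg_mul]
      rw [mul_neg, xi_mul_xi (tau l) l, neg_neg, sub_eq_add_neg]
    rw [sbr_ham, hp, hx, map_sub, hv_eq_ham, hv_eq_ham]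
    abel
  have hne : ham K n (xi K k * xi K (tau l)) ≠ 0 := fun h1 => by
    rw [h1, sbr_zero_left] at hbr
    have h2 := congrArg (coefE K k) hbr
    rw [hv, hv, map_zero, map_sub, map_sub, map_sub, coefE_eop, coefE_eop, coefE_eop, coefE_eop,
      if_pos rfl, if_neg hk.symm, if_neg h, if_neg h'] at h2
    simp at h2
  let α : Root K .H n := ⟨wt K .H (Pi.single k 1 - Pi.single l 1), fun h1 => by
      rw [h1] at hvk; simp at hvk,
    fun h1 => hne ((Submodule.mem_bot K).1 (h1 ▸ hR k l hk h h'))⟩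
  have hα : α.IsClassical := Root.isClassical_of_isHamWt (A := _) (by
    have h1 : ∑ i, (Pi.single k 1 - Pi.single l 1 : Fin n → ℤ) i = 0 := by simp
    rw [h1] at hwt
    exact hwt)
  refine B.coroot_mem α hα (hvBar K k - hvBar K l) ⟨Submodule.subset_span
    ⟨_, hR k l hk h h', ham K n (xi K l * xi K (tau k)), ?_, hbr.symm⟩, ?_⟩
  · show _ ∈ rootSpace K .H n (-wt K .H (Pi.single k 1 - Pi.single l 1))
    rw [← h0]
    exact hR l k hl h.symm hlk
  · show wt K .H (Pi.single k 1 - Pi.single l 1) (hvBar K k - hvBar K l) = 2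
    have e := LinearMap.map_sub (wt K .H (Pi.single k 1 - Pi.single l 1 : Fin n → ℤ))
      (hvBar K k) (hvBar K l)
    rw [hvk, hvl] at e
    exact e.trans (by norm_num)

/-- If `±H_i` is a bracket of vectors for `-ε_k` and `ε_k`, then it does not involve `ξ_k ∂_k`: it
is the Hamiltonian vector field of a derivative by `ξ_k`. -/
theorem ChevalleyBasis.coefE_H_bracket (B : ChevalleyBasis K .H n) {k : Fin n} (hk : tau k ≠ k)
    {β : Root K .H n} {k0 j} {m : ℤ} {i} (hm : |m| = 1)
    (h : sbr (B.X (gamRoot K hk) k0 : Op K n) (B.X β j) = m • (B.H i : Op K n)) :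
    coefE K k (B.H i) = 0 := by
  obtain ⟨c0, hc0⟩ := rootSpace_gam_le hk (B.X_mem (gamRoot K hk) k0)
  obtain ⟨F, -, hF⟩ := exists_hamSpace_of_mem_rootSpace (B.X_mem β j)
  rw [hc0, hF, ← sbrL_apply, map_smul, LinearMap.smul_apply, sbrL_apply, sbr_pd_ham] at h
  have h1 := congrArg (coefE K k) h
  rw [map_smul, map_neg, coefE_ham, pd_pd (tau k) k, map_neg, pd_pd_self, neg_zero, map_zero,
    neg_zero, smul_zero, map_zsmul, zsmul_eq_mul] at h1
  refine (mul_eq_zero.1 h1.symm).resolve_left ?_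
  have : m ≠ 0 := by rintro rfl; simp at hm
  exact_mod_cast this

/-- For the type `H`, the `H_i` are the elements `±(ξ_l ∂_l - ξ_{τ l} ∂_{τ l})`. -/
theorem ChevalleyBasis.exists_H_eq (B : ChevalleyBasis K .H n) (hn : 4 ≤ n) {l : Fin n}
    (hl : tau l ≠ l) :
    ∀ (k : Fin n) (hk : tau k ≠ k) (h : k ≠ l) (h' : k ≠ tau l), ∀ k0, ∃ j, ∃ c : ℤ, |c| = 1 ∧
      sbr (B.X (gamRoot K hk) k0 : Op K n) (B.X (gamNegRoot K hk hl h h') j) = c • hv K l := by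
  have key : ∀ l : Fin n, tau l ≠ l → ∃ i, ∃ c : K, (B.H i : Op K n) = c • hv K l ∧
      ∀ (k : Fin n) (hk : tau k ≠ k) (hl : tau l ≠ l) (h : k ≠ l) (h' : k ≠ tau l), ∀ k0, ∃ j,
        ∃ m : ℤ, |m| = 1 ∧
      sbr (B.X (gamRoot K hk) k0 : Op K n) (B.X (gamNegRoot K hk hl h h') j)
        = m • (B.H i : Op K n) := by
    intro l hl
    obtain ⟨i, hi⟩ := B.exists_H_bracket hl
    refine ⟨i, _, eq_smul_hv (B.H_mem i) hl fun k hk h h' => ?_, fun k hk _ h h' k0 => hi k hk h h' k0⟩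
    obtain ⟨k0⟩ := B.nonempty_mult (gamRoot K hk)
    obtain ⟨j, m, hm, hj⟩ := hi k hk h h' k0
    exact B.coefE_H_bracket hk hm hj
  obtain ⟨i, c, hi, hbr⟩ := key l hl
  obtain ⟨k, hk, h, h'⟩ := exists_pair_ne hn l
  obtain ⟨i', c', hi', -⟩ := key k hk
  have hne : ∀ i, (B.H i : Op K n) ≠ 0 := fun i => B.H_indep'.ne_zero i
  have hc0 : c ≠ 0 := fun h0 => hne i (by rw [hi, h0, zero_smul])
  have hc0' : c' ≠ 0 := fun h0 => hne i' (by rw [hi', h0, zero_smul])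
  have hii' : i ≠ i' := by
    rintro rfl
    have h1 := congrArg (coefE K k) (hi.symm.trans hi')
    rw [hv, hv, map_smul, map_smul, map_sub, map_sub, coefE_eop, coefE_eop, coefE_eop, coefE_eop,
      if_pos rfl, if_neg hk.symm, if_neg h, if_neg h'] at h1
    simp at h1
    exact hc0' h1.symm
  -- `c` is an integer because `-c` is a value of the root `-ε_l`.
  obtain ⟨m, hm⟩ := B.H_int (gamRoot K hl) i
  have hcm : c = ((-m : ℤ) : K) := by
    have h1 : (⟨(B.H i : Op K n), cartan_le_cartanBar K .H n (B.H_mem i)⟩ : cartanBar K .H n)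
        = c • hvBar K l := Subtype.ext hi
    rw [h1, map_smul, show (gamRoot K hl).1 = gam K l from rfl, gam_hvBar hl] at hm
    rw [Int.cast_neg, ← hm]
    simp
  -- Its inverse is an integer because of the coroot `h_k - h_l`.
  obtain ⟨z, hz⟩ := (Submodule.mem_span_range_iff_exists_fun ℤ).1 (B.hv_sub_hv_mem hk hl h h')
  have hzc : (z i : K) = -c⁻¹ := by
    have h1 : ∑ j, (z j : K) • (B.H j : Op K n)
        = ∑ j, ((if j = i' then c'⁻¹ else 0) + if j = i then -c⁻¹ else 0) • (B.H j : Op K n) := by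
      have h2 : ∑ j, (z j : K) • (B.H j : Op K n) = hv K k - hv K l := by
        rw [← hz]
        exact Finset.sum_congr rfl fun j _ =>
          Int.cast_smul_eq_zsmul (M := Op K n) K (z j) (B.H j : Op K n)
      have h3 : ∀ (M : Type _) [AddCommGroup M] [Module K M] (v : Fin (CartanType.rank .H n) → M),
          ∑ j, ((if j = i' then c'⁻¹ else 0) + if j = i then -c⁻¹ else 0) • v j
            = c'⁻¹ • v i' - c⁻¹ • v i := by
        intro M _ _ v
        simp [add_smul, Finset.sum_add_distrib, ite_smul, sub_eq_add_neg]
      refine h2.trans (Eq.trans ?_ (h3 (Op K n) fun j => (B.H j : Op K n)).symm)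
      rw [hi, hi', smul_smul, smul_smul, inv_mul_cancel₀ hc0, inv_mul_cancel₀ hc0', one_smul,
        one_smul]
    have h4 := eq_of_sum_smul_eq B.H_indep' h1 i
    rwa [if_neg hii', if_pos rfl, zero_add] at h4
  have hunit : m * z i = 1 := by
    have h1 : ((m * z i : ℤ) : K) = 1 := by
      have h2 : (m : K) = -c := by rw [hcm]; simp
      rw [Int.cast_mul, hzc, h2, neg_mul_neg, mul_inv_cancel₀ hc0]
    exact_mod_cast h1
  have hm1 : |m| = 1 := Int.isUnit_iff_abs_eq.1 (IsUnit.of_mul_eq_one _ hunit)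
  have hHi : (B.H i : Op K n) = (-m) • hv K l := by
    rw [hi, hcm]
    exact Int.cast_smul_eq_zsmul (M := Op K n) K (-m) (hv K l)
  intro k hk h h' k0
  obtain ⟨j, e, he, hj⟩ := hbr k hk hl h h' k0
  refine ⟨j, e * -m, by rw [abs_mul, abs_neg, he, hm1, one_mul], ?_⟩
  rw [hj, hHi]
  exact (mul_smul e (-m) (hv K l)).symm

end HamiltonianCartanBasis

/-! ### Even nonclassical root vectors of `H(n)` -/

section HamiltonianGood

variable {K : Type*} [Field K] [CharZero K] {n : ℕ}

/-- A lattice that is stable under commuting idempotents is spanned by joint eigenvectors. -/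
theorem le_closure_joint_idempotents {V ι : Type*} [AddCommGroup V] [Finite ι]
    (T : ι → V →+ V) (hcomm : ∀ i j v, T i (T j v) = T j (T i v))
    (hidem : ∀ i v, T i (T i v) = T i v) {M : AddSubgroup V} (hM : ∀ i, ∀ v ∈ M, T i v ∈ M) :
    M ≤ AddSubgroup.closure {v | v ∈ M ∧ ∀ i, T i v = v ∨ T i v = 0} := by
  classical
  cases nonempty_fintype ι
  have key : ∀ s : Finset ι, ∀ v ∈ M, (∀ i ∉ s, T i v = v ∨ T i v = 0) →
      v ∈ AddSubgroup.closure {v | v ∈ M ∧ ∀ i, T i v = v ∨ T i v = 0} := by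
    intro s
    induction s using Finset.induction_on with
    | empty =>
      exact fun v hv hs => AddSubgroup.subset_closure ⟨hv, fun i => hs i (Finset.notMem_empty i)⟩
    | insert j s hj ih =>
      intro v hv hs
      have h1 : v = T j v + (v - T j v) := (add_sub_cancel _ _).symm
      rw [h1]
      refine add_mem (ih _ (hM j v hv) fun i hi => ?_) (ih _ (sub_mem hv (hM j v hv)) fun i hi => ?_)
      · rcases eq_or_ne i j with rfl | hij
        · exact Or.inl (hidem i v)
        · rcases hs i (by simp [hij, hi]) with h | h
          · left; rw [hcomm, h]
          · right; rw [hcomm, h, map_zero]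
      · rcases eq_or_ne i j with rfl | hij
        · right; rw [map_sub, hidem, sub_self]
        · rcases hs i (by simp [hij, hi]) with h | h
          · left; rw [map_sub, hcomm, h]
          · right; rw [map_sub, hcomm, h, map_zero, sub_zero]
  exact fun v hv => key Finset.univ v hv fun i hi => absurd (Finset.mem_univ i) hi

theorem lamAug_eq_zero_of_euler {f : Lam K n} {c : K} (hc : c ≠ 0) (h : euler K n f = c • f) :
    lamAug K n f = 0 := by
  have h1 := congrArg (lamAug K n) h
  rw [euler_apply, map_sum, Finset.sum_eq_zero fun k _ => lamAug_eop k f, map_smul, eq_comm,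
    smul_eq_zero] at h1
  exact h1.resolve_left hc

/-- The Hamiltonian of a vector `u` of weight `ε_k` with `[∂_k, u]` proportional to
`ξ_l ∂_l - ξ_{τ l} ∂_{τ l}`. -/
theorem eq_triple {k l : Fin n} (hk : tau k ≠ k) {U : Lam K n}
    (hU : U ∈ hamSpace (-gam K k)) {c0 c : K}
    (h : c0 • sbr (pd K k) (ham K n U) = c • hv K l) :
    c0 • U = c • (xi K k * (xi K l * xi K (tau l))) := by
  have hwt := (isHamWt_wt (K := K) (-Pi.single k 1 : Fin n → ℤ)).neg
  have h1 : hamSpace (-gam K k) ≤ LinearMap.eqLocus (eop K k) LinearMap.id := by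
    refine hamSpace_le fun b hb hb' F _ hF => ?_
    have h2 := congrFun (hb'.unique hwt).1 k
    simp only [Pi.neg_apply, Pi.single_eq_same, Pi.single_eq_of_ne hk] at h2
    have h3 := hb k
    have h4 := hb (tau k)
    exact (eq_xi_mul_pd hF (k := k) (by omega)).symm
  have h2 : xi K k * pd K k U = U := h1 hU
  have h3 : euler K n (pd K k U) = (2 : K) • pd K k U := by
    have h4 := congrArg (pd K k) hU.2.2
    have h5 : (-gam K k) (eulerBar K n) = 1 := by
      rw [gam, hwt.2]; simp
    rw [pd_euler, map_smul, h5] at h4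
    have h6 : euler K n (pd K k U) = (1 + 2 : K) • pd K k U - pd K k U := by
      rw [← h4]; abel
    rw [h6]
    module
  have h4 : c0 • pd K k U = c • (xi K l * xi K (tau l)) := by
    refine sub_eq_zero.1 (ham_eq_zero ?_ ?_)
    · rw [sbr_pd_ham, hv_eq_ham, smul_neg, smul_neg, neg_inj] at h
      rw [map_sub, map_smul, map_smul, h, sub_self]
    · rw [map_sub, map_smul, map_smul, lamAug_eq_zero_of_euler two_ne_zero h3, lamAug_xi_mul,
        smul_zero, smul_zero, sub_zero]
  rw [← h2, ← mul_smul_comm, h4, mul_smul_comm]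

variable (K) in
/-- The operator `ξ_l ξ_{τ l} ∂_{τ k} ∂_k` that moves a pair of indices. -/
def movePair (k l : Fin n) : Op K n :=
  LinearMap.mulLeft K (xi K l * xi K (tau l)) * (pd K (tau k) * pd K k)

theorem movePair_apply (k l : Fin n) (F : Lam K n) :
    movePair K k l F = xi K l * (xi K (tau l) * pd K (tau k) (pd K k F)) :=
  mul_assoc (xi K l) (xi K (tau l)) _

theorem eop_pd_of_ne {k l : Fin n} (h : k ≠ l) (F : Lam K n) :
    eop K l (pd K k F) = pd K k (eop K l F) := eop_pd h.symm F

/-- The Hamiltonian vector field of `ξ_k ξ_l ξ_{τ l}`, applied to `∂_k F`: the pair of `k` is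
replaced by the pair of `l`, and the remaining term vanishes if `F` has weight `0` for `ξ_l ∂_l - ξ_{τ l} ∂_{τ l}`. -/
theorem ham_triple_apply {k l : Fin n} (hl : tau l ≠ l) (h : k ≠ l)
    (h' : k ≠ tau l) {F : Lam K n} (hF : hv K l F = 0) :
    ham K n (xi K k * (xi K l * xi K (tau l))) (pd K k F) = movePair K k l F := by
  have h1 : ham K n (xi K k * (xi K l * xi K (tau l))) (pd K k F)
      = movePair K k l F + xi K k * hv K l (pd K k F) := by
    rw [ham_apply, ← Finset.sum_erase_add _ _ (Finset.mem_univ k), pd_triple h h',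
      Finset.sum_eq_add l (tau l) hl.symm, tau_tau, movePair_apply, mul_assoc, hv_apply, eop_apply,
      eop_apply]
    · simp only [pd_xi_mul, pd_xi, h.symm, h'.symm, hl, hl.symm, if_true, if_false, mul_zero,
        sub_zero, zero_sub, mul_one, neg_mul, mul_neg, mul_sub, mul_assoc]
      abel
    · intro j hj hj'
      have hjk := Finset.ne_of_mem_erase hj
      simp [pd_xi_mul, pd_xi, hjk, hj'.1, hj'.2]
    · intro h2
      exact absurd (Finset.mem_erase.2 ⟨h.symm, Finset.mem_univ _⟩) h2
    · intro h2
      exact absurd (Finset.mem_erase.2 ⟨h'.symm, Finset.mem_univ _⟩) h2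
  rw [h1, hv_apply, eop_pd_of_ne h, eop_pd_of_ne h', ← map_sub, ← hv_apply, hF, map_zero, mul_zero,
    add_zero]

/-- The operators `movePair` preserve the lattice of an even root that vanishes on
`ξ_l ∂_l - ξ_{τ l} ∂_{τ l}`: up to sign they are `ad X_{ε_k} ∘ ad X_{-ε_k}`, where the bracket of the
two vectors is `±(ξ_l ∂_l - ξ_{τ l} ∂_{τ l})`. -/
theorem ChevalleyBasis.movePair_mem (B : ChevalleyBasis K .H n) (hn : 4 ≤ n) {α : Root K .H n}
    (hα : α.IsEven) {k l : Fin n} (hk : tau k ≠ k) (hl : tau l ≠ l) (h : k ≠ l) (h' : k ≠ tau l)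
    (hαl : α.1 (hvBar K l) = 0) {F : Lam K n} (hF : F ∈ hamSpace α.1)
    (hF' : ham K n F ∈ B.lat α.1) :
    movePair K k l F ∈ hamSpace α.1 ∧ ham K n (movePair K k l F) ∈ B.lat α.1 := by
  have hmem : ham K n (movePair K k l F) ∈ B.lat α.1 := by
    obtain ⟨k0⟩ := B.nonempty_mult (gamRoot K hk)
    obtain ⟨j, c, hc, hj⟩ := B.exists_H_eq hn hl k hk h h' k0
    obtain ⟨c0, hc0⟩ := rootSpace_gam_le hk (B.X_mem (gamRoot K hk) k0)
    obtain ⟨U, hU, hUj⟩ := exists_hamSpace_of_mem_rootSpace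
      (B.X_mem (gamNegRoot K hk hl h h') j)
    have hv' : ∀ y, sbr (B.X (gamRoot K hk) k0 : Op K n) y = c0 • sbr (pd K k) y := fun y => by
      rw [hc0, ← sbrL_apply (c0 • pd K k), map_smul, LinearMap.smul_apply, sbrL_apply]
    have h1 : c0 • U = (c : K) • (xi K k * (xi K l * xi K (tau l))) := by
      refine eq_triple hk hU ?_
      rw [hUj, hv'] at hj
      rw [hj]
      exact (Int.cast_smul_eq_zsmul (M := Op K n) K c _).symm
    have h2 : sbr (B.X (gamNegRoot K hk hl h h') j : Op K n)
        (sbr (B.X (gamRoot K hk) k0 : Op K n) (ham K n F)) = c • ham K n (movePair K k l F) := by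
      rw [hv', sbr_pd_ham, hUj, sbr_smul_right, ← sbrL_apply, map_neg, sbrL_apply, sbr_ham,
        ← map_neg, ← LinearMap.neg_apply, ← map_neg (ham K n), ← map_smul, ← LinearMap.smul_apply,
        ← map_smul (ham K n), smul_neg, ← map_smul (parInv K n), h1, map_smul, parInv_mul,
        parInv_mul, parInv_xi, parInv_xi, parInv_xi, neg_mul_neg, neg_mul, smul_neg, neg_neg,
        map_smul, LinearMap.smul_apply, ham_triple_apply hl h h' ?_, map_smul]
      · exact Int.cast_smul_eq_zsmul (M := Op K n) K c _
      · rw [hF.2.1, hαl, zero_smul]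
    have hodd : gam K k + α.1 ≠ 0 := by
      obtain ⟨A, d, hA⟩ := α.exists_isHamWt
      intro h0
      have h3 := ((isHamWt_wt (K := K) (-Pi.single k 1 : Fin n → ℤ)).add hA).unique
        (h0 ▸ IsHamWt.zero)
      obtain ⟨m, hm⟩ := hα.deg_even hn hA
      have h4 := h3.2
      simp at h4
      omega
    have h3 : sbr (B.X (gamNegRoot K hk hl h h') j : Op K n)
        (sbr (B.X (gamRoot K hk) k0 : Op K n) (ham K n F)) ∈ B.lat (-gam K k + (gam K k + α.1)) :=
      B.sbr_mem_lat (t := .H) hn (by rw [neg_add_cancel_left]; exact α.2.1)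
        (B.X_mem_lat (gamNegRoot K hk hl h h') j)
        (B.sbr_mem_lat (t := .H) hn hodd (B.X_mem_lat (gamRoot K hk) k0) hF')
    rw [neg_add_cancel_left, h2] at h3
    rcases (abs_eq (zero_le_one' ℤ)).1 hc with rfl | rfl
    · rwa [one_zsmul] at h3
    · rw [neg_one_zsmul] at h3
      exact neg_mem_iff.1 h3
  refine ⟨?_, hmem⟩
  obtain ⟨F', hF1, hF2⟩ := exists_hamSpace_of_mem_rootSpace (B.lat_le_rootSpace _ hmem)
  rw [sub_eq_zero.1 (ham_eq_zero (F := movePair K k l F - F') (by rw [map_sub, hF2, sub_self])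
    (by rw [map_sub, hF1.1, sub_zero, movePair_apply, lamAug_xi_mul]))]
  exact hF1

variable (K) in
/-- The projection onto the span of the monomials that contain the pair of `k` and avoid the pair
of `l`. -/
def pairProj (k l : Fin n) : Op K n := movePair K l k * movePair K k l

theorem pairProj_of_mem_lamWeight {k l : Fin n} (hk : tau k ≠ k) (hl : tau l ≠ l) (h : k ≠ l)
    (h' : k ≠ tau l) {b : Fin n → ℤ} {F : Lam K n} (hF : F ∈ lamWeight K b) :
    pairProj K k l F
      = ((b k * b (tau k) * ((1 - b l) * (1 - b (tau l))) : ℤ) : K) • F := by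
  have hlk : tau l ≠ k := h'.symm
  have hkl : tau k ≠ l := fun h1 => h' (by rw [← h1, tau_tau])
  have hkl' : tau k ≠ tau l := fun h1 => h (tau_injective h1)
  have e1 : pairProj K k l F = xi K k * (xi K (tau k) * pd K (tau l) (pd K l
      (xi K l * (xi K (tau l) * pd K (tau k) (pd K k F))))) := by
    show movePair K l k (movePair K k l F) = _
    rw [movePair_apply, movePair_apply]
  by_cases h0 : F = 0
  · rw [h0, map_zero, smul_zero]
  have hb := lamWeight_eq hF h0
  have hG := pd_mem_lamWeight (pd_mem_lamWeight hF k) (tau k)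
  rcases hb k with h1 | h1
  · rw [e1, pd_eq_zero hF h1]; simp [h1]
  rcases hb (tau k) with h2 | h2
  · rw [e1, pd_pd (tau k) k, pd_eq_zero hF h2]; simp [h2]
  have e2 : ∀ m, m ≠ k → m ≠ tau k → ∀ f, eop K m (pd K (tau k) (pd K k f))
      = pd K (tau k) (pd K k (eop K m f)) := fun m hm hm' f => by
    rw [eop_pd hm', eop_pd hm]
  have e3 : xi K k * (xi K (tau k) * pd K (tau k) (pd K k F)) = F := by
    have h3 := eq_xi_mul_pd hF h1
    have h4 := eq_xi_mul_pd (pd_mem_lamWeight hF k) (k := tau k) (by simp [hk, h2])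
    rw [← h4, ← h3]
  have e4 : pd K (tau l) (pd K l (xi K l * (xi K (tau l) * pd K (tau k) (pd K k F))))
      = (((1 - b l) * (1 - b (tau l)) : ℤ) : K) • pd K (tau k) (pd K k F) := by
    have h5 : ∀ m, m ≠ k → m ≠ tau k → eop K m (pd K (tau k) (pd K k F))
        = (b m : K) • pd K (tau k) (pd K k F) := fun m hm hm' => by
      rw [e2 m hm hm', hF m, map_smul, map_smul]
    have h6 : ∀ (m : Fin n) (f : Lam K n), pd K m (xi K m * f) = f - eop K m f := fun m f => by
      rw [pd_xi_mul, if_pos rfl, eop_apply]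
    rw [h6, eop_xi_mul hl.symm, h5 l h.symm hkl.symm, ← mul_sub, h6, map_sub, map_smul,
      h5 _ hlk hkl'.symm]
    push_cast
    module
  rw [e1, e4, mul_smul_comm, mul_smul_comm, e3, h1, h2, one_mul, one_mul]

/-- The pairs of distinct pairs of indices on which `α` vanishes. -/
def ZeroPairs (α : Root K .H n) : Type :=
  {p : Fin n × Fin n // tau p.1 ≠ p.1 ∧ tau p.2 ≠ p.2 ∧ p.1 ≠ p.2 ∧ p.1 ≠ tau p.2 ∧
    α.1 (hvBar K p.1) = 0 ∧ α.1 (hvBar K p.2) = 0}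

instance (α : Root K .H n) : Finite (ZeroPairs α) := Subtype.finite

theorem ChevalleyBasis.pairProj_mem (B : ChevalleyBasis K .H n) (hn : 4 ≤ n) {α : Root K .H n}
    (hα : α.IsEven) (p : ZeroPairs α) {F : Lam K n} (hF : F ∈ hamSpace α.1)
    (hF' : ham K n F ∈ B.lat α.1) :
    pairProj K p.1.1 p.1.2 F ∈ hamSpace α.1 ∧ ham K n (pairProj K p.1.1 p.1.2 F) ∈ B.lat α.1 := by
  obtain ⟨⟨k, l⟩, hk, hl, h, h', h0, h1⟩ := p
  obtain ⟨h2, h3⟩ := B.movePair_mem hn hα hk hl h h' h1 hF hF'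
  exact B.movePair_mem hn hα hl hk h.symm (fun h4 => h' (by rw [h4, tau_tau])) h0 h2 h3

theorem zero_or_one_mul (k l k' l' : ℤ) (hk : k = 0 ∨ k = 1) (hk' : k' = 0 ∨ k' = 1)
    (hl : l = 0 ∨ l = 1) (hl' : l' = 0 ∨ l' = 1) :
    k * k' * ((1 - l) * (1 - l')) = 0 ∨ k * k' * ((1 - l) * (1 - l')) = 1 := by
  rcases hk with rfl | rfl <;> rcases hk' with rfl | rfl <;> rcases hl with rfl | rfl <;>
    rcases hl' with rfl | rfl <;> simp

theorem pairProj_idem {α : Root K .H n} (p : ZeroPairs α) (F : Lam K n) :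
    pairProj K p.1.1 p.1.2 (pairProj K p.1.1 p.1.2 F) = pairProj K p.1.1 p.1.2 F := by
  obtain ⟨⟨k, l⟩, hk, hl, h, h', h0, h1⟩ := p
  have h2 : (⊤ : Submodule K (Lam K n)) ≤
      LinearMap.eqLocus (pairProj K k l * pairProj K k l) (pairProj K k l) := by
    refine lam_le_of_weights (fun _ _ _ => trivial) fun b f _ hf => ?_
    by_cases hf0 : f = 0
    · rw [hf0]; exact zero_mem _
    have hb := lamWeight_eq hf hf0
    show pairProj K k l (pairProj K k l f) = pairProj K k l f
    rw [pairProj_of_mem_lamWeight hk hl h h' hf, map_smul,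
      pairProj_of_mem_lamWeight hk hl h h' hf]
    rcases zero_or_one_mul (b k) (b l) (b (tau k)) (b (tau l)) (hb _) (hb _) (hb _) (hb _)
      with e | e <;> rw [e] <;> simp
  exact h2 (show F ∈ ⊤ from trivial)

theorem pairProj_comm {α : Root K .H n} (p q : ZeroPairs α) (F : Lam K n) :
    pairProj K p.1.1 p.1.2 (pairProj K q.1.1 q.1.2 F)
      = pairProj K q.1.1 q.1.2 (pairProj K p.1.1 p.1.2 F) := by
  obtain ⟨⟨k, l⟩, hk, hl, h, h', -, -⟩ := p
  obtain ⟨⟨i, j⟩, hi, hj, e, e', -, -⟩ := q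
  have h2 : (⊤ : Submodule K (Lam K n)) ≤ LinearMap.eqLocus (pairProj K k l * pairProj K i j)
      (pairProj K i j * pairProj K k l) := by
    refine lam_le_of_weights (fun _ _ _ => trivial) fun b f _ hf => ?_
    show pairProj K k l (pairProj K i j f) = pairProj K i j (pairProj K k l f)
    rw [pairProj_of_mem_lamWeight hk hl h h' hf, pairProj_of_mem_lamWeight hi hj e e' hf,
      map_smul, map_smul, pairProj_of_mem_lamWeight hk hl h h' hf,
      pairProj_of_mem_lamWeight hi hj e e' hf, smul_comm]
  exact h2 (show F ∈ ⊤ from trivial)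

theorem eop_pairProj {α : Root K .H n} (p : ZeroPairs α) (i : Fin n) (F : Lam K n) :
    pairProj K p.1.1 p.1.2 (eop K i F) = eop K i (pairProj K p.1.1 p.1.2 F) := by
  obtain ⟨⟨k, l⟩, hk, hl, h, h', -, -⟩ := p
  have h2 : (⊤ : Submodule K (Lam K n)) ≤ LinearMap.eqLocus (pairProj K k l * eop K i)
      (eop K i * pairProj K k l) := by
    refine lam_le_of_weights (fun _ _ _ => trivial) fun b f _ hf => ?_
    show pairProj K k l (eop K i f) = eop K i (pairProj K k l f)
    rw [pairProj_of_mem_lamWeight hk hl h h' hf, hf i, map_smul, map_smul,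
      pairProj_of_mem_lamWeight hk hl h h' hf, hf i, smul_comm]
  exact h2 (show F ∈ ⊤ from trivial)

/-- The weights of a given Hamiltonian space are separated by the operators `pairProj`. -/
theorem eq_of_pairProj_eq {α : Root K .H n} {b c : Fin n → ℤ} (hb : ∀ k, b k = 0 ∨ b k = 1)
    (hc : ∀ k, c k = 0 ∨ c k = 1) (hαb : IsHamWt α.1 (fun k => b k - b (tau k)) (∑ k, b k - 2))
    (hαc : IsHamWt α.1 (fun k => c k - c (tau k)) (∑ k, c k - 2))
    (h : ∀ p : ZeroPairs α, b p.1.1 * b (tau p.1.1) * ((1 - b p.1.2) * (1 - b (tau p.1.2)))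
      = c p.1.1 * c (tau p.1.1) * ((1 - c p.1.2) * (1 - c (tau p.1.2)))) : b = c := by
  obtain ⟨h1, h2⟩ := hαb.unique hαc
  have h3 : ∀ k, b (tau k) - c (tau k) = b k - c k := fun k => by
    have : b k - b (tau k) = c k - c (tau k) := congrFun h1 k
    omega
  have h4 : ∑ k, (b k - c k) = 0 := by rw [Finset.sum_sub_distrib]; omega
  have hfix : ∀ k, tau k = k → b k = c k := by
    intro k hk
    have h5 := sum_eq_of_tau_invariant (b := fun k => b k - c k) h3 hk
    rw [h4, Int.cast_zero, eq_comm, ZMod.intCast_eq_zero_iff_even] at h5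
    obtain ⟨m, hm⟩ := h5
    have := hb k
    have := hc k
    omega
  by_contra hne
  -- Two distinct weights differ by the exchange of some pairs of indices.
  obtain ⟨k, hk⟩ : ∃ k, 0 < b k - c k := by
    by_contra! h5
    have h6 := (Finset.sum_eq_zero_iff_of_nonpos fun k _ => h5 k).1 h4
    exact hne (funext fun k => sub_eq_zero.1 (h6 k (Finset.mem_univ k)))
  obtain ⟨l, hl⟩ : ∃ l, b l - c l < 0 := by
    by_contra! h5
    have h6 := (Finset.sum_eq_zero_iff_of_nonneg fun k _ => h5 k).1 h4
    exact hne (funext fun k => sub_eq_zero.1 (h6 k (Finset.mem_univ k)))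
  have hbk := hb k
  have hck := hc k
  have hbl := hb l
  have hcl := hc l
  have hbk' := hb (tau k)
  have hck' := hc (tau k)
  have hbl' := hb (tau l)
  have hcl' := hc (tau l)
  have h3k := h3 k
  have h3l := h3 l
  have e1 : b k = 1 ∧ b (tau k) = 1 ∧ c k = 0 ∧ c (tau k) = 0 := by omega
  have e2 : b l = 0 ∧ b (tau l) = 0 ∧ c l = 1 ∧ c (tau l) = 1 := by omega
  have h5 := h ⟨(k, l), fun h6 => by have := hfix k h6; omega, fun h6 => by have := hfix l h6; omega,
    fun h6 => by have h7 : k = l := h6; subst h7; omega,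
    fun h6 => by have h7 : k = tau l := h6; rw [← h7] at e2; omega,
    by rw [hαb.1]; simp [e1.1, e1.2.1], by rw [hαb.1]; simp [e2.1, e2.2.1]⟩
  dsimp only at h5
  rw [e1.1, e1.2.1, e1.2.2.1, e1.2.2.2, e2.1, e2.2.1] at h5
  omega

/-- A joint eigenvector of the operators `pairProj` in a Hamiltonian space is a weight vector. -/
theorem exists_lamWeight_of_pairProj {α : Root K .H n} {F : Lam K n} (hF : F ∈ hamSpace α.1)
    (h : ∀ p : ZeroPairs α, pairProj K p.1.1 p.1.2 F = F ∨ pairProj K p.1.1 p.1.2 F = 0)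
    (h0 : F ≠ 0) : ∃ b, F ∈ lamWeight K b ∧ (∀ k, b k = 0 ∨ b k = 1) ∧
      IsHamWt α.1 (fun k => b k - b (tau k)) (∑ k, b k - 2) := by
  have h1 : ∀ p : ZeroPairs α, ∃ s : K, pairProj K p.1.1 p.1.2 F = s • F := fun p => by
    rcases h p with h | h
    · exact ⟨1, by rw [h, one_smul]⟩
    · exact ⟨0, by rw [h, zero_smul]⟩
  choose s hs using h1
  let M : Submodule K (Lam K n) := hamSpace α.1 ⊓
    ⨅ p : ZeroPairs α, LinearMap.eqLocus (pairProj K p.1.1 p.1.2) (s p • LinearMap.id)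
  have hM : ∀ f, f ∈ M ↔ f ∈ hamSpace α.1 ∧ ∀ p, pairProj K p.1.1 p.1.2 f = s p • f := fun f => by
    rw [Submodule.mem_inf, Submodule.mem_iInf]; rfl
  have hstab : ∀ k, ∀ f ∈ M, eop K k f ∈ M := by
    intro k f hf
    rw [hM] at hf ⊢
    exact ⟨eop_mem_hamSpace k hf.1, fun p => by rw [eop_pairProj, hf.2, map_smul]⟩
  have hFM : F ∈ M := (hM F).2 ⟨hF, hs⟩
  obtain ⟨c, g, hg, hgc, hg0⟩ : ∃ c, ∃ g ∈ M, g ∈ lamWeight K c ∧ g ≠ 0 := by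
    by_contra! hc
    have h2 : M ≤ ⊥ := lam_le_of_weights hstab fun b f hf hfb => by
      rw [hc b f hf hfb]; exact zero_mem _
    exact h0 ((Submodule.mem_bot K).1 (h2 hFM))
  have hval : ∀ b f, f ∈ M → f ∈ lamWeight K b → f ≠ 0 → ∀ p : ZeroPairs α,
      ((b p.1.1 * b (tau p.1.1) * ((1 - b p.1.2) * (1 - b (tau p.1.2))) : ℤ) : K) = s p := by
    intro b f hf hfb hf0 p
    have h2 := ((hM f).1 hf).2 p
    rw [pairProj_of_mem_lamWeight p.2.1 p.2.2.1 p.2.2.2.1 p.2.2.2.2.1 hfb] at h2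
    exact smul_left_injective K hf0 h2
  refine ⟨c, ?_, lamWeight_eq hgc hg0, isHamWt_of_mem_lamWeight ((hM g).1 hg).1 hg0 hgc⟩
  have h2 : M ≤ lamWeight K c := by
    refine lam_le_of_weights hstab fun b f hf hfb => ?_
    by_cases hf0 : f = 0
    · rw [hf0]; exact zero_mem _
    have h3 : b = c := eq_of_pairProj_eq (lamWeight_eq hfb hf0) (lamWeight_eq hgc hg0)
      (isHamWt_of_mem_lamWeight ((hM f).1 hf).1 hf0 hfb)
      (isHamWt_of_mem_lamWeight ((hM g).1 hg).1 hg0 hgc) fun p => by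
        have h4 := (hval b f hf hfb hf0 p).trans (hval c g hg hgc hg0 p).symm
        exact_mod_cast h4
    rwa [← h3]
  exact h2 hFM

/-- For the type `H`, the lattice of an even nonclassical root is spanned by elements `x` with
`(ad x)² = 0`, namely by Hamiltonian vector fields of weight vectors for the full torus. -/
theorem ChevalleyBasis.lat_le_good_H (B : ChevalleyBasis K .H n) (hn : 4 ≤ n) {α : Root K .H n}
    (hα : α.IsEven) (hc : ¬ α.IsClassical) :
    B.lat α.1 ≤ AddSubgroup.closure {x | x ∈ B.lat α.1 ∧ ∀ y ∈ Hn K n, sbr x (sbr x y) = 0} := by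
  obtain ⟨A, d, hA⟩ := α.exists_isHamWt
  have hd := hα.deg_even hn hA
  have hd2 : 2 ≤ d := by
    have h1 := hA.neg_one_le α.2.2
    obtain ⟨m, hm⟩ := hd
    have h2 : d ≠ 0 := by
      rintro rfl
      exact hc (Root.isClassical_of_isHamWt hA)
    omega
  let M : AddSubgroup (Lam K n) :=
    (hamSpace α.1).toAddSubgroup ⊓ (B.lat α.1).comap (ham K n).toAddMonoidHom
  have hM : ∀ f, f ∈ M ↔ f ∈ hamSpace α.1 ∧ ham K n f ∈ B.lat α.1 := fun f => Iff.rfl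
  have h1 := le_closure_joint_idempotents (M := M)
    (fun p : ZeroPairs α => (pairProj K p.1.1 p.1.2).toAddMonoidHom) pairProj_comm pairProj_idem
    fun p f hf => B.pairProj_mem hn hα p hf.1 hf.2
  intro x hx
  obtain ⟨F, hF, rfl⟩ := exists_hamSpace_of_mem_rootSpace (B.lat_le_rootSpace _ hx)
  have h2 := h1 ((hM F).2 ⟨hF, hx⟩)
  refine AddSubgroup.closure_induction (p := fun f _ => ham K n f ∈ AddSubgroup.closure
    {x | x ∈ B.lat α.1 ∧ ∀ y ∈ Hn K n, sbr x (sbr x y) = 0}) ?_ ?_ ?_ ?_ h2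
  · rintro f ⟨hf, hf'⟩
    refine AddSubgroup.subset_closure ⟨hf.2, fun y hy => ?_⟩
    by_cases hf0 : f = 0
    · rw [hf0, map_zero, sbr_zero_left]
    obtain ⟨b, hfb, hb, hb'⟩ := exists_lamWeight_of_pairProj hf.1 hf' hf0
    obtain ⟨G, rfl⟩ := mem_Htn_iff.1 (Hn_le_Htn hy)
    have h3 := (hb'.unique hA).2
    rw [sbr_ham, sbr_ham, parInv_of_hamSpace hA hd hf.1, ham_ham_eq_zero hfb hb (by omega),
      map_zero]
  · rw [map_zero]; exact zero_mem _
  · intro a b _ _ ha hb; rw [map_add]; exact add_mem ha hb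
  · intro a _ ha; rw [map_neg]; exact neg_mem ha

end HamiltonianGood

/-! ### Uniform facts on roots -/

section Uniform

variable {K : Type*} [Field K] [CharZero K] {n : ℕ} {t : CartanType}

theorem Root.IsClassical.string (_hn : t.Admissible n) {α β : Root K t n} (hα : α.IsClassical) :
    2 • α.1 + β.1 ≠ 0 ∧ 3 • α.1 + β.1 ≠ 0 ∧ rootSpace K t n (3 • α.1 + β.1) = ⊥ := by
  by_cases ht : t = .H
  · subst ht; exact classical_string_H hα
  · exact classical_string ht hα

theorem Root.IsClassical.strings (_hn : t.Admissible n) {α β : Root K t n} (hα : α.IsClassical)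
    (hβ : β.IsClassical) (hne : α.1 + β.1 ≠ 0) :
    rootSpace K t n (2 • α.1 + β.1) = ⊥ ∨ rootSpace K t n (2 • β.1 + α.1) = ⊥ := by
  by_cases ht : t = .H
  · subst ht; exact classical_strings_H hα hβ hne
  · exact Or.inl (classical_strings ht hα hβ hne)

theorem Root.IsEven.opposite (hn : t.Admissible n) {α β : Root K t n} (hα : α.IsEven)
    (hβ : β.1 = -α.1) (hc : ¬ α.IsClassical) :
    ∀ x ∈ rootSpace K t n α.1, ∀ y ∈ rootSpace K t n β.1, sbr x y = 0 := by
  by_cases ht : t = .H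
  · subst ht; exact absurd (even_opposite_H hn hβ hα) hc
  · exact even_opposite ht hn hβ hα hc

theorem Root.IsOdd.opposite (hn : t.Admissible n) {α β : Root K t n} (hα : α.IsOdd)
    (hβ : β.1 = -α.1) : α.IsMinusOne ∨ β.IsMinusOne ∨
    ∀ x ∈ rootSpace K t n α.1, ∀ y ∈ rootSpace K t n β.1, sbr x y = 0 := by
  by_cases ht : t = .H
  · subst ht; exact (odd_opposite_H hn hβ hα).imp_right Or.inl
  · exact odd_opposite ht hn hβ hα

theorem Root.IsEven.abelian (hn : t.Admissible n) {α : Root K t n} (hα : α.IsEven) :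
    ∀ x ∈ rootSpace K t n α.1, ∀ y ∈ rootSpace K t n α.1, sbr x y = 0 := by
  by_cases ht : t = .H
  · subst ht; exact even_abelian_H hn hα
  · exact even_abelian ht hn hα

/-- The root vectors of weight `α` whose adjoint action has square zero on all root spaces, in the
lattice spanned by the root vectors of a Chevalley basis. -/
def ChevalleyBasis.good (B : ChevalleyBasis K t n) (α : Root K t n) : Set (Op K n) :=
  {x | x ∈ B.lat α.1 ∧ ∀ β : Root K t n, ∀ y ∈ rootSpace K t n β.1, sbr x (sbr x y) = 0}

theorem ChevalleyBasis.lat_le_closure_good (B : ChevalleyBasis K t n) (hn : t.Admissible n)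
    {α : Root K t n} (hα : α.IsEven) (hc : ¬ α.IsClassical) :
    B.lat α.1 ≤ AddSubgroup.closure (B.good α) := by
  by_cases ht : t = .H
  · subst ht
    exact (B.lat_le_good_H hn hα hc).trans
      (AddSubgroup.closure_mono fun x hx => ⟨hx.1, fun β y hy => hx.2 y hy.1⟩)
  · exact fun x hx => AddSubgroup.subset_closure
      ⟨hx, fun β => even_good ht hn hα hc (β := β) x (B.lat_le_rootSpace _ hx)⟩

theorem Root.isEven_of_add (hn : t.Admissible n) {α β δ : Root K t n} (hδ : δ.1 = α.1 + β.1)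
    (h : α.IsEven ∧ β.IsEven ∨ α.IsOdd ∧ β.IsOdd) : δ.IsEven := by
  obtain ⟨a, -, ha⟩ := α.exists_wt
  obtain ⟨b, -, hb⟩ := β.exists_wt
  have h1 : δ.1 = wt K t (a + b) := by rw [wt_add, ← ha, ← hb, hδ]
  have h2 : Even (∑ k, (a + b) k) := by
    have e : ∑ k, (a + b) k = ∑ k, a k + ∑ k, b k := by
      rw [← Finset.sum_add_distrib]; rfl
    rw [e]
    rcases h with ⟨h, h'⟩ | ⟨h, h'⟩
    · exact (h.sum hn ha).add (h'.sum hn hb)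
    · exact (h.sum hn ha).add_odd (h'.sum hn hb)
  have h3 := rootSpace_parity_of_wt hn h1
  rw [(ZMod.intCast_eq_zero_iff_even).2 h2] at h3
  exact h3

theorem Root.add_ne_zero_of_parity (hn : t.Admissible n) {α β : Root K t n} (hα : α.IsEven)
    (hβ : β.IsOdd) : α.1 + β.1 ≠ 0 := by
  obtain ⟨a, -, ha⟩ := α.exists_wt
  obtain ⟨b, -, hb⟩ := β.exists_wt
  intro h
  have h1 : wt K t (a + b) = wt K t (0 : Fin n → ℤ) := by rw [wt_add, ← ha, ← hb, h, wt_zero]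
  have h2 := sum_parity_of_wt_eq hn h1
  have e : ∑ k, (a + b) k = ∑ k, a k + ∑ k, b k := by
    rw [← Finset.sum_add_distrib]; rfl
  have h3 : Odd (∑ k, (a + b) k) := e ▸ (hα.sum hn ha).add_odd (hβ.sum hn hb)
  rw [(ZMod.intCast_eq_one_iff_odd).2 h3] at h2
  simp at h2

theorem Root.ext_val {α β : Root K t n} (h : α.1 = β.1) : α = β := Subtype.ext h

theorem sbr_eq_zero_of_rootSpace (hn : t.Admissible n) {μ ν : Module.Dual K (cartanBar K t n)}
    (h : rootSpace K t n (μ + ν) = ⊥) {x y : Op K n} (hx : x ∈ rootSpace K t n μ)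
    (hy : y ∈ rootSpace K t n ν) : sbr x y = 0 := by
  have h1 := sbr_mem_rootSpace hn hx hy
  rwa [h, Submodule.mem_bot] at h1

theorem sbr_neg_right (x y : Op K n) : sbr x (-y) = -sbr x y := by
  rw [← sbrL_apply, map_neg, sbrL_apply]

theorem sbr_comm_of_even {x : Op K n} (hx : HasParity 0 x) (y : Op K n) : sbr y x = -sbr x y := by
  rw [sbr_even_left hx, sbr_even_right y hx]
  exact (neg_sub _ _).symm

/-- For a classical root `α` and `y` in the lattice of another root, `[X_α, [X_α, y]] = 2 w` with
`w` in the lattice and `[X_α, w] = 0`. -/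
theorem ChevalleyBasis.exists_half_double_bracket (B : ChevalleyBasis K t n) (hn : t.Admissible n)
    {α β : Root K t n} (hα : α.IsClassical) (k : Fin α.mult) {y : Op K n} (hy : y ∈ B.lat β.1) :
    ∃ w ∈ B.lat (2 • α.1 + β.1), sbr (B.X α k : Op K n) (sbr (B.X α k : Op K n) y) = 2 • w ∧
      sbr (B.X α k : Op K n) w = 0 := by
  obtain ⟨hs1, -, hs⟩ := hα.string hn (β := β)
  suffices h : ∃ w ∈ B.lat (2 • α.1 + β.1),
      sbr (B.X α k : Op K n) (sbr (B.X α k : Op K n) y) = 2 • w by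
    obtain ⟨w, hw, hw'⟩ := h
    refine ⟨w, hw, hw', sbr_eq_zero_of_rootSpace hn ?_ (B.X_mem α k) (B.lat_le_rootSpace _ hw)⟩
    have e : α.1 + (2 • α.1 + β.1) = 3 • α.1 + β.1 := by module
    rw [e]
    exact hs
  refine AddSubgroup.closure_induction (p := fun y _ => ∃ w ∈ B.lat (2 • α.1 + β.1),
      sbr (B.X α k : Op K n) (sbr (B.X α k : Op K n) y) = 2 • w) ?_ ?_ ?_ ?_ hy
  · rintro _ ⟨β', l, hβ, rfl⟩
    obtain rfl := Root.ext_val hβ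
    by_cases h0 : rootSpace K t n (2 • α.1 + β'.1) = ⊥
    · refine ⟨0, zero_mem _, ?_⟩
      rw [smul_zero]
      refine sbr_eq_zero_of_rootSpace hn (ν := α.1 + β'.1) ?_ (B.X_mem α k)
        (sbr_mem_rootSpace hn (B.X_mem α k) (B.X_mem β' l))
      have e : α.1 + (α.1 + β'.1) = 2 • α.1 + β'.1 := by module
      rw [e]
      exact h0
    · obtain ⟨s, hs, -⟩ := B.double_bracket α β' ⟨2 • α.1 + β'.1, hs1, h0⟩ hα rfl k l
      have hX := B.X_mem_lat ⟨2 • α.1 + β'.1, hs1, h0⟩ s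
      rcases hs with hs | hs
      · exact ⟨_, hX, hs.trans (by norm_cast)⟩
      · refine ⟨_, neg_mem hX, hs.trans ?_⟩
        rw [smul_neg, neg_smul]
        norm_cast
  · exact ⟨0, zero_mem _, by rw [sbr_zero_right, sbr_zero_right, smul_zero]⟩
  · rintro a b _ _ ⟨w, hw, h⟩ ⟨w', hw', h'⟩
    exact ⟨w + w', add_mem hw hw', by rw [sbr_add_right, sbr_add_right, h, h', smul_add]⟩
  · rintro a _ ⟨w, hw, h⟩
    exact ⟨-w, neg_mem hw, by rw [sbr_neg_right, sbr_neg_right, h, smul_neg]⟩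

end Uniform

/-! ### The map to the enveloping superalgebra -/

section EnvMap

variable {K : Type*} [Field K] {t : CartanType} {n : ℕ}

variable (K t n) in
/-- The canonical map `𝔤 → U(𝔤)`, as a linear map. -/
def toEnvL : galg K t n →ₗ[K] Env K t n :=
  (RingQuot.mkAlgHom K (EnvRel K t n)).toLinearMap ∘ₗ TensorAlgebra.ι K

variable (K t n) in
/-- A linear extension of the canonical map `𝔤 → U(𝔤)` to all endomorphisms of `Λ(n)`. -/
def envMap : Op K n →ₗ[K] Env K t n := (toEnvL K t n).exists_extend.choose

theorem envMap_coe (x : galg K t n) : envMap K t n x = toEnv K t n x :=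
  LinearMap.congr_fun (toEnvL K t n).exists_extend.choose_spec x

variable [CharZero K]

theorem envMap_mul (hn : t.Admissible n) {x y : Op K n} (hx : x ∈ galg K t n)
    (hy : y ∈ galg K t n) {p q : ZMod 2} (hp : HasParity p x) (hq : HasParity q y) :
    envMap K t n x * envMap K t n y = (-1 : K) ^ (p.val * q.val) • (envMap K t n y * envMap K t n x)
      + envMap K t n (sbr x y) := by
  have h1 := RingQuot.mkAlgHom_rel K
    (EnvRel.bracket (K := K) (t := t) (n := n) p q ⟨x, hx⟩ ⟨y, hy⟩
      ⟨sbr x y, sbr_mem_galg hn hx hy⟩ hp hq rfl)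
  rw [map_mul, map_add, map_smul, map_mul] at h1
  rw [show envMap K t n x = toEnv K t n ⟨x, hx⟩ from envMap_coe ⟨x, hx⟩,
    show envMap K t n y = toEnv K t n ⟨y, hy⟩ from envMap_coe ⟨y, hy⟩,
    show envMap K t n (sbr x y) = toEnv K t n ⟨sbr x y, sbr_mem_galg hn hx hy⟩ from
      envMap_coe ⟨sbr x y, sbr_mem_galg hn hx hy⟩]
  exact h1

theorem envMap_sq {x : Op K n} (hx : x ∈ galg K t n) (hxx : x * x ∈ galg K t n)
    (hp : HasParity 1 x) : envMap K t n x * envMap K t n x = envMap K t n (x * x) := by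
  have h1 := RingQuot.mkAlgHom_rel K
    (EnvRel.square (K := K) (t := t) (n := n) ⟨x, hx⟩ ⟨x * x, hxx⟩ hp rfl)
  rw [map_mul] at h1
  rw [show envMap K t n x = toEnv K t n ⟨x, hx⟩ from envMap_coe ⟨x, hx⟩,
    show envMap K t n (x * x) = toEnv K t n ⟨x * x, hxx⟩ from envMap_coe ⟨x * x, hxx⟩]
  exact h1

theorem envMap_mul_of_even (hn : t.Admissible n) {x y : Op K n} (hx : x ∈ galg K t n)
    (hy : y ∈ galg K t n) {q : ZMod 2} (hp : HasParity 0 x) (hq : HasParity q y) :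
    envMap K t n x * envMap K t n y = envMap K t n y * envMap K t n x
      + envMap K t n (sbr x y) := by
  rw [envMap_mul hn hx hy hp hq, ZMod.val_zero, zero_mul, pow_zero, one_smul]

end EnvMap

/-! ### Commutation relations in the integral form -/

section Integral

variable {K : Type*} [Field K] [CharZero K] {t : CartanType} {n : ℕ}

/-- An algebra over a field of characteristic zero is a binomial ring. -/
instance : BinomialRing (Env K t n) :=
  letI : Module ℚ≥0 (Env K t n) := Module.compHom _ (algebraMap ℚ≥0 K)
  inferInstance

/-- The indices of the odd root vectors. -/
def PBWIndex.IsOdd : PBWIndex K t n → Prop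
  | .root γ _ => γ.IsOdd
  | .cartan _ => False

/-- The span of the products of factors of total degree less than `d`. -/
abbrev ChevalleyBasis.deg (B : ChevalleyBasis K t n) (d : ℕ) : AddSubgroup (Env K t n) :=
  degLT B.factor PBWIndex.IsOdd d

/-- The divided powers of the image of `x ∈ 𝔤` lie in the integral form. -/
abbrev ChevalleyBasis.Integral (B : ChevalleyBasis K t n) (x : Op K n) : Prop :=
  DPIntegral K B.factor PBWIndex.IsOdd (envMap K t n x)

/-- The divided powers of the image of `x ∈ 𝔤` commute with `v` modulo lower degree. -/
abbrev ChevalleyBasis.Comm (B : ChevalleyBasis K t n) (x : Op K n) (v : Env K t n) (b : ℕ) : Prop :=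
  CommutesMod K B.factor PBWIndex.IsOdd (envMap K t n x) v b

variable (B : ChevalleyBasis K t n)

theorem ChevalleyBasis.factor_root (α : Root K t n) (k : Fin α.mult) (m : ℕ) :
    B.factor (.root α k) m = dpow K (envMap K t n (B.X α k)) m := by
  rw [envMap_coe]; rfl

theorem ChevalleyBasis.factor_cartan (i : Fin (t.rank n)) (m : ℕ) :
    B.factor (.cartan i) m = bin K (envMap K t n (B.H i)) m := by
  rw [envMap_coe]; rfl

theorem map_mem_closure_image {M N : Type*} [AddCommGroup M] [AddCommGroup N] (f : M →+ N)
    {S : Set M} {x : M} (hx : x ∈ AddSubgroup.closure S) : f x ∈ AddSubgroup.closure (f '' S) := by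
  rw [← AddMonoidHom.map_closure]
  exact AddSubgroup.mem_map_of_mem f hx

theorem envMap_commute (hn : t.Admissible n) {x y : Op K n} (hx : x ∈ galg K t n)
    (hy : y ∈ galg K t n) {q : ZMod 2} (hp : HasParity 0 x) (hq : HasParity q y)
    (h : sbr x y = 0) : Commute (envMap K t n x) (envMap K t n y) := by
  have h1 := envMap_mul_of_even hn hx hy hp hq
  rwa [h, map_zero, add_zero] at h1

theorem ChevalleyBasis.mem_galg {ν : Module.Dual K (cartanBar K t n)} {x : Op K n}
    (hx : x ∈ B.lat ν) : x ∈ galg K t n := (B.lat_le_rootSpace ν hx).1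

theorem ChevalleyBasis.envMap_lat_mem {ν : Module.Dual K (cartanBar K t n)} {x : Op K n}
    (hx : x ∈ B.lat ν) : envMap K t n x ∈ B.deg 2 := by
  refine (AddSubgroup.closure_le ((B.deg 2).comap (envMap K t n).toAddMonoidHom)).2 ?_ hx
  rintro _ ⟨δ, k, -, rfl⟩
  have h := gen_mem_degLT (g := B.factor) (odd := PBWIndex.IsOdd) (.root δ k) 1 fun _ => le_rfl
  rwa [B.factor_root, dpow_one] at h

theorem ChevalleyBasis.integral_X {α : Root K t n} (hα : α.IsEven) (k : Fin α.mult) :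
    B.Integral (B.X α k) := fun m => by
  rw [← B.factor_root]
  exact gen_mem_degLT _ _ fun h => absurd h (Root.not_isOdd_of_isEven hα)

theorem ChevalleyBasis.integral_lat (hn : t.Admissible n) {ν : Module.Dual K (cartanBar K t n)}
    (hν : ∀ δ : Root K t n, δ.1 = ν → δ.IsEven) {x : Op K n} (hx : x ∈ B.lat ν) :
    B.Integral x := by
  refine dpIntegral_of_mem_closure ?_ ?_ (map_mem_closure_image (envMap K t n).toAddMonoidHom hx)
  · rintro _ ⟨_, ⟨δ, k, hδ, rfl⟩, rfl⟩ _ ⟨_, ⟨δ', k', hδ', rfl⟩, rfl⟩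
    obtain rfl := Root.ext_val (hδ.trans hδ'.symm)
    have h := hν δ hδ
    exact envMap_commute hn (B.X δ k).2 (B.X δ k').2 (h _ (B.X_mem δ k)) (h _ (B.X_mem δ k'))
      (h.abelian hn _ (B.X_mem δ k) _ (B.X_mem δ k'))
  · rintro _ ⟨_, ⟨δ, k, hδ, rfl⟩, rfl⟩
    exact B.integral_X (hν δ hδ) k

theorem ChevalleyBasis.integral_of_even (hn : t.Admissible n) {α : Root K t n} (hα : α.IsEven)
    {x : Op K n} (hx : x ∈ B.lat α.1) : B.Integral x :=
  B.integral_lat hn (fun _ h => Root.ext_val h ▸ hα) hx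

theorem Root.isEven_of_two_smul_add (hn : t.Admissible n) {α β δ : Root K t n}
    (hδ : δ.1 = 2 • α.1 + β.1) (hβ : β.IsEven) : δ.IsEven := by
  obtain ⟨a, -, ha⟩ := α.exists_wt
  obtain ⟨b, -, hb⟩ := β.exists_wt
  have h1 : δ.1 = wt K t (a + a + b) := by rw [wt_add, wt_add, ← ha, ← hb, hδ, two_smul]
  have h2 : Even (∑ k, (a + a + b) k) := by
    have e : ∑ k, (a + a + b) k = (∑ k, a k + ∑ k, a k) + ∑ k, b k := by
      rw [← Finset.sum_add_distrib, ← Finset.sum_add_distrib]; rfl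
    rw [e]
    exact (Even.add_self _).add (hβ.sum hn hb)
  have h3 := rootSpace_parity_of_wt hn h1
  rw [(ZMod.intCast_eq_zero_iff_even).2 h2] at h3
  exact h3

theorem envMap_nsmul_two (w : Op K n) : envMap K t n (2 • w) = 2 • envMap K t n w := map_nsmul _ _ _

theorem ChevalleyBasis.X_mul (hn : t.Admissible n) {α β : Root K t n} (hα : α.IsEven)
    {x y : Op K n} (hx : x ∈ B.lat α.1) {ν : Module.Dual K (cartanBar K t n)}
    (hy : y ∈ B.lat ν) : envMap K t n x * envMap K t n y
      = envMap K t n y * envMap K t n x + envMap K t n (sbr x y) := by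
  obtain ⟨q, hq⟩ := exists_parity_rootSpace hn ν
  exact envMap_mul_of_even hn (B.mem_galg hx) (B.mem_galg hy) (hα _ (B.lat_le_rootSpace _ hx))
    (hq _ (B.lat_le_rootSpace _ hy))

/-- Divided powers of a classical root vector `x` and of `y` in the lattice of an even root commute
modulo lower degree, if `[y, [x, y]] = 0`. -/
theorem ChevalleyBasis.comm_classical (hn : t.Admissible n) {α β : Root K t n}
    (hα : α.IsClassical) (hβ : β.IsEven) (h0 : α.1 + β.1 ≠ 0) (k : Fin α.mult) {y : Op K n}
    (hy : y ∈ B.lat β.1) (h : sbr y (sbr (B.X α k : Op K n) y) = 0) (b : ℕ) :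
    B.Comm (B.X α k) (dpow K (envMap K t n y) b) b := by
  have hα' : α.IsEven := hα.isEven hn
  have hx := B.X_mem_lat α k
  have hz := B.sbr_mem_lat hn h0 hx hy
  obtain ⟨w, hw, h2, h3⟩ := B.exists_half_double_bracket hn hα k hy
  refine commutesMod_dpow (B.X_mul (β := β) hn hα' hx hy) ?_ ?_ ?_ (B.integral_X hα' k)
    (B.integral_of_even hn hβ hy)
    (B.integral_lat hn (fun δ hδ => Root.isEven_of_add hn hδ (Or.inl ⟨hα', hβ⟩)) hz)
    (B.integral_lat hn (fun δ hδ => Root.isEven_of_two_smul_add hn hδ hβ) hw) b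
  · rw [B.X_mul (β := β) hn hα' hx hz, h2, envMap_nsmul_two]
  · rw [B.X_mul (β := β) hn hα' hx hw, h3, map_zero, add_zero]
  · have h1 := B.X_mul (β := β) hn hβ hy hz
    rwa [h, map_zero, add_zero] at h1

/-- To commute the divided powers of an element of the lattice of a nonclassical even root, it is
enough to consider the elements whose adjoint action has square zero. -/
theorem ChevalleyBasis.comm_of_good (hn : t.Admissible n) {α : Root K t n} (hα : α.IsEven)
    (hc : ¬ α.IsClassical) {v : Env K t n} {b : ℕ} (h : ∀ u ∈ B.good α, B.Comm u v b)
    {x : Op K n} (hx : x ∈ B.lat α.1) : B.Comm x v b := by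
  refine commutesMod_of_mem_closure (S := (envMap K t n).toAddMonoidHom '' B.good α) ?_ ?_ ?_
    (map_mem_closure_image (envMap K t n).toAddMonoidHom (B.lat_le_closure_good hn hα hc hx))
  · rintro _ ⟨u, hu, rfl⟩ _ ⟨u', hu', rfl⟩
    have h1 := B.lat_le_rootSpace _ hu.1
    have h2 := B.lat_le_rootSpace _ hu'.1
    exact envMap_commute hn h1.1 h2.1 (hα _ h1) (hα _ h2) (hα.abelian hn _ h1 _ h2)
  · rintro _ ⟨u, hu, rfl⟩
    exact B.integral_of_even hn hα hu.1
  · rintro _ ⟨u, hu, rfl⟩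
    exact h u hu

/-- In a commutator with a swapped inner bracket, only the sign changes. -/
theorem sbr_sbr_swap {x y z : Op K n} (hx : HasParity 0 x) (h : sbr z (sbr x y) = 0) :
    sbr z (sbr y x) = 0 := by
  rw [sbr_comm_of_even hx, sbr_neg_right, h, neg_zero]

/-- Divided powers of a classical root vector and of vectors for an even nonclassical root commute
modulo lower degree: the latter are sums of elements `u` with `(ad u)² = 0`. -/
theorem ChevalleyBasis.comm_classical_good (hn : t.Admissible n) {α β : Root K t n}
    (hα : α.IsClassical) (hβ : β.IsEven) (hc : ¬ β.IsClassical) (h0 : α.1 + β.1 ≠ 0)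
    (k : Fin α.mult) {y : Op K n} (hy : y ∈ B.lat β.1) (a : ℕ) :
    B.Comm y (dpow K (envMap K t n (B.X α k)) a) a := by
  refine B.comm_of_good hn hβ hc (fun u hu => ?_) hy
  refine commutesMod_comm.1 (B.comm_classical hn hα hβ h0 k hu.1 ?_) a
  exact sbr_sbr_swap (hβ _ (B.lat_le_rootSpace _ hu.1)) (hu.2 α _ (B.X_mem α k))

theorem ChevalleyBasis.comm_good (hn : t.Admissible n) {α β : Root K t n}
    (hα : α.IsEven) (hα' : ¬ α.IsClassical) (hβ : β.IsEven) (hβ' : ¬ β.IsClassical)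
    (h0 : α.1 + β.1 ≠ 0) {x y : Op K n} (hx : x ∈ B.lat α.1) (hy : y ∈ B.lat β.1) (b : ℕ) :
    B.Comm x (dpow K (envMap K t n y) b) b := by
  refine B.comm_of_good hn hα hα' (fun u hu => ?_) hx
  refine commutesMod_comm.1 (fun a => ?_) b
  refine B.comm_of_good hn hβ hβ' (fun v hv => ?_) hy
  refine commutesMod_comm.1 (fun b => ?_) a
  have hz := B.sbr_mem_lat hn h0 hu.1 hv.1
  have hu' := B.lat_le_rootSpace _ hu.1
  have hv' := B.lat_le_rootSpace _ hv.1
  refine commutesMod_dpow (W := 0) (B.X_mul (β := β) hn hα hu.1 hv.1) ?_ ?_ ?_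
    (B.integral_of_even hn hα hu.1) (B.integral_of_even hn hβ hv.1)
    (B.integral_lat hn (fun δ hδ => Root.isEven_of_add hn hδ (Or.inl ⟨hα, hβ⟩)) hz)
    dpIntegral_zero b
  · rw [B.X_mul (β := β) hn hα hu.1 hz, hu.2 β _ hv', map_zero, smul_zero]
  · rw [mul_zero, zero_mul]
  · have h1 := B.X_mul (β := β) hn hβ hv.1 hz
    rwa [sbr_sbr_swap (hβ _ hv') (hv.2 α _ hu'), map_zero, add_zero] at h1

variable {B} in
theorem ChevalleyBasis.mem_closure_H {h : Op K n}
    (hh : h ∈ Submodule.span ℤ (Set.range fun i => (B.H i : Op K n))) :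
    h ∈ AddSubgroup.closure (Set.range fun i => (B.H i : Op K n)) := by
  rw [← Submodule.span_int_eq_addSubgroupClosure]
  exact hh

theorem sbr_cartan {h h' : Op K n} (hh : h ∈ cartan K t n) (hh' : h' ∈ cartan K t n) :
    sbr h h' = 0 := by
  have h1 := sbr_torus (cartan_le_torus t hh) (torus_le_opWeight (cartan_le_torus t hh'))
  rw [h1]
  simp

theorem ChevalleyBasis.H_commute (hn : t.Admissible n) (i j : Fin (t.rank n)) :
    Commute (envMap K t n (B.H i)) (envMap K t n (B.H j)) :=
  envMap_commute hn (B.H i).2 (B.H j).2 (torus_parity (cartan_le_torus t (B.H_mem i)))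
    (torus_parity (cartan_le_torus t (B.H_mem j))) (sbr_cartan (B.H_mem i) (B.H_mem j))

theorem ChevalleyBasis.bin_H_mem (i : Fin (t.rank n)) (m : ℕ) :
    bin K (envMap K t n (B.H i)) m ∈ B.deg (m + 1) := by
  rw [← B.factor_cartan]
  exact gen_mem_degLT _ _ fun h => h.elim

theorem ChevalleyBasis.bin_mem (hn : t.Admissible n) {h : Op K n}
    (hh : h ∈ Submodule.span ℤ (Set.range fun i => (B.H i : Op K n))) (m : ℕ) :
    bin K (envMap K t n h) m ∈ B.deg (m + 1) := by
  refine bin_mem_degLT_of_mem_closure ?_ ?_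
    (map_mem_closure_image (envMap K t n).toAddMonoidHom (mem_closure_H hh)) m
  · rintro _ ⟨_, ⟨i, rfl⟩, rfl⟩ _ ⟨_, ⟨j, rfl⟩, rfl⟩
    exact B.H_commute hn i j
  · rintro _ ⟨_, ⟨i, rfl⟩, rfl⟩ m
    exact B.bin_H_mem i m

/-- Divided powers of even root vectors commute modulo lower degree. For opposite roots this is the
case of `sl₂` or trivial; in the other cases `[y, [x, y]] = 0` for one of the two orders, possibly
after a decomposition into elements with `(ad x)² = 0`. -/
theorem ChevalleyBasis.comm_even_even (hn : t.Admissible n) {α β : Root K t n} (hα : α.IsEven)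
    (hβ : β.IsEven) (k : Fin α.mult) (l : Fin β.mult) (b : ℕ) :
    B.Comm (B.X α k) (dpow K (envMap K t n (B.X β l)) b) b := by
  have hx := B.X_mem_lat α k
  have hy := B.X_mem_lat β l
  by_cases h0 : α.1 + β.1 = 0
  · have hβα : β.1 = -α.1 := (neg_eq_of_add_eq_zero_right h0).symm
    by_cases hc : α.IsClassical
    · obtain ⟨h, hh, hXY⟩ := B.classical_bracket α β hc hβα k l
      have hspan := B.coroot_mem α hc h hh
      have hg : (h : Op K n) ∈ galg K t n := hXY ▸ sbr_mem_galg hn (B.X α k).2 (B.X β l).2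
      have hp : HasParity 0 (h : Op K n) := torus_parity (cartanBar_le_torus t h.2)
      refine commutesMod_sl2 (H := envMap K t n h) ?_ ?_ ?_ (B.integral_X hα k)
        (B.integral_X hβ l) (B.bin_mem hn hspan) b
      · rw [B.X_mul (β := β) hn hα hx hy, hXY]
      · rw [envMap_mul_of_even hn hg (B.X α k).2 hp (hα _ (B.X_mem α k)), (B.X_mem α k).2 h, hh.2,
          map_smul, ofNat_smul_eq_nsmul, ofNat_zsmul]
      · rw [envMap_mul_of_even hn hg (B.X β l).2 hp (hβ _ (B.X_mem β l)), (B.X_mem β l).2 h, hβα,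
          LinearMap.neg_apply, hh.2, map_smul, neg_smul, neg_smul, ofNat_smul_eq_nsmul,
          ofNat_zsmul]
    · refine commutesMod_of_commute ?_ b
      have h1 := envMap_commute hn (B.X α k).2 (B.X β l).2 (hα _ (B.X_mem α k))
        (hβ _ (B.X_mem β l)) (hα.opposite hn hβα hc _ (B.X_mem α k) _ (B.X_mem β l))
      exact (h1.pow_right b).smul_right _
  · have h0' : β.1 + α.1 ≠ 0 := by rwa [add_comm]
    by_cases hc : α.IsClassical <;> by_cases hc' : β.IsClassical
    · rcases hc.strings hn hc' h0 with h | h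
      · refine commutesMod_comm.1 (fun b => ?_) b
        refine B.comm_classical hn hc' hα h0' l hx (sbr_sbr_swap (hα _ (B.X_mem α k)) ?_) b
        refine sbr_eq_zero_of_rootSpace hn (ν := α.1 + β.1) ?_ (B.X_mem α k)
          (sbr_mem_rootSpace hn (B.X_mem α k) (B.X_mem β l))
        have e : α.1 + (α.1 + β.1) = 2 • α.1 + β.1 := by module
        rw [e]
        exact h
      · refine B.comm_classical hn hc hβ h0 k hy ?_ b
        refine sbr_eq_zero_of_rootSpace hn (ν := α.1 + β.1) ?_ (B.X_mem β l)
          (sbr_mem_rootSpace hn (B.X_mem α k) (B.X_mem β l))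
        have e : β.1 + (α.1 + β.1) = 2 • β.1 + α.1 := by module
        rw [e]
        exact h
    · exact commutesMod_comm.1 (B.comm_classical_good hn hc hβ hc' h0 k hy) b
    · exact B.comm_classical_good hn hc' hα hc h0' l hx b
    · exact B.comm_good hn hα hc hβ hc' h0 hx hy b

theorem ChevalleyBasis.comm_even_odd (hn : t.Admissible n) {α β : Root K t n} (hα : α.IsEven)
    (hβ : β.IsOdd) (k : Fin α.mult) (l : Fin β.mult) :
    B.Comm (B.X α k) (envMap K t n (B.X β l)) 1 := by
  have h0 := Root.add_ne_zero_of_parity hn hα hβ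
  have hy := B.X_mem_lat β l
  by_cases hc : α.IsClassical
  · have hx := B.X_mem_lat α k
    have hz := B.sbr_mem_lat hn h0 hx hy
    obtain ⟨w, hw, h2, h3⟩ := B.exists_half_double_bracket hn hc k hy
    refine commutesMod_of_bracket (B.X_mul (β := β) hn hα hx hy) ?_ ?_ (B.integral_X hα k)
      (B.envMap_lat_mem hy) (B.envMap_lat_mem hz) (B.envMap_lat_mem hw)
    · rw [B.X_mul (β := β) hn hα hx hz, h2, envMap_nsmul_two]
    · rw [B.X_mul (β := β) hn hα hx hw, h3, map_zero, add_zero]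
  · refine B.comm_of_good hn hα hc (fun u hu => ?_) (B.X_mem_lat α k)
    have hz := B.sbr_mem_lat hn h0 hu.1 hy
    refine commutesMod_of_bracket (W := 0) (B.X_mul (β := β) hn hα hu.1 hy) ?_ ?_
      (B.integral_of_even hn hα hu.1) (B.envMap_lat_mem hy) (B.envMap_lat_mem hz) (zero_mem _)
    · rw [B.X_mul (β := β) hn hα hu.1 hz, hu.2 β _ (B.X_mem β l), map_zero, smul_zero]
    · rw [mul_zero, zero_mul]

theorem envMap_anticomm (hn : t.Admissible n) {x y : Op K n} (hx : x ∈ galg K t n)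
    (hy : y ∈ galg K t n) (hp : HasParity 1 x) (hq : HasParity 1 y) :
    envMap K t n x * envMap K t n y + envMap K t n y * envMap K t n x
      = envMap K t n (sbr x y) := by
  rw [envMap_mul hn hx hy hp hq, show (1 : ZMod 2).val = 1 from rfl, one_mul, pow_one, neg_smul,
    one_smul]
  abel

theorem ChevalleyBasis.minusOne_mem (hn : t.Admissible n) {γ β : Root K t n} (hγ : γ.IsMinusOne)
    (hβ : β.1 = -γ.1) (k : Fin γ.mult) (l : Fin β.mult) :
    envMap K t n (sbr (B.X γ k : Op K n) (B.X β l)) ∈ B.deg 2 := by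
  have h : sbr (B.X γ k : Op K n) (B.X β l)
      ∈ Submodule.span ℤ (Set.range fun i => (B.H i : Op K n)) := by
    by_cases ht : t = .H
    · obtain ⟨σ, -, h⟩ := B.minusOne_bracket_H ht γ β hγ hβ
      obtain ⟨m, hm, -⟩ := h k l
      rw [hm]
      exact Submodule.smul_mem _ m (Submodule.subset_span ⟨_, rfl⟩)
    · exact B.minusOne_bracket ht γ β hγ hβ k l
  have h1 := B.bin_mem hn h 1
  rwa [bin_one] at h1

theorem ChevalleyBasis.anticomm_odd_odd (hn : t.Admissible n) {α β : Root K t n} (hα : α.IsOdd)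
    (hβ : β.IsOdd) (k : Fin α.mult) (l : Fin β.mult) :
    envMap K t n (B.X α k) * envMap K t n (B.X β l)
      + envMap K t n (B.X β l) * envMap K t n (B.X α k) ∈ B.deg 2 := by
  have hx := B.X_mem α k
  have hy := B.X_mem β l
  have h1 := envMap_anticomm hn hx.1 hy.1 (hα _ hx) (hβ _ hy)
  by_cases h0 : α.1 + β.1 = 0
  · have hβα : β.1 = -α.1 := (neg_eq_of_add_eq_zero_right h0).symm
    rcases hα.opposite hn hβα with h | h | h
    · rw [h1]
      exact B.minusOne_mem hn h hβα k l
    · rw [add_comm, envMap_anticomm hn hy.1 hx.1 (hβ _ hy) (hα _ hx)]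
      exact B.minusOne_mem hn h (by rw [hβα, neg_neg]) l k
    · rw [h1, h _ hx _ hy, map_zero]
      exact zero_mem _
  · rw [h1]
    exact B.envMap_lat_mem (B.sbr_mem_lat hn h0 (B.X_mem_lat α k) (B.X_mem_lat β l))

theorem ChevalleyBasis.factor_zero (j : PBWIndex K t n) : B.factor j 0 = 1 := by
  cases j
  · rw [B.factor_root, dpow_zero]
  · rw [B.factor_cartan, bin_zero]

theorem ChevalleyBasis.cartan_root (hn : t.Admissible n) (i : Fin (t.rank n)) (α : Root K t n)
    (k : Fin α.mult) (a m : ℕ) (hm : α.IsOdd → m ≤ 1) :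
    B.factor (.cartan i) a * B.factor (.root α k) m
      - B.factor (.root α k) m * B.factor (.cartan i) a ∈ B.deg (a + m) := by
  obtain ⟨c, hc⟩ := B.H_int α i
  have hX := B.X_mem α k
  obtain ⟨q, hq⟩ := exists_parity_rootSpace hn α.1
  have h : envMap K t n (B.H i) * envMap K t n (B.X α k)
      = envMap K t n (B.X α k) * envMap K t n (B.H i) + c • envMap K t n (B.X α k) := by
    rw [envMap_mul_of_even hn (B.H i).2 hX.1 (torus_parity (cartan_le_torus t (B.H_mem i)))
      (hq _ hX), hX.2 ⟨B.H i, cartan_le_cartanBar K t n (B.H_mem i)⟩, hc, map_smul,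
      Int.cast_smul_eq_zsmul]
  have h1 := gen_mem_degLT (g := B.factor) (odd := PBWIndex.IsOdd) (.root α k) m hm
  rw [B.factor_root] at h1 ⊢
  rw [B.factor_cartan, bin_mul_dpow h, ← mul_sub, add_comm a m]
  exact mul_mem_degLT h1 (bin_add_intCast_sub_mem (B.bin_H_mem i) _ a)

theorem le_one_cases {m : ℕ} (h : m ≤ 1) : m = 0 ∨ m = 1 := by omega

/-- The factors commute up to sign, modulo lower degree. -/
theorem ChevalleyBasis.factor_comm (hn : t.Admissible n) (i j : PBWIndex K t n) (a b : ℕ)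
    (ha : i.IsOdd → a ≤ 1) (hb : j.IsOdd → b ≤ 1) :
    ∃ ε : ℤ, B.factor i a * B.factor j b - ε • (B.factor j b * B.factor i a) ∈ B.deg (a + b) := by
  have triv : ∀ {u v : Env K t n}, u * v - v * u ∈ B.deg (a + b) →
      ∃ ε : ℤ, u * v - ε • (v * u) ∈ B.deg (a + b) := fun h => ⟨1, by rwa [one_smul]⟩
  have swap : ∀ {u v : Env K t n}, u * v - v * u ∈ B.deg (b + a) →
      v * u - u * v ∈ B.deg (a + b) := fun h => by
    rw [← neg_sub, add_comm]; exact neg_mem h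
  rcases i with ⟨α, k⟩ | i <;> rcases j with ⟨β, l⟩ | j
  · rcases Root.isEven_or_isOdd hn α with hα | hα <;> rcases Root.isEven_or_isOdd hn β with hβ | hβ
    · rw [B.factor_root, B.factor_root]
      exact triv (B.comm_even_even hn hα hβ k l b a)
    · rcases le_one_cases (hb hβ) with rfl | rfl
      · exact triv (by rw [B.factor_zero, mul_one, one_mul, sub_self]; exact zero_mem _)
      · rw [B.factor_root, B.factor_root, dpow_one]
        exact triv (B.comm_even_odd hn hα hβ k l a)
    · rcases le_one_cases (ha hα) with rfl | rfl
      · exact triv (by rw [B.factor_zero, mul_one, one_mul, sub_self]; exact zero_mem _)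
      · rw [B.factor_root, B.factor_root, dpow_one]
        exact triv (swap (B.comm_even_odd hn hβ hα l k b))
    · rcases le_one_cases (ha hα) with rfl | rfl
      · exact triv (by rw [B.factor_zero, mul_one, one_mul, sub_self]; exact zero_mem _)
      rcases le_one_cases (hb hβ) with rfl | rfl
      · exact triv (by rw [B.factor_zero, mul_one, one_mul, sub_self]; exact zero_mem _)
      refine ⟨-1, ?_⟩
      rw [B.factor_root, B.factor_root, dpow_one, dpow_one, neg_smul, one_smul, sub_neg_eq_add]
      exact B.anticomm_odd_odd hn hα hβ k l
  · exact triv (swap (B.cartan_root hn j α k b a ha))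
  · exact triv (B.cartan_root hn i β l a b hb)
  · refine triv ?_
    rw [B.factor_cartan, B.factor_cartan,
      (bin_commute (bin_commute (B.H_commute hn i j).symm b).symm a).eq, sub_self]
    exact zero_mem _

theorem ChevalleyBasis.factor_merge (hn : t.Admissible n) (j : PBWIndex K t n) (a b : ℕ)
    (_h : ¬ j.IsOdd) :
    ∃ c : ℤ, B.factor j a * B.factor j b - c • B.factor j (a + b) ∈ B.deg (a + b) := by
  cases j with
  | root α k =>
    refine ⟨((a + b).choose a : ℕ), ?_⟩
    rw [B.factor_root, B.factor_root, B.factor_root, dpow_mul_dpow, natCast_zsmul, sub_self]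
    exact zero_mem _
  | cartan i =>
    rw [B.factor_cartan, B.factor_cartan, B.factor_cartan]
    exact bin_merge_mem (B.bin_H_mem i) a b

theorem sbr_self_of_odd {x : Op K n} (hx : HasParity 1 x) : sbr x x = 2 • (x * x) := by
  rw [sbr, evenPart_of_one hx, oddPart_of_one hx, two_smul]
  simp only [mul_zero, zero_mul, add_zero, zero_sub, sub_neg_eq_add]

theorem Root.two_smul_ne_zero (γ : Root K t n) : γ.1 + γ.1 ≠ 0 := by
  rw [← two_smul K]
  exact smul_ne_zero two_ne_zero γ.2.1

/-- The structure constants in `[X_γ, X_γ]` are even, so that `X_γ ∘ X_γ` lies in the lattice. -/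
theorem ChevalleyBasis.mul_self_mem_lat (hn : t.Admissible n) {γ : Root K t n} (hγ : γ.IsOdd)
    (k : Fin γ.mult) : (B.X γ k : Op K n) * B.X γ k ∈ B.lat (γ.1 + γ.1) := by
  have hs := sbr_self_of_odd (hγ _ (B.X_mem γ k))
  suffices h : ∃ w ∈ B.lat (γ.1 + γ.1), sbr (B.X γ k : Op K n) (B.X γ k) = 2 • w by
    obtain ⟨w, hw, h⟩ := h
    rwa [nsmul_cancel K (A := Op K n) two_ne_zero (hs.symm.trans h)]
  by_cases h0 : rootSpace K t n (γ.1 + γ.1) = ⊥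
  · exact ⟨0, zero_mem _, by
      rw [smul_zero]; exact sbr_eq_zero_of_rootSpace hn h0 (B.X_mem γ k) (B.X_mem γ k)⟩
  · obtain ⟨c, -, hc, -, h2⟩ := B.struct_const γ γ ⟨_, γ.two_smul_ne_zero, h0⟩ rfl k k
    have hev : ∀ s, ∃ d : ℤ, c s = 2 * d := fun s => by
      by_cases hs : c s = 0
      · exact ⟨0, by rw [hs, mul_zero]⟩
      · rcases abs_eq (by norm_num : (0 : ℤ) ≤ 2) |>.1 ((h2 rfl).1 s hs) with h | h
        exacts [⟨1, by rw [h, mul_one]⟩, ⟨-1, by rw [h, mul_neg_one]⟩]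
    choose d hd using hev
    refine ⟨∑ s, d s • (B.X ⟨_, γ.two_smul_ne_zero, h0⟩ s : Op K n),
      sum_mem fun s _ => zsmul_mem (B.X_mem_lat ⟨_, γ.two_smul_ne_zero, h0⟩ s) _, ?_⟩
    rw [hc, Finset.smul_sum]
    refine Finset.sum_congr rfl fun s _ => ?_
    rw [hd, mul_smul]
    exact ofNat_zsmul _ _

theorem ChevalleyBasis.factor_square (hn : t.Admissible n) (j : PBWIndex K t n) (h : j.IsOdd) :
    B.factor j 1 * B.factor j 1 ∈ B.deg 2 := by
  cases j with
  | root γ k =>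
    have h1 := B.mul_self_mem_lat hn h k
    rw [B.factor_root, dpow_one, envMap_sq (B.X γ k).2 (B.mem_galg h1) (h _ (B.X_mem γ k))]
    exact B.envMap_lat_mem h1
  | cartan i => exact h.elim

end Integral

/-! ### Linear independence of the ordered monomials -/

section Independence

variable {K : Type*} [Field K] [CharZero K] {t : CartanType} {n : ℕ}

theorem Wn_apply_one {D : Op K n} (hD : D ∈ Wn K n) : D 1 = 0 := by
  rw [mem_Wn_iff.1 hD 1]
  refine Finset.sum_eq_zero fun i _ => ?_
  rw [pd, CliffordAlgebra.contractLeft_one, mul_zero]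

/-- Eigenvectors for distinct linear forms on `𝔥‾` are independent. -/
theorem eq_zero_of_sum_weights (T : Finset (Module.Dual K (cartanBar K t n)))
    (y : Module.Dual K (cartanBar K t n) → Op K n)
    (hy : ∀ μ, ∀ h : cartanBar K t n, sbr (h : Op K n) (y μ) = μ h • y μ)
    (h0 : ∑ μ ∈ T, y μ = 0) : ∀ μ ∈ T, y μ = 0 := by
  classical
  induction T using Finset.induction_on generalizing y with
  | empty => exact fun μ hμ => absurd hμ (Finset.notMem_empty μ)
  | insert a T ha ih =>
    rw [Finset.sum_insert ha] at h0
    have key : ∀ μ ∈ T, y μ = 0 := by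
      intro μ hμ
      have hne : μ ≠ a := fun h => ha (h ▸ hμ)
      obtain ⟨h, hh⟩ : ∃ h, μ h ≠ a h := by
        by_contra! hcon
        exact hne (LinearMap.ext hcon)
      -- applying `ad h - a(h)` kills the component of weight `a`
      have h1 : ∑ ν ∈ T, (ν h - a h) • y ν = 0 := by
        have h2 := congrArg (fun z => sbrL K n (h : Op K n) z - a h • z) h0
        simp only [map_add, map_sum, sbrL_apply, map_zero, smul_zero, sub_zero, smul_add,
          Finset.smul_sum, hy] at h2
        rw [add_sub_add_left_eq_sub, ← Finset.sum_sub_distrib] at h2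
        rw [← h2]
        exact Finset.sum_congr rfl fun ν _ => sub_smul (M := Op K n) (ν h) (a h) (y ν)
      have h3 := ih (fun ν => (ν h - a h) • y ν) (fun ν h' => by
        rw [sbr_smul_right, hy, smul_comm]) h1 μ hμ
      exact (smul_eq_zero.1 h3).resolve_left (sub_ne_zero.2 hh)
    intro μ hμ
    rcases Finset.mem_insert.1 hμ with rfl | hμ
    · rwa [Finset.sum_eq_zero key, add_zero] at h0
    · exact key μ hμ

/-- The elements of a Chevalley basis, as a family. -/
def ChevalleyBasis.vec (B : ChevalleyBasis K t n) : PBWIndex K t n → Op K n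
  | .root α k => B.X α k
  | .cartan i => B.H i

/-- The weight of a member of a Chevalley basis. -/
def PBWIndex.weight : PBWIndex K t n → Module.Dual K (cartanBar K t n)
  | .root α _ => α.1
  | .cartan _ => 0

variable (B : ChevalleyBasis K t n)

/-- A Chevalley basis together with the identity operator, which does not lie in `𝔤`. -/
def ChevalleyBasis.vecOne : Option (PBWIndex K t n) → Op K n
  | none => 1
  | some j => B.vec j

/-- The weight of a member of a Chevalley basis, and `0` for the identity operator. -/
def weightOne : Option (PBWIndex K t n) → Module.Dual K (cartanBar K t n)
  | none => 0
  | some j => j.weight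

theorem ChevalleyBasis.sbr_vecOne (j : Option (PBWIndex K t n)) (h : cartanBar K t n) :
    sbr (h : Op K n) (B.vecOne j) = weightOne j h • B.vecOne j := by
  rcases j with _ | ⟨α, k⟩ | i
  · rw [vecOne, sbr_even_left (torus_parity (cartanBar_le_torus t h.2)), mul_one, one_mul, sub_self]
    exact (zero_smul K _).symm
  · exact (B.X_mem α k).2 h
  · have h1 := sbr_torus (cartanBar_le_torus t h.2)
      (torus_le_opWeight (cartan_le_torus t (B.H_mem i)))
    refine h1.trans ?_
    rw [show (weightOne (some (PBWIndex.cartan i)) : Module.Dual K (cartanBar K t n)) h = 0 from rfl]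
    simp [vecOne, vec]

theorem ChevalleyBasis.linearIndepOn_weight (μ : Module.Dual K (cartanBar K t n)) :
    LinearIndepOn K B.vecOne {j | weightOne j = μ} := by
  rcases Set.eq_empty_or_nonempty {j : Option (PBWIndex K t n) | weightOne j = μ} with he | ⟨j, hj⟩
  · rw [he]; exact linearIndepOn_empty K _
  by_cases hμ : μ = 0
  · subst hμ
    have hv : LinearIndependent K
        (fun j : Option (Fin (t.rank n)) => B.vecOne (j.map PBWIndex.cartan)) := by
      refine linearIndependent_option.2 ⟨B.H_indep', fun h => ?_⟩
      have h1 : Submodule.span K (Set.range fun i => (B.H i : Op K n))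
          ≤ LinearMap.ker (LinearMap.applyₗ (1 : Lam K n) : Op K n →ₗ[K] Lam K n) := by
        refine Submodule.span_le.2 ?_
        rintro _ ⟨i, rfl⟩
        exact Wn_apply_one (galg_le (B.H i).2)
      have h2 : (1 : Op K n) (1 : Lam K n) = 0 := h1 h
      exact one_ne_zero h2
    have hf : ∀ j : {j : Option (PBWIndex K t n) // weightOne j = 0},
        ∃ i : Option (Fin (t.rank n)), j.1 = i.map PBWIndex.cartan := by
      rintro ⟨_ | ⟨α, k⟩ | i, hj⟩
      · exact ⟨none, rfl⟩
      · exact absurd hj α.2.1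
      · exact ⟨some i, rfl⟩
    choose f hf using hf
    have h3 := hv.comp f fun a b hab => Subtype.ext (by rw [hf a, hf b, hab])
    have h4 : LinearIndependent K
        fun j : {j : Option (PBWIndex K t n) // weightOne j = 0} => B.vecOne j.1 := by
      simp only [hf]
      exact h3
    exact h4
  · obtain ⟨α, rfl⟩ : ∃ α : Root K t n, α.1 = μ := by
      rcases j with _ | ⟨α, k⟩ | i
      exacts [absurd hj.symm hμ, ⟨α, hj⟩, absurd hj.symm hμ]
    have hf : ∀ j : {j : Option (PBWIndex K t n) // weightOne j = α.1},
        ∃ k : Fin α.mult, j.1 = some (PBWIndex.root α k) := by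
      rintro ⟨_ | ⟨β, k⟩ | i, hj⟩
      · exact absurd hj.symm α.2.1
      · obtain rfl := Root.ext_val (α := β) (β := α) hj
        exact ⟨k, rfl⟩
      · exact absurd hj.symm α.2.1
    choose f hf using hf
    have h3 := (linearIndependent_coe (B.X_indep α)).comp f
      fun a b hab => Subtype.ext (by rw [hf a, hf b, hab])
    have h4 : LinearIndependent K
        fun j : {j : Option (PBWIndex K t n) // weightOne j = α.1} => B.vecOne j.1 := by
      simp only [hf]
      exact h3
    exact h4

theorem ChevalleyBasis.linearIndependent_vecOne : LinearIndependent K B.vecOne := by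
  classical
  rw [linearIndependent_iff']
  intro s g hg i hi
  have h1 := eq_zero_of_sum_weights (s.image weightOne)
    (fun μ => ∑ j ∈ s with weightOne j = μ, g j • B.vecOne j) (fun μ h => ?_) ?_ (weightOne i)
    (Finset.mem_image_of_mem _ hi)
  · exact linearIndepOn_iff'.1 (B.linearIndepOn_weight (weightOne i))
      (s.filter fun j => weightOne j = weightOne i) g (fun j hj => (Finset.mem_filter.1 hj).2) h1 i
      (Finset.mem_filter.2 ⟨hi, rfl⟩)
  · rw [← sbrL_apply, map_sum, Finset.smul_sum]
    refine Finset.sum_congr rfl fun j hj => ?_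
    rw [map_smul, sbrL_apply, B.sbr_vecOne, (Finset.mem_filter.1 hj).2, smul_comm]
  · exact (Finset.sum_fiberwise_of_maps_to (fun j hj => Finset.mem_image_of_mem weightOne hj)
      fun j => g j • B.vecOne j).trans hg

theorem exists_dual_functional {ι V : Type*} [AddCommGroup V] [Module K V] {v : ι → V}
    (hv : LinearIndependent K v) (j : ι) :
    ∃ lam : V →ₗ[K] K, lam (v j) = 1 ∧ ∀ i, i ≠ j → lam (v i) = 0 := by
  classical
  obtain ⟨lam, hlam⟩ := (Finsupp.lapply j ∘ₗ hv.repr).exists_extend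
  have h : ∀ i, lam (v i) = Finsupp.single i (1 : K) j := fun i => by
    have h1 := LinearMap.congr_fun hlam ⟨v i, Submodule.subset_span ⟨i, rfl⟩⟩
    rwa [LinearMap.comp_apply, LinearMap.comp_apply, hv.repr_eq_single i _ rfl,
      Finsupp.lapply_apply] at h1
  exact ⟨lam, by rw [h, Finsupp.single_eq_same], fun i hi => by
    rw [h, Finsupp.single_eq_of_ne' hi]⟩

variable (K n) in
/-- The parity automorphism of `End(Λ(n))`. -/
def parConjAlg : Op K n →ₐ[K] Op K n :=
  AlgHom.ofLinearMap (parConj K n)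
    (by rw [parConj_apply, mul_one, parInv_mul_parInv])
    (fun x y => by
      rw [parConj_apply, parConj_apply, parConj_apply]
      have h : x * y = x * (parInv K n * parInv K n) * y := by rw [parInv_mul_parInv, mul_one]
      rw [h]
      simp only [mul_assoc])

instance : Fact (∀ x, parConjAlg K n (parConjAlg K n x) = x) := ⟨parConj_parConj⟩

theorem HasParity.sPar {p : ZMod 2} {x : Op K n} (h : HasParity p x) : SPar (parConjAlg K n) p x := by
  rcases zmod_two_cases p with rfl | rfl
  · exact sPar_zero_iff.2 (parConj_of_zero h)
  · exact sPar_one_iff.2 (parConj_of_one h)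

variable (K t n) in
/-- The map from the enveloping superalgebra of `𝔤` to that of `End(Λ(n))`. -/
def envToSuper : Env K t n →ₐ[K] SuperEnv (parConjAlg K n) :=
  RingQuot.liftAlgHom K ⟨TensorAlgebra.lift K (senvι (parConjAlg K n) ∘ₗ (galg K t n).subtype), by
    rintro _ _ (⟨p, q, x, y, z, hx, hy, hz⟩ | ⟨x, z, hx, hz⟩)
    · simp only [map_mul, map_add, map_smul, TensorAlgebra.lift_ι_apply, LinearMap.comp_apply,
        Submodule.subtype_apply]
      rw [hz, sbr_of_parity hx hy]
      exact senvι_bracket hx.sPar hy.sPar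
    · simp only [map_mul, TensorAlgebra.lift_ι_apply, LinearMap.comp_apply,
        Submodule.subtype_apply]
      rw [hz]
      exact senvι_square hx.sPar⟩

theorem envToSuper_envMap (x : galg K t n) :
    envToSuper K t n (envMap K t n x) = senvι (parConjAlg K n) (x : Op K n) := by
  rw [envMap_coe]
  refine (RingQuot.liftAlgHom_mkAlgHom_apply K _ _ _).trans ?_
  rw [TensorAlgebra.lift_ι_apply]
  rfl

section Words

variable {E : Type*} [Ring E] [Algebra K E] {σ : E →ₐ[K] E} [Fact (∀ x, σ (σ x) = x)]

theorem wordsLT_mul {a b : ℕ} {u v : SuperEnv σ} (hu : u ∈ wordsLT σ (a + 1))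
    (hv : v ∈ wordsLT σ b) : u * v ∈ wordsLT σ (a + b) := by
  induction hu using Submodule.span_induction with
  | mem u hu =>
    obtain ⟨l, hl, rfl⟩ := hu
    induction hv using Submodule.span_induction with
    | mem v hv =>
      obtain ⟨l', hl', rfl⟩ := hv
      exact Submodule.subset_span ⟨l ++ l', by rw [List.length_append]; omega,
        by rw [List.map_append, List.prod_append]⟩
    | zero => rw [mul_zero]; exact zero_mem _
    | add v v' _ _ h h' => rw [mul_add]; exact add_mem h h'
    | smul c v _ h => rw [mul_smul_comm]; exact Submodule.smul_mem _ c h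
  | zero => rw [zero_mul]; exact zero_mem _
  | add u u' _ _ h h' => rw [add_mul]; exact add_mem h h'
  | smul c u _ h => rw [smul_mul_assoc]; exact Submodule.smul_mem _ c h

theorem wordsLT_mul' {a b : ℕ} {u v : SuperEnv σ} (hu : u ∈ wordsLT σ a)
    (hv : v ∈ wordsLT σ (b + 1)) : u * v ∈ wordsLT σ (a + b) := by
  cases a with
  | zero =>
    rw [wordsLT_zero, Submodule.mem_bot] at hu
    rw [hu, zero_mul]
    exact zero_mem _
  | succ a => exact wordsLT_mono (by omega) (wordsLT_mul hu hv)

variable {J : Type*} (x : J → E)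

/-- The word `l` is the leading term of `u`, up to a nonzero factor. -/
def HasLeadingWord (u : SuperEnv σ) (l : List J) : Prop :=
  ∃ c : K, c ≠ 0 ∧ u - c • senvWord x l ∈ wordsLT σ l.length

variable {x}

theorem hasLeadingWord_one : HasLeadingWord x (1 : SuperEnv σ) [] :=
  ⟨1, one_ne_zero, by simp [senvWord]⟩

theorem HasLeadingWord.mul {u v : SuperEnv σ} {l l' : List J} (h : HasLeadingWord x u l)
    (h' : HasLeadingWord x v l') : HasLeadingWord x (u * v) (l ++ l') := by
  obtain ⟨c, hc, h⟩ := h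
  obtain ⟨c', hc', h'⟩ := h'
  refine ⟨c * c', mul_ne_zero hc hc', ?_⟩
  have hv : v ∈ wordsLT σ (l'.length + 1) := by
    rw [← sub_add_cancel v (c' • senvWord x l')]
    exact add_mem (wordsLT_mono (Nat.le_succ _) h') (Submodule.smul_mem _ _ (senvWord_mem x l'))
  have h1 := add_mem (wordsLT_mul' h hv)
    (wordsLT_mul (Submodule.smul_mem _ c (senvWord_mem x l)) h')
  rw [List.length_append]
  convert h1 using 1
  have e : (senvWord x (l ++ l') : SuperEnv σ) = senvWord x l * senvWord x l' := by
    simp [senvWord]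
  rw [e, sub_mul, mul_sub, smul_mul_smul_comm]
  abel

theorem HasLeadingWord.smul {u : SuperEnv σ} {l : List J} (h : HasLeadingWord x u l) {a : K}
    (ha : a ≠ 0) : HasLeadingWord x (a • u) l := by
  obtain ⟨c, hc, h⟩ := h
  refine ⟨a * c, mul_ne_zero ha hc, ?_⟩
  rw [mul_smul, ← smul_sub]
  exact Submodule.smul_mem _ a h

/-- The leading word of a shifted letter `x_j - c` is the word with the letter `x_j`. -/
theorem hasLeadingWord_letter (j : J) (c : K) :
    HasLeadingWord x (senvι σ (x j) - algebraMap K _ c) [j] := by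
  refine ⟨1, one_ne_zero, ?_⟩
  have e : senvι σ (x j) - algebraMap K _ c - (1 : K) • senvWord x [j]
      = -c • (1 : SuperEnv σ) := by
    rw [senvWord, List.map_cons, List.map_nil, List.prod_cons, List.prod_nil, mul_one, one_smul,
      Algebra.algebraMap_eq_smul_one, neg_smul]
    abel
  rw [e]
  exact Submodule.smul_mem _ _ (one_mem_wordsLT 0)

end Words

theorem ChevalleyBasis.hasLeadingWord_factor (j : PBWIndex K t n) (m : ℕ) :
    HasLeadingWord B.vec (envToSuper K t n (B.factor j m)) (List.replicate m j) := by
  have hm : ((m.factorial : K)⁻¹) ≠ 0 := inv_ne_zero (by exact_mod_cast m.factorial_ne_zero)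
  cases j with
  | root α k =>
    rw [B.factor_root, dpow, map_smul, map_pow, envToSuper_envMap]
    refine HasLeadingWord.smul ?_ hm
    induction m with
    | zero => rw [pow_zero]; exact hasLeadingWord_one
    | succ m ih =>
      rw [pow_succ', List.replicate_succ]
      have h := hasLeadingWord_letter (σ := parConjAlg K n) (x := B.vec) (.root α k) (0 : K)
      rw [map_zero, sub_zero] at h
      exact h.mul (ih (inv_ne_zero (by exact_mod_cast m.factorial_ne_zero)))
  | cartan i =>
    rw [B.factor_cartan, bin, map_smul, map_list_prod, List.map_map]
    refine HasLeadingWord.smul ?_ hm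
    clear hm
    induction m with
    | zero => exact hasLeadingWord_one
    | succ m ih =>
      rw [List.range_succ, List.map_append, List.prod_append, List.replicate_succ']
      refine ih.mul ?_
      rw [List.map_singleton, List.prod_singleton, Function.comp_apply, map_sub, map_natCast,
        envToSuper_envMap, ← map_natCast (algebraMap K (SuperEnv (parConjAlg K n)))]
      exact hasLeadingWord_letter (PBWIndex.cartan i) (m : K)

variable [LinearOrder (PBWIndex K t n)]

/-- Writing out each index as often as its exponent says gives the sorted word. -/
theorem flatMap_replicate_sort {J : Type*} [LinearOrder J] (e : J →₀ ℕ) :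
    (e.support.sort (· ≤ ·)).flatMap (fun j => List.replicate (e j) j)
      = (Finsupp.toMultiset e).sort (· ≤ ·) := by
  classical
  refine List.Perm.eq_of_pairwise' (r := (· ≤ ·)) ?_ (Multiset.pairwise_sort _ _) ?_
  · refine List.pairwise_flatMap.2 ⟨fun j _ => List.pairwise_replicate.2 (Or.inr le_rfl), ?_⟩
    refine (Finset.pairwise_sort e.support (· ≤ ·)).imp ?_
    intro a b hab u hu v hv
    rw [List.eq_of_mem_replicate hu, List.eq_of_mem_replicate hv]
    exact hab
  · rw [List.perm_iff_count]
    intro j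
    rw [← Multiset.coe_count (a := j) (l := Multiset.sort _ _), Multiset.sort_eq,
      Finsupp.count_toMultiset, List.count_flatMap, ← Multiset.sum_coe, ← Multiset.map_coe,
      Finset.sort_eq]
    change ∑ i ∈ e.support, List.count j (List.replicate (e i) i) = e j
    simp only [List.count_replicate, beq_iff_eq]
    rw [Finset.sum_ite_eq']
    split_ifs with h
    · rfl
    · exact (Finsupp.notMem_support_iff.1 h).symm

theorem ChevalleyBasis.hasLeadingWord_monomial (e : PBWExponent K t n) :
    HasLeadingWord B.vec (envToSuper K t n (B.monomial e))
      ((Finsupp.toMultiset e.1).sort (· ≤ ·)) := by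
  rw [← flatMap_replicate_sort, monomial]
  generalize e.1.support.sort (· ≤ ·) = l
  induction l with
  | nil =>
    rw [List.map_nil, List.prod_nil, map_one]
    exact hasLeadingWord_one
  | cons j l ih =>
    rw [List.map_cons, List.prod_cons, map_mul, List.flatMap_cons]
    exact (B.hasLeadingWord_factor j _).mul ih

open Classical in
/-- The parity of a member of a Chevalley basis. -/
def PBWIndex.parity (j : PBWIndex K t n) : ZMod 2 := if j.IsOdd then 1 else 0

theorem ChevalleyBasis.sPar_vec (hn : t.Admissible n) (j : PBWIndex K t n) :
    SPar (parConjAlg K n) j.parity (B.vec j) := by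
  refine HasParity.sPar ?_
  rw [PBWIndex.parity]
  split_ifs with h
  · cases j with
    | root α k => exact h _ (B.X_mem α k)
    | cartan i => exact h.elim
  · cases j with
    | root α k => exact (Root.isEven_or_isOdd hn α).resolve_right h _ (B.X_mem α k)
    | cartan i => exact torus_parity (cartan_le_torus t (B.H_mem i))

/-- The ordered monomials are linearly independent over `K`: the leading words of the monomials of
maximal degree are independent modulo shorter words. -/
theorem ChevalleyBasis.linearIndependent_monomial (hn : t.Admissible n) :
    LinearIndependent K B.monomial := by
  classical
  rw [linearIndependent_iff']
  intro s g hg i hi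
  by_contra hgi
  set M : PBWExponent K t n → Multiset (PBWIndex K t n) := fun e => Finsupp.toMultiset e.1 with hM
  have hMinj : Function.Injective M := fun a b h => by
    refine Subtype.ext (Finsupp.ext fun j => ?_)
    rw [← Finsupp.count_toMultiset, ← Finsupp.count_toMultiset]
    exact congrArg (Multiset.count j) h
  obtain ⟨e₀, he₀, hmax⟩ := Finset.exists_max_image (s.filter fun e => g e ≠ 0)
    (fun e => (M e).card) ⟨i, Finset.mem_filter.2 ⟨hi, hgi⟩⟩
  set d := (M e₀).card with hd
  choose c hc hlead using B.hasLeadingWord_monomial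
  set top := s.filter fun e => g e ≠ 0 ∧ (M e).card = d with htop
  have hlead' : ∀ e, envToSuper K t n (B.monomial e)
      - c e • senvWord B.vec ((M e).sort (· ≤ ·)) ∈ wordsLT (parConjAlg K n) (M e).card := fun e => by
    have h := hlead e
    rwa [Multiset.length_sort] at h
  -- the sum of the leading terms of maximal degree is a combination of shorter words
  have h1 : ∑ e ∈ top, (g e * c e) • senvWord B.vec ((M e).sort (· ≤ ·))
      ∈ wordsLT (parConjAlg K n) d := by
    have h2 := congrArg (envToSuper K t n) hg
    rw [map_sum, map_zero, ← Finset.sum_filter_add_sum_filter_not s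
      (fun e => g e ≠ 0 ∧ (M e).card = d)] at h2
    have h3 : ∑ e ∈ s with ¬ (g e ≠ 0 ∧ (M e).card = d), envToSuper K t n (g e • B.monomial e)
        ∈ wordsLT (parConjAlg K n) d := by
      refine sum_mem fun e he => ?_
      rw [Finset.mem_filter] at he
      by_cases h0 : g e = 0
      · rw [h0, zero_smul, map_zero]; exact zero_mem _
      · have hle := hmax e (Finset.mem_filter.2 ⟨he.1, h0⟩)
        have hlt : (M e).card < d := lt_of_le_of_ne hle fun h => he.2 ⟨h0, h⟩
        rw [map_smul]
        refine Submodule.smul_mem _ _ ?_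
        rw [← sub_add_cancel (envToSuper K t n (B.monomial e))
          (c e • senvWord B.vec ((M e).sort (· ≤ ·)))]
        refine add_mem (wordsLT_mono hlt.le (hlead' e)) (Submodule.smul_mem _ _ ?_)
        have h4 := senvWord_mem (σ := parConjAlg K n) B.vec ((M e).sort (· ≤ ·))
        rw [Multiset.length_sort] at h4
        exact wordsLT_mono hlt h4
    have h5 : ∑ e ∈ top, g e • (envToSuper K t n (B.monomial e)
        - c e • senvWord B.vec ((M e).sort (· ≤ ·))) ∈ wordsLT (parConjAlg K n) d := by
      refine sum_mem fun e he => Submodule.smul_mem _ _ ?_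
      have h6 := hlead' e
      rwa [((Finset.mem_filter.1 he).2).2] at h6
    have h7 := neg_mem (add_mem h3 h5)
    convert h7 using 1
    rw [eq_neg_iff_add_eq_zero, ← h2]
    simp only [smul_sub, map_smul, Finset.sum_sub_distrib, mul_smul, htop]
    abel
  have hcard : ∀ m ∈ top.image M, m.card = d ∧
      ∀ j : PBWIndex K t n, j.parity ≠ 0 → m.count j ≤ 1 := by
    intro m hm
    obtain ⟨e, he, rfl⟩ := Finset.mem_image.1 hm
    refine ⟨(Finset.mem_filter.1 he).2.2, fun j hj => ?_⟩
    rw [Finsupp.count_toMultiset]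
    rcases j with ⟨γ, k⟩ | i
    · by_cases hγ : γ.IsOdd
      · exact e.2 γ k hγ
      · exact absurd (if_neg hγ) hj
    · exact absurd (if_neg id) hj
  have hfun : ∀ j, ∃ lam : Op K n →ₗ[K] K, lam 1 = 0 ∧ lam (B.vec j) = 1 ∧
      ∀ i, i ≠ j → lam (B.vec i) = 0 := fun j => by
    obtain ⟨lam, h2, h3⟩ := exists_dual_functional B.linearIndependent_vecOne (some j)
    exact ⟨lam, h3 none (by simp), h2, fun i hi => h3 (some i) (by simpa using hi)⟩
  have h8 := senvWord_independent B.vec PBWIndex.parity (B.sPar_vec hn) hfun d (top.image M) hcard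
    (fun m => if h : ∃ e, M e = m then g h.choose * c h.choose else 0)
  have hinv : ∀ e, (if h : ∃ e', M e' = M e then g h.choose * c h.choose else 0) = g e * c e := by
    intro e
    have h : ∃ e', M e' = M e := ⟨e, rfl⟩
    rw [dif_pos h, hMinj h.choose_spec]
  rw [Finset.sum_image fun a _ b _ h => hMinj h] at h8
  simp only [hinv] at h8
  have he₀' := Finset.mem_filter.1 he₀
  have h9 := h8 h1 (M e₀) (Finset.mem_image_of_mem _ (Finset.mem_filter.2 ⟨he₀'.1, he₀'.2, rfl⟩))
  rw [hinv] at h9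
  exact mul_ne_zero he₀'.2 (hc e₀) h9

end Independence

/-! ### The integral form is spanned by the ordered monomials -/

section Basis

variable {K : Type*} [Field K] [CharZero K] {t : CartanType} {n : ℕ} (B : ChevalleyBasis K t n)

theorem ChevalleyBasis.exists_mem_deg {y : Env K t n} (hy : y ∈ B.kostant) :
    ∃ d, y ∈ B.deg d := by
  induction hy using Subring.closure_induction with
  | mem y hy =>
    rcases hy with (⟨i, m, rfl⟩ | ⟨α, k, m, hα, rfl⟩) | ⟨γ, k, hγ, rfl⟩
    · exact ⟨_, gen_mem_degLT (g := B.factor) (.cartan i) m fun h => h.elim⟩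
    · exact ⟨_, gen_mem_degLT (g := B.factor) (.root α k) m fun h =>
        absurd h (Root.not_isOdd_of_isEven hα)⟩
    · refine ⟨2, ?_⟩
      rw [← envMap_coe]
      exact B.envMap_lat_mem (B.X_mem_lat γ k)
  | zero => exact ⟨0, zero_mem _⟩
  | one => exact ⟨1, one_mem_degLT 0⟩
  | add x y _ _ hx hy =>
    obtain ⟨a, ha⟩ := hx
    obtain ⟨b, hb⟩ := hy
    exact ⟨max a b, add_mem (degLT_mono (le_max_left a b) ha) (degLT_mono (le_max_right a b) hb)⟩
  | neg x _ hx =>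
    obtain ⟨a, ha⟩ := hx
    exact ⟨a, neg_mem ha⟩
  | mul x y _ _ hx hy =>
    obtain ⟨a, ha⟩ := hx
    obtain ⟨b, hb⟩ := hy
    exact ⟨a + b, mul_mem_degLT (degLT_mono (Nat.le_succ a) ha) hb⟩

theorem ChevalleyBasis.factor_mem (hn : t.Admissible n) (j : PBWIndex K t n) (m : ℕ)
    (hm : j.IsOdd → m ≤ 1) : B.factor j m ∈ B.kostant := by
  cases j with
  | root α k =>
    rcases Root.isEven_or_isOdd hn α with hα | hα
    · exact Subring.subset_closure (Or.inl (Or.inr ⟨α, k, m, hα, rfl⟩))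
    · rcases le_one_cases (hm hα) with rfl | rfl
      · rw [B.factor_zero]; exact one_mem _
      · rw [B.factor_root, dpow_one, envMap_coe]
        exact Subring.subset_closure (Or.inr ⟨α, k, hα, rfl⟩)
  | cartan i => exact Subring.subset_closure (Or.inl (Or.inl ⟨i, m, rfl⟩))

variable [LinearOrder (PBWIndex K t n)]

theorem ChevalleyBasis.monomial_mem (hn : t.Admissible n) (e : PBWExponent K t n) :
    B.monomial e ∈ B.kostant := by
  refine Subring.list_prod_mem _ fun y hy => ?_
  obtain ⟨j, -, rfl⟩ := List.mem_map.1 hy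
  refine B.factor_mem hn j _ fun h => ?_
  cases j with
  | root γ k => exact e.2 γ k h
  | cartan i => exact h.elim

/-- The Kostant superalgebra is spanned by the ordered monomials. -/
theorem ChevalleyBasis.mem_span_monomial (hn : t.Admissible n) {y : Env K t n}
    (hy : y ∈ B.kostant) : y ∈ AddSubgroup.closure (Set.range B.monomial) := by
  obtain ⟨d, hd⟩ := B.exists_mem_deg hy
  have h := degLT_le_ordSpan B.factor_zero (B.factor_comm hn) (B.factor_merge hn)
    (B.factor_square hn) d hd
  refine AddSubgroup.closure_mono ?_ h
  rintro _ ⟨e, he, rfl⟩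
  exact ⟨⟨e, fun γ k hγ => he (.root γ k) hγ⟩, rfl⟩

theorem ChevalleyBasis.exists_basis (hn : t.Admissible n) :
    ∃ b : Module.Basis (PBWExponent K t n) ℤ B.kostant,
      ∀ e : PBWExponent K t n, (b e : Env K t n) = B.monomial e := by
  set v : PBWExponent K t n → B.kostant := fun e => ⟨B.monomial e, B.monomial_mem hn e⟩ with hv
  have hli : LinearIndependent ℤ v := by
    have h1 : LinearIndependent ℤ B.monomial :=
      (B.linearIndependent_monomial hn).restrict_scalars
        (fun a b h => by simpa using h)
    exact LinearIndependent.of_comp B.kostant.subtype.toAddMonoidHom.toIntLinearMap h1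
  have hspan : ⊤ ≤ Submodule.span ℤ (Set.range v) := by
    rintro ⟨y, hy⟩ -
    have key : ∀ z ∈ AddSubgroup.closure (Set.range B.monomial),
        ∃ w ∈ Submodule.span ℤ (Set.range v), (w : Env K t n) = z := by
      intro z hz
      induction hz using AddSubgroup.closure_induction with
      | mem z hz =>
        obtain ⟨e, rfl⟩ := hz
        exact ⟨v e, Submodule.subset_span ⟨e, rfl⟩, rfl⟩
      | zero => exact ⟨0, zero_mem _, rfl⟩
      | add a b _ _ ha hb =>
        obtain ⟨w, hw, rfl⟩ := ha
        obtain ⟨w', hw', rfl⟩ := hb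
        exact ⟨w + w', add_mem hw hw', rfl⟩
      | neg a _ ha =>
        obtain ⟨w, hw, rfl⟩ := ha
        exact ⟨-w, neg_mem hw, rfl⟩
    obtain ⟨w, hw, h⟩ := key y (B.mem_span_monomial hn hy)
    rwa [← show w = ⟨y, hy⟩ from Subtype.ext h]
  exact ⟨Module.Basis.mk hli hspan, fun e => congrArg Subtype.val (Module.Basis.mk_apply hli hspan e)⟩

end Basis

end

end CartanSuper

theorem mainTheorem4 {K : Type*} [Field K] [IsAlgClosed K] [CharZero K]
    (t : CartanSuper.CartanType) (n : ℕ) (hn : t.Admissible n)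
    (B : CartanSuper.ChevalleyBasis K t n) [LinearOrder (CartanSuper.PBWIndex K t n)] :
    Module.Free ℤ B.kostant ∧
      ∃ b : Module.Basis (CartanSuper.PBWExponent K t n) ℤ B.kostant,
        ∀ e : CartanSuper.PBWExponent K t n, (b e : CartanSuper.Env K t n) = B.monomial e := by
  obtain ⟨b, hb⟩ := B.exists_basis hn
  exact ⟨Module.Free.of_basis b, b, hb⟩
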